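/- Let $k$ be a field. All complexes are cochain complexes of $k$-vector spaces, dg modules are right modules, $\mathcal{D}(\mathcal{A})$ is the derived category of dg modules over a dg category $\mathcal{A}$, and $\mathcal{D}_{\mathrm{fd}}(\mathcal{A})$ is the dg category of those $\mathcal{A}$-modules $M$ in $\mathcal{D}(\mathcal{A})$ such that $H^*(M(a))$ is finite dimensional (in total) for every $a\in\mathcal{A}$. The dg category $\mathcal{A}$ is reflexive if the evaluation functor $$\mathcal{A}^{\mathrm{op}}\to \mathcal{D}_{\mathrm{fd}}\bigl(\mathcal{D}_{\mathrm{fd}}(\mathcal{A})^{\mathrm{op}}\bigr),\qquad a\mapsto \bigl(M\mapsto M(a)\bigr)$$ is a Morita equivalence, i.e. it is quasi-fully faithful and its image generates the target as a thick subcategory. A dg algebra is regarded as a dg category with one object. For a dg algebra $A$ and an $A$-module $M$ put $A^!_M=\mathbb{R}\mathrm{End}_A(M)^{\mathrm{op}}$, over which $M$ is again a right module; $A$ is derived complete at $M$ if the natural map $A\to \mathbb{R}\mathrm{End}_{A^!_M}(M)^{\mathrm{op}}$ is a quasi-isomorphism. $A$ is proper if $H^*(A)$ is finite dimensional in total. **Theorem.**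 Let $A$ be a coconnective dg algebra over $k$ (that is, $H^i(A)=0$ for $i<0$) such that $H^0(A)$ is a finite dimensional semisimple $k$-algebra. 1. There is a weight truncation $\sigma_{\le 0}A$ of $A$, i.e. an $A$-module $S$ with a morphism $A\to S$ in $\mathcal{D}(A)$ such that $H^i(A)\to H^i(S)$ is an isomorphism for all $i\le 0$ and $H^i(S)=0$ for all $i>0$. 2. For every such $S=\sigma_{\le 0}A$, the dg algebra $A$ is reflexive if and only if it is derived complete at $\sigma_{\le 0}A$. 3. If $A$ is moreover proper, then $A$ is reflexive. -/

import Mathlib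

open CategoryTheory

universe w u v v₁ v₂ o o₁ o₂ h h₁ h₂

noncomputable section

/-! ### Complexes and signs

Complexes are Mathlib's cochain complexes of `k`-vector spaces.  Multiplicative structures are given
on elements; an operation raising degrees takes a proof `p + q = n` that the degrees match, so that
no transport along equalities of degrees is needed. -/

/-- The sign `(-1)^n` as a scalar of `k`. -/
def koszulSign (k : Type v) [Field k] (n : ℤ) : k := ((n.negOnePow : ℤ) : k)

section Sign

variable (k : Type v) [Field k]

theorem koszulSign_add (m n : ℤ) :
    koszulSign k (m + n) = koszulSign k m * koszulSign k n := by
  simp [koszulSign, Int.negOnePow_add]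

theorem koszulSign_zero : koszulSign k 0 = 1 := by simp [koszulSign]

theorem koszulSign_one : koszulSign k 1 = -1 := by simp [koszulSign]

theorem koszulSign_mul_self (n : ℤ) : koszulSign k n * koszulSign k n = 1 := by
  rw [← koszulSign_add]
  simp [koszulSign, Int.negOnePow_even (n + n) ⟨n, rfl⟩]

end Sign

/-- A complex of vector spaces has finite dimensional total cohomology. -/
def HasFiniteTotalCohomology {k : Type v} [Field k] (K : CochainComplex (ModuleCat.{w} k) ℤ) :
    Prop :=
  (∀ n : ℤ, Module.Finite k (K.homology n)) ∧ {n : ℤ | ¬ Limits.IsZero (K.homology n)}.Finite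

/-- A family of linear maps `φ n : K^n → L^n` (in practice a chain map, `K` and `L` being allowed to
live in different universes) induces a bijection on cohomology: injectivity and surjectivity are
spelled out on cocycles and coboundaries. -/
def InducesCohomologyIso {k : Type v} [Field k] (K : CochainComplex (ModuleCat.{v₁} k) ℤ)
    (L : CochainComplex (ModuleCat.{v₂} k) ℤ) (φ : ∀ n : ℤ, K.X n →ₗ[k] L.X n) : Prop :=
  ∀ n : ℤ,
    (∀ x : K.X n, (K.d n (n + 1)).hom x = 0 →
      (∃ y : L.X (n - 1), (L.d (n - 1) n).hom y = φ n x) →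
      ∃ z : K.X (n - 1), (K.d (n - 1) n).hom z = x) ∧
    (∀ y : L.X n, (L.d n (n + 1)).hom y = 0 →
      ∃ x : K.X n, (K.d n (n + 1)).hom x = 0 ∧
        ∃ z : L.X (n - 1), (L.d (n - 1) n).hom z = φ n x - y)

/-! ### Dg categories -/

/-- A dg category over `k`: a category enriched in complexes of `k`-vector spaces.
`comp g f` is the composite `g ∘ f`. -/
structure DGCategory (k : Type v) [Field k] where
  Obj : Type o
  Hom : Obj → Obj → CochainComplex (ModuleCat.{h} k) ℤ
  id : ∀ a : Obj, (Hom a a).X 0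
  comp : ∀ {a b c : Obj} {p q n : ℤ}, p + q = n →
    ((Hom b c).X p →ₗ[k] (Hom a b).X q →ₗ[k] (Hom a c).X n)
  id_comp : ∀ {a b : Obj} {n : ℤ} (f : (Hom a b).X n), comp (zero_add n) (id b) f = f
  comp_id : ∀ {a b : Obj} {n : ℤ} (f : (Hom a b).X n), comp (add_zero n) f (id a) = f
  assoc : ∀ {a b c e : Obj} {p q r s t n : ℤ} (hpq : p + q = s) (hqr : q + r = t)
    (hsr : s + r = n) (hpt : p + t = n)
    (x : (Hom c e).X p) (y : (Hom b c).X q) (z : (Hom a b).X r),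
    comp hsr (comp hpq x y) z = comp hpt x (comp hqr y z)
  leibniz : ∀ {a b c : Obj} {p q n : ℤ} (hpq : p + q = n)
    (x : (Hom b c).X p) (y : (Hom a b).X q),
    ((Hom a c).d n (n + 1)).hom (comp hpq x y) =
      comp (by lia) (((Hom b c).d p (p + 1)).hom x) y +
        koszulSign k p • comp (by lia) x (((Hom a b).d q (q + 1)).hom y)

namespace DGCategory

variable {k : Type v} [Field k]

/-- The opposite dg category, with the Koszul sign `g ∘ᵒᵖ f = (-1)^{|g||f|} f ∘ g`. -/
abbrev op (𝒜 : DGCategory.{v, o, h} k) : DGCategory.{v, o, h} k where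
  Obj := 𝒜.Obj
  Hom a b := 𝒜.Hom b a
  id := 𝒜.id
  comp {a b c p q n} hpq :=
    koszulSign k (p * q) • (𝒜.comp (a := c) (b := b) (c := a) (show q + p = n by lia)).flip
  id_comp f := by simp [koszulSign_zero, 𝒜.comp_id]
  comp_id f := by simp [koszulSign_zero, 𝒜.id_comp]
  assoc {a b c e p q r s t n} hpq hqr hsr hpt x y z := by
    subst hpq hqr
    simp only [LinearMap.smul_apply, LinearMap.flip_apply, map_smul, smul_smul]
    rw [𝒜.assoc (p := r) (q := q) (r := p) (s := q + r) (t := p + q) (n := n)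
      (by lia) (by lia) (by lia) (by lia)]
    congr 1
    rw [← koszulSign_add, ← koszulSign_add]
    congr 1
    ring
  leibniz {a b c p q n} hpq x y := by
    simp only [LinearMap.smul_apply, LinearMap.flip_apply, map_smul, smul_smul]
    rw [𝒜.leibniz (p := q) (q := p) (n := n) (by lia), smul_add, smul_smul]
    have e1 : koszulSign k ((p + 1) * q) = koszulSign k (p * q) * koszulSign k q := by
      rw [← koszulSign_add]; congr 1; ring
    have e2 : koszulSign k p * koszulSign k (p * (q + 1)) = koszulSign k (p * q) := by
      rw [show p * (q + 1) = p * q + p by ring, koszulSign_add, mul_comm, mul_assoc,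
        koszulSign_mul_self, mul_one]
    rw [e1, e2]
    exact add_comm _ _

/-- The dg category with objects indexed by `ι` and morphisms those of `𝒜` between the objects
`P i`; for an injective `P` this is the full dg subcategory of `𝒜` on the objects `P i`. -/
abbrev full (𝒜 : DGCategory.{v, o, h} k) {ι : Type o₁} (P : ι → 𝒜.Obj) : DGCategory.{v, o₁, h} k where
  Obj := ι
  Hom i j := 𝒜.Hom (P i) (P j)
  id i := 𝒜.id (P i)
  comp hpq := 𝒜.comp hpq
  id_comp := 𝒜.id_comp
  comp_id := 𝒜.comp_id
  assoc := 𝒜.assoc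
  leibniz := 𝒜.leibniz

end DGCategory

/-- A dg functor. -/
structure DGFunctor {k : Type v} [Field k] (𝒜 : DGCategory.{v, o₁, h₁} k)
    (ℬ : DGCategory.{v, o₂, h₂} k) where
  obj : 𝒜.Obj → ℬ.Obj
  map : ∀ {a b : 𝒜.Obj} (n : ℤ), (𝒜.Hom a b).X n →ₗ[k] (ℬ.Hom (obj a) (obj b)).X n
  map_id : ∀ a : 𝒜.Obj, map 0 (𝒜.id a) = ℬ.id (obj a)
  map_comp : ∀ {a b c : 𝒜.Obj} {p q n : ℤ} (hpq : p + q = n)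
    (x : (𝒜.Hom b c).X p) (y : (𝒜.Hom a b).X q),
    map n (𝒜.comp hpq x y) = ℬ.comp hpq (map p x) (map q y)
  map_d : ∀ {a b : 𝒜.Obj} (n : ℤ) (x : (𝒜.Hom a b).X n),
    map (n + 1) (((𝒜.Hom a b).d n (n + 1)).hom x) =
      ((ℬ.Hom (obj a) (obj b)).d n (n + 1)).hom (map n x)

/-! ### Dg modules -/

/-- A right dg module over a dg category. -/
structure DGModule {k : Type v} [Field k] (𝒜 : DGCategory.{v, o, h} k) where
  obj : 𝒜.Obj → CochainComplex (ModuleCat.{w} k) ℤ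
  act : ∀ {a b : 𝒜.Obj} {p q n : ℤ}, p + q = n →
    ((obj b).X p →ₗ[k] (𝒜.Hom a b).X q →ₗ[k] (obj a).X n)
  act_id : ∀ {a : 𝒜.Obj} {n : ℤ} (m : (obj a).X n), act (add_zero n) m (𝒜.id a) = m
  act_act : ∀ {a b c : 𝒜.Obj} {p q r s t n : ℤ} (hpq : p + q = s) (hqr : q + r = t)
    (hsr : s + r = n) (hpt : p + t = n)
    (m : (obj c).X p) (x : (𝒜.Hom b c).X q) (y : (𝒜.Hom a b).X r),
    act hsr (act hpq m x) y = act hpt m (𝒜.comp hqr x y)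
  leibniz : ∀ {a b : 𝒜.Obj} {p q n : ℤ} (hpq : p + q = n)
    (m : (obj b).X p) (x : (𝒜.Hom a b).X q),
    ((obj a).d n (n + 1)).hom (act hpq m x) =
      act (by lia) (((obj b).d p (p + 1)).hom m) x +
        koszulSign k p • act (by lia) m (((𝒜.Hom a b).d q (q + 1)).hom x)

namespace DGModule

open CochainComplex.HomComplex

variable {k : Type v} [Field k] {𝒜 : DGCategory.{v, o, h} k}

/-- A morphism of dg modules: chain maps commuting with the action. -/
@[ext]
structure Hom (M N : DGModule.{w} 𝒜) where
  app : ∀ a : 𝒜.Obj, M.obj a ⟶ N.obj a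
  app_act : ∀ {a b : 𝒜.Obj} {p q n : ℤ} (hpq : p + q = n)
    (m : (M.obj b).X p) (x : (𝒜.Hom a b).X q),
    ((app a).f n).hom (M.act hpq m x) = N.act hpq (((app b).f p).hom m) x

instance : Category (DGModule.{w} 𝒜) where
  Hom := Hom
  id M := { app := fun a => 𝟙 (M.obj a), app_act := fun _ _ _ => rfl }
  comp f g :=
    { app := fun a => f.app a ≫ g.app a
      app_act := fun hpq m x => by simp [f.app_act hpq, g.app_act hpq] }
  id_comp f := Hom.ext (funext fun _ => Category.id_comp _)
  comp_id f := Hom.ext (funext fun _ => Category.comp_id _)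
  assoc f g e := Hom.ext (funext fun _ => Category.assoc _ _ _)

/-- The representable module `𝒜(-, b)`. For a dg algebra it is the algebra as a right module over
itself. -/
def representable (𝒜 : DGCategory.{v, o, h} k) (b : 𝒜.Obj) : DGModule.{h} 𝒜 where
  obj a := 𝒜.Hom a b
  act hpq := 𝒜.comp hpq
  act_id := 𝒜.comp_id
  act_act := 𝒜.assoc
  leibniz := 𝒜.leibniz

/-- A morphism of dg modules is a quasi-isomorphism. -/
def IsQuasiIso {M N : DGModule.{w} 𝒜} (f : M ⟶ N) : Prop := ∀ a : 𝒜.Obj, QuasiIso (f.app a)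

/-- A dg module with vanishing cohomology. -/
def IsAcyclic (M : DGModule.{w} 𝒜) : Prop := ∀ a : 𝒜.Obj, (M.obj a).Acyclic

/-- Perfectly valued (proper) modules: those with finite dimensional total cohomology at every
object. -/
def IsPerfectlyValued (M : DGModule.{w} 𝒜) : Prop :=
  ∀ a : 𝒜.Obj, HasFiniteTotalCohomology (M.obj a)

/-! ### The dg category of dg modules -/

/-- The space of morphisms of degree `n`: families of degree `n` cochains commuting with the action
(no sign, since the action is on the right). -/
def homSubmodule (M N : DGModule.{w} 𝒜) (n : ℤ) :
    Submodule k (∀ a : 𝒜.Obj, Cochain (M.obj a) (N.obj a) n) where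
  carrier := {f | ∀ (a b : 𝒜.Obj) (p r s p' s' : ℤ) (hp : p + n = p') (hr : p + r = s)
    (hs : s + n = s') (hr' : p' + r = s') (m : (M.obj b).X p) (x : (𝒜.Hom a b).X r),
    ((f a).v s s' hs).hom (M.act hr m x) = N.act hr' (((f b).v p p' hp).hom m) x}
  add_mem' {f g} hf hg a b p r s p' s' hp hr hs hr' m x := by
    simp [hf a b p r s p' s' hp hr hs hr', hg a b p r s p' s' hp hr hs hr']
  zero_mem' a b p r s p' s' hp hr hs hr' m x := by simp
  smul_mem' c f hf a b p r s p' s' hp hr hs hr' m x := by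
    simp [hf a b p r s p' s' hp hr hs hr']

theorem units_smul_eq (V : Type w) [AddCommGroup V] [Module k V] (n : ℤ) (x : V) :
    n.negOnePow • x = koszulSign k n • x := by
  rw [koszulSign, Int.cast_smul_eq_zsmul]
  rfl

theorem δ_apply {K L : CochainComplex (ModuleCat.{w} k) ℤ} {n : ℤ} (z : Cochain K L n)
    (p q q₁ q₂ : ℤ) (hq : p + (n + 1) = q) (hq₁ : p + n = q₁) (hq₂ : p + 1 = q₂) (m : K.X p) :
    ((δ n (n + 1) z).v p q hq).hom m =
      (L.d q₁ q).hom ((z.v p q₁ hq₁).hom m) -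
        koszulSign k n • (z.v q₂ q (by lia)).hom ((K.d p q₂).hom m) := by
  rw [δ_v n (n + 1) rfl z p q hq q₁ q₂ (by lia) hq₂, Int.negOnePow_succ]
  simp [units_smul_eq (k := k), sub_eq_add_neg]

theorem δ_mem_homSubmodule (M N : DGModule.{w} 𝒜) (n m : ℤ)
    (f : ∀ a : 𝒜.Obj, Cochain (M.obj a) (N.obj a) n) (hf : f ∈ homSubmodule M N n) :
    (fun a => δ n m (f a)) ∈ homSubmodule M N m := by
  by_cases hnm : n + 1 = m
  · subst hnm
    intro a b p r s p' s' hp hr hs hr' m x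
    obtain ⟨p'', hp''⟩ : ∃ t, p + n = t := ⟨_, rfl⟩
    obtain ⟨s'', hs''⟩ : ∃ t, s + n = t := ⟨_, rfl⟩
    obtain rfl : p' = p'' + 1 := by lia
    obtain rfl : s' = s'' + 1 := by lia
    subst hr
    rw [δ_apply _ _ _ s'' (p + r + 1) hs hs'' rfl, δ_apply _ _ _ p'' (p + 1) hp hp'' rfl,
      hf a b p r (p + r) p'' s'' hp'' rfl hs'' (by lia), N.leibniz, M.leibniz, map_add, map_smul,
      hf a b (p + 1) r (p + r + 1) (p'' + 1) (s'' + 1) (by lia) (by lia) (by lia) (by lia),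
      hf a b p (r + 1) (p + r + 1) p'' (s'' + 1) hp'' (by lia) (by lia) (by lia), map_sub,
      map_smul, LinearMap.sub_apply, LinearMap.smul_apply,
      smul_add, smul_smul, show koszulSign k p'' = koszulSign k n * koszulSign k p by
        rw [← hp'', koszulSign_add, mul_comm]]
    abel
  · have : (fun a => δ n m (f a)) = 0 := funext fun a => δ_shape n m hnm (f a)
    rw [this]
    exact Submodule.zero_mem _

/-- The complex of morphisms from `M` to `N`, with differential `f ↦ d ∘ f - (-1)^n f ∘ d` in
degree `n`. -/
def homComplex (M N : DGModule.{w} 𝒜) : CochainComplex (ModuleCat.{max o w} k) ℤ where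
  X n := ModuleCat.of k (homSubmodule M N n)
  d n m := ModuleCat.ofHom
    { toFun := fun f => ⟨fun a => δ n m (f.1 a), δ_mem_homSubmodule M N n m f.1 f.2⟩
      map_add' := fun f g => Subtype.ext (funext fun a => δ_add n m (f.1 a) (g.1 a))
      map_smul' := fun c f => Subtype.ext (funext fun a => δ_smul n m c (f.1 a)) }
  shape n m hnm := by
    refine ModuleCat.hom_ext (LinearMap.ext fun f => Subtype.ext (funext fun a => ?_))
    exact δ_shape n m hnm (f.1 a)
  d_comp_d' n m l _ _ := by
    refine ModuleCat.hom_ext (LinearMap.ext fun f => Subtype.ext (funext fun a => ?_))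
    exact δ_δ n m l (f.1 a)

/-- Composition `g ∘ f` of morphisms of dg modules of degrees `p` and `q`. -/
def homComp {L M N : DGModule.{w} 𝒜} {p q n : ℤ} (hpq : p + q = n) :
    (homComplex M N).X p →ₗ[k] (homComplex L M).X q →ₗ[k] (homComplex L N).X n :=
  LinearMap.mk₂ k
    (fun (g : homSubmodule M N p) (f : homSubmodule L M q) =>
      (⟨fun a => (f.1 a).comp (g.1 a) (show q + p = n by lia), by
        intro a b i r s i' s' hi hr hs hr' m x
        rw [Cochain.comp_v _ _ _ s (s + q) s' rfl (by lia),
          Cochain.comp_v _ _ _ i (i + q) i' rfl (by lia)]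
        simp only [ModuleCat.hom_comp, LinearMap.comp_apply]
        rw [f.2 a b i r s (i + q) (s + q) rfl hr rfl (by lia),
          g.2 a b (i + q) r (s + q) i' s' (by lia) (by lia) (by lia) hr']⟩ : homSubmodule L N n))
    (fun _ _ _ => Subtype.ext (funext fun _ => Cochain.comp_add _ _ _ (show q + p = n by lia)))
    (fun _ _ _ => Subtype.ext (funext fun _ => Cochain.comp_smul _ _ _ (show q + p = n by lia)))
    (fun _ _ _ => Subtype.ext (funext fun _ => Cochain.add_comp _ _ _ (show q + p = n by lia)))
    (fun _ _ _ => Subtype.ext (funext fun _ => Cochain.smul_comp _ _ _ (show q + p = n by lia)))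

theorem homComp_apply {L M N : DGModule.{w} 𝒜} {p q n : ℤ} (hpq : p + q = n)
    (g : homSubmodule M N p) (f : homSubmodule L M q) (a : 𝒜.Obj) (r s t : ℤ) (hrs : r + q = s)
    (hst : s + p = t) (hrt : r + n = t) (m : (L.obj a).X r) :
    (((homComp hpq g f : homSubmodule L N n).1 a).v r t hrt).hom m =
      ((g.1 a).v s t hst).hom (((f.1 a).v r s hrs).hom m) := by
  change (((f.1 a).comp (g.1 a) (show q + p = n by lia)).v r t hrt).hom m = _
  rw [Cochain.comp_v _ _ _ r s t hrs hst]
  rfl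

variable (𝒜) in
/-- The dg category of dg modules over `𝒜`. -/
abbrev dgCat : DGCategory.{v, max o h v (w + 1), max o w} k where
  Obj := DGModule.{w} 𝒜
  Hom M N := homComplex M N
  id M := (⟨fun a => Cochain.ofHom (𝟙 (M.obj a)), by
    intro a b p r s p' s' hp hr hs hr' m x
    obtain rfl : p = p' := by lia
    obtain rfl : s = s' := by lia
    simp⟩ : homSubmodule M M 0)
  comp hpq := homComp hpq
  id_comp {M N n} (f : homSubmodule M N n) :=
    Subtype.ext (funext fun a => Cochain.comp_id (f.1 a))
  comp_id {M N n} (f : homSubmodule M N n) :=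
    Subtype.ext (funext fun a => Cochain.id_comp (f.1 a))
  assoc {K L M N p q r s t n} hpq hqr hsr hpt
      (x : homSubmodule M N p) (y : homSubmodule L M q) (z : homSubmodule K L r) :=
    Subtype.ext (funext fun a =>
      (Cochain.comp_assoc (z.1 a) (y.1 a) (x.1 a) (show r + q = t by lia)
        (show q + p = s by lia) (by lia)).symm)
  leibniz {L M N p q n} hpq (g : homSubmodule M N p) (f : homSubmodule L M q) := by
    refine Subtype.ext (funext fun a => ?_)
    have := δ_comp (f.1 a) (g.1 a) (show q + p = n by lia) (q + 1) (p + 1) (n + 1) rfl rfl rfl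
    rw [units_smul_eq (k := k)] at this
    exact this

/-- A morphism of dg modules as an element of degree `0` of the complex of morphisms. -/
def Hom.toHomComplex {M N : DGModule.{w} 𝒜} (f : M ⟶ N) : (homComplex M N).X 0 :=
  (⟨fun a => Cochain.ofHom (f.app a), by
    intro a b p r s p' s' hp hr hs hr' m x
    obtain rfl : p = p' := by lia
    obtain rfl : s = s' := by lia
    simpa using f.app_act hr m x⟩ : homSubmodule M N 0)

/-! ### The derived category: h-projective resolutions and thick subcategories -/

/-- A dg module is h-projective if there are only nullhomotopic maps from its shifts to acyclic
modules, i.e. the complex of morphisms to any acyclic module is acyclic. -/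
def IsHProjective (P : DGModule.{w} 𝒜) : Prop :=
  ∀ N : DGModule.{w} 𝒜, N.IsAcyclic → (homComplex P N).Acyclic

/-- `p : P ⟶ M` is an h-projective resolution. The complex `homComplex P N` then computes
`RHom(M, N)`. -/
def IsResolution {P M : DGModule.{w} 𝒜} (p : P ⟶ M) : Prop := P.IsHProjective ∧ IsQuasiIso p

/-- A short exact sequence of dg modules. -/
def IsShortExact {L M N : DGModule.{w} 𝒜} (f : L ⟶ M) (g : M ⟶ N) : Prop :=
  ∀ (a : 𝒜.Obj) (n : ℤ), Function.Injective ((f.app a).f n).hom ∧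
    Function.Exact ((f.app a).f n).hom ((g.app a).f n).hom ∧
    Function.Surjective ((g.app a).f n).hom

/-- A class of dg modules which is (the class of objects of) a thick subcategory of the derived
category. The exact triangles of the derived category are, up to isomorphism, those given by short
exact sequences of dg modules; closure under shifts is the case of the sequence
`0 → M → cone (id) → M[1] → 0`. As direct summands split off in the derived category, it is enough
to ask for closure under retracts of dg modules and under quasi-isomorphism. -/
structure IsThick (T : DGModule.{w} 𝒜 → Prop) : Prop where
  of_isAcyclic : ∀ M, M.IsAcyclic → T M
  iff_of_isQuasiIso : ∀ {M N : DGModule.{w} 𝒜} (f : M ⟶ N), IsQuasiIso f → (T M ↔ T N)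
  left : ∀ {L M N : DGModule.{w} 𝒜} (f : L ⟶ M) (g : M ⟶ N), IsShortExact f g → T M → T N → T L
  middle : ∀ {L M N : DGModule.{w} 𝒜} (f : L ⟶ M) (g : M ⟶ N), IsShortExact f g → T L → T N → T M
  right : ∀ {L M N : DGModule.{w} 𝒜} (f : L ⟶ M) (g : M ⟶ N), IsShortExact f g → T L → T M → T N
  of_retract : ∀ {M N : DGModule.{w} 𝒜}, Retract M N → T N → T M

/-- The thick subcategory of the derived category generated by a class of dg modules. -/
def thick (S : DGModule.{w} 𝒜 → Prop) (M : DGModule.{w} 𝒜) : Prop :=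
  ∀ T : DGModule.{w} 𝒜 → Prop, IsThick T → (∀ X, S X → T X) → T M

end DGModule

open DGModule

/-- A dg functor `F` from `𝒞` to dg modules over `ℬ` is quasi-fully faithful as a functor to the
derived category of `ℬ`: the maps `𝒞(a, b) ⟶ RHom(F a, F b)` are quasi-isomorphisms, where the
target is computed by an h-projective resolution of `F a` (the choice of which does not matter). -/
def DGFunctor.IsQuasiFullyFaithful {k : Type v} [Field k] {𝒞 : DGCategory.{v, o₁, h₁} k}
    {ℬ : DGCategory.{v, o₂, h₂} k} (F : DGFunctor 𝒞 (dgCat.{w} ℬ)) : Prop :=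
  ∀ a b : 𝒞.Obj, ∃ (Q : DGModule.{w} ℬ) (p : Q ⟶ F.obj a), IsResolution p ∧
    InducesCohomologyIso (𝒞.Hom a b) (homComplex Q (F.obj b))
      (fun n => ((homComp (add_zero n)).flip (Hom.toHomComplex p)).comp (F.map n))

/-- A dg functor `F` from `𝒞` to dg modules over `ℬ` induces a Morita equivalence from `𝒞` to the
derived category of perfectly valued modules over `ℬ`: it is quasi-fully faithful and the thick
subcategory generated by its image consists exactly of the perfectly valued modules. (The target is
pretriangulated and idempotent complete.) -/
def DGFunctor.IsMoritaEquivalenceToDfd {k : Type v} [Field k] {𝒞 : DGCategory.{v, o₁, h₁} k}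
    {ℬ : DGCategory.{v, o₂, h₂} k} (F : DGFunctor 𝒞 (dgCat.{w} ℬ)) : Prop :=
  F.IsQuasiFullyFaithful ∧
    ∀ N : DGModule.{w} ℬ, thick (fun X => ∃ a : 𝒞.Obj, X = F.obj a) N ↔ N.IsPerfectlyValued

/-! ### Evaluation functors and reflexivity -/

/-- The complex `K`, viewed in a larger universe. -/
abbrev uliftComplex {k : Type v} [Field k] (K : CochainComplex (ModuleCat.{w} k) ℤ) :
    CochainComplex (ModuleCat.{max w u} k) ℤ :=
  ((ModuleCat.uliftFunctor.{u} k).mapHomologicalComplex (ComplexShape.up ℤ)).obj K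

section Evaluation

open CochainComplex.HomComplex

variable {k : Type v} [Field k] {𝒜 : DGCategory.{v, o, h} k} {ι : Type o₁}

/-- The action of morphisms `f : P j → P i` on the values at `a`, with the sign
`m · f = (-1)^{|m||f|} f(m)` which turns the left action into a right action of the opposite. -/
def evaluationAct (P : ι → DGModule.{w} 𝒜) (a : 𝒜.Obj) (i j : ι) {p q n : ℤ} (hpq : p + q = n) :
    ULift.{u} (((P j).obj a).X p) →ₗ[k] homSubmodule (P j) (P i) q →ₗ[k]
      ULift.{u} (((P i).obj a).X n) :=
  LinearMap.mk₂ k (fun m f => ULift.up (koszulSign k (p * q) • ((f.1 a).v p n hpq).hom m.down))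
    (fun m m' f => ULift.ext _ _ (by simp))
    (fun c m f => ULift.ext _ _ (by simp [smul_comm c]))
    (fun m f f' => ULift.ext _ _ (by simp))
    (fun c m f => ULift.ext _ _ (by simp [smul_comm c]))

/-- For a family `P` of `𝒜`-modules and an object `a`, the module `P i ↦ P i (a)` over the opposite
of the dg category of the `P i`. -/
def evaluationModule (P : ι → DGModule.{w} 𝒜) (a : 𝒜.Obj) :
    DGModule.{max w u} ((dgCat.{w} 𝒜).full P).op where
  obj i := uliftComplex.{w, u} ((P i).obj a)
  act {i j p q n} hpq := evaluationAct P a i j hpq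
  act_id {i n} m := by
    refine ULift.ext _ _ ?_
    change koszulSign k (n * 0) • ((Cochain.ofHom (𝟙 ((P i).obj a))).v n n _).hom m.down = m.down
    simp [koszulSign_zero]
  act_act {i j l p q r s t n} hpq hqr hsr hpt m f g := by
    refine ULift.ext _ _ ?_
    change koszulSign k (s * r) • ((g.1 a).v s n hsr).hom
        (koszulSign k (p * q) • ((f.1 a).v p s hpq).hom m.down) =
      koszulSign k (p * t) • ((koszulSign k (q * r) •
        ((f.1 a).comp (g.1 a) hqr)).v p n hpt).hom m.down
    rw [Cochain.smul_v, Cochain.comp_v _ _ hqr p s n hpq hsr, map_smul, smul_smul]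
    simp only [ModuleCat.hom_smul, ModuleCat.hom_comp, LinearMap.smul_apply, LinearMap.comp_apply,
      smul_smul, ← koszulSign_add]
    congr 2
    subst hpq hqr
    ring
  leibniz {i j p q n} hpq m f := by
    refine ULift.ext _ _ ?_
    change (((P i).obj a).d n (n + 1)).hom (koszulSign k (p * q) • ((f.1 a).v p n hpq).hom m.down) =
      koszulSign k ((p + 1) * q) • ((f.1 a).v (p + 1) (n + 1) (by lia)).hom
          ((((P j).obj a).d p (p + 1)).hom m.down) +
        koszulSign k p • (koszulSign k (p * (q + 1)) •
          ((δ q (q + 1) (f.1 a)).v p (n + 1) (by lia)).hom m.down)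
    rw [δ_apply _ p (n + 1) n (p + 1) (by lia) hpq rfl, map_smul, smul_smul, ← koszulSign_add,
      smul_sub, smul_smul, ← koszulSign_add,
      show p + p * (q + 1) = p * q + (p + p) by ring, koszulSign_add k (p * q) (p + p),
      koszulSign_add k p p, koszulSign_mul_self, mul_one,
      show p * q + (p + p) + q = (p + 1) * q + (p + p) by ring,
      koszulSign_add k _ (p + p), koszulSign_add k p p, koszulSign_mul_self, mul_one]
    abel

/-- A morphism `x : b → a` of `𝒜`, of degree `n`, acts on evaluation modules by
`m ↦ (-1)^{n|m|} m · x`. -/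
def evaluationMap (P : ι → DGModule.{w} 𝒜) (a b : 𝒜.Obj) (n : ℤ) :
    (𝒜.Hom b a).X n →ₗ[k]
      homSubmodule (evaluationModule.{w, u} P a) (evaluationModule.{w, u} P b) n where
  toFun x := ⟨fun i => Cochain.mk fun p q hpq => ModuleCat.ofHom
      (X := ULift.{u} (((P i).obj a).X p)) (Y := ULift.{u} (((P i).obj b).X q))
      (ULift.moduleEquiv.symm.toLinearMap ∘ₗ (koszulSign k (n * p) • ((P i).act hpq).flip x) ∘ₗ
        ULift.moduleEquiv.toLinearMap), by
    intro i j p r s p' s' hp hr hs hr' m f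
    refine ULift.ext _ _ ?_
    change koszulSign k (n * s) • (P i).act hs
        (koszulSign k (p * r) • ((f.1 a).v p s hr).hom m.down) x =
      koszulSign k (p' * r) • ((f.1 b).v p' s' hr').hom
        (koszulSign k (n * p) • (P j).act hp m.down x)
    rw [map_smul, map_smul, LinearMap.smul_apply, f.2 b a p n p' s s' hr hp hr' hs, smul_smul,
      smul_smul, ← koszulSign_add, ← koszulSign_add]
    congr 2
    subst hr hp
    ring⟩
  map_add' x y := by
    refine Subtype.ext (funext fun (i : ι) => Cochain.ext _ _ fun p q hpq =>
      ModuleCat.hom_ext (LinearMap.ext fun m => ULift.ext _ _ ?_))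
    change koszulSign k (n * p) • (P i).act hpq m.down (x + y) =
      koszulSign k (n * p) • (P i).act hpq m.down x +
        koszulSign k (n * p) • (P i).act hpq m.down y
    rw [map_add, smul_add]
  map_smul' c x := by
    refine Subtype.ext (funext fun (i : ι) => Cochain.ext _ _ fun p q hpq =>
      ModuleCat.hom_ext (LinearMap.ext fun m => ULift.ext _ _ ?_))
    change koszulSign k (n * p) • (P i).act hpq m.down (c • x) =
      c • koszulSign k (n * p) • (P i).act hpq m.down x
    rw [map_smul, smul_comm]

theorem evaluationMap_apply (P : ι → DGModule.{w} 𝒜) (a b : 𝒜.Obj) (n : ℤ)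
    (x : (𝒜.Hom b a).X n) (i : ι) (p q : ℤ) (hpq : p + n = q)
    (m : ULift.{u} (((P i).obj a).X p)) :
    (((evaluationMap.{w, u} P a b n x).1 i).v p q hpq).hom m =
      ULift.up (koszulSign k (n * p) • (P i).act hpq m.down x) := rfl

theorem evaluation_ext (P : ι → DGModule.{w} 𝒜) (a b : 𝒜.Obj) (n : ℤ)
    (f g : homSubmodule (evaluationModule.{w, u} P a) (evaluationModule.{w, u} P b) n)
    (H : ∀ (i : ι) (p q : ℤ) (hpq : p + n = q) (m : ULift.{u} (((P i).obj a).X p)),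
      ((f.1 i).v p q hpq).hom m = ((g.1 i).v p q hpq).hom m) : f = g :=
  Subtype.ext (funext fun i => Cochain.ext _ _ fun p q hpq =>
    ModuleCat.hom_ext (LinearMap.ext fun m => H i p q hpq m))

theorem evaluationMap_id (P : ι → DGModule.{w} 𝒜) (a : 𝒜.Obj) :
    evaluationMap.{w, u} P a a 0 (𝒜.id a) = (dgCat _).id (evaluationModule.{w, u} P a) := by
  refine evaluation_ext P a a 0 _ _ fun i p q hpq m => ?_
  obtain rfl : p = q := by lia
  rw [evaluationMap_apply, (P i).act_id, zero_mul, koszulSign_zero, one_smul]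
  change m = ((Cochain.ofHom (𝟙 (uliftComplex.{w, u} ((P i).obj a)))).v p p hpq).hom m
  rw [Cochain.ofHom_v]
  rfl

theorem evaluationMap_comp (P : ι → DGModule.{w} 𝒜) {a b c : 𝒜.Obj} {p q n : ℤ} (hpq : p + q = n)
    (x : (𝒜.Hom c b).X p) (y : (𝒜.Hom b a).X q) :
    evaluationMap.{w, u} P a c n (𝒜.op.comp hpq x y) =
      homComp hpq (evaluationMap.{w, u} P b c p x) (evaluationMap.{w, u} P a b q y) := by
  refine evaluation_ext P a c n _ _ fun i r t hrt m => ?_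
  refine Eq.trans ?_ (homComp_apply hpq (evaluationMap.{w, u} P b c p x)
    (evaluationMap.{w, u} P a b q y) i r (r + q) t rfl (by lia) hrt m).symm
  rw [evaluationMap_apply, evaluationMap_apply, evaluationMap_apply]
  refine ULift.ext _ _ ?_
  change koszulSign k (n * r) • (P i).act hrt m.down
      (koszulSign k (p * q) • 𝒜.comp (show q + p = n by lia) y x) =
    koszulSign k (p * (r + q)) • (P i).act (show r + q + p = t by lia)
      (koszulSign k (q * r) • (P i).act rfl m.down y) x
  rw [map_smul, map_smul, LinearMap.smul_apply, smul_smul, smul_smul,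
    (P i).act_act rfl (show q + p = n by lia) (by lia) hrt, ← koszulSign_add, ← koszulSign_add]
  congr 2
  subst hpq
  ring

theorem evaluationMap_d (P : ι → DGModule.{w} 𝒜) (a b : 𝒜.Obj) (n : ℤ) (x : (𝒜.Hom b a).X n) :
    evaluationMap.{w, u} P a b (n + 1) (((𝒜.Hom b a).d n (n + 1)).hom x) =
      ((homComplex (evaluationModule.{w, u} P a) (evaluationModule.{w, u} P b)).d n (n + 1)).hom
        (evaluationMap.{w, u} P a b n x) := by
  refine evaluation_ext P a b (n + 1) _ _ fun i p q hpq m => ?_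
  refine Eq.trans ?_ (δ_apply (k := k) ((evaluationMap.{w, u} P a b n x).1 i)
    p q (p + n) (p + 1) hpq rfl rfl m).symm
  obtain rfl : q = p + n + 1 := by lia
  refine ULift.ext _ _ ?_
  change koszulSign k ((n + 1) * p) • (P i).act hpq m.down (((𝒜.Hom b a).d n (n + 1)).hom x) =
    (((P i).obj b).d (p + n) (p + n + 1)).hom (koszulSign k (n * p) • (P i).act rfl m.down x) -
      koszulSign k n • (koszulSign k (n * (p + 1)) • (P i).act (show p + 1 + n = p + n + 1 by lia)
        ((((P i).obj a).d p (p + 1)).hom m.down) x)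
  rw [map_smul, (P i).leibniz, smul_add, smul_smul, smul_smul, ← koszulSign_add,
    ← koszulSign_add, show n * p + p = (n + 1) * p by ring,
    show n + n * (p + 1) = n * p + (n + n) by ring, koszulSign_add k _ (n + n),
    koszulSign_add k n n, koszulSign_mul_self, mul_one, add_sub_cancel_left]

/-- The evaluation functor `a ↦ (P i ↦ P i (a))`. -/
def evaluation (P : ι → DGModule.{w} 𝒜) :
    DGFunctor 𝒜.op (dgCat.{max w u} ((dgCat.{w} 𝒜).full P).op) where
  obj a := evaluationModule.{w, u} P a
  map {a b} n := evaluationMap.{w, u} P a b n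
  map_id a := evaluationMap_id P a
  map_comp hpq x y := evaluationMap_comp P hpq x y
  map_d {a b} n x := evaluationMap_d P a b n x

end Evaluation

/-- The dg category `D_fd(𝒜)`: the full dg subcategory of the dg category of `𝒜`-modules on the
h-projective modules that are perfectly valued. -/
def Dfd {k : Type v} [Field k] (𝒜 : DGCategory.{v, o, h} k) :
    DGCategory.{v, max o h v (w + 1), max o w} k :=
  (dgCat.{w} 𝒜).full
    (fun M : {M : DGModule.{w} 𝒜 // M.IsHProjective ∧ M.IsPerfectlyValued} => M.1)

/-- The evaluation functor of `𝒜`, from `𝒜ᵒᵖ` to modules over `D_fd(𝒜)ᵒᵖ`, sending `a` to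
`M ↦ M(a)`. Modules over the large dg category `D_fd(𝒜)ᵒᵖ` live one universe higher. -/
def DGCategory.ev {k : Type u} [Field k] (𝒜 : DGCategory.{u, u, u} k) :
    DGFunctor 𝒜.op (dgCat.{u + 1} (Dfd.{u} 𝒜).op) :=
  evaluation.{u, u + 1}
    (fun M : {M : DGModule.{u} 𝒜 // M.IsHProjective ∧ M.IsPerfectlyValued} => M.1)

/-- A (small) dg category is reflexive if its evaluation functor is a Morita equivalence from `𝒜ᵒᵖ`
to `D_fd(D_fd(𝒜)ᵒᵖ)`. -/
def DGCategory.IsReflexive {k : Type u} [Field k] (𝒜 : DGCategory.{u, u, u} k) : Prop :=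
  𝒜.ev.IsMoritaEquivalenceToDfd

/-! ### Dg algebras -/

/-- A dg algebra over `k`. -/
structure DGAlgebra (k : Type u) [Field k] where
  complex : CochainComplex (ModuleCat.{u} k) ℤ
  one : complex.X 0
  mul : ∀ {p q n : ℤ}, p + q = n → (complex.X p →ₗ[k] complex.X q →ₗ[k] complex.X n)
  one_mul : ∀ {n : ℤ} (x : complex.X n), mul (zero_add n) one x = x
  mul_one : ∀ {n : ℤ} (x : complex.X n), mul (add_zero n) x one = x
  mul_assoc : ∀ {p q r s t n : ℤ} (hpq : p + q = s) (hqr : q + r = t)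
    (hsr : s + r = n) (hpt : p + t = n) (x : complex.X p) (y : complex.X q) (z : complex.X r),
    mul hsr (mul hpq x y) z = mul hpt x (mul hqr y z)
  leibniz : ∀ {p q n : ℤ} (hpq : p + q = n) (x : complex.X p) (y : complex.X q),
    (complex.d n (n + 1)).hom (mul hpq x y) =
      mul (by lia) ((complex.d p (p + 1)).hom x) y +
        koszulSign k p • mul (by lia) x ((complex.d q (q + 1)).hom y)

namespace DGAlgebra

variable {k : Type u} [Field k] (A : DGAlgebra.{u} k)

/-- A dg algebra as a dg category with one object. -/
def toDGCategory : DGCategory.{u, u, u} k where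
  Obj := PUnit.{u + 1}
  Hom _ _ := A.complex
  id _ := A.one
  comp hpq := A.mul hpq
  id_comp := A.one_mul
  comp_id := A.mul_one
  assoc := A.mul_assoc
  leibniz := A.leibniz

/-- Right dg modules over a dg algebra. -/
abbrev RightModule := DGModule.{u} A.toDGCategory

/-- `A` as a right module over itself. -/
def regular : A.RightModule := representable A.toDGCategory PUnit.unit

/-- The underlying complex of a dg module. -/
abbrev RightModule.complex {A : DGAlgebra.{u} k} (M : A.RightModule) :
    CochainComplex (ModuleCat.{u} k) ℤ :=
  M.obj PUnit.unit

/-- The space of cocycles of degree `0`, a ring. -/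
def Z0 : Type u := LinearMap.ker (A.complex.d 0 1).hom

theorem d_one : (A.complex.d 0 1).hom A.one = 0 := by
  have h := A.leibniz (add_zero 0) A.one A.one
  rw [koszulSign_zero, one_smul, A.mul_one] at h
  have h2 := A.mul_one ((A.complex.d 0 (0 + 1)).hom A.one)
  have h3 := A.one_mul ((A.complex.d 0 (0 + 1)).hom A.one)
  have h4 : (A.complex.d 0 (0 + 1)).hom A.one =
      (A.complex.d 0 (0 + 1)).hom A.one + (A.complex.d 0 (0 + 1)).hom A.one :=
    h.trans (congrArg₂ (· + ·) h2 h3)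
  exact left_eq_add.mp h4

instance : AddCommGroup A.Z0 := inferInstanceAs (AddCommGroup (LinearMap.ker _))

theorem d_mul_of_cocycle (x y : A.complex.X 0) (hx : (A.complex.d 0 1).hom x = 0)
    (hy : (A.complex.d 0 1).hom y = 0) :
    (A.complex.d 0 1).hom (A.mul (add_zero 0) x y) = 0 := by
  have hx' : (A.complex.d 0 (0 + 1)).hom x = 0 := hx
  have hy' : (A.complex.d 0 (0 + 1)).hom y = 0 := hy
  have h := A.leibniz (add_zero 0) x y
  rw [hx', hy', map_zero, map_zero, LinearMap.zero_apply, smul_zero, add_zero] at h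
  exact h

instance : Ring A.Z0 where
  mul x y := ⟨A.mul (add_zero 0) x.1 y.1, A.d_mul_of_cocycle x.1 y.1 x.2 y.2⟩
  one := ⟨A.one, A.d_one⟩
  mul_assoc x y z := Subtype.ext (A.mul_assoc _ _ _ _ x.1 y.1 z.1)
  one_mul x := Subtype.ext (A.one_mul x.1)
  mul_one x := Subtype.ext (A.mul_one x.1)
  left_distrib x y z := Subtype.ext (map_add _ _ _)
  right_distrib x y z := Subtype.ext (LinearMap.map_add₂ _ _ _ _)
  zero_mul x := Subtype.ext (LinearMap.map_zero₂ _ _)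
  mul_zero x := Subtype.ext (map_zero _)
  __ := (inferInstance : AddCommGroup A.Z0)

/-- The two-sided ideal of coboundaries of degree `0` in the ring of cocycles. -/
def B0 : Ideal A.Z0 where
  carrier := {x | ∃ y : A.complex.X (-1), (A.complex.d (-1) 0).hom y = x.1}
  add_mem' := by
    rintro _ _ ⟨y, hy⟩ ⟨z, hz⟩
    exact ⟨y + z, by rw [map_add, hy, hz]; rfl⟩
  zero_mem' := ⟨0, map_zero _⟩
  smul_mem' := by
    rintro c x ⟨y, hy⟩
    refine ⟨A.mul (zero_add (-1)) c.1 y, ?_⟩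
    have hc : (A.complex.d 0 (0 + 1)).hom c.1 = 0 := c.2
    have hy' : (A.complex.d (-1) (-1 + 1)).hom y = x.1 := hy
    have h := A.leibniz (zero_add (-1)) c.1 y
    rw [hc, hy', map_zero, LinearMap.zero_apply, koszulSign_zero, one_smul, zero_add] at h
    exact h

instance : A.B0.IsTwoSided where
  mul_mem_of_left := by
    rintro x c ⟨y, hy⟩
    refine ⟨A.mul (add_zero (-1)) y c.1, ?_⟩
    have hc : (A.complex.d 0 (0 + 1)).hom c.1 = 0 := c.2
    have hy' : (A.complex.d (-1) (-1 + 1)).hom y = x.1 := hy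
    have h := A.leibniz (add_zero (-1)) y c.1
    rw [hc, hy', map_zero, smul_zero, add_zero] at h
    exact h

/-- The ring `H⁰(A)`. -/
abbrev H0 : Type u := A.Z0 ⧸ A.B0

/-- `A` is coconnective: its cohomology vanishes in negative degrees. -/
def IsCoconnective : Prop := ∀ n : ℤ, n < 0 → Limits.IsZero (A.complex.homology n)

/-- `A` is proper: its total cohomology is finite dimensional. -/
def IsProper : Prop := HasFiniteTotalCohomology A.complex

/-- A dg algebra is reflexive if it is reflexive as a dg category with one object. -/
def IsReflexive : Prop := A.toDGCategory.IsReflexive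

variable {A}

/-- The centraliser `A^!_M = REnd_A(M)ᵒᵖ` of `A` relative to an `A`-module, as a dg category with one
object, for an h-projective representative `P` of the module. -/
abbrev centraliser (P : A.RightModule) : DGCategory.{u, u, u} k :=
  ((dgCat.{u} A.toDGCategory).full (fun _ : PUnit.{u + 1} => P)).op

/-- The functor from (the opposite of) `A` to modules over the centraliser which on objects is
`A ↦ RHom_A(A, M) = M`, i.e. `M` as a right module over its centraliser, with the map
`A ⟶ End(M)ᵒᵖ` given by the action of `A` on `M`. -/
def doubleCentraliserFunctor (P : A.RightModule) :
    DGFunctor A.toDGCategory.op (dgCat.{u} (centraliser P)) :=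
  evaluation.{u, u} (fun _ : PUnit.{u + 1} => P)

/-- `A` is derived complete with respect to `M`: the natural map from `A` to its derived completion
`A^!!_M = REnd(M)ᵒᵖ`, the derived endomorphisms being those of the module `M` over the centraliser
`A^!_M`, is a quasi-isomorphism. Both derived endomorphism complexes are computed by h-projective
resolutions. -/
def IsDerivedCompleteAt (A : DGAlgebra.{u} k) (M : A.RightModule) : Prop :=
  ∃ (P : A.RightModule) (p : P ⟶ M), IsResolution p ∧ (doubleCentraliserFunctor P).IsQuasiFullyFaithful

/-- `S` is a weight truncation `σ_{≤0} A` of `A`, with truncation map `A ⟶ S`: the cohomology of `S`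
vanishes in positive degrees, and `H^i(A) ⟶ H^i(S)` is bijective for `i ≤ 0`. By the long exact
sequence the fibre `σ_{>0} A` of the map then has cohomology in positive degrees only. Morphisms out
of the free module `A` in the derived category are represented by morphisms of dg modules. -/
def IsWeightTruncation (A : DGAlgebra.{u} k) (S : A.RightModule) : Prop :=
  ∃ f : A.regular ⟶ S,
    (∀ n : ℤ, n ≤ 0 → IsIso (HomologicalComplex.homologyMap (f.app PUnit.unit) n)) ∧
    ∀ n : ℤ, 0 < n → Limits.IsZero (S.complex.homology n)

end DGAlgebra

end

-- Write `D` for `D_fd(A)`, `P` for an h-projective model of `σ_{≤0} A`, and `E` for the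
-- `Dᵒᵖ`-module `M ↦ M(pt)`, which is the only object in the image of the evaluation functor.
-- Reflexivity has two halves: evaluation is quasi-fully faithful, and `E` generates exactly the
-- perfectly valued `Dᵒᵖ`-modules. The second half turns out to hold always, and the first can be
-- tested at the single object `P`, where it is derived completeness.
--
-- Construction of `P`. Cells are attached to `A` so as to kill all cohomology in positive degrees,
-- and the procedure is iterated and passed to the colimit. Classes of degree at least 2 can be
-- killed by free cells, because coconnectivity keeps these away from degrees `≤ 0`. In degree 1,
-- free cells would turn relations between the killed classes into new classes of degree 0.
-- Semisimplicity prevents this: `H¹` is a direct sum of cyclic projective modules `e H⁰(A)`, and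
-- one attaches cells modelled on the homotopy summand `e A` (`exists_idempotent_module`), so that
-- the attaching map is injective on `H¹`. The outcome is a truncation model (`IsTruncationModel`):
-- classes of top degree in any module are realised by maps out of `P`, and `RHom(P, Y)` has no
-- cohomology in degree `j` if `Y` has none in degrees `≥ j`. Every resolution of every weight
-- truncation is such a model (`IsWeightTruncation.isTruncationModel`), so the choice of `S` is
-- irrelevant. `P` lies in `D`, since its only cohomology is `H⁰(A)`.
--
-- `P` generates `D`. A module with cohomology in one degree is a homotopy retract of a finite sum
-- of shifts of `P` (`IsTruncationModel.exists_section`). In general a sum of shifts of `P` is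
-- mapped onto the top cohomology, and the cone has smaller amplitude. Hence a `Dᵒᵖ`-module which is
-- acyclic at `P` is acyclic (`isAcyclic_of_hZero_truncationModel`).
--
-- `E` generates the perfectly valued modules. `End(P)` has no cohomology in positive degrees, and
-- `E(P) = P` has cohomology `H⁰(A)` in degree 0. In the lowest cohomology of `N(P)` choose a
-- nonzero class `y` whose orbit under `H⁰(End(P))` has minimal dimension. A Nakayama argument shows
-- that `y` is killed by the endomorphisms that kill the generator of `H⁰(P)`. So the orbit of `y`
-- is in effect a cyclic module over the semisimple ring `H⁰(A)`, that is, a direct summand of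
-- `H⁰(E(P))`. Because `End(P)` is connective, truncation by cells lifts this summand to a summand
-- `K` of a shift of `E` with a map `K → N` injective on cohomology (`IsThick.exists_piece`).
-- Replacing `N` by the cone lowers the total dimension (`IsThick.of_finite`).
--
-- Full faithfulness. A semifree module over `End(P)ᵒᵖ` extends to a semifree `Dᵒᵖ`-module on the
-- same generators. As `P` detects acyclicity, a resolution of `P` over its centraliser extends to a
-- resolution of `E`, and the two complexes of morphisms coincide
-- (`isQuasiFullyFaithful_evaluation_iff`). If `A` is proper, then `A` itself lies in `D` and
-- represents `E`, so evaluation is quasi-fully faithful by Yoneda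
-- (`IsProper.isQuasiFullyFaithful_ev`).

universe w' x

set_option autoImplicit false

noncomputable section

/-! ### Cohomology on elements -/

section Cohomology

variable {k : Type v} [Field k]

/-- `x` is a cocycle. -/
def IsCocycle (K : CochainComplex (ModuleCat.{w} k) ℤ) {n : ℤ} (x : K.X n) : Prop :=
  ∀ m, (K.d n m).hom x = 0

/-- `x` is a coboundary. -/
def IsBd (K : CochainComplex (ModuleCat.{w} k) ℤ) {n : ℤ} (x : K.X n) : Prop :=
  ∃ (m : ℤ) (y : K.X m), (K.d m n).hom y = x

/-- The cohomology of `K` vanishes in degree `n`. -/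
def HZero (K : CochainComplex (ModuleCat.{w} k) ℤ) (n : ℤ) : Prop :=
  ∀ x : K.X n, IsCocycle K x → IsBd K x

variable {K : CochainComplex (ModuleCat.{w} k) ℤ} {L : CochainComplex (ModuleCat.{w'} k) ℤ}

theorem dd_apply (K : CochainComplex (ModuleCat.{w} k) ℤ) (i j l : ℤ) (x : K.X i) :
    (K.d j l).hom ((K.d i j).hom x) = 0 := by
  exact congrArg (fun f => f.hom x) (K.d_comp_d i j l)

theorem d_eq_zero (K : CochainComplex (ModuleCat.{w} k) ℤ) {i j : ℤ} (hij : i + 1 ≠ j)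
    (x : K.X i) : (K.d i j).hom x = 0 := by
  rw [K.shape i j (by simpa using hij)]; rfl

theorem isCocycle_of {n m : ℤ} (hm : n + 1 = m) {x : K.X n} (hx : (K.d n m).hom x = 0) :
    IsCocycle K x := by
  intro l
  by_cases hl : n + 1 = l
  · subst hl; subst hm; exact hx
  · exact d_eq_zero K hl x

theorem IsBd.isCocycle {n : ℤ} {x : K.X n} (hx : IsBd K x) : IsCocycle K x := by
  obtain ⟨m, y, rfl⟩ := hx
  exact fun l => dd_apply K _ _ _ y

theorem isBd_d {m n : ℤ} (y : K.X m) : IsBd K ((K.d m n).hom y) := ⟨m, y, rfl⟩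

theorem isCocycle_d {m n : ℤ} (y : K.X m) : IsCocycle K ((K.d m n).hom y) := (isBd_d y).isCocycle

theorem isBd_zero {n : ℤ} : IsBd K (0 : K.X n) := ⟨n, 0, map_zero _⟩

theorem isCocycle_zero {n : ℤ} : IsCocycle K (0 : K.X n) := fun _ => map_zero _

theorem IsBd.out {n : ℤ} {x : K.X n} (hx : IsBd K x) {m : ℤ} (hm : m + 1 = n) :
    ∃ y : K.X m, (K.d m n).hom y = x := by
  obtain ⟨l, y, rfl⟩ := hx
  by_cases hl : l + 1 = n
  · obtain rfl : l = m := by lia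
    exact ⟨y, rfl⟩
  · exact ⟨0, by rw [map_zero, d_eq_zero K hl]⟩

theorem IsCocycle.add {n : ℤ} {x y : K.X n} (hx : IsCocycle K x) (hy : IsCocycle K y) :
    IsCocycle K (x + y) := fun m => by rw [map_add, hx m, hy m, add_zero]

theorem IsCocycle.sub {n : ℤ} {x y : K.X n} (hx : IsCocycle K x) (hy : IsCocycle K y) :
    IsCocycle K (x - y) := fun m => by rw [map_sub, hx m, hy m, sub_zero]

theorem IsBd.add {n : ℤ} {x y : K.X n} (hx : IsBd K x) (hy : IsBd K y) : IsBd K (x + y) := by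
  obtain ⟨a, ha⟩ := hx.out (sub_add_cancel n 1)
  obtain ⟨b, hb⟩ := hy.out (sub_add_cancel n 1)
  exact ⟨_, a + b, by rw [map_add, ha, hb]⟩

theorem IsBd.smul {n : ℤ} {x : K.X n} (c : k) (hx : IsBd K x) : IsBd K (c • x) := by
  obtain ⟨m, y, rfl⟩ := hx
  exact ⟨m, c • y, map_smul _ _ _⟩

theorem IsBd.neg {n : ℤ} {x : K.X n} (hx : IsBd K x) : IsBd K (-x) := by
  obtain ⟨m, y, rfl⟩ := hx
  exact ⟨m, -y, map_neg _ _⟩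

theorem IsBd.sub {n : ℤ} {x y : K.X n} (hx : IsBd K x) (hy : IsBd K y) : IsBd K (x - y) := by
  rw [sub_eq_add_neg]; exact hx.add hy.neg

theorem IsBd.sum {n : ℤ} {ι : Type*} (s : Finset ι) {f : ι → K.X n} (hf : ∀ i ∈ s, IsBd K (f i)) :
    IsBd K (∑ i ∈ s, f i) :=
  Finset.sum_induction f (IsBd K) (fun _ _ h₁ h₂ => h₁.add h₂) isBd_zero hf

theorem koszulSign_ne_zero (n : ℤ) : koszulSign k n ≠ 0 := fun h => by
  have := koszulSign_mul_self k n
  rw [h, zero_mul] at this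
  exact zero_ne_one this

theorem koszulSign_smul_smul {V : Type*} [AddCommGroup V] [Module k V] (n : ℤ) (x : V) :
    koszulSign k n • koszulSign k n • x = x := by
  rw [smul_smul, koszulSign_mul_self, one_smul]

theorem koszulSign_neg (n : ℤ) : koszulSign k (-n) = koszulSign k n := by
  simp [koszulSign, Int.negOnePow_neg]

theorem koszulSign_succ (n : ℤ) : koszulSign k (n + 1) = -koszulSign k n := by
  rw [koszulSign_add, koszulSign_one, mul_neg_one]

theorem koszulSign_sub (m n : ℤ) :
    koszulSign k (m - n) = koszulSign k m * koszulSign k n := by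
  rw [sub_eq_add_neg, koszulSign_add, koszulSign_neg]

theorem isBd_smul_iff {n : ℤ} {c : k} (hc : c ≠ 0) {x : K.X n} : IsBd K (c • x) ↔ IsBd K x :=
  ⟨fun hx => by simpa [smul_smul, hc] using hx.smul c⁻¹, fun hx => hx.smul c⟩

theorem isBd_iff_of_sub {n : ℤ} {x y : K.X n} (hxy : IsBd K (x - y)) : IsBd K x ↔ IsBd K y :=
  ⟨fun hx => by simpa using hx.sub hxy, fun hy => by simpa using hxy.add hy⟩

/-- A family of maps is injective on cohomology in degree `n`. -/
def InjH (K : CochainComplex (ModuleCat.{w} k) ℤ) (L : CochainComplex (ModuleCat.{w'} k) ℤ) (n : ℤ)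
    (φ : K.X n → L.X n) : Prop :=
  ∀ x : K.X n, IsCocycle K x → IsBd L (φ x) → IsBd K x

/-- A family of maps is surjective on cohomology in degree `n`. -/
def SurjH (K : CochainComplex (ModuleCat.{w} k) ℤ) (L : CochainComplex (ModuleCat.{w'} k) ℤ) (n : ℤ)
    (φ : K.X n → L.X n) : Prop :=
  ∀ y : L.X n, IsCocycle L y → ∃ x : K.X n, IsCocycle K x ∧ IsBd L (φ x - y)

/-- Differentials between non-consecutive degrees vanish, so quantifying over all degrees in
`IsCocycle` and `IsBd` changes nothing. It removes the degrees `n - 1` and `n + 1` from all later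
statements. -/
theorem inducesCohomologyIso_iff {φ : ∀ n : ℤ, K.X n →ₗ[k] L.X n} :
    InducesCohomologyIso K L φ ↔ ∀ n, InjH K L n (φ n) ∧ SurjH K L n (φ n) := by
  refine forall_congr' fun n => and_congr ⟨fun H x hx hb => ?_, fun H x hx hb => ?_⟩
    ⟨fun H y hy => ?_, fun H y hy => ?_⟩
  · obtain ⟨z, hz⟩ := H x (hx _) (hb.out (sub_add_cancel n 1))
    exact ⟨_, z, hz⟩
  · obtain ⟨z, hz⟩ := hb
    exact (H x (isCocycle_of rfl hx) ⟨_, z, hz⟩).out (sub_add_cancel n 1)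
  · obtain ⟨x, hx, z, hz⟩ := H y (hy _)
    exact ⟨x, isCocycle_of rfl hx, _, z, hz⟩
  · obtain ⟨x, hx, hb⟩ := H y (isCocycle_of rfl hy)
    exact ⟨x, hx _, hb.out (sub_add_cancel n 1)⟩

/-! ### Homology objects in terms of cocycles and coboundaries -/

section Homology

theorem homologyπ_surj (K : CochainComplex (ModuleCat.{w} k) ℤ) (n : ℤ) (y : K.homology n) :
    ∃ c : K.cycles n, (K.homologyπ n).hom c = y :=
  (ModuleCat.epi_iff_surjective (K.homologyπ n)).1 inferInstance y

theorem isCocycle_iCycles (K : CochainComplex (ModuleCat.{w} k) ℤ) (n : ℤ) (c : K.cycles n) :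
    IsCocycle K ((K.iCycles n).hom c) := fun m => by
  exact congrArg (fun f => f.hom c) (K.iCycles_d n m)

theorem exists_iCycles {n : ℤ} (x : K.X n) (hx : IsCocycle K x) :
    ∃ c : K.cycles n, (K.iCycles n).hom c = x := by
  refine ⟨((K.sc n).moduleCatCyclesIso.inv).hom ⟨x, hx _⟩, ?_⟩
  have := congrArg (fun f => f.hom ⟨x, hx _⟩) (K.sc n).moduleCatCyclesIso_inv_iCycles
  exact this

/-- Read off from the explicit model of homology as cycles modulo the range of the differential. All
comparisons between homology objects and elements go through this. -/
theorem homologyπ_eq_zero_iff {n : ℤ} (c : K.cycles n) :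
    (K.homologyπ n).hom c = 0 ↔ IsBd K ((K.iCycles n).hom c) := by
  have h1 := congrArg (fun f => f.hom c) (K.sc n).π_moduleCatCyclesIso_hom
  have h2 : (((K.sc n).moduleCatCyclesIso.hom).hom c).1 = (K.iCycles n).hom c :=
    congrArg (fun f => f.hom c) (K.sc n).moduleCatCyclesIso_hom_i
  have h3 : (K.homologyπ n).hom c = 0 ↔
      ((K.sc n).moduleCatHomologyIso.hom).hom ((K.homologyπ n).hom c) = 0 :=
    ((K.sc n).moduleCatHomologyIso.toLinearEquiv.map_eq_zero_iff).symm
  rw [h3]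
  have h4 : ((K.sc n).moduleCatHomologyIso.hom).hom ((K.homologyπ n).hom c) =
      (LinearMap.range (K.sc n).moduleCatToCycles).mkQ (((K.sc n).moduleCatCyclesIso.hom).hom c) := h1
  rw [h4]
  refine (Submodule.Quotient.mk_eq_zero _).trans ?_
  constructor
  · rintro ⟨y, hy⟩
    exact ⟨_, y, (congrArg Subtype.val hy).trans h2⟩
  · intro hb
    obtain ⟨y, hy⟩ := hb.out (m := (ComplexShape.up ℤ).prev n) (by simp)
    exact ⟨y, Subtype.ext (hy.trans h2.symm)⟩

theorem isZero_homology_iff (n : ℤ) : Limits.IsZero (K.homology n) ↔ HZero K n := by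
  rw [ModuleCat.isZero_iff_subsingleton (R := k) (M := K.homology n)]
  constructor
  · intro hs x hx
    obtain ⟨c, rfl⟩ := exists_iCycles x hx
    exact (homologyπ_eq_zero_iff c).1 (Subsingleton.elim _ _)
  · intro H
    refine subsingleton_of_forall_eq 0 fun y => ?_
    obtain ⟨c, rfl⟩ := homologyπ_surj K n y
    exact (homologyπ_eq_zero_iff c).2 (H _ (isCocycle_iCycles K n c))

theorem acyclic_iff_hZero : K.Acyclic ↔ ∀ n, HZero K n :=
  forall_congr' fun n => (K.exactAt_iff_isZero_homology n).trans (isZero_homology_iff n)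

variable {K' : CochainComplex (ModuleCat.{w} k) ℤ}

theorem f_d_apply (φ : K ⟶ K') (i j : ℤ) (x : K.X i) :
    (K'.d i j).hom ((φ.f i).hom x) = (φ.f j).hom ((K.d i j).hom x) := by
  exact congrArg (fun f => f.hom x) (φ.comm i j)

theorem IsCocycle.map (φ : K ⟶ K') {n : ℤ} {x : K.X n} (hx : IsCocycle K x) :
    IsCocycle K' ((φ.f n).hom x) := fun m => by rw [f_d_apply, hx, map_zero]

theorem IsBd.map (φ : K ⟶ K') {n : ℤ} {x : K.X n} (hx : IsBd K x) :
    IsBd K' ((φ.f n).hom x) := by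
  obtain ⟨m, y, rfl⟩ := hx
  exact ⟨m, _, f_d_apply φ m n y⟩

theorem homologyMap_π (φ : K ⟶ K') (n : ℤ) (c : K.cycles n) :
    ∃ c' : K'.cycles n, (K'.iCycles n).hom c' = (φ.f n).hom ((K.iCycles n).hom c) ∧
      (HomologicalComplex.homologyMap φ n).hom ((K.homologyπ n).hom c) =
        (K'.homologyπ n).hom c' := by
  refine ⟨(HomologicalComplex.cyclesMap φ n).hom c, ?_, ?_⟩
  · exact congrArg (fun f => f.hom c) (HomologicalComplex.cyclesMap_i φ n)
  · exact congrArg (fun f => f.hom c) (HomologicalComplex.homologyπ_naturality φ n)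

theorem isIso_homologyMap_iff (φ : K ⟶ K') (n : ℤ) :
    IsIso (HomologicalComplex.homologyMap φ n) ↔
      InjH K K' n (φ.f n).hom ∧ SurjH K K' n (φ.f n).hom := by
  rw [ConcreteCategory.isIso_iff_bijective]
  refine and_congr ⟨fun hi x hx hb => ?_, fun H => ?_⟩ ⟨fun hs y hy => ?_, fun H y => ?_⟩
  · obtain ⟨c, rfl⟩ := exists_iCycles x hx
    obtain ⟨c', h1, h2⟩ := homologyMap_π φ n c
    refine (homologyπ_eq_zero_iff c).1 (hi (h2.trans ?_))
    rw [(homologyπ_eq_zero_iff c').2 (h1 ▸ hb)]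
    exact (map_zero (HomologicalComplex.homologyMap φ n).hom).symm
  · refine (injective_iff_map_eq_zero (HomologicalComplex.homologyMap φ n).hom).2 fun y hy => ?_
    obtain ⟨c, rfl⟩ := homologyπ_surj K n y
    obtain ⟨c', h1, h2⟩ := homologyMap_π φ n c
    rw [h2] at hy
    exact (homologyπ_eq_zero_iff c).2
      (H _ (isCocycle_iCycles K n c) (h1 ▸ (homologyπ_eq_zero_iff c').1 hy))
  · obtain ⟨c, rfl⟩ := exists_iCycles y hy
    obtain ⟨z, hz⟩ := hs ((K'.homologyπ n).hom c)
    obtain ⟨b, rfl⟩ := homologyπ_surj K n z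
    obtain ⟨c', h1, h2⟩ := homologyMap_π φ n b
    refine ⟨_, isCocycle_iCycles K n b, ?_⟩
    rw [← h1, ← map_sub]
    refine (homologyπ_eq_zero_iff _).1 ?_
    rw [map_sub, ← h2]
    exact sub_eq_zero.2 hz
  · obtain ⟨c, rfl⟩ := homologyπ_surj K' n y
    obtain ⟨x, hx, hb⟩ := H _ (isCocycle_iCycles K' n c)
    obtain ⟨b, rfl⟩ := exists_iCycles x hx
    obtain ⟨c', h1, h2⟩ := homologyMap_π φ n b
    refine ⟨(K.homologyπ n).hom b, h2.trans (sub_eq_zero.1 ?_)⟩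
    rw [← map_sub]
    refine (homologyπ_eq_zero_iff _).2 ?_
    rw [map_sub, h1]
    exact hb

theorem quasiIso_iff_elements (φ : K ⟶ K') :
    QuasiIso φ ↔ ∀ n, InjH K K' n (φ.f n).hom ∧ SurjH K K' n (φ.f n).hom := by
  rw [quasiIso_iff]
  exact forall_congr' fun n =>
    (quasiIsoAt_iff_isIso_homologyMap φ n).trans (isIso_homologyMap_iff φ n)

end Homology

/-! ### The cohomology spaces -/

/-- The space of cocycles. -/
abbrev cocycles (K : CochainComplex (ModuleCat.{w} k) ℤ) (n : ℤ) : Submodule k (K.X n) :=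
  LinearMap.ker (K.d n (n + 1)).hom

/-- The space of coboundaries, in that of cocycles. -/
abbrev coboundaries (K : CochainComplex (ModuleCat.{w} k) ℤ) (n : ℤ) : Submodule k (cocycles K n) :=
  (LinearMap.range (K.d (n - 1) n).hom).comap (cocycles K n).subtype

/-- The cohomology spaces as quotients. -/
abbrev Hn (K : CochainComplex (ModuleCat.{w} k) ℤ) (n : ℤ) : Type w := cocycles K n ⧸ coboundaries K n

/-- The class of a cocycle. -/
def clsOf (K : CochainComplex (ModuleCat.{w} k) ℤ) {n : ℤ} (x : K.X n) (hx : IsCocycle K x) :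
    Hn K n := Submodule.Quotient.mk ⟨x, hx _⟩

theorem exists_cls {n : ℤ} (y : Hn K n) : ∃ (x : K.X n) (hx : IsCocycle K x), clsOf K x hx = y := by
  obtain ⟨⟨x, hx⟩, rfl⟩ := Submodule.Quotient.mk_surjective _ y
  exact ⟨x, isCocycle_of rfl hx, rfl⟩

theorem cls_eq_zero_iff {n : ℤ} {x : K.X n} {hx : IsCocycle K x} : clsOf K x hx = 0 ↔ IsBd K x := by
  rw [clsOf, Submodule.Quotient.mk_eq_zero]
  exact ⟨fun ⟨y, hy⟩ => ⟨_, y, hy⟩, fun hb => hb.out (sub_add_cancel n 1)⟩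

theorem cls_eq_iff {n : ℤ} {x y : K.X n} {hx : IsCocycle K x} {hy : IsCocycle K y} :
    clsOf K x hx = clsOf K y hy ↔ IsBd K (x - y) := by
  rw [← sub_eq_zero]
  exact cls_eq_zero_iff (hx := hx.sub hy)

theorem hZero_iff_subsingleton {n : ℤ} : HZero K n ↔ Subsingleton (Hn K n) := by
  constructor
  · intro H
    refine subsingleton_of_forall_eq 0 fun y => ?_
    obtain ⟨x, hx, rfl⟩ := exists_cls y
    exact cls_eq_zero_iff.2 (H x hx)
  · intro hs x hx
    exact cls_eq_zero_iff.1 (Subsingleton.elim (clsOf K x hx) 0)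

/-- The comparison of the two versions of cohomology. -/
def homologyEquivHn (K : CochainComplex (ModuleCat.{w} k) ℤ) (n : ℤ) : K.homology n ≃ₗ[k] Hn K n :=
  ((K.homologyIsoSc' (n - 1) n (n + 1) (by simp) (by simp)).toLinearEquiv.trans
    (K.sc' (n - 1) n (n + 1)).moduleCatHomologyIso.toLinearEquiv).trans
    (Submodule.quotEquivOfEq _ _ (by
      ext ⟨x, hx⟩
      exact ⟨fun ⟨y, hy⟩ => ⟨y, congrArg Subtype.val hy⟩, fun ⟨y, hy⟩ => ⟨y, Subtype.ext hy⟩⟩))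

theorem finite_homology_iff (n : ℤ) :
    Module.Finite k (K.homology n) ↔ Module.Finite k (Hn K n) :=
  Module.Finite.equiv_iff (homologyEquivHn K n)

/-- Finite support in `ℤ` is traded for a lower and an upper bound, the form needed for inductions
on amplitude. -/
theorem hasFiniteTotalCohomology_iff :
    HasFiniteTotalCohomology K ↔ (∀ n, Module.Finite k (Hn K n)) ∧
      ∃ a b : ℤ, ∀ n, (n < a ∨ b < n) → HZero K n := by
  refine and_congr (forall_congr' fun n => finite_homology_iff n) ⟨fun hf => ?_, ?_⟩
  · obtain ⟨a, ha⟩ := hf.bddBelow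
    obtain ⟨b, hb⟩ := hf.bddAbove
    refine ⟨a, b, fun n hn => (isZero_homology_iff n).1 ?_⟩
    by_contra h
    have h1 := ha h
    have h2 := hb h
    lia
  · rintro ⟨a, b, H⟩
    refine (Set.finite_Icc a b).subset fun n hn => ?_
    by_contra h
    exact hn ((isZero_homology_iff n).2 (H n (by simp only [Set.mem_Icc] at h; lia)))

end Cohomology

/-! ### Construction of complexes and modules from data on elements -/

section Construction

variable {k : Type v} [Field k]

/-- A complex from its terms and differentials. -/
def mkComplex (X : ℤ → Type w) [∀ i, AddCommGroup (X i)] [∀ i, Module k (X i)]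
    (d : ∀ i j : ℤ, i + 1 = j → (X i →ₗ[k] X j))
    (hd : ∀ (i j l : ℤ) (hij : i + 1 = j) (hjl : j + 1 = l) (x : X i), d j l hjl (d i j hij x) = 0) :
    CochainComplex (ModuleCat.{w} k) ℤ where
  X i := ModuleCat.of k (X i)
  d i j := if hij : i + 1 = j then ModuleCat.ofHom (d i j hij) else 0
  shape i j hij := dif_neg (by simpa using hij)
  d_comp_d' i j l hij hjl := by
    rw [dif_pos (by simpa using hij), dif_pos (by simpa using hjl)]
    exact ModuleCat.hom_ext (LinearMap.ext fun x => hd i j l _ _ x)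

theorem mkComplex_d (X : ℤ → Type w) [∀ i, AddCommGroup (X i)] [∀ i, Module k (X i)]
    (d : ∀ i j : ℤ, i + 1 = j → (X i →ₗ[k] X j))
    (hd : ∀ (i j l : ℤ) (hij : i + 1 = j) (hjl : j + 1 = l) (x : X i), d j l hjl (d i j hij x) = 0)
    {i j : ℤ} (hij : i + 1 = j) (x : X i) :
    ((mkComplex X d hd).d i j).hom x = d i j hij x := by
  have : (mkComplex X d hd).d i j = ModuleCat.ofHom (d i j hij) := dif_pos hij
  rw [this]
  rfl

/-- A module from its terms, differentials and action. -/
def mkModule {𝒜 : DGCategory.{v, o, h} k} (X : 𝒜.Obj → ℤ → Type w)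
    [∀ a i, AddCommGroup (X a i)] [∀ a i, Module k (X a i)]
    (d : ∀ (a : 𝒜.Obj) (i j : ℤ), i + 1 = j → (X a i →ₗ[k] X a j))
    (hd : ∀ (a : 𝒜.Obj) (i j l : ℤ) (hij : i + 1 = j) (hjl : j + 1 = l) (x : X a i),
      d a j l hjl (d a i j hij x) = 0)
    (act : ∀ {a b : 𝒜.Obj} {p q n : ℤ}, p + q = n →
      (X b p →ₗ[k] (𝒜.Hom a b).X q →ₗ[k] X a n))
    (act_id : ∀ {a : 𝒜.Obj} {n : ℤ} (m : X a n), act (add_zero n) m (𝒜.id a) = m)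
    (act_act : ∀ {a b c : 𝒜.Obj} {p q r s t n : ℤ} (hpq : p + q = s) (hqr : q + r = t)
      (hsr : s + r = n) (hpt : p + t = n)
      (m : X c p) (x : (𝒜.Hom b c).X q) (y : (𝒜.Hom a b).X r),
      act hsr (act hpq m x) y = act hpt m (𝒜.comp hqr x y))
    (leibniz : ∀ {a b : 𝒜.Obj} {p q n : ℤ} (hpq : p + q = n)
      (m : X b p) (x : (𝒜.Hom a b).X q),
      d a n (n + 1) rfl (act hpq m x) =
        act (show p + 1 + q = n + 1 by lia) (d b p (p + 1) rfl m) x +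
          koszulSign k p • act (show p + (q + 1) = n + 1 by lia) m
            (((𝒜.Hom a b).d q (q + 1)).hom x)) :
    DGModule.{w} 𝒜 where
  obj a := mkComplex (X a) (d a) (hd a)
  act hpq := act hpq
  act_id m := act_id m
  act_act hpq hqr hsr hpt m x y := act_act hpq hqr hsr hpt m x y
  leibniz {a b p q n} hpq m x := by
    refine (mkComplex_d (X a) (d a) (hd a) rfl _).trans ((leibniz hpq m x).trans ?_)
    exact congrArg (fun z => act (show p + 1 + q = n + 1 by lia) z x + koszulSign k p •
      act (show p + (q + 1) = n + 1 by lia) m (((𝒜.Hom a b).d q (q + 1)).hom x))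
      (mkComplex_d (X b) (d b) (hd b) rfl m).symm

end Construction

/-! ### Products of cocycles and coboundaries in a dg module -/

namespace DGModule

open CochainComplex.HomComplex

variable {k : Type v} [Field k] {𝒜 : DGCategory.{v, o, h} k}

theorem act_d (M : DGModule.{w} 𝒜) {a b : 𝒜.Obj} {p q n p' q' n' : ℤ} (hpq : p + q = n)
    (hp : p + 1 = p') (hq : q + 1 = q') (hn : n + 1 = n')
    (m : (M.obj b).X p) (x : (𝒜.Hom a b).X q) :
    ((M.obj a).d n n').hom (M.act hpq m x) =
      M.act (show p' + q = n' by lia) (((M.obj b).d p p').hom m) x +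
        koszulSign k p • M.act (show p + q' = n' by lia) m (((𝒜.Hom a b).d q q').hom x) := by
  subst hp hq hn
  exact M.leibniz hpq m x

theorem isCocycle_act (M : DGModule.{w} 𝒜) {a b : 𝒜.Obj} {p q n : ℤ} (hpq : p + q = n)
    {m : (M.obj b).X p} {x : (𝒜.Hom a b).X q} (hm : IsCocycle (M.obj b) m)
    (hx : IsCocycle (𝒜.Hom a b) x) : IsCocycle (M.obj a) (M.act hpq m x) := by
  refine isCocycle_of rfl ?_
  rw [M.act_d hpq rfl rfl rfl, hm, hx, map_zero, map_zero, smul_zero, add_zero,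
    LinearMap.zero_apply]

theorem isBd_act_left (M : DGModule.{w} 𝒜) {a b : 𝒜.Obj} {p q n : ℤ} (hpq : p + q = n)
    {m : (M.obj b).X p} {x : (𝒜.Hom a b).X q} (hm : IsBd (M.obj b) m)
    (hx : IsCocycle (𝒜.Hom a b) x) : IsBd (M.obj a) (M.act hpq m x) := by
  obtain ⟨y, rfl⟩ := hm.out (sub_add_cancel p 1)
  refine ⟨n - 1, M.act (show p - 1 + q = n - 1 by lia) y x, ?_⟩
  rw [M.act_d _ (sub_add_cancel p 1) rfl (sub_add_cancel n 1), hx, map_zero, smul_zero, add_zero]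

theorem isBd_act_right (M : DGModule.{w} 𝒜) {a b : 𝒜.Obj} {p q n : ℤ} (hpq : p + q = n)
    {m : (M.obj b).X p} {x : (𝒜.Hom a b).X q} (hm : IsCocycle (M.obj b) m)
    (hx : IsBd (𝒜.Hom a b) x) : IsBd (M.obj a) (M.act hpq m x) := by
  obtain ⟨y, rfl⟩ := hx.out (sub_add_cancel q 1)
  refine ⟨n - 1, koszulSign k p • M.act (show p + (q - 1) = n - 1 by lia) m y, ?_⟩
  rw [map_smul, M.act_d _ rfl (sub_add_cancel q 1) (sub_add_cancel n 1), hm, map_zero,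
    LinearMap.zero_apply, zero_add, koszulSign_smul_smul]

/-! ### Evaluating morphisms of any degree -/

/-- The value of a morphism of degree `n` at an element. -/
def hv {M N : DGModule.{w} 𝒜} {n : ℤ} {a : 𝒜.Obj} {p q : ℤ} (hpq : p + n = q) :
    (homComplex M N).X n →ₗ[k] (M.obj a).X p →ₗ[k] (N.obj a).X q where
  toFun f := (((f : homSubmodule M N n).1 a).v p q hpq).hom
  map_add' _ _ := rfl
  map_smul' _ _ := rfl

variable {L M N : DGModule.{w} 𝒜}

theorem hom_ext' {n : ℤ} {f g : (homComplex M N).X n}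
    (H : ∀ (a : 𝒜.Obj) (p q : ℤ) (hpq : p + n = q) (m : (M.obj a).X p), hv hpq f m = hv hpq g m) :
    f = g :=
  Subtype.ext (funext fun a => Cochain.ext _ _ fun p q hpq =>
    ModuleCat.hom_ext (LinearMap.ext fun m => H a p q hpq m))

theorem hv_act {n : ℤ} (f : (homComplex M N).X n) {a b : 𝒜.Obj} {p r s p' s' : ℤ}
    (hp : p + n = p') (hr : p + r = s) (hs : s + n = s') (hr' : p' + r = s')
    (m : (M.obj b).X p) (x : (𝒜.Hom a b).X r) :
    hv hs f (M.act hr m x) = N.act hr' (hv hp f m) x :=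
  (f : homSubmodule M N n).2 a b p r s p' s' hp hr hs hr' m x

/-- A morphism of degree `n` from its values. -/
def mkHom {n : ℤ} (F : ∀ (a : 𝒜.Obj) (p q : ℤ), p + n = q → ((M.obj a).X p →ₗ[k] (N.obj a).X q))
    (hF : ∀ (a b : 𝒜.Obj) (p r s p' s' : ℤ) (hp : p + n = p') (hr : p + r = s)
      (hs : s + n = s') (hr' : p' + r = s') (m : (M.obj b).X p) (x : (𝒜.Hom a b).X r),
      F a s s' hs (M.act hr m x) = N.act hr' (F b p p' hp m) x) : (homComplex M N).X n :=
  (⟨fun a => Cochain.mk fun p q hpq => ModuleCat.ofHom (F a p q hpq), hF⟩ : homSubmodule M N n)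

theorem hv_mkHom {n : ℤ}
    (F : ∀ (a : 𝒜.Obj) (p q : ℤ), p + n = q → ((M.obj a).X p →ₗ[k] (N.obj a).X q)) (hF)
    {a : 𝒜.Obj} {p q : ℤ} (hpq : p + n = q) (m : (M.obj a).X p) :
    hv hpq (mkHom F hF) m = F a p q hpq m := rfl

theorem hv_d {n n' : ℤ} (hn : n + 1 = n') (f : (homComplex M N).X n) {a : 𝒜.Obj} {p q q₁ q₂ : ℤ}
    (hpq : p + n' = q) (h₁ : p + n = q₁) (h₂ : p + 1 = q₂) (m : (M.obj a).X p) :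
    hv hpq (((homComplex M N).d n n').hom f) m =
      ((N.obj a).d q₁ q).hom (hv h₁ f m) -
        koszulSign k n • hv (show q₂ + n = q by lia) f (((M.obj a).d p q₂).hom m) := by
  subst hn
  exact δ_apply _ p q q₁ q₂ hpq h₁ h₂ m

theorem hv_comp {p q n : ℤ} (hpq : p + q = n) (g : (homComplex M N).X p)
    (f : (homComplex L M).X q) {a : 𝒜.Obj} {r s t : ℤ} (hrs : r + q = s)
    (hst : s + p = t) (hrt : r + n = t) (m : (L.obj a).X r) :
    hv hrt (homComp hpq g f) m = hv hst g (hv hrs f m) :=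
  homComp_apply hpq g f a r s t hrs hst hrt m

theorem hv_toHomComplex (f : M ⟶ N) {a : 𝒜.Obj} {p : ℤ} (m : (M.obj a).X p) :
    hv (add_zero p) (Hom.toHomComplex f) m = ((f.app a).f p).hom m := by
  change (((Cochain.ofHom (f.app a)).v p p (add_zero p)).hom) m = _
  rw [Cochain.ofHom_v]

/-- A closed morphism commutes with differentials, up to sign. -/
theorem hv_cocycle {n : ℤ} {f : (homComplex M N).X n} (hf : IsCocycle (homComplex M N) f)
    {a : 𝒜.Obj} {p q p' q' : ℤ} (hpq : p + n = q) (hp : p + 1 = p') (hq : p' + n = q')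
    (m : (M.obj a).X p) :
    ((N.obj a).d q q').hom (hv hpq f m) =
      koszulSign k n • hv hq f (((M.obj a).d p p').hom m) := by
  have := hv_d rfl f (show p + (n + 1) = q' by lia) hpq hp m
  rw [hf, map_zero, LinearMap.zero_apply] at this
  exact (sub_eq_zero.1 this.symm)

theorem isCocycle_hom_iff {n : ℤ} {f : (homComplex M N).X n} :
    IsCocycle (homComplex M N) f ↔
      ∀ (a : 𝒜.Obj) (p q p' q' : ℤ) (hpq : p + n = q) (_ : p + 1 = p') (hq : p' + n = q')
        (m : (M.obj a).X p), ((N.obj a).d q q').hom (hv hpq f m) =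
          koszulSign k n • hv hq f (((M.obj a).d p p').hom m) := by
  constructor
  · exact fun hf a p q p' q' hpq hp hq m => hv_cocycle hf hpq hp hq m
  · intro H
    refine isCocycle_of rfl (hom_ext' fun a p q hpq m => ?_)
    rw [hv_d rfl f hpq rfl rfl, H a p _ _ q rfl rfl (by lia), sub_self, map_zero,
      LinearMap.zero_apply]

theorem isCocycle_hv {n : ℤ} {f : (homComplex M N).X n} (hf : IsCocycle (homComplex M N) f)
    {a : 𝒜.Obj} {p q : ℤ} (hpq : p + n = q) {m : (M.obj a).X p} (hm : IsCocycle (M.obj a) m) :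
    IsCocycle (N.obj a) (hv hpq f m) := by
  refine isCocycle_of rfl ?_
  rw [hv_cocycle hf hpq rfl (by lia), hm, map_zero, smul_zero]

theorem isBd_hv {n : ℤ} {f : (homComplex M N).X n} (hf : IsCocycle (homComplex M N) f)
    {a : 𝒜.Obj} {p q : ℤ} (hpq : p + n = q) {m : (M.obj a).X p} (hm : IsBd (M.obj a) m) :
    IsBd (N.obj a) (hv hpq f m) := by
  obtain ⟨y, rfl⟩ := hm.out (sub_add_cancel p 1)
  refine ⟨q - 1, koszulSign k n • hv (show p - 1 + n = q - 1 by lia) f y, ?_⟩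
  rw [map_smul, hv_cocycle hf _ (sub_add_cancel p 1) hpq, koszulSign_smul_smul]

theorem isBd_hv_of_isBd {n : ℤ} {f : (homComplex M N).X n} (hf : IsBd (homComplex M N) f)
    {a : 𝒜.Obj} {p q : ℤ} (hpq : p + n = q) {m : (M.obj a).X p} (hm : IsCocycle (M.obj a) m) :
    IsBd (N.obj a) (hv hpq f m) := by
  obtain ⟨g, rfl⟩ := hf.out (sub_add_cancel n 1)
  rw [hv_d (sub_add_cancel n 1) g hpq rfl rfl, hm, map_zero, smul_zero, sub_zero]
  exact isBd_d _

theorem isCocycle_toHomComplex (f : M ⟶ N) :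
    IsCocycle (homComplex M N) (Hom.toHomComplex f) := by
  refine isCocycle_hom_iff.2 fun a p q p' q' hpq hp hq m => ?_
  obtain rfl : p = q := by lia
  obtain rfl : p' = q' := by lia
  rw [hv_toHomComplex, hv_toHomComplex, koszulSign_zero, one_smul, f_d_apply]

/-- A closed morphism of degree `0` is a morphism of modules. -/
def homOfCocycle (f : (homComplex M N).X 0) (hf : IsCocycle (homComplex M N) f) : M ⟶ N where
  app a :=
    { f := fun n => ModuleCat.ofHom (hv (add_zero n) f)
      comm' := fun i j hij => by
        refine ModuleCat.hom_ext (LinearMap.ext fun x => ?_)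
        have hij' : i + 1 = j := hij
        have := hv_cocycle hf (a := a) (add_zero i) hij' (add_zero j) x
        rw [koszulSign_zero, one_smul] at this
        exact this }
  app_act hpq m x := hv_act f _ _ _ _ m x

theorem homOfCocycle_app (f : (homComplex M N).X 0) (hf : IsCocycle (homComplex M N) f)
    (a : 𝒜.Obj) {n : ℤ} (x : (M.obj a).X n) :
    (((homOfCocycle f hf).app a).f n).hom x = hv (add_zero n) f x := rfl

theorem toHomComplex_homOfCocycle (f : (homComplex M N).X 0) (hf : IsCocycle (homComplex M N) f) :
    Hom.toHomComplex (homOfCocycle f hf) = f := by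
  refine hom_ext' fun a p q hpq m => ?_
  obtain rfl : p = q := by lia
  rw [hv_toHomComplex]; rfl

/-- The identity as an element of the complex of endomorphisms. -/
abbrev idHom (M : DGModule.{w} 𝒜) : (homComplex M M).X 0 := (dgCat.{w} 𝒜).id M

theorem hv_id {a : 𝒜.Obj} {p : ℤ} (m : (M.obj a).X p) :
    hv (add_zero p) (idHom M) m = m :=
  hv_toHomComplex (𝟙 M) m

theorem isCocycle_id : IsCocycle (homComplex M M) (idHom M) :=
  isCocycle_toHomComplex (𝟙 M)

theorem comp_d {p q n p' q' n' : ℤ} (hpq : p + q = n) (hp : p + 1 = p') (hq : q + 1 = q')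
    (hn : n + 1 = n') (g : (homComplex M N).X p) (f : (homComplex L M).X q) :
    ((homComplex L N).d n n').hom (homComp hpq g f) =
      homComp (show p' + q = n' by lia) (((homComplex M N).d p p').hom g) f +
        koszulSign k p • homComp (show p + q' = n' by lia) g (((homComplex L M).d q q').hom f) := by
  subst hp hq hn
  exact (dgCat.{w} 𝒜).leibniz hpq g f

theorem comp_assoc {K : DGModule.{w} 𝒜} {p q r s t n : ℤ} (hpq : p + q = s) (hqr : q + r = t)
    (hsr : s + r = n) (hpt : p + t = n) (f : (homComplex M N).X p) (g : (homComplex L M).X q)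
    (e : (homComplex K L).X r) :
    homComp hsr (homComp hpq f g) e = homComp hpt f (homComp hqr g e) :=
  (dgCat.{w} 𝒜).assoc hpq hqr hsr hpt f g e

theorem id_comp {n : ℤ} (f : (homComplex M N).X n) : homComp (zero_add n) (idHom N) f = f :=
  (dgCat.{w} 𝒜).id_comp f

theorem comp_id {n : ℤ} (f : (homComplex M N).X n) : homComp (add_zero n) f (idHom M) = f :=
  (dgCat.{w} 𝒜).comp_id f

theorem isCocycle_comp {p q n : ℤ} (hpq : p + q = n) {g : (homComplex M N).X p}
    {f : (homComplex L M).X q} (hg : IsCocycle (homComplex M N) g)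
    (hf : IsCocycle (homComplex L M) f) : IsCocycle (homComplex L N) (homComp hpq g f) := by
  refine isCocycle_of rfl ?_
  rw [comp_d hpq rfl rfl rfl, hf, hg, map_zero, map_zero, smul_zero, add_zero,
    LinearMap.zero_apply]

theorem isBd_comp_left {p q n : ℤ} (hpq : p + q = n) {g : (homComplex M N).X p}
    {f : (homComplex L M).X q} (hg : IsBd (homComplex M N) g)
    (hf : IsCocycle (homComplex L M) f) : IsBd (homComplex L N) (homComp hpq g f) := by
  obtain ⟨y, rfl⟩ := hg.out (sub_add_cancel p 1)
  refine ⟨n - 1, homComp (show p - 1 + q = n - 1 by lia) y f, ?_⟩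
  rw [comp_d _ (sub_add_cancel p 1) rfl (sub_add_cancel n 1), hf, map_zero, smul_zero, add_zero]

theorem isBd_comp_right {p q n : ℤ} (hpq : p + q = n) {g : (homComplex M N).X p}
    {f : (homComplex L M).X q} (hg : IsCocycle (homComplex M N) g)
    (hf : IsBd (homComplex L M) f) : IsBd (homComplex L N) (homComp hpq g f) := by
  obtain ⟨y, rfl⟩ := hf.out (sub_add_cancel q 1)
  refine ⟨n - 1, koszulSign k p • homComp (show p + (q - 1) = n - 1 by lia) g y, ?_⟩
  rw [map_smul, comp_d _ rfl (sub_add_cancel q 1) (sub_add_cancel n 1), hg, map_zero,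
    LinearMap.zero_apply, zero_add, koszulSign_smul_smul]

theorem isQuasiIso_iff {f : M ⟶ N} :
    IsQuasiIso f ↔ ∀ (a : 𝒜.Obj) (n : ℤ), InjH (M.obj a) (N.obj a) n ((f.app a).f n).hom ∧
      SurjH (M.obj a) (N.obj a) n ((f.app a).f n).hom :=
  forall_congr' fun a => quasiIso_iff_elements (f.app a)

theorem isAcyclic_iff : M.IsAcyclic ↔ ∀ (a : 𝒜.Obj) (n : ℤ), HZero (M.obj a) n :=
  forall_congr' fun _ => acyclic_iff_hZero

/-! ### Shifts -/

/-- The shift `M[m]`. -/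
def shift (M : DGModule.{w} 𝒜) (m : ℤ) : DGModule.{w} 𝒜 :=
  mkModule (fun a i => (M.obj a).X (i + m))
    -- The right action is left unchanged, and an element of degree `p` of the shift has degree `p +
    -- m` in `M`. The sign `(-1)^m` on the differential compensates for this in the Leibniz rule.
    (fun a i j _ => koszulSign k m • ((M.obj a).d (i + m) (j + m)).hom)
    (fun a i j l _ _ x => by
      simp only [LinearMap.smul_apply, map_smul, dd_apply, smul_zero])
    (fun {a b p q n} hpq => M.act (show p + m + q = n + m by lia))
    (fun {a n} y => by exact M.act_id y)
    (fun {a b c p q r s t n} hpq hqr hsr hpt y x z => M.act_act _ hqr _ _ y x z)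
    (fun {a b p q n} hpq y x => by
      simp only [LinearMap.smul_apply, map_smul]
      rw [M.act_d _ (show p + m + 1 = p + 1 + m by lia) rfl (show n + m + 1 = n + 1 + m by lia),
        smul_add, smul_smul, koszulSign_add, mul_comm (koszulSign k p), ← mul_assoc,
        koszulSign_mul_self, one_mul])

theorem shift_d (M : DGModule.{w} 𝒜) (m : ℤ) {a : 𝒜.Obj} {i j : ℤ} (hij : i + 1 = j)
    (x : (M.obj a).X (i + m)) :
    (((M.shift m).obj a).d i j).hom x = koszulSign k m • ((M.obj a).d (i + m) (j + m)).hom x :=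
  congrArg (fun g => ModuleCat.Hom.hom g x) (dif_pos hij)

/-! ### Cones -/

section Cone

variable {n : ℤ} (f : (homComplex L M).X n) (hf : IsCocycle (homComplex L M) f)

/-- The cone of a closed morphism of degree `n`. -/
def cone : DGModule.{w} 𝒜 :=
  -- The second summand is shifted so that `f`, of degree `n`, raises the degree by one. The sign
  -- `-(-1)^n` on its differential makes the square vanish, since `d f = (-1)^n f d` for closed `f`.
  mkModule (fun a i => (M.obj a).X i × (L.obj a).X (i + 1 - n))
    (fun a i j hij =>
      LinearMap.prod (((M.obj a).d i j).hom.coprod (hv (show i + 1 - n + n = j by lia) f))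
        ((-koszulSign k n) • (((L.obj a).d (i + 1 - n) (j + 1 - n)).hom ∘ₗ LinearMap.snd k _ _)))
    (fun a i j l hij hjl x => by
      subst hij hjl
      refine Prod.ext ?_ ?_
      · change ((M.obj a).d _ _).hom (((M.obj a).d i (i + 1)).hom x.1 + hv _ f x.2) +
          hv _ f ((-koszulSign k n) • ((L.obj a).d _ _).hom x.2) = 0
        rw [map_add, dd_apply, zero_add, map_smul, hv_cocycle hf _
          (show i + 1 - n + 1 = i + 1 + 1 - n by lia) (show i + 1 + 1 - n + n = i + 1 + 1 by lia),
          neg_smul, add_neg_cancel]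
      · change (-koszulSign k n) • ((L.obj a).d _ _).hom
          ((-koszulSign k n) • ((L.obj a).d _ _).hom x.2) = 0
        rw [map_smul, dd_apply, smul_zero, smul_zero])
    (fun {a b p q r} hpq =>
      LinearMap.mk₂ k (fun m x => (M.act hpq m.1 x, L.act (show p + 1 - n + q = r + 1 - n by lia) m.2 x))
        (fun m m' x => by simp) (fun c m x => by simp) (fun m x x' => by simp)
        (fun c m x => by simp))
    (fun {a p} y => Prod.ext (M.act_id y.1) (L.act_id y.2))
    (fun {a b c p q r s t n} hpq hqr hsr hpt y x z =>
      Prod.ext (M.act_act _ hqr _ _ y.1 x z) (L.act_act _ hqr _ _ y.2 x z))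
    (fun {a b p q r} hpq y x => by
      refine Prod.ext ?_ ?_
      · change ((M.obj a).d r (r + 1)).hom (M.act hpq y.1 x) + hv _ f (L.act _ y.2 x) =
          M.act _ (((M.obj b).d p (p + 1)).hom y.1 + hv _ f y.2) x +
            koszulSign k p • M.act _ y.1 _
        rw [M.leibniz, map_add, LinearMap.add_apply,
          hv_act f (show p + 1 - n + n = p + 1 by lia) _ _ (by lia)]
        abel
      · change (-koszulSign k n) • ((L.obj a).d _ _).hom (L.act _ y.2 x) =
          L.act _ ((-koszulSign k n) • ((L.obj b).d _ _).hom y.2) x + koszulSign k p • L.act _ y.2 _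
        rw [L.act_d _ (show p + 1 - n + 1 = p + 1 + 1 - n by lia) rfl
          (show r + 1 - n + 1 = r + 1 + 1 - n by lia), smul_add, map_smul, smul_smul,
          LinearMap.smul_apply]
        congr 2
        rw [koszulSign_sub, koszulSign_succ]
        linear_combination (koszulSign k p) * koszulSign_mul_self k n)

variable {a : 𝒜.Obj} {i j : ℤ}

/-- The elements of the cone. -/
def coneMk (y : (M.obj a).X i) (l : (L.obj a).X (i + 1 - n)) : ((cone f hf).obj a).X i := (y, l)

/-- The first component of an element of the cone. -/
def coneFst : ((cone f hf).obj a).X i →ₗ[k] (M.obj a).X i := LinearMap.fst k _ _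

/-- The second component of an element of the cone. -/
def coneSnd : ((cone f hf).obj a).X i →ₗ[k] (L.obj a).X (i + 1 - n) := LinearMap.snd k _ _

@[simp] theorem coneFst_mk (y : (M.obj a).X i) (l : (L.obj a).X (i + 1 - n)) :
    coneFst f hf (coneMk f hf y l) = y := rfl

@[simp] theorem coneSnd_mk (y : (M.obj a).X i) (l : (L.obj a).X (i + 1 - n)) :
    coneSnd f hf (coneMk f hf y l) = l := rfl

theorem coneMk_eta (z : ((cone f hf).obj a).X i) :
    coneMk f hf (coneFst f hf z) (coneSnd f hf z) = z := rfl

theorem cone_ext {z z' : ((cone f hf).obj a).X i} (h₁ : coneFst f hf z = coneFst f hf z')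
    (h₂ : coneSnd f hf z = coneSnd f hf z') : z = z' := Prod.ext h₁ h₂

theorem cone_d (hij : i + 1 = j) (z : ((cone f hf).obj a).X i) :
    (((cone f hf).obj a).d i j).hom z =
      coneMk f hf (((M.obj a).d i j).hom (coneFst f hf z) +
          hv (show i + 1 - n + n = j by lia) f (coneSnd f hf z))
        ((-koszulSign k n) • ((L.obj a).d (i + 1 - n) (j + 1 - n)).hom (coneSnd f hf z)) :=
  congrArg (fun g => ModuleCat.Hom.hom g z) (dif_pos hij)

theorem cone_act {b : 𝒜.Obj} {p q r : ℤ} (hpq : p + q = r) (z : ((cone f hf).obj b).X p)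
    (x : (𝒜.Hom a b).X q) :
    (cone f hf).act hpq z x = coneMk f hf (M.act hpq (coneFst f hf z) x)
      (L.act (show p + 1 - n + q = r + 1 - n by lia) (coneSnd f hf z) x) := rfl

end Cone

end DGModule

/-! ### Morphisms into and out of a cone -/

namespace DGModule

variable {k : Type v} [Field k] {𝒜 : DGCategory.{v, o, h} k}
variable {L M N Y : DGModule.{w} 𝒜}

/-- The identity morphism, applied from degree `p` to an equal degree `p + 0 = p'`, serves as a
transport between the two degrees. This rule and the following ones remove such transports. -/
theorem hv_hv_id {n : ℤ} (f : (homComplex M N).X n) {a : 𝒜.Obj} {p p' q : ℤ} (hp : p + 0 = p')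
    (hq : p' + n = q) (m : (M.obj a).X p) :
    hv hq f (hv hp (idHom M) m) = hv (show p + n = q by lia) f m := by
  rw [← hv_comp (add_zero n) f (idHom M) hp hq, comp_id]

theorem hv_id_hv {n : ℤ} (f : (homComplex M N).X n) {a : 𝒜.Obj} {p q q' : ℤ} (hp : p + n = q)
    (hq : q + 0 = q') (m : (M.obj a).X p) :
    hv hq (idHom N) (hv hp f m) = hv (show p + n = q' by lia) f m := by
  rw [← hv_comp (zero_add n) (idHom N) f hp hq, id_comp]

theorem hv_id_act {a b : 𝒜.Obj} {p q r p' r' : ℤ} (hpq : p + q = r) (hp : p + 0 = p')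
    (hr : r + 0 = r') (m : (M.obj b).X p) (x : (𝒜.Hom a b).X q) :
    hv hr (idHom M) (M.act hpq m x) = M.act (show p' + q = r' by lia) (hv hp (idHom M) m) x :=
  hv_act _ _ _ _ _ m x

theorem d_hv_id {a : 𝒜.Obj} {p q p' q' : ℤ} (hpq : p + 0 = q) (hp : p + 1 = p') (hq : p' + 0 = q')
    (m : (M.obj a).X p) :
    ((M.obj a).d q q').hom (hv hpq (idHom M) m) =
      hv hq (idHom M) (((M.obj a).d p p').hom m) := by
  rw [hv_cocycle isCocycle_id hpq hp hq, koszulSign_zero, one_smul]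

/-- A closed morphism induces isomorphisms on cohomology. -/
def IsQI {n : ℤ} (f : (homComplex L M).X n) : Prop :=
  ∀ (a : 𝒜.Obj) (p q : ℤ) (hpq : p + n = q),
    (∀ l : (L.obj a).X p, IsCocycle (L.obj a) l → IsBd (M.obj a) (hv hpq f l) →
      IsBd (L.obj a) l) ∧
    ∀ y : (M.obj a).X q, IsCocycle (M.obj a) y → ∃ l : (L.obj a).X p, IsCocycle (L.obj a) l ∧
      IsBd (M.obj a) (hv hpq f l - y)

theorem isQI_toHomComplex_iff {f : L ⟶ M} : IsQI (Hom.toHomComplex f) ↔ IsQuasiIso f := by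
  rw [isQuasiIso_iff]
  constructor
  · intro H a n
    have := H a n n (add_zero n)
    simp only [hv_toHomComplex] at this
    exact this
  · intro H a p q hpq
    obtain rfl : p = q := by lia
    simp only [hv_toHomComplex]
    exact H a p

section Cone

variable {n : ℤ} (f : (homComplex L M).X n) (hf : IsCocycle (homComplex L M) f)

/-- The morphism from the cone with given components. -/
def coneDesc {j j' : ℤ} (hj : j' = j + n - 1) (g : (homComplex M Y).X j)
    (t : (homComplex L Y).X j') : (homComplex (cone f hf) Y).X j :=
  mkHom (fun a p q hpq => hv hpq g ∘ₗ coneFst f hf +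
      hv (show p + 1 - n + j' = q by lia) t ∘ₗ coneSnd f hf)
    (fun a b p r s p' s' hp hr hs hr' m x => by
      simp only [LinearMap.add_apply, LinearMap.comp_apply, cone_act, coneFst_mk, coneSnd_mk]
      rw [hv_act g hp hr hs hr', hv_act t (show p + 1 - n + j' = p' by lia) _ _ hr', map_add,
        LinearMap.add_apply])

theorem hv_coneDesc {j j' : ℤ} (hj : j' = j + n - 1) (g : (homComplex M Y).X j)
    (t : (homComplex L Y).X j') {a : 𝒜.Obj} {p q : ℤ} (hpq : p + j = q)
    (z : ((cone f hf).obj a).X p) :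
    hv hpq (coneDesc f hf hj g t) z =
      hv hpq g (coneFst f hf z) + hv (show p + 1 - n + j' = q by lia) t (coneSnd f hf z) := rfl

/-- The morphism to the cone with given components. -/
def coneLift {j j' : ℤ} (hj : j' = j + 1 - n) (g : (homComplex Y M).X j)
    (t : (homComplex Y L).X j') : (homComplex Y (cone f hf)).X j :=
  mkHom (fun a p q hpq => (LinearMap.prod (hv hpq g) (hv (show p + j' = q + 1 - n by lia) t) :
      (Y.obj a).X p →ₗ[k] (M.obj a).X q × (L.obj a).X (q + 1 - n)))
    (fun a b p r s p' s' hp hr hs hr' m x =>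
      Prod.ext (hv_act g hp hr hs hr' m x) (hv_act t _ hr _ (by lia) m x))

theorem hv_coneLift {j j' : ℤ} (hj : j' = j + 1 - n) (g : (homComplex Y M).X j)
    (t : (homComplex Y L).X j') {a : 𝒜.Obj} {p q : ℤ} (hpq : p + j = q) (y : (Y.obj a).X p) :
    hv hpq (coneLift f hf hj g t) y =
      coneMk f hf (hv hpq g y) (hv (show p + j' = q + 1 - n by lia) t y) := rfl

/-- A morphism out of the cone is a pair `(g, t)`. The differential of the cone feeds `L` into `M`
along `f`, whence the term `g ∘ f`: the pair is closed if and only if `g` is closed and `t` is a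
homotopy from `g ∘ f` to zero, up to sign. -/
theorem coneDesc_d {j j' i i' : ℤ} (hj : j' = j + n - 1) (hi : j + 1 = i) (hi' : j' + 1 = i')
    (g : (homComplex M Y).X j) (t : (homComplex L Y).X j') :
    ((homComplex (cone f hf) Y).d j i).hom (coneDesc f hf hj g t) =
      coneDesc f hf (show i' = i + n - 1 by lia) (((homComplex M Y).d j i).hom g)
        (((homComplex L Y).d j' i').hom t -
          koszulSign k j • homComp (show j + n = i' by lia) g f) := by
  refine hom_ext' fun a p q hpq z => ?_
  rw [hv_d hi _ hpq rfl rfl, hv_coneDesc, hv_coneDesc, hv_coneDesc, cone_d _ _ rfl, coneFst_mk,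
    coneSnd_mk, hv_d hi g hpq rfl rfl]
  simp only [map_sub, LinearMap.sub_apply, map_smul, LinearMap.smul_apply, map_add]
  rw [hv_d hi' t _ (show p + 1 - n + j' = p + j by lia)
      (show p + 1 - n + 1 = p + 1 + 1 - n by lia),
    hv_comp _ g f (show p + 1 - n + n = p + 1 by lia) (show p + 1 + j = q by lia),
    smul_add, smul_add, smul_smul,
    show koszulSign k j * -koszulSign k n = koszulSign k j' by
      rw [hj, koszulSign_sub, koszulSign_add, koszulSign_one, mul_neg_one, mul_neg]]
  abel

theorem coneLift_d {j j' i i' : ℤ} (hj : j' = j + 1 - n) (hi : j + 1 = i) (hi' : j' + 1 = i')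
    (g : (homComplex Y M).X j) (t : (homComplex Y L).X j') :
    ((homComplex Y (cone f hf)).d j i).hom (coneLift f hf hj g t) =
      coneLift f hf (show i' = i + 1 - n by lia)
        (((homComplex Y M).d j i).hom g + homComp (show n + j' = i by lia) f t)
        ((-koszulSign k n) • ((homComplex Y L).d j' i').hom t) := by
  refine hom_ext' fun a p q hpq z => cone_ext f hf ?_ ?_
  · rw [hv_d hi _ hpq rfl rfl, hv_coneLift, hv_coneLift, hv_coneLift,
      cone_d _ _ (show p + j + 1 = q by lia), map_sub, map_smul, coneFst_mk, coneFst_mk,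
      coneFst_mk, coneFst_mk, coneSnd_mk, map_add, LinearMap.add_apply, hv_d hi g hpq rfl rfl,
      hv_comp _ f t (show p + j' = p + j + 1 - n by lia) (by lia)]
    abel
  · rw [hv_d hi _ hpq rfl rfl, hv_coneLift, hv_coneLift, hv_coneLift,
      cone_d _ _ (show p + j + 1 = q by lia), map_sub, map_smul, coneSnd_mk, coneSnd_mk,
      coneSnd_mk, coneSnd_mk, map_smul, LinearMap.smul_apply,
      hv_d hi' t (show p + i' = q + 1 - n by lia) (show p + j' = p + j + 1 - n by lia) rfl,
      smul_sub, smul_smul,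
      show -koszulSign k n * koszulSign k j' = koszulSign k j by
        rw [hj, koszulSign_sub, koszulSign_succ]
        linear_combination (koszulSign k j) * koszulSign_mul_self k n]

theorem coneDesc_surj {j j' : ℤ} (hj : j' = j + n - 1) (φ : (homComplex (cone f hf) Y).X j) :
    ∃ (g : (homComplex M Y).X j) (t : (homComplex L Y).X j'), φ = coneDesc f hf hj g t := by
  refine ⟨homComp (add_zero j) φ (coneLift f hf (show 1 - n = 0 + 1 - n by lia) (idHom M) 0),
    homComp (show j + (n - 1) = j' by lia) φ
      (coneLift f hf (show 0 = n - 1 + 1 - n by lia) 0 (idHom L)), ?_⟩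
  refine hom_ext' fun a p q hpq z => ?_
  rw [hv_coneDesc, hv_comp _ _ _ (add_zero p) hpq, hv_comp _ _ _
    (show p + 1 - n + (n - 1) = p by lia) hpq, hv_coneLift, hv_coneLift, ← map_add]
  congr 1
  refine cone_ext f hf ?_ ?_
  · rw [map_add, coneFst_mk, coneFst_mk, hv_id, map_zero, LinearMap.zero_apply, add_zero]
  · rw [map_add, coneSnd_mk, coneSnd_mk, hv_id, map_zero, LinearMap.zero_apply, zero_add]

theorem coneLift_surj {j j' : ℤ} (hj : j' = j + 1 - n) (φ : (homComplex Y (cone f hf)).X j) :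
    ∃ (g : (homComplex Y M).X j) (t : (homComplex Y L).X j'), φ = coneLift f hf hj g t := by
  refine ⟨homComp (zero_add j) (coneDesc f hf (show n - 1 = 0 + n - 1 by lia) (idHom M) 0) φ,
    homComp (show 1 - n + j = j' by lia)
      (coneDesc f hf (show 0 = 1 - n + n - 1 by lia) 0 (idHom L)) φ, ?_⟩
  refine hom_ext' fun a p q hpq z => cone_ext f hf ?_ ?_
  · rw [hv_coneLift, hv_comp _ _ _ hpq (add_zero q), hv_coneDesc, coneFst_mk, hv_id, map_zero,
      LinearMap.zero_apply, add_zero]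
  · rw [hv_coneLift, hv_comp _ _ _ hpq (show q + (1 - n) = q + 1 - n by lia), hv_coneDesc,
      coneSnd_mk, hv_id, map_zero, LinearMap.zero_apply, zero_add]

/-- The inclusion in the cone. -/
def coneInl : (homComplex M (cone f hf)).X 0 :=
  coneLift f hf (show 1 - n = 0 + 1 - n by lia) (idHom M) 0

/-- The inclusion of the source in the cone; it is not closed. -/
def coneInr : (homComplex L (cone f hf)).X (n - 1) :=
  coneLift f hf (show 0 = n - 1 + 1 - n by lia) 0 (idHom L)

/-- The first projection from the cone; it is not closed. -/
def conePr : (homComplex (cone f hf) M).X 0 :=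
  coneDesc f hf (show n - 1 = 0 + n - 1 by lia) (idHom M) 0

/-- The projection from the cone to the source. -/
def coneBd : (homComplex (cone f hf) L).X (1 - n) :=
  coneDesc f hf (show 0 = 1 - n + n - 1 by lia) 0 (idHom L)

theorem hv_coneInl {a : 𝒜.Obj} {p : ℤ} (m : (M.obj a).X p) :
    hv (add_zero p) (coneInl f hf) m = coneMk f hf m 0 := by
  rw [coneInl, hv_coneLift, hv_id, map_zero, LinearMap.zero_apply]

theorem hv_coneBd {a : 𝒜.Obj} {p : ℤ} (z : ((cone f hf).obj a).X p) :
    hv (show p + (1 - n) = p + 1 - n by lia) (coneBd f hf) z = coneSnd f hf z := by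
  rw [coneBd, hv_coneDesc, map_zero, LinearMap.zero_apply, zero_add, hv_id]

theorem hv_conePr {a : 𝒜.Obj} {p : ℤ} (z : ((cone f hf).obj a).X p) :
    hv (add_zero p) (conePr f hf) z = coneFst f hf z := by
  rw [conePr, hv_coneDesc, map_zero, LinearMap.zero_apply, add_zero, hv_id]

theorem isCocycle_coneInl : IsCocycle (homComplex M (cone f hf)) (coneInl f hf) := by
  refine isCocycle_of rfl ?_
  rw [coneInl, coneLift_d f hf _ rfl rfl, isCocycle_id, map_zero, map_zero, smul_zero, add_zero]
  exact hom_ext' fun a p q hpq z => rfl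

theorem isCocycle_coneBd : IsCocycle (homComplex (cone f hf) L) (coneBd f hf) := by
  refine isCocycle_of rfl ?_
  rw [coneBd, coneDesc_d f hf _ rfl rfl, isCocycle_id, map_zero, map_zero, LinearMap.zero_apply,
    smul_zero, sub_zero]
  refine hom_ext' fun a p q hpq z => ?_
  rw [hv_coneDesc]
  simp

/-- The projection to `M` fails to be closed precisely by the attaching morphism. Together with the
two identities that follow, this describes the cone by equations inside the dg category, which every
dg module respects. `hZero_of_cone` relies on that. -/
theorem conePr_d : ((homComplex (cone f hf) M).d 0 1).hom (conePr f hf) =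
    -homComp (show n + (1 - n) = 1 by lia) f (coneBd f hf) := by
  rw [conePr, coneDesc_d f hf _ (zero_add 1) (show n - 1 + 1 = n by lia), isCocycle_id, map_zero,
    koszulSign_zero, one_smul]
  refine hom_ext' fun a p q hpq z => ?_
  rw [hv_coneDesc, map_neg, LinearMap.neg_apply,
    hv_comp _ f _ (show p + (1 - n) = p + 1 - n by lia) (by lia), hv_coneBd]
  simp only [map_zero, LinearMap.zero_apply, zero_sub, zero_add, map_neg, LinearMap.neg_apply]
  congr 1
  exact (hv_comp (zero_add n) (idHom M) f (show p + 1 - n + n = q by lia) (add_zero q) (by lia)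
    _).trans (hv_id _)

theorem conePr_coneInl : homComp (add_zero 0) (conePr f hf) (coneInl f hf) = idHom M := by
  refine hom_ext' fun a p q hpq z => ?_
  obtain rfl : p = q := by lia
  rw [hv_comp _ _ _ (add_zero p) (add_zero p), hv_coneInl, hv_conePr, coneFst_mk, hv_id]

theorem coneBd_coneInl : homComp (add_zero (1 - n)) (coneBd f hf) (coneInl f hf) = 0 := by
  refine hom_ext' fun a p q hpq z => ?_
  obtain rfl : q = p + 1 - n := by lia
  rw [hv_comp _ _ _ (add_zero p) (by lia), hv_coneInl, hv_coneBd, coneSnd_mk]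
  rfl

/-! ### Maps out of a cone -/

/-- Write `φ = (φ₁, φ₂)`. Closedness gives `dφ₂ = (-1)^j φ₁ f`, and `φ₁ = dg`, so `φ₂ + (-1)^i g f`
is closed. A primitive of it is the missing component. The extension restricts to `g` strictly and
not only up to homotopy, as is needed to pass to sequential colimits. -/
theorem cone_extend {j i : ℤ} (hi : i + 1 = j) {φ : (homComplex (cone f hf) Y).X j}
    (hφ : IsCocycle (homComplex (cone f hf) Y) φ) {g : (homComplex M Y).X i}
    (hg : ((homComplex M Y).d i j).hom g = homComp (add_zero j) φ (coneInl f hf))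
    (hL : HZero (homComplex L Y) (j + n - 1)) :
    ∃ g' : (homComplex (cone f hf) Y).X i, ((homComplex (cone f hf) Y).d i j).hom g' = φ ∧
      homComp (add_zero i) g' (coneInl f hf) = g := by
  have hres : ∀ {l l' : ℤ} (hl : l' = l + n - 1) (g₁ : (homComplex M Y).X l)
      (t₁ : (homComplex L Y).X l'),
      homComp (add_zero l) (coneDesc f hf hl g₁ t₁) (coneInl f hf) = g₁ := by
    intro l l' hl g₁ t₁
    refine hom_ext' fun a p q hpq z => ?_
    rw [hv_comp _ _ _ (add_zero p) hpq, hv_coneInl, hv_coneDesc, coneFst_mk, coneSnd_mk, map_zero,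
      add_zero]
  obtain ⟨φ₁, φ₂, rfl⟩ := coneDesc_surj f hf (j' := j + n - 1) rfl φ
  rw [hres] at hg
  have h2 := congrArg (fun z => homComp (show j + 1 + (n - 1) = j + n by lia) z (coneInr f hf))
    ((coneDesc_d f hf rfl rfl (show j + n - 1 + 1 = j + n by lia) φ₁ φ₂).symm.trans (hφ _))
  have h3 : ((homComplex L Y).d (j + n - 1) (j + n)).hom φ₂ =
      koszulSign k j • homComp rfl φ₁ f := by
    rw [← sub_eq_zero]
    simp only [map_zero, LinearMap.zero_apply] at h2
    rw [← h2]
    refine hom_ext' fun a p q hpq z => ?_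
    rw [hv_comp _ _ _ (show p + (n - 1) = p + n - 1 by lia) (show p + n - 1 + (j + 1) = q by lia),
      hv_coneDesc, coneInr, hv_coneLift, coneSnd_mk, coneFst_mk, map_zero, LinearMap.zero_apply,
      map_zero, zero_add, hv_hv_id]
  have hsgn : koszulSign k j = -koszulSign k i := by rw [← hi, koszulSign_succ]
  obtain ⟨t, ht⟩ := (hL (φ₂ + koszulSign k i • homComp (show i + n = j + n - 1 by lia) g f)
    (isCocycle_of (show j + n - 1 + 1 = j + n by lia) (by
      rw [map_add, h3, map_smul, comp_d _ hi rfl (show j + n - 1 + 1 = j + n by lia), hf,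
        map_zero, smul_zero, add_zero, hg, hsgn, neg_smul, neg_add_cancel]))).out
    (show i + n - 1 + 1 = j + n - 1 by lia)
  refine ⟨coneDesc f hf rfl g t, ?_, hres _ _ _⟩
  rw [coneDesc_d f hf rfl hi (show i + n - 1 + 1 = j + n - 1 by lia), ht, hg, add_sub_cancel_right]

theorem hZero_hom_cone {j : ℤ} (hM : HZero (homComplex M Y) j)
    (hL : HZero (homComplex L Y) (j + n - 1)) : HZero (homComplex (cone f hf) Y) j := by
  intro φ hφ
  obtain ⟨g, hg⟩ := (hM _ (isCocycle_comp (add_zero j) hφ (isCocycle_coneInl f hf))).out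
    (sub_add_cancel j 1)
  obtain ⟨g', hg', -⟩ := cone_extend f hf (sub_add_cancel j 1) hφ hg hL
  exact ⟨_, g', hg'⟩

theorem isHProjective_cone (hM : M.IsHProjective) (hL : L.IsHProjective) :
    (cone f hf).IsHProjective := fun Y hY =>
  acyclic_iff_hZero.2 fun _ => hZero_hom_cone f hf (acyclic_iff_hZero.1 (hM Y hY) _)
    (acyclic_iff_hZero.1 (hL Y hY) _)

/-! ### The cohomology of a cone -/

variable {f hf}

theorem isCocycle_coneMk_iff {a : 𝒜.Obj} {p : ℤ} {y : (M.obj a).X p}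
    {l : (L.obj a).X (p + 1 - n)} :
    IsCocycle ((cone f hf).obj a) (coneMk f hf y l) ↔ IsCocycle (L.obj a) l ∧
      ((M.obj a).d p (p + 1)).hom y + hv (show p + 1 - n + n = p + 1 by lia) f l = 0 := by
  constructor
  · intro H
    have := H (p + 1)
    rw [cone_d f hf rfl, coneFst_mk, coneSnd_mk] at this
    refine ⟨isCocycle_of (show p + 1 - n + 1 = p + 1 + 1 - n by lia) ?_,
      congrArg (coneFst f hf) this⟩
    have h2 : (-koszulSign k n) • ((L.obj a).d (p + 1 - n) (p + 1 + 1 - n)).hom l = 0 :=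
      congrArg (coneSnd f hf) this
    exact (smul_eq_zero.1 h2).resolve_left (neg_ne_zero.2 (koszulSign_ne_zero n))
  · rintro ⟨hl, hy⟩
    refine isCocycle_of rfl ?_
    rw [cone_d f hf rfl, coneFst_mk, coneSnd_mk, hy, hl, smul_zero]
    rfl

theorem isBd_coneMk_zero {a : 𝒜.Obj} {p q : ℤ} (hpq : q + n = p) {y : (M.obj a).X p}
    {l : (L.obj a).X q} (hl : IsCocycle (L.obj a) l) (hy : IsBd (M.obj a) (hv hpq f l - y)) :
    IsBd ((cone f hf).obj a) (coneMk f hf y 0) := by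
  obtain rfl : q = p - 1 + 1 - n := by lia
  obtain ⟨m, hm⟩ := hy.out (sub_add_cancel p 1)
  refine ⟨p - 1, coneMk f hf (-m) l, ?_⟩
  rw [cone_d f hf (sub_add_cancel p 1), coneFst_mk, coneSnd_mk, map_neg, hm, hl, smul_zero]
  congr 1
  abel

/-- Both conclusions are read off from the two components of a primitive. The second one is
exactness of the long exact sequence at `M`. -/
theorem IsBd.of_coneMk {a : 𝒜.Obj} {p q : ℤ} (hpq : q + n = p) {y : (M.obj a).X p}
    {l' : (L.obj a).X (p + 1 - n)} (hb : IsBd ((cone f hf).obj a) (coneMk f hf y l')) :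
    IsBd (L.obj a) l' ∧ (l' = 0 → ∃ l : (L.obj a).X q, IsCocycle (L.obj a) l ∧
      IsBd (M.obj a) (hv hpq f l - y)) := by
  obtain ⟨z, hz⟩ := hb.out (sub_add_cancel p 1)
  rw [cone_d f hf (sub_add_cancel p 1)] at hz
  have h1 : _ = y := congrArg (coneFst f hf) hz
  have h2 : (-koszulSign k n) • ((L.obj a).d (p - 1 + 1 - n) (p + 1 - n)).hom (coneSnd f hf z) = l' :=
    congrArg (coneSnd f hf) hz
  refine ⟨h2 ▸ (isBd_d _).smul _, fun h0 => ?_⟩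
  obtain rfl : q = p - 1 + 1 - n := by lia
  refine ⟨coneSnd f hf z, isCocycle_of (show p - 1 + 1 - n + 1 = p + 1 - n by lia) ?_, ?_⟩
  · rw [h0] at h2
    exact (smul_eq_zero.1 h2).resolve_left (neg_ne_zero.2 (koszulSign_ne_zero n))
  · rw [← h1, coneFst_mk, sub_add_cancel_right]
    exact (isBd_d _).neg

/-- Exactness at the cone: if the second component is `dm`, subtracting the boundary of `(0, ±m)`
makes it vanish. -/
theorem exists_sub_coneMk_zero {a : 𝒜.Obj} {p : ℤ} {z : ((cone f hf).obj a).X p}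
    (hz : IsCocycle ((cone f hf).obj a) z) (hb : IsBd (L.obj a) (coneSnd f hf z)) :
    ∃ y : (M.obj a).X p, IsCocycle (M.obj a) y ∧
      IsBd ((cone f hf).obj a) (z - coneMk f hf y 0) := by
  obtain ⟨m, hm⟩ := hb.out (show p - 1 + 1 - n + 1 = p + 1 - n by lia)
  have e : z - (((cone f hf).obj a).d (p - 1) p).hom
      (coneMk f hf 0 ((-koszulSign k n) • m)) = coneMk f hf (coneFst f hf (z -
        (((cone f hf).obj a).d (p - 1) p).hom (coneMk f hf 0 ((-koszulSign k n) • m)))) 0 := by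
    refine cone_ext f hf rfl ?_
    rw [coneSnd_mk, map_sub, cone_d f hf (sub_add_cancel p 1), coneSnd_mk, coneSnd_mk, map_smul,
      hm, neg_smul, neg_smul, smul_neg, neg_neg, koszulSign_smul_smul, sub_self]
  have hc := hz.sub (isCocycle_d (m := p - 1) (n := p) (coneMk f hf 0 ((-koszulSign k n) • m)))
  rw [e, isCocycle_coneMk_iff] at hc
  refine ⟨coneFst f hf (z - (((cone f hf).obj a).d (p - 1) p).hom
      (coneMk f hf 0 ((-koszulSign k n) • m))), isCocycle_of rfl ?_, ?_⟩
  · have h2 := hc.2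
    rw [map_zero, add_zero] at h2
    exact h2
  · rw [← e, sub_sub_cancel]
    exact isBd_d _

/-- Vanishing in degree `p` only needs surjectivity onto the cohomology of `M` in degree `p` and
injectivity one degree further. Inductions on amplitude know the two only in particular degrees, so
the degrees are kept separate. -/
theorem hZero_cone {a : 𝒜.Obj} {p q r : ℤ} (hpq : q + n = p) (hr : q + 1 = r) (hr' : r + n = p + 1)
    (hi : ∀ l : (L.obj a).X r, IsCocycle (L.obj a) l → IsBd (M.obj a) (hv hr' f l) →
      IsBd (L.obj a) l)
    (hs : ∀ y : (M.obj a).X p, IsCocycle (M.obj a) y → ∃ l : (L.obj a).X q, IsCocycle (L.obj a) l ∧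
      IsBd (M.obj a) (hv hpq f l - y)) : HZero ((cone f hf).obj a) p := by
  intro z hz
  obtain rfl : r = p + 1 - n := by lia
  have hz' := hz
  rw [← coneMk_eta f hf z, isCocycle_coneMk_iff] at hz'
  obtain ⟨y, hy, hb⟩ := exists_sub_coneMk_zero hz (hi _ hz'.1 (by
    rw [eq_neg_of_add_eq_zero_right hz'.2]
    exact (isBd_d _).neg))
  obtain ⟨l, hl, hb'⟩ := hs y hy
  exact (isBd_iff_of_sub hb).2 (isBd_coneMk_zero hpq hl hb')

theorem isAcyclic_cone_iff : (cone f hf).IsAcyclic ↔ IsQI f := by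
  rw [isAcyclic_iff]
  constructor
  · intro H a p q hpq
    constructor
    · intro l hl hb
      obtain ⟨q', rfl⟩ : ∃ q', q = q' + 1 := ⟨q - 1, by lia⟩
      obtain rfl : p = q' + 1 - n := by lia
      obtain ⟨m, hm⟩ := hb.out rfl
      refine (IsBd.of_coneMk (hf := hf) (q := q' - n) (by lia) (H a q' (coneMk f hf (-m) l)
        (isCocycle_coneMk_iff.2 ⟨hl, ?_⟩))).1
      rw [map_neg, hm, neg_add_cancel]
    · intro y hy
      refine (IsBd.of_coneMk (hf := hf) hpq (H a q (coneMk f hf y 0)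
        (isCocycle_coneMk_iff.2 ⟨isCocycle_zero, ?_⟩))).2 rfl
      rw [hy, map_zero, add_zero]
  · intro H a p
    exact hZero_cone (q := p - n) (r := p + 1 - n) (by lia) (by lia) (by lia)
      (H a _ _ _).1 (H a _ _ _).2

end Cone

/-! ### H-projective modules and quasi-isomorphisms -/

/-- The pair `(g, 0)` is a closed morphism to the acyclic cone of `f`, hence a boundary. The second
component of a primitive is the lift, and the first component is the homotopy between `f g'` and
`g`. -/
theorem IsHProjective.exists_lift {Q : DGModule.{w} 𝒜} (hQ : Q.IsHProjective)
    {f : (homComplex L M).X 0} (hf : IsCocycle (homComplex L M) f) (hq : IsQI f) {n : ℤ}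
    {g : (homComplex Q M).X n} (hg : IsCocycle (homComplex Q M) g) :
    ∃ g' : (homComplex Q L).X n, IsCocycle (homComplex Q L) g' ∧
      IsBd (homComplex Q M) (homComp (zero_add n) f g' - g) := by
  have hac := acyclic_iff_hZero.1 (hQ _ (isAcyclic_cone_iff (hf := hf).2 hq))
  have hc : IsCocycle (homComplex Q (cone f hf))
      (coneLift f hf (show n + 1 = n + 1 - 0 by lia) g 0) := by
    refine isCocycle_of rfl ?_
    rw [coneLift_d f hf _ rfl rfl, hg, map_zero, map_zero, smul_zero, add_zero]
    exact hom_ext' fun a p q hpq z => rfl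
  obtain ⟨e, he⟩ := (hac n _ hc).out (sub_add_cancel n 1)
  obtain ⟨s, t, rfl⟩ := coneLift_surj f hf (show n = n - 1 + 1 - 0 by lia) e
  rw [coneLift_d f hf _ (sub_add_cancel n 1) rfl] at he
  have h1 : ((homComplex Q M).d (n - 1) n).hom s + homComp (zero_add n) f t = g := by
    refine hom_ext' fun a p q hpq z => ?_
    exact congrArg (fun φ => coneFst f hf (hv hpq φ z)) he
  have h2 : (-koszulSign k 0) • ((homComplex Q L).d n (n + 1)).hom t = 0 := by
    refine hom_ext' fun a p q hpq z => ?_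
    obtain ⟨q', rfl⟩ : ∃ q', q = q' + 1 - 0 := ⟨q - 1, by lia⟩
    exact congrArg (fun φ => coneSnd f hf (hv (show p + n = q' by lia) φ z)) he
  refine ⟨t, isCocycle_of rfl ((smul_eq_zero.1 h2).resolve_left
    (neg_ne_zero.2 (koszulSign_ne_zero 0))), ?_⟩
  rw [← h1, sub_add_cancel_right]
  exact (isBd_d _).neg

/-- Composition with a quasi-isomorphism is injective on classes of morphisms from an h-projective
module. -/
theorem IsHProjective.isBd_of_comp {Q : DGModule.{w} 𝒜} (hQ : Q.IsHProjective)
    {f : (homComplex L M).X 0} (hf : IsCocycle (homComplex L M) f) (hq : IsQI f) {n : ℤ}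
    {g : (homComplex Q L).X n} (hg : IsCocycle (homComplex Q L) g)
    (hb : IsBd (homComplex Q M) (homComp (zero_add n) f g)) : IsBd (homComplex Q L) g := by
  have hac := acyclic_iff_hZero.1 (hQ _ (isAcyclic_cone_iff (hf := hf).2 hq))
  obtain ⟨s, hs⟩ := hb.out (sub_add_cancel n 1)
  -- If `f g = ds`, then `(-s, g)` is a closed morphism to the acyclic cone, and the second
  -- component of a primitive exhibits `g` as a coboundary.
  have hc : IsCocycle (homComplex Q (cone f hf))
      (coneLift f hf (show n = n - 1 + 1 - 0 by lia) (-s) g) := by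
    refine isCocycle_of (sub_add_cancel n 1) ?_
    rw [coneLift_d f hf _ (sub_add_cancel n 1) rfl, hg, map_neg, hs, neg_add_cancel, smul_zero]
    exact hom_ext' fun a p q hpq z => rfl
  obtain ⟨e, he⟩ := (hac (n - 1) _ hc).out (sub_add_cancel (n - 1) 1)
  obtain ⟨s', t, rfl⟩ := coneLift_surj f hf (show n - 1 = n - 1 - 1 + 1 - 0 by lia) e
  rw [coneLift_d f hf _ (sub_add_cancel (n - 1) 1) (sub_add_cancel n 1)] at he
  have h2 : (-koszulSign k 0) • ((homComplex Q L).d (n - 1) n).hom t = g := by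
    refine hom_ext' fun a p q hpq z => ?_
    obtain ⟨q', rfl⟩ : ∃ q', q = q' + 1 - 0 := ⟨q - 1, by lia⟩
    exact congrArg (fun φ => coneSnd f hf (hv (show p + (n - 1) = q' by lia) φ z)) he
  rw [← h2]
  exact (isBd_d _).smul _

/-- A quasi-isomorphism between h-projective modules is a homotopy equivalence. -/
theorem IsHProjective.exists_homotopyInverse {P Q : DGModule.{w} 𝒜} (hP : P.IsHProjective)
    (hQ : Q.IsHProjective) {f : (homComplex P Q).X 0} (hf : IsCocycle (homComplex P Q) f)
    (hq : IsQI f) : ∃ g : (homComplex Q P).X 0, IsCocycle (homComplex Q P) g ∧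
      IsBd (homComplex Q Q) (homComp (add_zero 0) f g - idHom Q) ∧
      IsBd (homComplex P P) (homComp (add_zero 0) g f - idHom P) := by
  obtain ⟨g, hg, hb⟩ := hQ.exists_lift hf hq isCocycle_id
  refine ⟨g, hg, hb, hP.isBd_of_comp hf hq
    ((isCocycle_comp _ hg hf).sub isCocycle_id) ?_⟩
  have := isBd_comp_left (zero_add 0) hb hf
  rw [map_sub, LinearMap.sub_apply] at this
  rw [map_sub]
  rw [comp_assoc (zero_add 0) (zero_add 0) (zero_add 0) (zero_add 0), id_comp] at this
  rwa [comp_id]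

theorem IsQI.comp {m n l : ℤ} {f : (homComplex M N).X m} {g : (homComplex L M).X n}
    (hf : IsQI f) (hg : IsQI g) (hfc : IsCocycle (homComplex M N) f)
    (hgc : IsCocycle (homComplex L M) g) (hl : m + n = l) : IsQI (homComp hl f g) := by
  intro a p q hpq
  have e : ∀ z : (L.obj a).X p, hv hpq (homComp hl f g) z =
      hv (show p + n + m = q by lia) f (hv rfl g z) := fun z => hv_comp _ _ _ _ _ _ z
  constructor
  · intro z hz hb
    rw [e] at hb
    exact (hg a _ _ _).1 z hz ((hf a _ _ _).1 _ (isCocycle_hv hgc _ hz) hb)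
  · intro y hy
    obtain ⟨z, hz, hb⟩ := (hf a (p + n) q (by lia)).2 y hy
    obtain ⟨z', hz', hb'⟩ := (hg a p _ rfl).2 z hz
    refine ⟨z', hz', ?_⟩
    rw [e]
    have := (isBd_hv hfc (show p + n + m = q by lia) hb').add hb
    rwa [map_sub, sub_add_sub_cancel] at this

end DGModule

/-! ### Identities and the Leibniz rule in a dg category -/

namespace DGCategory

variable {k : Type v} [Field k] (𝒞 : DGCategory.{v, o, h} k)

theorem isCocycle_id (a : 𝒞.Obj) : IsCocycle (𝒞.Hom a a) (𝒞.id a) := by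
  refine isCocycle_of rfl ?_
  have h := 𝒞.leibniz (add_zero 0) (𝒞.id a) (𝒞.id a)
  rw [koszulSign_zero, one_smul, 𝒞.comp_id] at h
  exact left_eq_add.mp (h.trans (congrArg₂ (· + ·) (𝒞.comp_id _) (𝒞.id_comp _)))

/-- The identity in a degree equal to `0`. -/
def idAt (a : 𝒞.Obj) {n : ℤ} (hn : n = 0) : (𝒞.Hom a a).X n := hn ▸ 𝒞.id a

theorem isCocycle_idAt (a : 𝒞.Obj) {n : ℤ} (hn : n = 0) :
    IsCocycle (𝒞.Hom a a) (𝒞.idAt a hn) := by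
  subst hn
  exact 𝒞.isCocycle_id a

theorem idAt_comp {a b : 𝒞.Obj} {n p : ℤ} (hn : n = 0) (hp : n + p = p) (f : (𝒞.Hom a b).X p) :
    𝒞.comp hp (𝒞.idAt b hn) f = f := by
  subst hn
  exact 𝒞.id_comp f

theorem comp_idAt {a b : 𝒞.Obj} {n p : ℤ} (hn : n = 0) (hp : p + n = p) (f : (𝒞.Hom a b).X p) :
    𝒞.comp hp f (𝒞.idAt a hn) = f := by
  subst hn
  exact 𝒞.comp_id f

theorem act_idAt (M : DGModule.{w} 𝒞) {a : 𝒞.Obj} {n p : ℤ} (hn : n = 0) (hp : p + n = p)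
    (m : (M.obj a).X p) : M.act hp m (𝒞.idAt a hn) = m := by
  subst hn
  exact M.act_id m

theorem comp_d {a b c : 𝒞.Obj} {p q n p' q' n' : ℤ} (hpq : p + q = n) (hp : p + 1 = p')
    (hq : q + 1 = q') (hn : n + 1 = n') (f : (𝒞.Hom b c).X p) (g : (𝒞.Hom a b).X q) :
    ((𝒞.Hom a c).d n n').hom (𝒞.comp hpq f g) =
      𝒞.comp (show p' + q = n' by lia) (((𝒞.Hom b c).d p p').hom f) g +
        koszulSign k p • 𝒞.comp (show p + q' = n' by lia) f (((𝒞.Hom a b).d q q').hom g) := by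
  subst hp hq hn
  exact 𝒞.leibniz hpq f g

/-! ### Semifree modules -/

section Semifree

open scoped Classical

variable {𝒞} {s : 𝒞.Obj} {X : Type x} (deg : X → ℤ)

/-- The terms of the direct sum of the shifts of `𝒞(-, s)` by `deg x`. -/
abbrev Fr (s : 𝒞.Obj) (deg : X → ℤ) (a : 𝒞.Obj) (n : ℤ) : Type (max x h) :=
  Π₀ x : X, (𝒞.Hom a s).X (n - deg x)

/-- The right action on a direct sum of shifts of `𝒞(-, s)`. -/
def frAct {a b : 𝒞.Obj} {p q n : ℤ} (hpq : p + q = n) :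
    Fr s deg b p →ₗ[k] (𝒞.Hom a b).X q →ₗ[k] Fr s deg a n :=
  LinearMap.mk₂ k (fun z c => z.mapRange
      (fun x m => 𝒞.comp (show p - deg x + q = n - deg x by lia) m c) (fun x => by simp))
    (fun z z' c => DFinsupp.ext fun x => by simp) (fun r z c => DFinsupp.ext fun x => by simp)
    (fun z c c' => DFinsupp.ext fun x => by simp) (fun r z c => DFinsupp.ext fun x => by simp)

theorem frAct_apply {a b : 𝒞.Obj} {p q n : ℤ} (hpq : p + q = n) (z : Fr s deg b p)
    (c : (𝒞.Hom a b).X q) (x : X) :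
    frAct deg hpq z c x = 𝒞.comp (show p - deg x + q = n - deg x by lia) (z x) c := by
  simp [frAct]

theorem frAct_single {a b : 𝒞.Obj} {p q n : ℤ} (hpq : p + q = n) (x : X)
    (m : (𝒞.Hom b s).X (p - deg x)) (c : (𝒞.Hom a b).X q) :
    frAct deg hpq (DFinsupp.single x m) c =
      DFinsupp.single x (𝒞.comp (show p - deg x + q = n - deg x by lia) m c) := by
  simp [frAct]

theorem frAct_frAct {a b c : 𝒞.Obj} {p q r e t n : ℤ} (hpq : p + q = e) (hqr : q + r = t)
    (her : e + r = n) (hpt : p + t = n) (z : Fr s deg c p) (f : (𝒞.Hom b c).X q)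
    (g : (𝒞.Hom a b).X r) :
    frAct deg her (frAct deg hpq z f) g = frAct deg hpt z (𝒞.comp hqr f g) := by
  refine DFinsupp.ext fun x => ?_
  rw [frAct_apply, frAct_apply, frAct_apply]
  exact 𝒞.assoc _ _ _ _ _ _ _

theorem fr_induction {s a : 𝒞.Obj} {deg : X → ℤ} {n : ℤ} {p : Fr s deg a n → Prop}
    (z : Fr s deg a n) (zero : p 0) (add : ∀ z z', p z → p z' → p (z + z'))
    (single : ∀ x c, p (DFinsupp.single x c)) : p z :=
  DFinsupp.induction z zero fun x c z _ _ hz => add _ z (single x c) hz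

variable {deg} (bd : ∀ x, Fr s deg s (deg x + 1))

/-- The differential for which the generators have boundaries `bd`. -/
def frD (a : 𝒞.Obj) {i j : ℤ} (hij : i + 1 = j) : Fr s deg a i →ₗ[k] Fr s deg a j :=
  DFinsupp.lsum ℕ fun x => frAct deg (show deg x + 1 + (i - deg x) = j by lia) (bd x) +
    koszulSign k (deg x) • (DFinsupp.lsingle x ∘ₗ ((𝒞.Hom a s).d (i - deg x) (j - deg x)).hom)

theorem frD_single (a : 𝒞.Obj) {i j : ℤ} (hij : i + 1 = j) (x : X)
    (c : (𝒞.Hom a s).X (i - deg x)) :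
    frD bd a hij (DFinsupp.single x c) =
      frAct deg (show deg x + 1 + (i - deg x) = j by lia) (bd x) c +
        koszulSign k (deg x) •
          DFinsupp.single x (((𝒞.Hom a s).d (i - deg x) (j - deg x)).hom c) := by
  simp [frD]

theorem frD_frAct {a b : 𝒞.Obj} {p q n p' q' n' : ℤ} (hpq : p + q = n) (hp : p + 1 = p')
    (hq : q + 1 = q') (hn : n + 1 = n') (z : Fr s deg b p) (c : (𝒞.Hom a b).X q) :
    frD bd a hn (frAct deg hpq z c) =
      frAct deg (show p' + q = n' by lia) (frD bd b hp z) c +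
        koszulSign k p • frAct deg (show p + q' = n' by lia) z (((𝒞.Hom a b).d q q').hom c) := by
  induction z using fr_induction with
  | zero => simp
  | add z z' h h' => 
    simp only [map_add, LinearMap.add_apply, smul_add] at h h' ⊢
    rw [h, h']; abel
  | single x m =>
    have hsgn : koszulSign k (deg x) * koszulSign k (p - deg x) = koszulSign k p := by
      rw [← koszulSign_add, add_sub_cancel]
    rw [frAct_single, frD_single, frD_single, frAct_single,
      𝒞.comp_d _ (show p - deg x + 1 = p' - deg x by lia) hq (show n - deg x + 1 = n' - deg x by lia),
      map_add, LinearMap.add_apply, map_smul, LinearMap.smul_apply, frAct_single,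
      frAct_frAct deg _ (show p - deg x + q = n - deg x by lia) _ (by lia),
      DFinsupp.single_add, smul_add, DFinsupp.single_smul, smul_smul, hsgn]
    exact (add_assoc _ _ _).symm

/-- On `x · c` the two terms `bd x · dc` have opposite signs and cancel, which leaves the boundary
of `bd x`. -/
theorem frD_frD (hbd : ∀ x, frD bd s (rfl : deg x + 1 + 1 = _) (bd x) = 0) (a : 𝒞.Obj) {i j l : ℤ}
    (hij : i + 1 = j) (hjl : j + 1 = l) (z : Fr s deg a i) : frD bd a hjl (frD bd a hij z) = 0 := by
  induction z using fr_induction with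
  | zero => simp
  | add z z' h h' => rw [map_add, map_add, h, h', add_zero]
  | single x c =>
    rw [frD_single, map_add, map_smul, frD_single,
      frD_frAct bd _ rfl (show i - deg x + 1 = j - deg x by lia), hbd, map_zero,
      LinearMap.zero_apply, zero_add, dd_apply, DFinsupp.single_zero, smul_zero, add_zero,
      koszulSign_succ, neg_smul, neg_add_cancel]

end Semifree

end DGCategory

open DGCategory

/-- Generators, with degrees and boundaries, of a semifree module whose cells are shifts of
`𝒞(-, s)`. -/
structure SemifreeDatum {k : Type v} [Field k] (𝒞 : DGCategory.{v, o, h} k) (s : 𝒞.Obj) where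
  X : Type x
  deg : X → ℤ
  bd : ∀ y, Fr s deg s (deg y + 1)
  rank : X → ℕ
  rank_lt : ∀ y z, bd y z ≠ 0 → rank z < rank y
  frD_bd : ∀ y, frD bd s (rfl : deg y + 1 + 1 = _) (bd y) = 0

namespace SemifreeDatum

open DGModule

open scoped Classical

variable {k : Type v} [Field k] {𝒞 : DGCategory.{v, o, h} k} {s : 𝒞.Obj}
  (D : SemifreeDatum.{v, o, h, x} 𝒞 s)

/-- The semifree module on a datum. -/
def module : DGModule.{max x h w} 𝒞 :=
  mkModule (fun a n => ULift.{w} (Fr s D.deg a n))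
    (fun a i j hij => ULift.moduleEquiv.symm.toLinearMap ∘ₗ frD D.bd a hij ∘ₗ
      ULift.moduleEquiv.toLinearMap)
    (fun a i j l hij hjl z => ULift.ext _ _ (frD_frD D.bd D.frD_bd a hij hjl z.down))
    (fun {a b p q n} hpq => LinearMap.mk₂ k (fun z c => ULift.up (frAct D.deg hpq z.down c))
      (fun z z' c => ULift.ext _ _ (by simp)) (fun r z c => ULift.ext _ _ (by simp))
      (fun z c c' => ULift.ext _ _ (by simp)) (fun r z c => ULift.ext _ _ (by simp)))
    (fun {a n} z => ULift.ext _ _ (DFinsupp.ext fun x => by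
      change frAct D.deg (add_zero n) z.down (𝒞.id a) x = _
      rw [frAct_apply]
      exact 𝒞.comp_id _))
    (fun hpq hqr hsr hpt z f g => ULift.ext _ _ (frAct_frAct D.deg hpq hqr hsr hpt z.down f g))
    (fun hpq z c => ULift.ext _ _ (frD_frAct D.bd hpq rfl rfl rfl z.down c))

variable {a b : 𝒞.Obj}

/-- The elements of the semifree module. -/
def el {n : ℤ} : Fr s D.deg a n ≃ₗ[k] ((module.{w} D).obj a).X n := ULift.moduleEquiv.symm

theorem el_d {i j : ℤ} (hij : i + 1 = j) (z : Fr s D.deg a i) :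
    (((module.{w} D).obj a).d i j).hom (el.{w} D z) = el.{w} D (frD D.bd a hij z) :=
  congrArg (fun g => ModuleCat.Hom.hom g (el.{w} D z)) (dif_pos hij)

theorem el_act {p q n : ℤ} (hpq : p + q = n) (z : Fr s D.deg b p) (c : (𝒞.Hom a b).X q) :
    (module.{w} D).act hpq (el.{w} D z) c = el.{w} D (frAct D.deg hpq z c) := rfl

/-- The generators of the semifree module. -/
def gen (y : D.X) : ((module.{w} D).obj s).X (D.deg y) :=
  el.{w} D (DFinsupp.single y (𝒞.idAt s (sub_self _)))

theorem gen_act (y : D.X) {n : ℤ}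
    (c : (𝒞.Hom a s).X (n - D.deg y)) :
    (module.{w} D).act (show D.deg y + (n - D.deg y) = n by lia) (gen.{w} D y) c =
      el.{w} D (DFinsupp.single y c) := by
  rw [gen, el_act, frAct_single, idAt_comp]

theorem gen_d (y : D.X) :
    (((module.{w} D).obj s).d (D.deg y) (D.deg y + 1)).hom (gen.{w} D y) = el.{w} D (D.bd y) := by
  rw [gen, el_d _ rfl, frD_single, isCocycle_idAt, DFinsupp.single_zero, smul_zero, add_zero]
  congr 1
  refine DFinsupp.ext fun x => ?_
  rw [frAct_apply, comp_idAt]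

variable {Y : DGModule.{max x h w} 𝒞}

/-- The morphism with given values on the generators. -/
def lift {n : ℤ} (y : ∀ x, (Y.obj s).X (D.deg x + n)) : (homComplex (module.{w} D) Y).X n :=
  mkHom (fun a p q hpq => (DFinsupp.lsum ℕ fun x =>
      Y.act (show D.deg x + n + (p - D.deg x) = q by lia) (y x)) ∘ₗ (el.{w} D).symm.toLinearMap)
    (fun a b p r t p' t' hp hr ht hr' m c => by
      obtain ⟨z, rfl⟩ := (el.{w} D).surjective m
      rw [el_act]
      simp only [LinearMap.comp_apply, LinearEquiv.coe_coe, LinearEquiv.symm_apply_apply]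
      induction z using fr_induction with
      | zero => simp
      | add z z' h h' => simp only [map_add, LinearMap.add_apply, h, h']
      | single x m =>
        rw [frAct_single, DFinsupp.lsum_single, DFinsupp.lsum_single]
        exact (Y.act_act _ _ _ _ _ _ _).symm)

theorem hv_lift_single {n : ℤ} (y : ∀ x, (Y.obj s).X (D.deg x + n)) {p q : ℤ} (hpq : p + n = q)
    (x : D.X) (c : (𝒞.Hom a s).X (p - D.deg x)) :
    hv hpq (lift D y) (el.{w} D (DFinsupp.single x c)) =
      Y.act (show D.deg x + n + (p - D.deg x) = q by lia) (y x) c := by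
  rw [lift, hv_mkHom, LinearMap.comp_apply, LinearEquiv.coe_coe, LinearEquiv.symm_apply_apply,
    DFinsupp.lsum_single]

theorem hv_lift_gen {n : ℤ} (y : ∀ x, (Y.obj s).X (D.deg x + n)) (x : D.X) :
    hv rfl (lift D y) (gen.{w} D x) = y x := by
  rw [gen, hv_lift_single, act_idAt]

/-- A morphism is evaluated on `z` through the generators in the support of `z` alone. Combined with
`rank_lt`, this makes a recursion over the cells consistent. -/
theorem hv_congr {n : ℤ} {f g : (homComplex (module.{w} D) Y).X n} {p q : ℤ} (hpq : p + n = q)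
    (z : Fr s D.deg a p)
    (H : ∀ x, z x ≠ 0 → hv rfl f (gen.{w} D x) = hv rfl g (gen.{w} D x)) :
    hv hpq f (el.{w} D z) = hv hpq g (el.{w} D z) := by
  rw [← DFinsupp.sum_single (f := z), DFinsupp.sum, map_sum, map_sum, map_sum]
  refine Finset.sum_congr rfl fun x hx => ?_
  rw [← gen_act D x, hv_act f rfl _ _ (by lia),
    hv_act g rfl _ _ (by lia), H x (by simpa using hx)]

theorem hom_ext {n : ℤ} {f g : (homComplex (module.{w} D) Y).X n}
    (H : ∀ x, hv rfl f (gen.{w} D x) = hv rfl g (gen.{w} D x)) : f = g := by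
  refine hom_ext' fun a p q hpq m => ?_
  obtain ⟨z, rfl⟩ := (el.{w} D).surjective m
  exact hv_congr D hpq z fun x _ => H x

theorem hv_d_gen {n n' : ℤ} (hn : n + 1 = n') (f : (homComplex (module.{w} D) Y).X n) (x : D.X)
    {q : ℤ} (hq : D.deg x + n' = q) :
    hv hq (((homComplex (module.{w} D) Y).d n n').hom f) (gen.{w} D x) =
      ((Y.obj s).d (D.deg x + n) q).hom (hv rfl f (gen.{w} D x)) -
        koszulSign k n • hv (show D.deg x + 1 + n = q by lia) f (el.{w} D (D.bd x)) := by
  rw [hv_d hn f hq rfl rfl, gen_d]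

theorem d_lift {n n' : ℤ} (hn : n + 1 = n') (y : ∀ x, (Y.obj s).X (D.deg x + n)) :
    ((homComplex (module.{w} D) Y).d n n').hom (lift D y) = lift D fun x =>
      ((Y.obj s).d (D.deg x + n) (D.deg x + n')).hom (y x) -
        koszulSign k n • hv (show D.deg x + 1 + n = D.deg x + n' by lia) (lift D y)
          (el.{w} D (D.bd x)) :=
  hom_ext D fun x => by rw [hv_d_gen D hn, hv_lift_gen, hv_lift_gen]

/-! ### Extension over cells -/

/-- The value at a generator of a primitive of `φ`, given its values at the previous generators. -/
def primitiveStep {j i : ℤ} (φ : (homComplex (module.{w} D) Y).X j) (x : D.X)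
    (prev : ∀ x', D.rank x' < D.rank x → (Y.obj s).X (D.deg x' + i)) : (Y.obj s).X (D.deg x + i) :=
  Classical.epsilon fun y =>
    ((Y.obj s).d (D.deg x + i) (D.deg x + j)).hom y - koszulSign k i • (if h : i + 1 = j then
      hv (show D.deg x + 1 + i = D.deg x + j by lia) (lift D fun x' =>
        if hx : D.rank x' < D.rank x then prev x' hx else 0) (el.{w} D (D.bd x)) else 0) =
      hv rfl φ (gen.{w} D x)

/-- The values of a primitive of `φ`, chosen recursively on the rank. -/
def primitive {j i : ℤ} (φ : (homComplex (module.{w} D) Y).X j) :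
    ∀ x, (Y.obj s).X (D.deg x + i) :=
  (measure D.rank).wf.fix (primitiveStep D φ)

/-- When the value at `x` is chosen, the values at cells of smaller rank are available and all
others are replaced by `0`. By `rank_lt` the boundary of `x` does not notice the replacement, so the
chosen value solves the equation as soon as a solution exists. -/
theorem primitive_spec {j i : ℤ} (hi : i + 1 = j) (φ : (homComplex (module.{w} D) Y).X j) (x : D.X)
    (H : ∃ y, ((Y.obj s).d (D.deg x + i) (D.deg x + j)).hom y - koszulSign k i •
      hv (show D.deg x + 1 + i = D.deg x + j by lia) (lift D (primitive D (i := i) φ))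
        (el.{w} D (D.bd x)) = hv rfl φ (gen.{w} D x)) :
    hv rfl (((homComplex (module.{w} D) Y).d i j).hom (lift D (primitive D φ))) (gen.{w} D x) =
      hv rfl φ (gen.{w} D x) := by
  rw [hv_d_gen D hi, hv_lift_gen]
  have key : hv (show D.deg x + 1 + i = D.deg x + j by lia) (lift D fun x' =>
        if _hx : D.rank x' < D.rank x then primitive D (i := i) φ x' else 0) (el.{w} D (D.bd x)) =
      hv (show D.deg x + 1 + i = D.deg x + j by lia) (lift D (primitive D (i := i) φ))
        (el.{w} D (D.bd x)) := by
    refine hv_congr D _ _ fun x' hx' => ?_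
    rw [hv_lift_gen, hv_lift_gen, dif_pos (D.rank_lt x x' hx')]
  rw [← key] at H ⊢
  have e : primitive D (i := i) φ x = primitiveStep D φ x fun x' _ => primitive D φ x' :=
    (measure D.rank).wf.fix_eq (primitiveStep D φ) x
  simp only [primitiveStep, dif_pos hi] at e
  have := Classical.epsilon_spec H
  rw [e]
  exact this

/-- A closed morphism out of a semifree module is nullhomotopic if there are no obstructions on the
cells. -/
theorem isBd_of_cells {j : ℤ} {φ : (homComplex (module.{w} D) Y).X j}
    (hφ : IsCocycle (homComplex (module.{w} D) Y) φ)
    (H : ∀ x, HZero (Y.obj s) (D.deg x + j) ∨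
      D.bd x = 0 ∧ IsBd (Y.obj s) (hv rfl φ (gen.{w} D x))) :
    IsBd (homComplex (module.{w} D) Y) φ := by
  obtain ⟨i, hi⟩ : ∃ i, i + 1 = j := ⟨j - 1, by lia⟩
  refine ⟨i, lift D (primitive D φ), hom_ext D fun x => ?_⟩
  induction hr : D.rank x using Nat.strong_induction_on generalizing x with
  | _ r ih =>
  refine primitive_spec D hi φ x ?_
  have hb : ((Y.obj s).d (D.deg x + j) (D.deg x + j + 1)).hom
      (hv (show D.deg x + 1 + i = D.deg x + j by lia) (lift D (primitive D (i := i) φ))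
        (el.{w} D (D.bd x))) =
      hv (show D.deg x + 1 + j = D.deg x + j + 1 by lia) φ (el.{w} D (D.bd x)) := by
    have h1 := hv_congr D (f := ((homComplex (module.{w} D) Y).d i j).hom (lift D (primitive D φ)))
      (g := φ) (show D.deg x + 1 + j = D.deg x + j + 1 by lia) (D.bd x)
      fun x' hx' => ih _ (hr ▸ D.rank_lt x x' hx') x' rfl
    rw [← h1, hv_d hi _ _ (show D.deg x + 1 + i = D.deg x + j by lia) rfl, el_d D rfl, D.frD_bd,
      map_zero, map_zero, smul_zero, sub_zero]
  have hsgn : koszulSign k j = -koszulSign k i := by rw [← hi, koszulSign_succ]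
  -- The obstruction to extending the primitive over the cell `x`. It is closed because the
  -- primitive is already correct on the cells occurring in the boundary of `x`.
  have hc : IsCocycle (Y.obj s) (hv rfl φ (gen.{w} D x) + koszulSign k i •
      hv (show D.deg x + 1 + i = D.deg x + j by lia) (lift D (primitive D (i := i) φ))
        (el.{w} D (D.bd x))) := by
    refine isCocycle_of rfl ?_
    rw [map_add, map_smul, hb, hv_cocycle hφ rfl rfl (show D.deg x + 1 + j = D.deg x + j + 1 by lia),
      gen_d, hsgn, neg_smul, neg_add_cancel]
  have hbd : IsBd (Y.obj s) (hv rfl φ (gen.{w} D x) + koszulSign k i •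
      hv (show D.deg x + 1 + i = D.deg x + j by lia) (lift D (primitive D (i := i) φ))
        (el.{w} D (D.bd x))) := by
    rcases H x with hx | ⟨hx, hx'⟩
    · exact hx _ hc
    · rw [hx, map_zero, map_zero, smul_zero, add_zero]
      exact hx'
  obtain ⟨y, hy⟩ := hbd.out (show D.deg x + i + 1 = D.deg x + j by lia)
  exact ⟨y, by rw [hy, add_sub_cancel_right]⟩

theorem isHProjective : (module.{w} D).IsHProjective := fun _ hY =>
  acyclic_iff_hZero.2 fun _ _ hφ => isBd_of_cells D hφ fun _ => .inl (isAcyclic_iff.1 hY _ _)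

end SemifreeDatum

/-! ### Semifree resolutions -/

/-- Formal cells: a cell of degree `n ∈ I` consists of a value in `V n` and a formal boundary, a finite
combination of cells with coefficients. -/
inductive Cell (I : Set ℤ) (G : ℤ → Type h) (V : ℤ → Type w) : ℤ → Type (max h w)
  | mk (n : ℤ) (hn : n ∈ I) (m : V n) (l : ℕ) (i : Fin l → ℤ) (y : ∀ j, Cell I G V (i j))
      (r : ∀ j, G (n + 1 - i j)) : Cell I G V n

namespace Cell

variable {I : Set ℤ} {G : ℤ → Type h} {V : ℤ → Type w}

/-- The height of a formal cell. -/
def rank : ∀ {n : ℤ}, Cell I G V n → ℕ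
  | _, mk _ _ _ _ _ y _ => (Finset.univ.sup fun j => rank (y j)) + 1

theorem mem : ∀ {n : ℤ}, Cell I G V n → n ∈ I
  | _, mk _ hn _ _ _ _ _ => hn

end Cell

namespace DGModule

open DGCategory SemifreeDatum

open scoped Classical

variable {k : Type v} [Field k] {𝒞 : DGCategory.{v, o, h} k} (N : DGModule.{w} 𝒞)
  (s : 𝒞.Obj) (I Deg : Set ℤ) (Gen : ∀ n, Set ((N.obj s).X n))

section Step

variable {s} {X : Type x} (deg : X → ℤ)

/-- A combination of cells. -/
def comb {l : ℕ} {i : ℤ} (y : Fin l → X) (r : ∀ j, (𝒞.Hom s s).X (i - deg (y j))) :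
    Fr s deg s i := ∑ j, DFinsupp.single (y j) (r j)

/-- The differential and the value of a combination of cells are such that it can be the boundary of a
new cell with value `m`. -/
def Admissible {n : ℤ} (m : (N.obj s).X n) {l : ℕ} (y : Fin l → X)
    (r : ∀ j, (𝒞.Hom s s).X (n + 1 - deg (y j))) (b : ∀ j, Fr s deg s (deg (y j) + 1))
    (v : ∀ j, (N.obj s).X (deg (y j))) : Prop :=
  ∑ j, (frAct deg (show deg (y j) + 1 + (n + 1 - deg (y j)) = n + 1 + 1 by lia) (b j) (r j) +
      koszulSign k (deg (y j)) • DFinsupp.single (y j)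
        (((𝒞.Hom s s).d (n + 1 - deg (y j)) (n + 1 + 1 - deg (y j))).hom (r j))) = 0 ∧
    ∑ j, N.act (show deg (y j) + (n + 1 - deg (y j)) = n + 1 by lia) (v j) (r j) =
      ((N.obj s).d n (n + 1)).hom m ∧
    (n ∈ Deg ∨ comb deg y r = 0 ∧ m ∈ Gen n)

/-- The boundary and the value of a new cell, if it is admissible, and zero otherwise. -/
def cellStep {n : ℤ} (m : (N.obj s).X n) {l : ℕ} (y : Fin l → X)
    (r : ∀ j, (𝒞.Hom s s).X (n + 1 - deg (y j))) (b : ∀ j, Fr s deg s (deg (y j) + 1))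
    (v : ∀ j, (N.obj s).X (deg (y j))) : Fr s deg s (n + 1) × (N.obj s).X n :=
  if N.Admissible Deg Gen deg m y r b v then (comb deg y r, m) else 0

end Step

/-- Formal cells for a semifree resolution of `N`. -/
abbrev ResCell (n : ℤ) : Type (max h w) :=
  Cell I (fun n => (𝒞.Hom s s).X n) (fun n => (N.obj s).X n) n

/-- The degree of a formal cell. -/
abbrev resDeg (c : Σ n, N.ResCell s I n) : ℤ := c.1

/-- The boundary and the value of a formal cell. -/
def cellData : ∀ {n : ℤ}, N.ResCell s I n → Fr s (N.resDeg s I) s (n + 1) × (N.obj s).X n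
  | _, .mk _ _ m _ i y r => N.cellStep Deg Gen (N.resDeg s I) m (fun j => ⟨i j, y j⟩) r
    (fun j => (cellData (y j)).1) (fun j => (cellData (y j)).2)

/-- There is a system of cells in degrees in `I` such that every admissible combination of cells is
the boundary of a cell with the required value. -/
theorem exists_cells (hGen : ∀ n, 0 ∈ Gen n) :
    ∃ (X : Type (max h w)) (deg : X → ℤ) (rank : X → ℕ) (bd : ∀ x, Fr s deg s (deg x + 1))
      (val : ∀ x, (N.obj s).X (deg x)),
      (∀ x, deg x ∈ I) ∧ (∀ x, deg x ∈ Deg ∨ bd x = 0 ∧ val x ∈ Gen _) ∧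
      (∀ x, bd x = 0 ∧ val x = 0 ∨ ∃ (l : ℕ) (y : Fin l → X) (r : ∀ _, _),
        (∀ j, rank (y j) < rank x) ∧ bd x = comb deg y r ∧
        N.Admissible Deg Gen deg (val x) y r (fun j => bd (y j)) (fun j => val (y j))) ∧
      ∀ n ∈ I, ∀ (m : (N.obj s).X n) (l : ℕ) (y : Fin l → X) (r : ∀ _, _),
        N.Admissible Deg Gen deg m y r (fun j => bd (y j)) (fun j => val (y j)) →
        ∃ x, ∃ hx : n = deg x,
          bd x = hx ▸ comb deg y r ∧ val x = hx ▸ m := by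
  have spec : ∀ x : Σ n, N.ResCell s I n, cellData N s I Deg Gen x.2 = 0 ∨
      ∃ (l : ℕ) (y : Fin l → Σ n, N.ResCell s I n) (r : ∀ j, (𝒞.Hom s s).X (x.1 + 1 - (y j).1)),
        (∀ j, (y j).2.rank < x.2.rank) ∧
        (cellData N s I Deg Gen x.2).1 = comb (N.resDeg s I) y r ∧
        N.Admissible Deg Gen (N.resDeg s I) (cellData N s I Deg Gen x.2).2 y r
          (fun j => (cellData N s I Deg Gen (y j).2).1)
          (fun j => (cellData N s I Deg Gen (y j).2).2) := by
    rintro ⟨n, _, hn, m, l, i, y, r⟩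
    have e : cellData N s I Deg Gen (Cell.mk n hn m l i y r) =
        N.cellStep Deg Gen (N.resDeg s I) m (fun j => ⟨i j, y j⟩) r
        (fun j => (cellData N s I Deg Gen (y j)).1) (fun j => (cellData N s I Deg Gen (y j)).2) := by
      rw [cellData]
    -- All formal cells are kept. An inadmissible one becomes a cell without boundary and with value
    -- `0 ∈ Gen n`, and the classes it adds are treated like all the others.
    by_cases hc : N.Admissible Deg Gen (N.resDeg s I) m (fun j => ⟨i j, y j⟩) r
        (fun j => (cellData N s I Deg Gen (y j)).1) (fun j => (cellData N s I Deg Gen (y j)).2)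
    · rw [cellStep, if_pos hc] at e
      refine .inr ⟨l, fun j => ⟨i j, y j⟩, r, fun j => ?_, congrArg Prod.fst e, ?_⟩
      · change _ < Cell.rank (Cell.mk n hn m l i y r)
        rw [Cell.rank.eq_def _ (Cell.mk n hn m l i y r)]
        exact Nat.lt_succ_of_le (Finset.le_sup (f := fun j => (y j).rank) (Finset.mem_univ j))
      · have e2 : (cellData N s I Deg Gen (Cell.mk n hn m l i y r)).2 = m := congrArg Prod.snd e
        change N.Admissible Deg Gen (N.resDeg s I)
          (cellData N s I Deg Gen (Cell.mk n hn m l i y r)).2 _ _ _ _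
        rw [e2]
        exact hc
    · rw [cellStep, if_neg hc] at e
      exact .inl e
  refine ⟨Σ n, N.ResCell s I n, N.resDeg s I, fun x => x.2.rank,
    fun x => (cellData N s I Deg Gen x.2).1, fun x => (cellData N s I Deg Gen x.2).2,
    fun x => x.2.mem, fun x => ?_, fun x => ?_, fun n hn m l y r hc => ?_⟩
  · rcases spec x with h0 | ⟨l, y, r, hr, hb, ha⟩
    · refine .inr ⟨congrArg Prod.fst h0, ?_⟩
      change (cellData N s I Deg Gen x.2).2 ∈ _
      rw [h0]
      exact hGen _
    · exact ha.2.2.imp id fun h => ⟨hb.trans h.1, h.2⟩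
  · exact (spec x).imp (fun h0 => ⟨congrArg Prod.fst h0, congrArg Prod.snd h0⟩) id
  · have e : cellData N s I Deg Gen
        (Cell.mk n hn m l (fun j => (y j).1) (fun j => (y j).2) r) =
        (comb (N.resDeg s I) y r, m) := by
      rw [cellData]
      exact if_pos hc
    exact ⟨⟨n, _⟩, rfl, congrArg Prod.fst e, congrArg Prod.snd e⟩

/-- Semifree modules mapping to `N` with cells in prescribed degrees: in degrees in `Deg` all possible
cells are attached, and in the other degrees of `I` only cells without boundary with values in
`Gen`. -/
theorem exists_semifree (N : DGModule.{max h w} 𝒞) (Gen : ∀ n, Set ((N.obj s).X n))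
    (hGen : ∀ n, 0 ∈ Gen n) :
    ∃ (D : SemifreeDatum.{v, o, h, max h w} 𝒞 s) (p : (homComplex (module.{w} D) N).X 0),
      IsCocycle (homComplex (module.{w} D) N) p ∧ (∀ x, D.deg x ∈ I) ∧
      (∀ x, D.deg x ∈ Deg ∨
        D.bd x = 0 ∧ hv (add_zero (D.deg x)) p (gen.{w} D x) ∈ Gen (D.deg x)) ∧
      (∀ n ∈ I, n ∈ Deg → ∀ (z : ((module.{w} D).obj s).X (n + 1)) (m : (N.obj s).X n),
        IsCocycle ((module.{w} D).obj s) z →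
        hv (add_zero (n + 1)) p z = ((N.obj s).d n (n + 1)).hom m →
        ∃ y : ((module.{w} D).obj s).X n, (((module.{w} D).obj s).d n (n + 1)).hom y = z) ∧
      ∀ n ∈ I, ∀ m : (N.obj s).X n, IsCocycle (N.obj s) m → n ∈ Deg ∨ m ∈ Gen n →
        ∃ x, ∃ hx : n = D.deg x, D.bd x = 0 ∧
          hv (add_zero (D.deg x)) p (gen.{w} D x) = hx ▸ m := by
  obtain ⟨X, deg, rank, bd, val, hI, hD, hspec, hex⟩ := exists_cells N s I Deg Gen hGen
  let D : SemifreeDatum.{v, o, h, max h w} 𝒞 s :=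
    { X := X
      deg := deg
      bd := bd
      rank := rank
      rank_lt := fun x z hz => by
        rcases hspec x with ⟨h0, -⟩ | ⟨l, y, r, hr, hb, -⟩
        · exact (hz (by rw [h0]; rfl)).elim
        · rw [hb, comb, DFinsupp.finsetSum_apply] at hz
          obtain ⟨j, -, hj⟩ := Finset.exists_ne_zero_of_sum_ne_zero hz
          rw [DFinsupp.single_apply] at hj
          split_ifs at hj with h
          · exact h ▸ hr j
          · exact (hj rfl).elim
      frD_bd := fun x => by
        rcases hspec x with ⟨h0, -⟩ | ⟨l, y, r, -, hb, ha⟩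
        · rw [h0, map_zero]
        · rw [hb, comb, map_sum, ← ha.1]
          exact Finset.sum_congr rfl fun j _ => frD_single _ _ _ _ _ }
  let p : (homComplex (module.{w} D) N).X 0 := SemifreeDatum.lift D fun x => hv rfl (idHom N) (val x)
  have hp : ∀ x, hv (add_zero (D.deg x)) p (gen.{w} D x) = val x := fun x => by
    have h1 : hv rfl p (gen.{w} D x) = hv rfl (idHom N) (val x) := hv_lift_gen _ _ _
    rw [← hv_id_hv p rfl (show D.deg x + 0 + 0 = D.deg x by lia), h1, hv_id_hv]
    exact hv_id _
  have hps : ∀ (x : X) {i : ℤ} (c : (𝒞.Hom s s).X (i - deg x)),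
      hv (add_zero i) p (el.{w} D (DFinsupp.single x c)) =
        N.act (show deg x + (i - deg x) = i by lia) (val x) c := fun x i c => by
    rw [← gen_act D x c, hv_act p (add_zero _) _ _ (show deg x + (i - deg x) = i by lia), hp]
  have hpc : ∀ {l : ℕ} {i : ℤ} (y : Fin l → X) (r : ∀ j, (𝒞.Hom s s).X (i - deg (y j))),
      hv (add_zero i) p (el.{w} D (comb deg y r)) =
        ∑ j, N.act (show deg (y j) + (i - deg (y j)) = i by lia) (val (y j)) (r j) :=
    fun y r => by
      rw [comb, map_sum, map_sum]
      exact Finset.sum_congr rfl fun j _ => hps _ _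
  have hpd : ∀ x, hv (add_zero (deg x + 1)) p (el.{w} D (bd x)) =
      ((N.obj s).d (deg x) (deg x + 1)).hom (val x) := fun x => by
    rcases hspec x with ⟨h0, h1⟩ | ⟨l, y, r, -, hb, ha⟩
    · rw [h0, h1, map_zero, map_zero, map_zero]
    · rw [hb, hpc, ha.2.1]
  refine ⟨D, p, ?_, hI, fun x => ?_, fun n hn hnD z m hz hzm => ?_, fun n hn m hm hnm => ?_⟩
  · refine isCocycle_of rfl (SemifreeDatum.hom_ext D fun x => ?_)
    rw [hv_d_gen D rfl, koszulSign_zero, one_smul, map_zero, LinearMap.zero_apply, sub_eq_zero]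
    have h1 : hv rfl p (gen.{w} D x) = hv rfl (idHom N) (val x) := hv_lift_gen _ _ _
    rw [h1, d_hv_id _ rfl (show D.deg x + 1 + 0 = D.deg x + (0 + 1) by lia), ← hpd, hv_id_hv]
  · rw [hp]
    exact hD x
  · obtain ⟨z, rfl⟩ := (el.{w} D).surjective z
    let e := z.support.equivFin
    have hz' : comb deg (fun j => (e.symm j).1) (fun j => z (e.symm j).1) = z := by
      refine Eq.trans ?_ (DFinsupp.sum_single (f := z))
      exact (Equiv.sum_comp e.symm
        (fun i : z.support => (DFinsupp.single i.1 (z i.1) : Fr s D.deg s (n + 1)))).trans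
        (Finset.sum_coe_sort z.support
          fun i => (DFinsupp.single i (z i) : Fr s D.deg s (n + 1)))
    -- The cocycle `z` is itself a combination of cells with value `dm`, hence admissible, so some
    -- cell has boundary `z`.
    obtain ⟨x, rfl, hb, -⟩ := hex n hn m _ (fun j => (e.symm j).1) (fun j => z (e.symm j).1)
      ⟨by
        have := hz (n + 1 + 1)
        rw [el_d D rfl, LinearEquiv.map_eq_zero_iff, ← hz', comb, map_sum] at this
        rw [← this]
        exact Finset.sum_congr rfl fun j _ => (frD_single D.bd _ _ _ _).symm,
        by rw [← hzm, ← hpc, hz'], .inl hnD⟩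
    refine ⟨gen.{w} D x, ?_⟩
    rw [gen_d]
    exact congrArg _ (hb.trans hz')
  -- A cocycle of `N` is the value of a cell attached along the empty combination.
  · obtain ⟨x, hx, hb, hv'⟩ := hex n hn m 0 Fin.elim0 (fun j => j.elim0)
      ⟨by simp, by simp [hm (n + 1)], hnm.imp id fun h => ⟨by simp [comb], h⟩⟩
    refine ⟨x, hx, ?_, (hp x).trans hv'⟩
    subst hx
    exact hb.trans (by simp [comb])

end DGModule

namespace DGModule

open scoped Classical

variable {k : Type v} [Field k] {𝒜 : DGCategory.{v, o, h} k}

/-! ### Direct sums of shifts -/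

section Coprod

variable {X : Type w} (L : X → DGModule.{w} 𝒜) (n : X → ℤ) {Y : DGModule.{w} 𝒜}

theorem dfinsupp_induction {M : X → Type*} [∀ x, AddCommGroup (M x)] {p : (Π₀ x, M x) → Prop}
    (z : Π₀ x, M x) (zero : p 0) (add : ∀ z z', p z → p z' → p (z + z'))
    (single : ∀ x c, p (DFinsupp.single x c)) : p z :=
  DFinsupp.induction z zero fun x c z _ _ hz => add _ z (single x c) hz

/-- The direct sum of the modules `L x`, shifted by `-n x`. -/
def coprod : DGModule.{w} 𝒜 :=
  mkModule (fun a i => Π₀ x, ((L x).obj a).X (i - n x))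
    (fun a i j _ => DFinsupp.mapRange.linearMap fun x =>
      koszulSign k (n x) • (((L x).obj a).d (i - n x) (j - n x)).hom)
    (fun a i j l _ _ z => DFinsupp.ext fun x => by
      simp [dd_apply])
    (fun {a b p q i} hpq => LinearMap.mk₂ k
      (fun z c => z.mapRange (fun x m => (L x).act (show p - n x + q = i - n x by lia) m c)
        (fun x => by simp))
      (fun z z' c => DFinsupp.ext fun x => by simp) (fun r z c => DFinsupp.ext fun x => by simp)
      (fun z c c' => DFinsupp.ext fun x => by simp) (fun r z c => DFinsupp.ext fun x => by simp))
    (fun {a i} z => DFinsupp.ext fun x => by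
      simp only [LinearMap.mk₂_apply, DFinsupp.mapRange_apply]
      exact (L x).act_id _)
    (fun hpq hqr hsr hpt z f g => DFinsupp.ext fun x => by
      simp only [LinearMap.mk₂_apply, DFinsupp.mapRange_apply]
      exact (L x).act_act _ _ _ _ _ _ _)
    (fun {a b p q i} hpq z c => DFinsupp.ext fun x => by
      simp only [LinearMap.mk₂_apply, DFinsupp.mapRange_apply, DFinsupp.mapRange.linearMap_apply,
        LinearMap.smul_apply, DFinsupp.add_apply, DFinsupp.smul_apply, map_smul]
      rw [(L x).act_d _ (show p - n x + 1 = p + 1 - n x by lia) rfl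
        (show i - n x + 1 = i + 1 - n x by lia), smul_add, smul_smul, ← koszulSign_add,
        add_sub_cancel])

variable {a b : 𝒜.Obj} {i j : ℤ}

/-- The components of an element of a direct sum. -/
def cpFun : ((coprod L n).obj a).X i ≃ₗ[k] Π₀ x, ((L x).obj a).X (i - n x) := LinearEquiv.refl _ _

theorem cpFun_d (hij : i + 1 = j) (z : ((coprod L n).obj a).X i) (x : X) :
    cpFun L n ((((coprod L n).obj a).d i j).hom z) x =
      koszulSign k (n x) • (((L x).obj a).d (i - n x) (j - n x)).hom (cpFun L n z x) := by
  have h : (((coprod L n).obj a).d i j).hom z = DFinsupp.mapRange.linearMap (fun x =>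
      koszulSign k (n x) • (((L x).obj a).d (i - n x) (j - n x)).hom) (cpFun L n z) :=
    congrArg (fun g => ModuleCat.Hom.hom g z) (dif_pos hij)
  rw [h]
  exact DFinsupp.mapRange_apply (fun x c => koszulSign k (n x) •
    (((L x).obj a).d (i - n x) (j - n x)).hom c) (fun x => by simp) (cpFun L n z) x

theorem cpFun_act {p q : ℤ} (hpq : p + q = i) (z : ((coprod L n).obj b).X p)
    (c : (𝒜.Hom a b).X q) (x : X) :
    cpFun L n ((coprod L n).act hpq z c) x =
      (L x).act (show p - n x + q = i - n x by lia) (cpFun L n z x) c :=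
  DFinsupp.mapRange_apply (fun x m => (L x).act (show p - n x + q = i - n x by lia) m c)
    (fun x => by simp) (cpFun L n z) x

/-- The elements of a summand. -/
def cpSingle (x : X) : ((L x).obj a).X (i - n x) →ₗ[k] ((coprod L n).obj a).X i :=
  (cpFun L n).symm.toLinearMap ∘ₗ
    DFinsupp.lsingle (R := k) (M := fun x => ((L x).obj a).X (i - n x)) x

theorem cpFun_cpSingle_same (x : X) (c : ((L x).obj a).X (i - n x)) :
    cpFun L n (cpSingle L n x c) x = c :=
  DFinsupp.single_eq_same (β := fun x => ((L x).obj a).X (i - n x))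

theorem cpFun_cpSingle_ne {x y : X} (hxy : y ≠ x) (c : ((L x).obj a).X (i - n x)) :
    cpFun L n (cpSingle L n x c) y = 0 :=
  DFinsupp.single_eq_of_ne (β := fun x => ((L x).obj a).X (i - n x)) hxy

theorem cp_ext {z z' : ((coprod L n).obj a).X i} (H : ∀ x, cpFun L n z x = cpFun L n z' x) :
    z = z' := (cpFun L n).injective (DFinsupp.ext H)

theorem cpSingle_d (hij : i + 1 = j) (x : X) (c : ((L x).obj a).X (i - n x)) :
    (((coprod L n).obj a).d i j).hom (cpSingle L n x c) =
      cpSingle L n x (koszulSign k (n x) • (((L x).obj a).d (i - n x) (j - n x)).hom c) := by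
  refine cp_ext L n fun y => ?_
  rw [cpFun_d _ _ hij]
  by_cases hy : y = x
  · subst hy
    rw [cpFun_cpSingle_same, cpFun_cpSingle_same]
  · rw [cpFun_cpSingle_ne _ _ hy, cpFun_cpSingle_ne _ _ hy, map_zero, smul_zero]

theorem cpSingle_act {p q : ℤ} (hpq : p + q = i) (x : X) (z : ((L x).obj b).X (p - n x))
    (c : (𝒜.Hom a b).X q) :
    (coprod L n).act hpq (cpSingle L n x z) c =
      cpSingle L n x ((L x).act (show p - n x + q = i - n x by lia) z c) := by
  refine cp_ext L n fun y => ?_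
  rw [cpFun_act]
  by_cases hy : y = x
  · subst hy
    rw [cpFun_cpSingle_same, cpFun_cpSingle_same]
  · rw [cpFun_cpSingle_ne _ _ hy, cpFun_cpSingle_ne _ _ hy, map_zero, LinearMap.zero_apply]

theorem cp_induction {p : ((coprod L n).obj a).X i → Prop} (z : ((coprod L n).obj a).X i)
    (zero : p 0) (add : ∀ z z', p z → p z' → p (z + z')) (single : ∀ x c, p (cpSingle L n x c)) :
    p z := dfinsupp_induction (M := fun x => ((L x).obj a).X (i - n x)) (p := p) (cpFun L n z)
    zero add single

theorem cp_sum (z : ((coprod L n).obj a).X i) :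
    ∃ t : Finset X, z = ∑ x ∈ t, cpSingle L n x (cpFun L n z x) :=
  ⟨(cpFun L n z).support, (cpFun L n).injective (by
    rw [map_sum]
    exact (DFinsupp.sum_single (f := cpFun L n z)).symm)⟩

theorem isCocycle_cp_iff {z : ((coprod L n).obj a).X i} :
    IsCocycle ((coprod L n).obj a) z ↔ ∀ x, IsCocycle ((L x).obj a) (cpFun L n z x) := by
  constructor
  · intro hz x
    refine isCocycle_of (show i - n x + 1 = i + 1 - n x by lia) ?_
    have := cpFun_d L n rfl z x
    rw [hz, map_zero] at this
    exact (smul_eq_zero.1 this.symm).resolve_left (koszulSign_ne_zero _)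
  · intro H
    refine isCocycle_of rfl (cp_ext L n fun x => ?_)
    rw [cpFun_d L n rfl, H, smul_zero, map_zero]
    rfl

theorem isBd_cpSingle {x : X} {c : ((L x).obj a).X (i - n x)} (hc : IsBd ((L x).obj a) c) :
    IsBd ((coprod L n).obj a) (cpSingle L n x c) := by
  obtain ⟨y, rfl⟩ := hc.out (show i - 1 - n x + 1 = i - n x by lia)
  refine ⟨i - 1, cpSingle L n x (koszulSign k (n x) • y), ?_⟩
  rw [cpSingle_d _ _ (sub_add_cancel i 1), map_smul (((L x).obj a).d _ _).hom, koszulSign_smul_smul]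

theorem isBd_cp {z : ((coprod L n).obj a).X i} (H : ∀ x, IsBd ((L x).obj a) (cpFun L n z x)) :
    IsBd ((coprod L n).obj a) z := by
  obtain ⟨t, ht⟩ := cp_sum L n z
  rw [ht]
  exact IsBd.sum t fun x _ => isBd_cpSingle L n (H x)

/-- The inclusion of a summand. -/
def cpInj (x : X) : (homComplex (L x) (coprod L n)).X (n x) :=
  mkHom (fun a p q hpq => cpSingle L n x ∘ₗ hv (show p + 0 = q - n x by lia) (idHom (L x)))
    (fun a b p r s p' s' hp hr hs hr' m c => by
      rw [LinearMap.comp_apply, LinearMap.comp_apply, cpSingle_act,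
        hv_id_act hr (show p + 0 = p' - n x by lia)])

theorem hv_cpInj (x : X) {p q : ℤ} (hpq : p + n x = q) (c : ((L x).obj a).X p) :
    hv hpq (cpInj L n x) c = cpSingle L n x (hv (show p + 0 = q - n x by lia) (idHom (L x)) c) := rfl

theorem isCocycle_cpInj (x : X) : IsCocycle (homComplex (L x) (coprod L n)) (cpInj L n x) := by
  refine isCocycle_hom_iff.2 fun a p q p' q' hpq hp hq c => ?_
  rw [hv_cpInj, hv_cpInj, cpSingle_d L n (by lia),
    d_hv_id _ hp (show p' + 0 = q' - n x by lia), map_smul]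

/-- The morphism out of a direct sum with given components. -/
def cpDesc (f : ∀ x, (homComplex (L x) Y).X (n x + j)) : (homComplex (coprod L n) Y).X j :=
  mkHom (fun a p q hpq => (DFinsupp.lsum (M := fun x => ((L x).obj a).X (p - n x)) ℕ
      fun x => hv (show p - n x + (n x + j) = q by lia) (f x)) ∘ₗ (cpFun L n).toLinearMap)
    (fun a b p r s p' s' hp hr hs hr' m c => by
      induction m using cp_induction with
      | zero => simp
      | add z z' h h' => simp only [map_add, LinearMap.add_apply, h, h']
      | single x z =>
        rw [cpSingle_act]
        refine (DFinsupp.lsum_single (M := fun x => ((L x).obj a).X (s - n x)) ℕ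
          (fun x => hv (show s - n x + (n x + j) = s' by lia) (f x)) _ _).trans
          (Eq.trans ?_ (congrArg (fun t => Y.act hr' t c)
            (DFinsupp.lsum_single (M := fun x => ((L x).obj b).X (p - n x)) ℕ
            (fun x => hv (show p - n x + (n x + j) = p' by lia) (f x)) _ _).symm))
        exact hv_act (f x) _ _ _ _ _ _)

theorem hv_cpDesc_single (f : ∀ x, (homComplex (L x) Y).X (n x + j)) {p q : ℤ} (hpq : p + j = q)
    (x : X) (c : ((L x).obj a).X (p - n x)) :
    hv hpq (cpDesc L n f) (cpSingle L n x c) = hv (show p - n x + (n x + j) = q by lia) (f x) c :=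
  DFinsupp.lsum_single (M := fun x => ((L x).obj a).X (p - n x)) ℕ
    (fun x => hv (show p - n x + (n x + j) = q by lia) (f x)) _ _

theorem cp_hom_ext {f g : (homComplex (coprod L n) Y).X j}
    (H : ∀ x, homComp (add_comm j (n x)) f (cpInj L n x) = homComp (add_comm j (n x)) g (cpInj L n x)) :
    f = g := by
  refine hom_ext' fun a p q hpq m => ?_
  induction m using cp_induction with
  | zero => simp
  | add z z' h h' => simp only [map_add, h, h']
  | single x z =>
    have := congrArg (fun t => hv (show p - n x + (n x + j) = q by lia) t z) (H x)
    rw [hv_comp _ _ _ (sub_add_cancel p (n x)) hpq, hv_comp _ _ _ (sub_add_cancel p (n x)) hpq,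
      hv_cpInj, hv_id] at this
    exact this

theorem cpDesc_inj (f : ∀ x, (homComplex (L x) Y).X (n x + j)) (x : X) :
    homComp (add_comm j (n x)) (cpDesc L n f) (cpInj L n x) = f x := by
  refine hom_ext' fun a p q hpq m => ?_
  rw [hv_comp _ _ _ rfl (show p + n x + j = q by lia), hv_cpInj, hv_cpDesc_single, hv_hv_id]

theorem cpDesc_d (hij : i + 1 = j) (f : ∀ x, (homComplex (L x) Y).X (n x + i)) :
    ((homComplex (coprod L n) Y).d i j).hom (cpDesc L n f) =
      cpDesc L n fun x => ((homComplex (L x) Y).d (n x + i) (n x + j)).hom (f x) := by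
  refine hom_ext' fun a p q hpq m => ?_
  induction m using cp_induction with
  | zero => simp
  | add z z' h h' => simp only [map_add, h, h']
  | single x z =>
    rw [hv_d hij _ hpq rfl rfl, cpSingle_d L n rfl, hv_cpDesc_single, hv_cpDesc_single,
      hv_cpDesc_single, hv_d (show n x + i + 1 = n x + j by lia) _ _
      (show p - n x + (n x + i) = p + i by lia) (show p - n x + 1 = p + 1 - n x by lia), map_smul,
      smul_smul, koszulSign_add, mul_comm]

theorem hZero_hom_coprod (H : ∀ x, HZero (homComplex (L x) Y) (n x + j)) :
    HZero (homComplex (coprod L n) Y) j := by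
  intro φ hφ
  choose g hg using fun x => (H x _ (isCocycle_comp (add_comm j (n x)) hφ
    (isCocycle_cpInj L n x))).out (show n x + (j - 1) + 1 = n x + j by lia)
  refine ⟨j - 1, cpDesc L n g, ?_⟩
  rw [cpDesc_d L n (sub_add_cancel j 1)]
  exact cp_hom_ext L n fun x => by rw [cpDesc_inj, hg]

theorem isHProjective_coprod (H : ∀ x, (L x).IsHProjective) : (coprod L n).IsHProjective :=
  fun Y hY => acyclic_iff_hZero.2 fun _ =>
    hZero_hom_coprod L n fun x => acyclic_iff_hZero.1 (H x Y hY) _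

theorem isCocycle_cpDesc {f : ∀ x, (homComplex (L x) Y).X (n x + j)}
    (hf : ∀ x, IsCocycle (homComplex (L x) Y) (f x)) :
    IsCocycle (homComplex (coprod L n) Y) (cpDesc L n f) := by
  refine isCocycle_of rfl ?_
  rw [cpDesc_d L n rfl]
  exact cp_hom_ext L n fun x => by
    rw [cpDesc_inj, hf, map_zero, LinearMap.zero_apply]

end Coprod

end DGModule

namespace DGModule

variable {k : Type v} [Field k] {𝒜 : DGCategory.{v, o, h} k}

/-! ### Sequential colimits -/

section Colimit

variable (F : ℕ ⥤ DGModule.{w} 𝒜)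

/-- The transition maps of a sequence of modules. -/
abbrev seqMap (a : 𝒜.Obj) (i : ℤ) (j l : ℕ) (hjl : j ≤ l) :
    ((F.obj j).obj a).X i →ₗ[k] ((F.obj l).obj a).X i :=
  (((F.map (homOfLE hjl)).app a).f i).hom

instance (a : 𝒜.Obj) (i : ℤ) : DirectedSystem (fun j => ((F.obj j).obj a).X i)
    (fun j l hjl => seqMap F a i j l hjl) where
  map_self {j} x := by
    have : F.map (homOfLE (le_refl j)) = 𝟙 _ := F.map_id j
    rw [seqMap, this]
    rfl
  map_map {j l m} hjl hlm x := by
    have : F.map (homOfLE (hjl.trans hlm)) = F.map (homOfLE hjl) ≫ F.map (homOfLE hlm) :=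
      F.map_comp (homOfLE hjl) (homOfLE hlm)
    rw [seqMap, seqMap, seqMap, this]
    rfl

/-- The terms of the colimit. -/
abbrev SeqX (a : 𝒜.Obj) (i : ℤ) : Type w :=
  Module.DirectLimit (fun j => ((F.obj j).obj a).X i) (seqMap F a i)

/-- The maps to the terms of the colimit. -/
abbrev seqOf (a : 𝒜.Obj) (i : ℤ) (j : ℕ) : ((F.obj j).obj a).X i →ₗ[k] SeqX F a i :=
  Module.DirectLimit.of k ℕ (fun j => ((F.obj j).obj a).X i) (seqMap F a i) j

theorem seqOf_seqMap (a : 𝒜.Obj) (i : ℤ) {j l : ℕ} (hjl : j ≤ l) (x : ((F.obj j).obj a).X i) :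
    seqOf F a i l (seqMap F a i j l hjl x) = seqOf F a i j x := Module.DirectLimit.of_f

/-- The differential of the colimit. -/
def seqD (a : 𝒜.Obj) (i j : ℤ) : SeqX F a i →ₗ[k] SeqX F a j :=
  Module.DirectLimit.map (fun l => (((F.obj l).obj a).d i j).hom)
    (fun _ _ hlm => LinearMap.ext fun x => f_d_apply ((F.map (homOfLE hlm)).app a) i j x)

theorem seqD_of (a : 𝒜.Obj) (i j : ℤ) (l : ℕ) (x : ((F.obj l).obj a).X i) :
    seqD F a i j (seqOf F a i l x) = seqOf F a j l ((((F.obj l).obj a).d i j).hom x) :=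
  Module.DirectLimit.map_apply_of ..

/-- The action on the colimit. -/
def seqAct {a b : 𝒜.Obj} {p q n : ℤ} (hpq : p + q = n) :
    SeqX F b p →ₗ[k] (𝒜.Hom a b).X q →ₗ[k] SeqX F a n :=
  Module.DirectLimit.lift k ℕ (fun j => ((F.obj j).obj b).X p) (seqMap F b p)
    (fun l => ((F.obj l).act hpq).compr₂ (seqOf F a n l))
    (fun l m hlm x => LinearMap.ext fun c => by
      have := (F.map (homOfLE hlm)).app_act hpq x c
      simp only [LinearMap.compr₂_apply]
      rw [← seqOf_seqMap F a n hlm]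
      exact congrArg _ this.symm)

theorem seqAct_of {a b : 𝒜.Obj} {p q n : ℤ} (hpq : p + q = n) (l : ℕ)
    (x : ((F.obj l).obj b).X p) (c : (𝒜.Hom a b).X q) :
    seqAct F hpq (seqOf F b p l x) c = seqOf F a n l ((F.obj l).act hpq x c) := by
  rw [seqAct, Module.DirectLimit.lift_of]
  rfl

/-- The colimit of a sequence of modules. -/
def seqColimit : DGModule.{w} 𝒜 :=
  mkModule (SeqX F) (fun a i j _ => seqD F a i j)
    (fun a i j l _ _ z => by
      obtain ⟨m, x, rfl⟩ := Module.DirectLimit.exists_of z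
      rw [seqD_of, seqD_of, dd_apply, map_zero])
    (fun hpq => seqAct F hpq)
    (fun {a n} z => by
      obtain ⟨m, x, rfl⟩ := Module.DirectLimit.exists_of z
      rw [seqAct_of, (F.obj m).act_id])
    (fun hpq hqr hsr hpt z f g => by
      obtain ⟨m, x, rfl⟩ := Module.DirectLimit.exists_of z
      rw [seqAct_of, seqAct_of, seqAct_of, (F.obj m).act_act hpq hqr hsr hpt])
    (fun {a b p q n} hpq z c => by
      obtain ⟨m, x, rfl⟩ := Module.DirectLimit.exists_of z
      rw [seqAct_of, seqD_of, seqD_of, seqAct_of, seqAct_of, (F.obj m).leibniz, map_add, map_smul])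

/-- The morphisms to the colimit. -/
def seqι (l : ℕ) : F.obj l ⟶ seqColimit F where
  app a :=
    { f := fun i => ModuleCat.ofHom (seqOf F a i l)
      comm' := fun i j hij => by
        refine ModuleCat.hom_ext (LinearMap.ext fun x => ?_)
        have : ((seqColimit F).obj a).d i j = ModuleCat.ofHom (seqD F a i j) := dif_pos hij
        rw [this]
        exact seqD_of F a i j l x }
  app_act hpq m x := (seqAct_of F hpq _ m x).symm

variable {F} {a : 𝒜.Obj}

theorem exists_seqι {i : ℤ} (z : ((seqColimit F).obj a).X i) :
    ∃ (l : ℕ) (x : ((F.obj l).obj a).X i), (((seqι F l).app a).f i).hom x = z :=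
  Module.DirectLimit.exists_of z

theorem seqι_seqMap {i : ℤ} {l m : ℕ} (hlm : l ≤ m) (x : ((F.obj l).obj a).X i) :
    (((seqι F m).app a).f i).hom (seqMap F a i l m hlm x) = (((seqι F l).app a).f i).hom x :=
  Module.DirectLimit.of_f

theorem exists_seqMap_eq_zero {i : ℤ} {l : ℕ} {x : ((F.obj l).obj a).X i}
    (hx : (((seqι F l).app a).f i).hom x = 0) : ∃ (m : ℕ) (hlm : l ≤ m), seqMap F a i l m hlm x = 0 :=
  Module.DirectLimit.of.zero_exact hx

/-- Cocycles of the colimit come from cocycles. -/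
theorem exists_seqι_cocycle {i : ℤ} {z : ((seqColimit F).obj a).X i}
    (hz : IsCocycle ((seqColimit F).obj a) z) : ∃ (l : ℕ) (x : ((F.obj l).obj a).X i),
      IsCocycle ((F.obj l).obj a) x ∧ (((seqι F l).app a).f i).hom x = z := by
  obtain ⟨l, x, rfl⟩ := exists_seqι z
  have h := hz (i + 1)
  rw [f_d_apply] at h
  obtain ⟨m, hlm, hm⟩ := exists_seqMap_eq_zero h
  refine ⟨m, seqMap F a i l m hlm x, isCocycle_of rfl ?_, seqι_seqMap hlm x⟩
  rw [f_d_apply]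
  exact hm

/-- Elements which become coboundaries in the colimit do so at some stage. -/
theorem exists_isBd_seqMap {i : ℤ} {l : ℕ} {x : ((F.obj l).obj a).X i}
    (hx : IsBd ((seqColimit F).obj a) ((((seqι F l).app a).f i).hom x)) :
    ∃ (m : ℕ) (hlm : l ≤ m), IsBd ((F.obj m).obj a) (seqMap F a i l m hlm x) := by
  obtain ⟨z, hz⟩ := hx.out (sub_add_cancel i 1)
  obtain ⟨m, y, rfl⟩ := exists_seqι z
  rw [f_d_apply, ← seqι_seqMap (le_max_left m l), ← seqι_seqMap (le_max_right m l), ← sub_eq_zero,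
    ← map_sub] at hz
  obtain ⟨m', hm', h0⟩ := exists_seqMap_eq_zero hz
  refine ⟨m', (le_max_right m l).trans hm', ?_⟩
  rw [map_sub, sub_eq_zero] at h0
  have e := DirectedSystem.map_map' (fun j l hjl => seqMap F a i j l hjl) (le_max_right m l) hm' x
  rw [← e, ← h0]
  exact ((isBd_d y).map _).map _

variable {Y : DGModule.{w} 𝒜} {n : ℤ}

theorem seq_compat {g : ∀ l, (homComplex (F.obj l) Y).X n}
    (hg : ∀ l, homComp (add_zero n) (g (l + 1)) (Hom.toHomComplex (F.map (homOfLE (Nat.le_succ l)))) =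
      g l) {p q : ℤ} (hpq : p + n = q) (l m : ℕ) (hlm : l ≤ m)
    (x : ((F.obj l).obj a).X p) : hv hpq (g m) (seqMap F a p l m hlm x) = hv hpq (g l) x := by
  induction hlm with
  | refl => rw [DirectedSystem.map_self' (fun j l hjl => seqMap F a p j l hjl)]
  | @step m hlm ih =>
    rw [← ih, ← hg m, hv_comp _ _ _ (add_zero p) hpq, hv_toHomComplex]
    exact congrArg _ (DirectedSystem.map_map' (fun j l hjl => seqMap F a p j l hjl) hlm
      (Nat.le_succ m) x).symm

/-- The morphism out of the colimit with given restrictions. -/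
def seqDesc (g : ∀ l, (homComplex (F.obj l) Y).X n)
    (hg : ∀ l, homComp (add_zero n) (g (l + 1)) (Hom.toHomComplex (F.map (homOfLE (Nat.le_succ l)))) =
      g l) : (homComplex (seqColimit F) Y).X n :=
  mkHom (fun a p q hpq => Module.DirectLimit.lift k ℕ (fun j => ((F.obj j).obj a).X p)
      (seqMap F a p) (fun l => hv hpq (g l)) (seq_compat hg hpq))
    (fun a b p r s p' s' hp hr hs hr' m c => by
      obtain ⟨l, x, rfl⟩ := Module.DirectLimit.exists_of m
      have h1 : (seqColimit F).act hr (seqOf F b p l x) c = seqOf F a s l ((F.obj l).act hr x c) :=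
        seqAct_of F hr l x c
      refine (congrArg _ h1).trans ((Module.DirectLimit.lift_of _ (seq_compat hg hs) _).trans
        (Eq.trans ?_ (congrArg (fun t => Y.act hr' t c)
          (Module.DirectLimit.lift_of _ (seq_compat hg hp) _).symm)))
      exact hv_act _ _ _ _ _ _ _)

theorem seqDesc_ι (g : ∀ l, (homComplex (F.obj l) Y).X n) (hg) (l : ℕ) :
    homComp (add_zero n) (seqDesc g hg) (Hom.toHomComplex (seqι F l)) = g l := by
  refine hom_ext' fun a p q hpq x => ?_
  rw [hv_comp _ _ _ (add_zero p) hpq, hv_toHomComplex]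
  exact Module.DirectLimit.lift_of _ (seq_compat hg hpq) x

theorem seq_hom_ext {f g : (homComplex (seqColimit F) Y).X n}
    (H : ∀ l, homComp (add_zero n) f (Hom.toHomComplex (seqι F l)) =
      homComp (add_zero n) g (Hom.toHomComplex (seqι F l))) : f = g := by
  refine hom_ext' fun a p q hpq z => ?_
  obtain ⟨l, x, rfl⟩ := exists_seqι z
  have := congrArg (fun t => hv hpq t x) (H l)
  rw [hv_comp _ _ _ (add_zero p) hpq, hv_comp _ _ _ (add_zero p) hpq, hv_toHomComplex] at this
  exact this

theorem toHomComplex_comp {L M N : DGModule.{w} 𝒜} (f : L ⟶ M) (g : M ⟶ N) :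
    Hom.toHomComplex (f ≫ g) = homComp (add_zero 0) (Hom.toHomComplex g) (Hom.toHomComplex f) := by
  refine hom_ext' fun a p q hpq z => ?_
  obtain rfl : p = q := by lia
  rw [hv_comp _ _ _ (add_zero p) (add_zero p), hv_toHomComplex, hv_toHomComplex, hv_toHomComplex]
  rfl

theorem seqι_succ (l : ℕ) : F.map (homOfLE (Nat.le_succ l)) ≫ seqι F (l + 1) = seqι F l := by
  refine Hom.ext (funext fun a => HomologicalComplex.hom_ext _ _ fun i =>
    ModuleCat.hom_ext (LinearMap.ext fun x => ?_))
  exact seqι_seqMap (Nat.le_succ l) x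

/-- Primitives extend over the colimit if they extend over each step. -/
theorem seq_extend {j i : ℤ} (hi : i + 1 = j) {φ : (homComplex (seqColimit F) Y).X j}
    (hφ : IsCocycle (homComplex (seqColimit F) Y) φ) (g₀ : (homComplex (F.obj 0) Y).X i)
    (h₀ : ((homComplex (F.obj 0) Y).d i j).hom g₀ =
      homComp (add_zero j) φ (Hom.toHomComplex (seqι F 0)))
    (H : ∀ (l : ℕ) (ψ : (homComplex (F.obj (l + 1)) Y).X j) (g : (homComplex (F.obj l) Y).X i),
      IsCocycle (homComplex (F.obj (l + 1)) Y) ψ → ((homComplex (F.obj l) Y).d i j).hom g =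
        homComp (add_zero j) ψ (Hom.toHomComplex (F.map (homOfLE (Nat.le_succ l)))) →
      ∃ g' : (homComplex (F.obj (l + 1)) Y).X i, ((homComplex (F.obj (l + 1)) Y).d i j).hom g' = ψ ∧
        homComp (add_zero i) g' (Hom.toHomComplex (F.map (homOfLE (Nat.le_succ l)))) = g) :
    ∃ g : (homComplex (seqColimit F) Y).X i, ((homComplex (seqColimit F) Y).d i j).hom g = φ ∧
      homComp (add_zero i) g (Hom.toHomComplex (seqι F 0)) = g₀ := by
  -- Each primitive has to restrict strictly to the preceding one, for only then do they glue to a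
  -- morphism out of the colimit.
  have step : ∀ (l : ℕ) (g : {g : (homComplex (F.obj l) Y).X i //
      ((homComplex (F.obj l) Y).d i j).hom g =
        homComp (add_zero j) φ (Hom.toHomComplex (seqι F l))}),
      ∃ g' : {g : (homComplex (F.obj (l + 1)) Y).X i //
        ((homComplex (F.obj (l + 1)) Y).d i j).hom g =
          homComp (add_zero j) φ (Hom.toHomComplex (seqι F (l + 1)))},
        homComp (add_zero i) g'.1 (Hom.toHomComplex (F.map (homOfLE (Nat.le_succ l)))) = g.1 := by
    rintro l ⟨g, hg⟩
    obtain ⟨g', hg', e⟩ := H l (homComp (add_zero j) φ (Hom.toHomComplex (seqι F (l + 1)))) g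
      (isCocycle_comp _ hφ (isCocycle_toHomComplex _)) (by
        rw [hg, comp_assoc (add_zero j) (add_zero 0) (add_zero j) (add_zero j), ← toHomComplex_comp,
          seqι_succ])
    exact ⟨⟨g', hg'⟩, e⟩
  choose s hs using step
  let g : ∀ l, {g : (homComplex (F.obj l) Y).X i // ((homComplex (F.obj l) Y).d i j).hom g =
      homComp (add_zero j) φ (Hom.toHomComplex (seqι F l))} :=
    fun l => Nat.rec ⟨g₀, h₀⟩ (fun l g => s l g) l
  refine ⟨seqDesc (fun l => (g l).1) (fun l => hs l (g l)), seq_hom_ext fun l => ?_,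
    seqDesc_ι _ _ 0⟩
  rw [← (g l).2, ← seqDesc_ι (fun l => (g l).1) (fun l => hs l (g l)) l,
    comp_d (add_zero i) hi (zero_add 1) hi, isCocycle_toHomComplex, map_zero, smul_zero, add_zero]

end Colimit

end DGModule

namespace DGModule

open DGCategory

variable {k : Type v} [Field k] {𝒞 : DGCategory.{v, o, h} k} {s : 𝒞.Obj} {Y Z : DGModule.{h} 𝒞}

/-! ### Morphisms out of representable modules -/

variable (𝒞 s) in
/-- The identity, as an element of a representable module. -/
def repId : ((representable 𝒞 s).obj s).X 0 := 𝒞.id s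

variable (Y) in
/-- The orbit map of an element of a module. -/
def orbit {n : ℤ} (y : (Y.obj s).X n) {a : 𝒞.Obj} {p q : ℤ} (hpq : p + n = q) :
    ((representable 𝒞 s).obj a).X p →ₗ[k] (Y.obj a).X q :=
  Y.act (show n + p = q by lia) y

theorem orbit_add {n : ℤ} (y y' : (Y.obj s).X n) {a : 𝒞.Obj} {p q : ℤ} (hpq : p + n = q)
    (c : ((representable 𝒞 s).obj a).X p) :
    orbit Y (y + y') hpq c = orbit Y y hpq c + orbit Y y' hpq c :=
  LinearMap.congr_fun (map_add (Y.act (show n + p = q by lia)) y y') c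

theorem orbit_smul {n : ℤ} (r : k) (y : (Y.obj s).X n) {a : 𝒞.Obj} {p q : ℤ} (hpq : p + n = q)
    (c : ((representable 𝒞 s).obj a).X p) : orbit Y (r • y) hpq c = r • orbit Y y hpq c :=
  LinearMap.congr_fun (map_smul (Y.act (show n + p = q by lia)) r y) c

theorem orbit_repId {n : ℤ} (y : (Y.obj s).X n) : orbit Y y (zero_add n) (repId 𝒞 s) = y :=
  Y.act_id y

theorem orbit_act {n : ℤ} (y : (Y.obj s).X n) {a b : 𝒞.Obj} {p r t p' t' : ℤ} (hp : p + n = p')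
    (hr : p + r = t) (ht : t + n = t') (hr' : p' + r = t') (m : ((representable 𝒞 s).obj b).X p)
    (x : (𝒞.Hom a b).X r) :
    orbit Y y ht ((representable 𝒞 s).act hr m x) = Y.act hr' (orbit Y y hp m) x :=
  (Y.act_act _ _ _ _ y m x).symm

theorem repId_act {a : 𝒞.Obj} {p : ℤ} (c : ((representable 𝒞 s).obj a).X p) :
    (representable 𝒞 s).act (zero_add p) (repId 𝒞 s) c = c := 𝒞.id_comp c

theorem isCocycle_repId : IsCocycle ((representable 𝒞 s).obj s) (repId 𝒞 s) := 𝒞.isCocycle_id s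

/-- The morphism from a representable module given by an element. -/
def ofElt {n : ℤ} : (Y.obj s).X n →ₗ[k] (homComplex (representable 𝒞 s) Y).X n where
  toFun y := mkHom (fun _ _ _ hpq => orbit Y y hpq)
    (fun _ _ _ _ _ _ _ _ _ _ _ m x => orbit_act y _ _ _ _ m x)
  map_add' y y' := hom_ext' fun _ _ _ hpq c => by
    rw [map_add, LinearMap.add_apply, hv_mkHom, hv_mkHom, hv_mkHom, orbit_add]
  map_smul' r y := hom_ext' fun _ _ _ _ c => by
    rw [map_smul, LinearMap.smul_apply, hv_mkHom, hv_mkHom, orbit_smul, RingHom.id_apply]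

theorem hv_ofElt_id {n : ℤ} (y : (Y.obj s).X n) :
    hv (zero_add n) (ofElt y) (repId 𝒞 s) = y := orbit_repId y

/-- Yoneda: `f(c) = f(1 · c) = f(1) · c`. -/
theorem ofElt_hv_id {n : ℤ} (f : (homComplex (representable 𝒞 s) Y).X n) :
    ofElt (hv (zero_add n) f (repId 𝒞 s)) = f := by
  refine hom_ext' fun a p q hpq c => ?_
  have := hv_act f (zero_add n) (zero_add p) hpq (show n + p = q by lia) (repId 𝒞 s) c
  exact this.symm.trans (congrArg _ (repId_act c))

theorem ofElt_d {n m : ℤ} (y : (Y.obj s).X n) :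
    ((homComplex (representable 𝒞 s) Y).d n m).hom (ofElt y) = ofElt (((Y.obj s).d n m).hom y) := by
  by_cases hm : n + 1 = m
  · rw [← ofElt_hv_id (((homComplex (representable 𝒞 s) Y).d n m).hom (ofElt y)),
      hv_d hm _ (zero_add m) (zero_add n) (zero_add 1), hv_ofElt_id,
      isCocycle_repId 1, map_zero, smul_zero, sub_zero]
  · rw [d_eq_zero _ hm, d_eq_zero _ hm, map_zero]

theorem isCocycle_ofElt {n : ℤ} {y : (Y.obj s).X n} (hy : IsCocycle (Y.obj s) y) :
    IsCocycle (homComplex (representable 𝒞 s) Y) (ofElt y) := fun m => by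
  rw [ofElt_d, hy, map_zero]

theorem isBd_ofElt {n : ℤ} {y : (Y.obj s).X n} (hy : IsBd (Y.obj s) y) :
    IsBd (homComplex (representable 𝒞 s) Y) (ofElt y) := by
  obtain ⟨m, z, rfl⟩ := hy
  exact ⟨m, ofElt z, ofElt_d z⟩

theorem hZero_hom_representable {n : ℤ} (H : HZero (Y.obj s) n) :
    HZero (homComplex (representable 𝒞 s) Y) n := fun φ hφ => by
  rw [← ofElt_hv_id φ]
  exact isBd_ofElt (H _ (isCocycle_hv hφ _ isCocycle_repId))

theorem isHProjective_representable : (representable 𝒞 s).IsHProjective := fun _ hY =>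
  acyclic_iff_hZero.2 fun _ => hZero_hom_representable (isAcyclic_iff.1 hY _ _)

theorem comp_ofElt {n m l : ℤ} (hl : m + n = l) (f : (homComplex Y Z).X m) (y : (Y.obj s).X n) :
    homComp hl f (ofElt y) = ofElt (hv (show n + m = l by lia) f y) := by
  rw [← ofElt_hv_id (homComp hl f (ofElt y)), hv_comp hl _ _ (zero_add n) (show n + m = l by lia),
    hv_ofElt_id]

end DGModule

/-! ### The action of `H⁰(A)` on cohomology -/

namespace DGAlgebra

open DGModule

/-- The object of a dg algebra regarded as a dg category. -/
def pt {k : Type u} [Field k] (A : DGAlgebra.{u} k) : A.toDGCategory.Obj := PUnit.unit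

variable {k : Type u} [Field k] (A : DGAlgebra.{u} k) (M : A.RightModule) (n : ℤ)

theorem Z0.isCocycle {A : DGAlgebra.{u} k} (z : A.Z0) : IsCocycle A.complex z.1 :=
  isCocycle_of (zero_add 1) z.2

/-- Multiplication by a cocycle of degree `0`. -/
def actZ0 (z : A.Z0) : (M.obj A.pt).X n →ₗ[k] (M.obj A.pt).X n :=
  (M.act (a := A.pt) (b := A.pt) (add_zero n)).flip z.1

variable {A M n} in
theorem isCocycle_actZ0 (z : A.Z0) {m : (M.obj A.pt).X n} (hm : IsCocycle (M.obj A.pt) m) :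
    IsCocycle (M.obj A.pt) (A.actZ0 M n z m) :=
  M.isCocycle_act (a := A.pt) (add_zero n) hm z.isCocycle

variable {A M n} in
theorem isBd_actZ0 (z : A.Z0) {m : (M.obj A.pt).X n} (hm : IsBd (M.obj A.pt) m) :
    IsBd (M.obj A.pt) (A.actZ0 M n z m) :=
  M.isBd_act_left (a := A.pt) (add_zero n) hm z.isCocycle

theorem actZ0_mul (z w : A.Z0) (m : (M.obj A.pt).X n) :
    A.actZ0 M n (z * w) m = A.actZ0 M n w (A.actZ0 M n z m) :=
  (M.act_act (a := A.pt) (b := A.pt) (c := A.pt) (add_zero n) (add_zero 0)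
    (add_zero n) (add_zero n) m z.1 w.1).symm

theorem actZ0_one (m : (M.obj A.pt).X n) : A.actZ0 M n 1 m = m := M.act_id (a := A.pt) m

theorem actZ0_add (z w : A.Z0) (m : (M.obj A.pt).X n) :
    A.actZ0 M n (z + w) m = A.actZ0 M n z m + A.actZ0 M n w m :=
  map_add (M.act (a := A.pt) (b := A.pt) (add_zero n) m) z.1 w.1

theorem actZ0_zero (m : (M.obj A.pt).X n) : A.actZ0 M n 0 m = 0 :=
  map_zero (M.act (a := A.pt) (b := A.pt) (add_zero n) m)

theorem mem_B0_iff (z : A.Z0) : z ∈ A.B0 ↔ IsBd A.complex z.1 :=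
  ⟨fun ⟨y, hy⟩ => ⟨_, y, hy⟩, fun h => h.out (show (-1 : ℤ) + 1 = 0 by lia)⟩

/-- The action of `H⁰(A)` on cohomology, as a ring homomorphism. -/
def hnAct : A.H0 →+* (Module.End k (Hn (M.obj A.pt) n))ᵐᵒᵖ :=
  Ideal.Quotient.lift A.B0
    { toFun := fun z => .op (Submodule.mapQ _ _
        ((A.actZ0 M n z).restrict (p := cocycles (M.obj A.pt) n) (q := cocycles (M.obj A.pt) n)
          fun _ hm => isCocycle_actZ0 z (isCocycle_of rfl hm) _)
        fun m hm => (isBd_actZ0 z ⟨_, hm⟩).out (sub_add_cancel n 1))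
      map_one' := MulOpposite.unop_injective (LinearMap.ext fun x => by
        obtain ⟨m, hm, rfl⟩ := exists_cls x
        exact congrArg _ (Subtype.ext (A.actZ0_one M n m)))
      map_mul' := fun z w => MulOpposite.unop_injective (LinearMap.ext fun x => by
        obtain ⟨m, hm, rfl⟩ := exists_cls x
        exact congrArg _ (Subtype.ext (A.actZ0_mul M n z w m)))
      map_zero' := MulOpposite.unop_injective (LinearMap.ext fun x => by
        obtain ⟨m, hm, rfl⟩ := exists_cls x
        exact congrArg _ (Subtype.ext (A.actZ0_zero M n m)))
      map_add' := fun z w => MulOpposite.unop_injective (LinearMap.ext fun x => by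
        obtain ⟨m, hm, rfl⟩ := exists_cls x
        exact congrArg _ (Subtype.ext (A.actZ0_add M n z w m))) }
    (fun z hz => MulOpposite.unop_injective (LinearMap.ext fun x => by
      obtain ⟨m, hm, rfl⟩ := exists_cls x
      exact (cls_eq_zero_iff (hx := isCocycle_actZ0 z hm)).2
        (M.isBd_act_right (a := A.pt) (add_zero n) hm ((A.mem_B0_iff z).1 hz))))

/-- Cohomology is a right module over `H⁰(A)`. -/
abbrev hnModule : Module (A.H0)ᵐᵒᵖ (Hn (M.obj A.pt) n) where
  smul r x := (A.hnAct M n r.unop).unop x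
  one_smul x := by
    change (A.hnAct M n 1).unop x = x
    rw [map_one]; rfl
  mul_smul r t x := by
    change (A.hnAct M n (t.unop * r.unop)).unop x = _
    rw [map_mul]; rfl
  smul_zero r := map_zero _
  smul_add r := map_add _
  add_smul r t x := by
    change (A.hnAct M n (r.unop + t.unop)).unop x = _
    rw [map_add]; rfl
  zero_smul x := by
    change (A.hnAct M n 0).unop x = _
    rw [map_zero]; rfl

theorem hn_smul_cls (z : A.Z0) {m : (M.obj A.pt).X n} (hm : IsCocycle (M.obj A.pt) m) :
    letI := A.hnModule M n
    (MulOpposite.op (Ideal.Quotient.mk A.B0 z) • clsOf (M.obj A.pt) m hm : Hn (M.obj A.pt) n) =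
      clsOf (M.obj A.pt) (A.actZ0 M n z m) (isCocycle_actZ0 z hm) := rfl

end DGAlgebra

/-! ### Modules over semisimple rings -/

/-- The ideal is generated by an idempotent `f`, and `e = 1 - f` works. Passing to `1 - f` turns
membership into an equation, so that annihilators are expressed by idempotents. -/
theorem IsSemisimpleRing.exists_idempotent_ideal {S : Type*} [Ring S] [IsSemisimpleRing S]
    (I : Ideal S) : ∃ e : S, IsIdempotentElem e ∧ ∀ r, r ∈ I ↔ r * e = 0 := by
  obtain ⟨f, hf, rfl⟩ := IsSemisimpleRing.ideal_eq_span_idempotent I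
  refine ⟨1 - f, hf.one_sub, fun r => ?_⟩
  rw [Ideal.mem_span_singleton', mul_sub, mul_one, sub_eq_zero]
  constructor
  · rintro ⟨a, rfl⟩
    rw [mul_assoc, hf.eq]
  · intro h
    exact ⟨r, h.symm⟩

/-- Decompose into simple submodules and choose a nonzero vector `v` in each. The annihilator of `v`
is also that of an idempotent `e`, so `S v ≅ S e`. This is the shape in which the decomposition can
be realised by modules over `A`. -/
theorem IsSemisimpleModule.exists_cyclic_decomposition {S : Type*} {V : Type x} [Ring S]
    [IsSemisimpleRing S] [AddCommGroup V] [Module S V] :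
    ∃ (X : Type x) (e : X → S) (v : X → V), (∀ x, IsIdempotentElem (e x)) ∧
      (∀ x, e x • v x = v x) ∧ Submodule.span S (Set.range v) = ⊤ ∧
      ∀ (t : Finset X) (r : X → S), ∑ x ∈ t, r x • v x = 0 → ∀ x ∈ t, r x * e x = 0 := by
  obtain ⟨s, hs, hs', hsimple⟩ := IsSemisimpleModule.exists_sSupIndep_sSup_simples_eq_top S V
  have hne : ∀ m : s, ∃ v : V, v ∈ m.1 ∧ v ≠ 0 := fun m => by
    have := hsimple m.1 m.2
    exact (Submodule.ne_bot_iff m.1).1 (isSimpleModule_iff_isAtom.1 this).1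
  choose v hv hv0 using hne
  have hspan : ∀ m : s, Submodule.span S {v m} = m.1 := fun m => by
    have := hsimple m.1 m.2
    have h := (isSimpleModule_iff_isAtom.1 this).le_iff.1
      ((Submodule.span_singleton_le_iff_mem (v m) m.1).2 (hv m))
    refine h.resolve_left fun h => hv0 m ?_
    exact Submodule.span_singleton_eq_bot.1 h
  choose e he he' using fun m : s =>
    IsSemisimpleRing.exists_idempotent_ideal (LinearMap.ker (LinearMap.toSpanSingleton S V (v m)))
  refine ⟨s, e, v, he, fun m => ?_, ?_, ?_⟩
  · have := (he' m (1 - e m)).2 (by rw [sub_mul, one_mul, (he m).eq, sub_self])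
    rw [LinearMap.mem_ker, LinearMap.toSpanSingleton_apply, sub_smul, one_smul, sub_eq_zero] at this
    exact this.symm
  · rw [eq_top_iff, ← hs', sSup_le_iff]
    intro m hm
    exact (hspan ⟨m, hm⟩).ge.trans (Submodule.span_mono (Set.singleton_subset_iff.2 ⟨_, rfl⟩))
  · intro t r h m hm
    have h1 := (iSupIndep_iff_finsetSum_eq_zero_imp_eq_zero _).1 ((sSupIndep_iff _).1 hs) t
      (fun m => r m • v m) (fun m _ => m.1.smul_mem _ (hv m)) h m hm
    exact (he' m (r m)).1 h1

/-- The surjection `π` from the free module onto `V` has a section `σ`, since `V` is projective.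
Then `1 - σ π` is a projection onto the relations between the generators, and `c` is its matrix. -/
theorem IsSemisimpleRing.exists_syzygy_retraction {S V X : Type*} [Ring S] [IsSemisimpleRing S]
    [AddCommGroup V] [Module S V] [Fintype X] (m : X → V)
    (hm : Submodule.span S (Set.range m) = ⊤) :
    ∃ c : X → X → S, (∀ i, ∑ j, c i j • m j = 0) ∧
      ∀ r : X → S, ∑ i, r i • m i = 0 → ∀ j, ∑ i, r i * c i j = r j := by
  classical
  let π : (X → S) →ₗ[S] V := Fintype.linearCombination S m
  have hπ : Function.Surjective π := LinearMap.range_eq_top.1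
    ((Fintype.range_linearCombination S m).trans hm)
  have : Module.Projective S V := Module.projective_of_isSemisimpleRing S V
  obtain ⟨σ, hσ⟩ := Module.projective_lifting_property π LinearMap.id hπ
  have hσ' : ∀ y, π (σ y) = y := LinearMap.congr_fun hσ
  refine ⟨fun i => Pi.single i 1 - σ (m i), fun i => ?_, fun r hr j => ?_⟩
  · have : π (Pi.single i 1 - σ (m i)) = 0 := by
      rw [map_sub, hσ', Fintype.linearCombination_apply_single, one_smul, sub_self]
    exact this
  · have : ∑ i, r i • (Pi.single i 1 - σ (m i)) = r := by
      simp only [smul_sub, Finset.sum_sub_distrib, ← map_smul, ← map_sum, hr, map_zero, sub_zero]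
      funext j
      simp [Finset.sum_apply, Pi.single_apply]
    simpa [Finset.sum_apply] using congrFun this j

/-! ### Elementwise consequences for cohomology -/

namespace DGAlgebra

open DGModule

variable {k : Type u} [Field k] (A : DGAlgebra.{u} k) (M : A.RightModule) (n : ℤ)

theorem sub_mem_B0_iff {z w : A.Z0} :
    Ideal.Quotient.mk A.B0 z = Ideal.Quotient.mk A.B0 w ↔ z - w ∈ A.B0 :=
  Ideal.Quotient.eq

variable {A M n} in
theorem isCocycle_sum {ι : Type*} (t : Finset ι) {m : ι → (M.obj A.pt).X n}
    (hm : ∀ i, IsCocycle (M.obj A.pt) (m i)) : IsCocycle (M.obj A.pt) (∑ i ∈ t, m i) := fun l => by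
  rw [map_sum]
  exact Finset.sum_eq_zero fun i _ => hm i l

theorem cls_sum {ι : Type*} (t : Finset ι) {m : ι → (M.obj A.pt).X n}
    (hm : ∀ i, IsCocycle (M.obj A.pt) (m i)) :
    ∑ i ∈ t, clsOf (M.obj A.pt) (m i) (hm i) = clsOf (M.obj A.pt) _ (isCocycle_sum t hm) := by
  classical
  refine (map_sum (coboundaries (M.obj A.pt) n).mkQ (fun i => (⟨m i, LinearMap.mem_ker.2 (hm i _)⟩ :
    cocycles (M.obj A.pt) n)) t).symm.trans (congrArg _ (Subtype.ext ?_))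
  exact map_sum (cocycles (M.obj A.pt) n).subtype _ t

theorem hn_sum_smul_cls {ι : Type*} (t : Finset ι) (z : ι → A.Z0) {m : ι → (M.obj A.pt).X n}
    (hm : ∀ i, IsCocycle (M.obj A.pt) (m i)) :
    letI := A.hnModule M n
    ∑ i ∈ t, (MulOpposite.op (Ideal.Quotient.mk A.B0 (z i)) • clsOf (M.obj A.pt) (m i) (hm i) :
      Hn (M.obj A.pt) n) = clsOf (M.obj A.pt) (∑ i ∈ t, A.actZ0 M n (z i) (m i))
        (isCocycle_sum t fun i => isCocycle_actZ0 (z i) (hm i)) :=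
  A.cls_sum M n t fun i => isCocycle_actZ0 (z i) (hm i)

/-- The cohomology of a module decomposes into cyclic projective modules over `H⁰(A)`. -/
theorem exists_cyclic_decomposition [IsSemisimpleRing A.H0] :
    ∃ (X : Type u) (e : X → A.Z0) (v : X → (M.obj A.pt).X n), (∀ x, e x * e x - e x ∈ A.B0) ∧
      (∀ x, IsCocycle (M.obj A.pt) (v x)) ∧ (∀ x, IsBd (M.obj A.pt) (A.actZ0 M n (e x) (v x) - v x)) ∧
      (∀ m : (M.obj A.pt).X n, IsCocycle (M.obj A.pt) m → ∃ (t : Finset X) (r : X → A.Z0),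
        IsBd (M.obj A.pt) (m - ∑ x ∈ t, A.actZ0 M n (r x) (v x))) ∧
      ∀ (t : Finset X) (r : X → A.Z0), IsBd (M.obj A.pt) (∑ x ∈ t, A.actZ0 M n (r x) (v x)) →
        ∀ x ∈ t, e x * r x ∈ A.B0 := by
  let _ := A.hnModule M n
  obtain ⟨X, e, v, he, hev, hv, hind⟩ :=
    IsSemisimpleModule.exists_cyclic_decomposition (S := (A.H0)ᵐᵒᵖ) (V := Hn (M.obj A.pt) n)
  choose v' hv' hvv using fun x => exists_cls (v x)
  choose e' hee using fun x => Ideal.Quotient.mk_surjective (e x).unop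
  have hop : ∀ x, e x = .op (Ideal.Quotient.mk A.B0 (e' x)) := fun x =>
    MulOpposite.unop_injective (hee x).symm
  refine ⟨X, e', v', fun x => ?_, hv', fun x => ?_, fun m hm => ?_, fun t r h x hx => ?_⟩
  · rw [← sub_mem_B0_iff, map_mul]
    have := (he x).eq
    rw [hop, ← MulOpposite.op_mul] at this
    exact MulOpposite.op_injective this
  · refine (cls_eq_iff (hx := isCocycle_actZ0 _ (hv' x)) (hy := hv' x)).1 ?_
    rw [← hn_smul_cls (hm := hv' x), hvv, ← hop, hev]
  · have hm' : clsOf (M.obj A.pt) m hm ∈ Submodule.span (A.H0)ᵐᵒᵖ (Set.range v) := hv ▸ trivial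
    obtain ⟨c, hc⟩ := (Finsupp.mem_span_range_iff_exists_finsupp).1 hm'
    choose r hr using fun x => Ideal.Quotient.mk_surjective (c x).unop
    refine ⟨c.support, r, (cls_eq_iff (hx := hm)
      (hy := isCocycle_sum _ fun x => isCocycle_actZ0 _ (hv' x))).1 ?_⟩
    rw [← hn_sum_smul_cls (hm := hv'), ← hc]
    exact Finset.sum_congr rfl fun x _ => by rw [hr, hvv]; rfl
  · have := hind t (fun x => .op (Ideal.Quotient.mk A.B0 (r x))) ?_ x hx
    · rw [hop, ← MulOpposite.op_mul, MulOpposite.op_eq_zero_iff, ← map_mul,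
        Ideal.Quotient.eq_zero_iff_mem] at this
      exact this
    · simp only [← hvv]
      rw [hn_sum_smul_cls]
      exact cls_eq_zero_iff.2 h

/-- Generators of the cohomology of a module over `H⁰(A)`, and a projection onto the relations
between them. -/
theorem exists_syzygy_retraction [IsSemisimpleRing A.H0]
    (hfin : Module.Finite k (Hn (M.obj A.pt) n)) :
    ∃ (X : Type u) (_ : Fintype X) (m : X → (M.obj A.pt).X n) (c : X → X → A.Z0),
      (∀ i, IsCocycle (M.obj A.pt) (m i)) ∧
      (∀ y : (M.obj A.pt).X n, IsCocycle (M.obj A.pt) y → ∃ r : X → A.Z0,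
        IsBd (M.obj A.pt) (y - ∑ i, A.actZ0 M n (r i) (m i))) ∧
      (∀ i, IsBd (M.obj A.pt) (∑ j, A.actZ0 M n (c i j) (m j))) ∧
      ∀ r : X → A.Z0, IsBd (M.obj A.pt) (∑ i, A.actZ0 M n (r i) (m i)) →
        ∀ j, ∑ i, c i j * r i - r j ∈ A.B0 := by
  let _ := A.hnModule M n
  -- Scalars act through `H⁰(A)`, as multiples of the unit. Hence a finite spanning set over `k`
  -- also spans over `H⁰(A)`.
  have hk : ∀ (a : k) (y : Hn (M.obj A.pt) n),
      ∃ s : (A.H0)ᵐᵒᵖ, s • y = a • y := fun a y => by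
    obtain ⟨y, hy, rfl⟩ := exists_cls y
    refine ⟨.op (Ideal.Quotient.mk A.B0 ⟨a • A.one, LinearMap.mem_ker.2 (by
      rw [map_smul, A.d_one, smul_zero])⟩), ?_⟩
    refine (A.hn_smul_cls M n _ hy).trans ?_
    refine congrArg (coboundaries (M.obj A.pt) n).mkQ (Subtype.ext ?_)
    change M.act (a := A.pt) (b := A.pt) (add_zero n) y (a • A.one) = a • y
    refine (map_smul (M.act (a := A.pt) (b := A.pt) (add_zero n) y) a A.one).trans ?_
    exact congrArg _ (M.act_id (a := A.pt) y)
  obtain ⟨d, w, hw⟩ := Module.Finite.exists_fin (R := k) (M := Hn (M.obj A.pt) n)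
  let v : ULift.{u} (Fin d) → Hn (M.obj A.pt) n := fun i => w i.down
  have hv : Submodule.span k (Set.range v) = ⊤ := by
    rw [← hw]
    exact congrArg _ (Equiv.ulift.surjective.range_comp w)
  have hv' : Submodule.span (A.H0)ᵐᵒᵖ (Set.range v) = ⊤ := by
    refine eq_top_iff.2 fun y _ => ?_
    have hy : y ∈ Submodule.span k (Set.range v) := hv ▸ trivial
    induction hy using Submodule.span_induction with
    | mem y hy => exact Submodule.subset_span hy
    | zero => exact Submodule.zero_mem _
    | add y z _ _ hy hz => exact Submodule.add_mem _ (hy trivial) (hz trivial)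
    | smul a y _ hy =>
      obtain ⟨s, hs⟩ := hk a y
      exact hs ▸ Submodule.smul_mem _ s (hy trivial)
  obtain ⟨c, hc, hc'⟩ := IsSemisimpleRing.exists_syzygy_retraction v hv'
  choose m hm hmv using fun i => exists_cls (v i)
  choose c' hcc using fun i j => Ideal.Quotient.mk_surjective (c i j).unop
  have hop : ∀ i j, c i j = .op (Ideal.Quotient.mk A.B0 (c' i j)) := fun i j =>
    MulOpposite.unop_injective (hcc i j).symm
  refine ⟨ULift.{u} (Fin d), inferInstance, m, c', hm, fun y hy => ?_, fun i => ?_, fun r h j => ?_⟩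
  · have hy' : clsOf (M.obj A.pt) y hy ∈ Submodule.span (A.H0)ᵐᵒᵖ (Set.range v) := hv' ▸ trivial
    obtain ⟨r, hr⟩ := (Submodule.mem_span_range_iff_exists_fun _).1 hy'
    choose r' hrr using fun i => Ideal.Quotient.mk_surjective (r i).unop
    refine ⟨r', (cls_eq_iff (hx := hy) (hy := isCocycle_sum _ fun x => isCocycle_actZ0 _ (hm x))).1 ?_⟩
    rw [← hn_sum_smul_cls (hm := hm), ← hr]
    exact Finset.sum_congr rfl fun x _ => by rw [hrr, hmv]; rfl
  · refine (cls_eq_zero_iff (hx := isCocycle_sum _ fun x => isCocycle_actZ0 _ (hm x))).1 ?_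
    rw [← hn_sum_smul_cls (hm := hm), ← hc i]
    exact Finset.sum_congr rfl fun j _ => by rw [hop, hmv]
  · have := hc' (fun i => .op (Ideal.Quotient.mk A.B0 (r i))) ?_ j
    · rw [← sub_mem_B0_iff, map_sum]
      refine MulOpposite.op_injective (Eq.trans ?_ this)
      rw [Finset.op_sum]
      exact Finset.sum_congr rfl fun i _ => by rw [hop, map_mul, MulOpposite.op_mul]
    · simp only [← hmv]
      rw [hn_sum_smul_cls]
      exact cls_eq_zero_iff.2 h

end DGAlgebra

namespace DGModule

open DGCategory SemifreeDatum

/-! ### The projective module of an idempotent up to homotopy -/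

variable {k : Type v} [Field k] {𝒞 : DGCategory.{v, o, h} k} {s : 𝒞.Obj}

theorem hv_ofElt_hv {Y Z : DGModule.{h} 𝒞} {n m l p q r : ℤ} (f : (homComplex Y Z).X m)
    (y : (Y.obj s).X n) {a : 𝒞.Obj} (hpq : p + n = q) (hq : q + m = r) (hl : n + m = l)
    (c : ((representable 𝒞 s).obj a).X p) :
    hv hq f (hv hpq (ofElt y) c) = hv (show p + l = r by lia) (ofElt (hv hl f y)) c := by
  rw [← comp_ofElt (show m + n = l by lia), hv_comp _ _ _ hpq hq]

/-- `U` is a model of the summand `e 𝒞(-, s)` split off by the homotopy idempotent `e`. It is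
semifree with cells in degrees `≤ 0`: in degree `0`, cells without boundary whose values `m` satisfy
`e m ∼ m`, and in negative degrees all cells needed to make `i` injective on cohomology up to degree
`0`. If `u` lifts `e`, the orbit map of `u` composed after `i` is homotopic to the identity of `U`.
As a homotopy retract, `U` inherits the vanishing of morphisms from the representable module. -/
theorem exists_idempotent_module (e : ((representable 𝒞 s).obj s).X 0)
    (he : IsCocycle ((representable 𝒞 s).obj s) e)
    (hee : IsBd ((representable 𝒞 s).obj s)
      (hv (add_zero 0) (ofElt (Y := representable 𝒞 s) e) e - e))
    (hneg : ∀ n < 0, HZero ((representable 𝒞 s).obj s) n) :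
    ∃ (U : DGModule.{h} 𝒞) (i : (homComplex U (representable 𝒞 s)).X 0),
      IsCocycle (homComplex U (representable 𝒞 s)) i ∧ U.IsHProjective ∧
      (∀ (Y : DGModule.{h} 𝒞) (m : ℤ), HZero (Y.obj s) m → HZero (homComplex U Y) m) ∧
      (∀ n ≤ 0, ∀ z : (U.obj s).X n, IsCocycle (U.obj s) z →
        IsBd ((representable 𝒞 s).obj s) (hv (add_zero n) i z) → IsBd (U.obj s) z) ∧
      (∀ (n : ℤ) (z : (U.obj s).X n), IsCocycle (U.obj s) z → IsBd ((representable 𝒞 s).obj s)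
        (hv (add_zero n) (ofElt (Y := representable 𝒞 s) e) (hv (add_zero n) i z) -
          hv (add_zero n) i z)) ∧
      ∃ u : (U.obj s).X 0, IsCocycle (U.obj s) u ∧ hv (add_zero 0) i u = e := by
  let N := representable 𝒞 s
  let lam : (homComplex N N).X 0 := ofElt (Y := N) e
  have hlam : IsCocycle (homComplex N N) lam := isCocycle_ofElt he
  let Gen : ∀ n, Set ((N.obj s).X n) := fun n => {m | IsBd (N.obj s) (hv (add_zero n) lam m - m)}
  obtain ⟨D, i, hi, hI, hcell, hinj, hsurj⟩ := exists_semifree.{h} s (Set.Iic 0) (Set.Iio 0) N Gen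
    (fun n => by
      change IsBd _ _
      rw [map_zero, sub_zero]
      exact isBd_zero)
  let U : DGModule.{h} 𝒞 := module.{h} D
  have hinj' : ∀ n ≤ 0, ∀ z : (U.obj s).X n, IsCocycle (U.obj s) z →
      IsBd (N.obj s) (hv (add_zero n) i z) → IsBd (U.obj s) z := fun n hn z hz hb => by
    obtain ⟨n, rfl⟩ : ∃ n', n = n' + 1 := ⟨n - 1, by lia⟩
    obtain ⟨m, hm⟩ := hb.out rfl
    obtain ⟨y, hy⟩ := hinj n (by simp; lia) (by simp; lia) z m hz hm.symm
    exact ⟨n, y, hy⟩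
  have hUneg : ∀ n < 0, HZero (U.obj s) n := fun n hn z hz =>
    hinj' n hn.le z hz (hneg n hn _ (isCocycle_hv hi _ hz))
  obtain ⟨u, hu, hiu⟩ : ∃ u : (U.obj s).X 0, IsCocycle (U.obj s) u ∧ hv (add_zero 0) i u = e := by
    obtain ⟨x, hx, hb, hv'⟩ := hsurj 0 (by simp) e he (.inr hee)
    have key : ∀ (n : ℤ) (hn : 0 = n) (g : (U.obj s).X n), IsCocycle (U.obj s) g →
        hv (add_zero n) i g = hn ▸ e →
        ∃ u : (U.obj s).X 0, IsCocycle (U.obj s) u ∧ hv (add_zero 0) i u = e := by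
      rintro _ rfl g hg h
      exact ⟨g, hg, h⟩
    refine key _ hx (gen.{h} D x) (isCocycle_of rfl ?_) hv'
    rw [gen_d, hb, map_zero]
  -- Checked on cells. Those of negative degree meet no cohomology of `U`. On a generator `x` of
  -- degree `0`, the map `i` sends `u · i(x) - x` to `e i(x) - i(x)`, which is a coboundary by the
  -- choice of `Gen`, and `i` is injective on cohomology there.
  have hri : IsBd (homComplex U U) (homComp (add_zero 0) (ofElt u) i - idHom U) := by
    refine isBd_of_cells D ((isCocycle_comp _ (isCocycle_ofElt hu) hi).sub isCocycle_id) fun x => ?_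
    have hx0 : D.deg x ≤ 0 := hI x
    rcases hcell x with hx | ⟨hb, hg⟩
    · exact .inl (hUneg _ (by simpa using hx))
    · refine .inr ⟨hb, ?_⟩
      have hgc : IsCocycle (U.obj s) (gen.{h} D x) := isCocycle_of rfl (by rw [gen_d, hb, map_zero])
      have hg' : IsBd (N.obj s) (hv (add_zero (D.deg x)) lam (hv (add_zero (D.deg x)) i (gen.{h} D x))
        - hv (add_zero (D.deg x)) i (gen.{h} D x)) := hg
      have key : IsBd (U.obj s) (hv (add_zero (D.deg x)) (homComp (add_zero 0) (ofElt u) i - idHom U)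
          (gen.{h} D x)) := by
        refine hinj' _ hx0 _ (isCocycle_hv ((isCocycle_comp _ (isCocycle_ofElt hu) hi).sub
          isCocycle_id) _ hgc) ?_
        rw [map_sub, LinearMap.sub_apply, hv_id, map_sub, hv_comp _ _ _ (add_zero _) (add_zero _),
          hv_ofElt_hv i u _ _ (add_zero 0), hiu]
        exact hg'
      have cast : ∀ (m : ℤ) (hm : D.deg x + 0 = m), IsBd (U.obj s) (hv hm (homComp (add_zero 0)
          (ofElt u) i - idHom U) (gen.{h} D x)) := by
        intro m hm
        obtain rfl : m = D.deg x := by lia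
        exact key
      exact cast _ rfl
  refine ⟨U, i, hi, isHProjective D, fun Y m hY φ hφ => ?_, hinj', fun n z hz => ?_, u, hu, hiu⟩
  · have h1 := hZero_hom_representable hY (homComp (add_zero m) φ (ofElt u))
      (isCocycle_comp _ hφ (isCocycle_ofElt hu))
    have h2 := isBd_comp_left (add_zero m) h1 hi
    have h3 := isBd_comp_right (add_zero m) hφ hri
    rw [map_sub, comp_id, ← comp_assoc (add_zero m) (add_zero 0) (add_zero m) (add_zero m)] at h3
    exact (isBd_iff_of_sub h3).1 h2
  · have h1 := isBd_hv_of_isBd (isBd_comp_right (add_zero 0) hi hri) (add_zero n) hz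
    rw [map_sub, comp_id, map_sub, LinearMap.sub_apply, hv_comp _ _ _ (add_zero n) (add_zero n),
      hv_comp _ _ _ (add_zero n) (add_zero n), hv_ofElt_hv i u _ _ (add_zero 0), hiu] at h1
    exact h1

end DGModule

/-! ### Weight extensions: attaching cells of positive degree -/

namespace DGModule

open DGCategory

variable {k : Type v} [Field k] {𝒞 : DGCategory.{v, o, h} k} {s : 𝒞.Obj}

/-- A morphism which induces isomorphisms on cohomology in degrees `≤ 0`, and along which
morphisms extend in the absence of cohomology in high degrees. -/
structure IsWeightExtension (s : 𝒞.Obj) {M N : DGModule.{h} 𝒞} (g : M ⟶ N) : Prop where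
  inj : ∀ n ≤ 0, ∀ m : (M.obj s).X n, IsCocycle (M.obj s) m →
    IsBd (N.obj s) (((g.app s).f n).hom m) → IsBd (M.obj s) m
  surj : ∀ n ≤ 0, ∀ z : (N.obj s).X n, IsCocycle (N.obj s) z → ∃ m : (M.obj s).X n,
    IsCocycle (M.obj s) m ∧ IsBd (N.obj s) (((g.app s).f n).hom m - z)
  extend : ∀ {Y : DGModule.{h} 𝒞} {i j : ℤ} (_ : i + 1 = j), (∀ l ≥ j, HZero (Y.obj s) l) →
    ∀ {φ : (homComplex N Y).X j}, IsCocycle (homComplex N Y) φ → ∀ {h : (homComplex M Y).X i},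
      ((homComplex M Y).d i j).hom h = homComp (add_zero j) φ (Hom.toHomComplex g) →
      ∃ h' : (homComplex N Y).X i, ((homComplex N Y).d i j).hom h' = φ ∧
        homComp (add_zero i) h' (Hom.toHomComplex g) = h

theorem IsWeightExtension.comp {L M N : DGModule.{h} 𝒞} {f : L ⟶ M} {g : M ⟶ N}
    (hf : IsWeightExtension s f) (hg : IsWeightExtension s g) : IsWeightExtension s (f ≫ g) where
  inj n hn m hm hb := hf.inj n hn m hm (hg.inj n hn _ (hm.map _) hb)
  surj n hn z hz := by
    obtain ⟨y, hy, hyz⟩ := hg.surj n hn z hz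
    obtain ⟨x, hx, hxy⟩ := hf.surj n hn y hy
    refine ⟨x, hx, ?_⟩
    have := (hxy.map (g.app s)).add hyz
    rw [map_sub, sub_add_sub_cancel] at this
    exact this
  extend {Y i j} hij hY φ hφ h hh := by
    rw [toHomComplex_comp, ← comp_assoc (add_zero j) (add_zero 0) (add_zero j) (add_zero j)] at hh
    obtain ⟨h₁, hd₁, he₁⟩ := hf.extend hij hY (isCocycle_comp _ hφ (isCocycle_toHomComplex g)) hh
    obtain ⟨h₂, hd₂, he₂⟩ := hg.extend hij hY hφ hd₁
    refine ⟨h₂, hd₂, ?_⟩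
    rw [toHomComplex_comp, ← comp_assoc (add_zero i) (add_zero 0) (add_zero i) (add_zero i), he₂,
      he₁]

/-- Attaching cells to kill cohomology classes of positive degree. -/
theorem exists_isWeightExtension_attach (hneg : ∀ n < 0, HZero ((representable 𝒞 s).obj s) n) (M : DGModule.{h} 𝒞)
    {X : Type h} (n : X → ℤ) (hn : ∀ x, 1 ≤ n x) (e : X → ((representable 𝒞 s).obj s).X 0)
    (he : ∀ x, IsCocycle ((representable 𝒞 s).obj s) (e x))
    (hee : ∀ x, IsBd ((representable 𝒞 s).obj s)
      (hv (add_zero 0) (ofElt (Y := representable 𝒞 s) (e x)) (e x) - e x)) (v : ∀ x, (M.obj s).X (n x))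
    (hvc : ∀ x, IsCocycle (M.obj s) (v x))
    (hind : ∀ (t : Finset X) (c : ∀ x, ((representable 𝒞 s).obj s).X (1 - n x)), (∀ x, IsCocycle ((representable 𝒞 s).obj s) (c x)) →
      (∀ x, IsBd ((representable 𝒞 s).obj s) (hv (add_zero (1 - n x)) (ofElt (Y := representable 𝒞 s) (e x)) (c x) - c x)) →
      IsBd (M.obj s) (∑ x ∈ t, M.act (a := s) (b := s)
        (show n x + (1 - n x) = 1 by lia) (v x) (c x)) → ∀ x ∈ t, IsBd ((representable 𝒞 s).obj s) (c x)) :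
    ∃ (N : DGModule.{h} 𝒞) (g : M ⟶ N), IsWeightExtension s g ∧
      ∀ x, IsBd (N.obj s) (((g.app s).f (n x)).hom (M.act (add_zero (n x)) (v x) (e x))) := by
  choose U i hi hU hUY hUinj hUe u hu hiu using fun x => exists_idempotent_module
    (e x) (he x) (hee x) hneg
  let f : ∀ x, (homComplex (U x) M).X (n x + 0) := fun x =>
    homComp rfl (ofElt (v x)) (i x)
  have hf : ∀ x, IsCocycle (homComplex (U x) M) (f x) := fun x =>
    isCocycle_comp _ (isCocycle_ofElt (hvc x)) (hi x)
  -- The attaching morphism. On the summand `x` it is `i x` followed by the orbit map of `v x`, so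
  -- it sends `u x` to `v x · e x`, the class to be killed.
  let F := cpDesc U n f
  have hF : IsCocycle (homComplex (coprod U n) M) F := isCocycle_cpDesc U n hf
  have hfx : ∀ (x : X) {p q : ℤ} (hpq : p + (n x + 0) = q) (c : ((U x).obj s).X p),
      hv hpq (f x) c = M.act (a := s) (b := s) (show n x + p = q by lia)
        (v x) (hv (add_zero p) (i x) c) := fun x p q hpq c =>
    hv_comp _ _ _ (add_zero p) (show p + n x = q by lia) hpq c
  -- `U x` has no cohomology in negative degrees because `i x` embeds it into that of the
  -- representable module. It is shifted up by `n x ≥ 1`.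
  have hlow : ∀ m ≤ 0, HZero ((coprod U n).obj s) m := fun m hm l hl => by
    refine isBd_cp U n fun x => ?_
    have hx : IsCocycle ((U x).obj s) (cpFun U n l x) := (isCocycle_cp_iff U n).1 hl x
    have := hn x
    exact hUinj x _ (by lia) _ hx (hneg _ (by lia) _ (isCocycle_hv (hi x) _ hx))
  -- In degree `1` this is the independence hypothesis `hind`. It keeps the cone from acquiring new
  -- classes in degree `0`.
  have hle : ∀ m ≤ 1, ∀ l : ((coprod U n).obj s).X m,
      IsCocycle ((coprod U n).obj s) l →
      IsBd (M.obj s) (hv (add_zero m) F l) → IsBd ((coprod U n).obj s) l := by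
    intro m hm l hl hb
    rcases hm.lt_or_eq with hm | rfl
    · exact hlow m (by lia) l hl
    · have hx : ∀ x, IsCocycle ((U x).obj s) (cpFun U n l x) := (isCocycle_cp_iff U n).1 hl
      obtain ⟨t, ht⟩ := cp_sum U n l
      have h1 := hind t (fun x => hv (add_zero (1 - n x)) (i x) (cpFun U n l x))
        (fun x => isCocycle_hv (hi x) _ (hx x)) (fun x => hUe x _ _ (hx x)) (by
          rw [ht, map_sum] at hb
          refine (congrArg (IsBd (M.obj s)) (Finset.sum_congr rfl fun x _ => ?_)).mp hb
          rw [hv_cpDesc_single, hfx])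
      rw [ht]
      refine IsBd.sum t fun x hxt => isBd_cpSingle U n ?_
      have := hn x
      exact hUinj x _ (by lia) _ (hx x) (h1 x hxt)
  refine ⟨cone F hF, homOfCocycle (coneInl F hF) (isCocycle_coneInl F hF), ⟨?_, ?_, ?_⟩, ?_⟩
  · intro m hm y hy hb
    rw [homOfCocycle_app, hv_coneInl] at hb
    obtain ⟨l, hl, hly⟩ := (IsBd.of_coneMk (add_zero m) hb).2 rfl
    exact (isBd_iff_of_sub hly).1 (isBd_hv hF _ (hlow m hm l hl))
  · intro m hm z hz
    have hz' := isCocycle_coneMk_iff.1 ((coneMk_eta F hF z).symm ▸ hz)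
    have hb : IsBd ((coprod U n).obj s) (coneSnd F hF z) := by
      refine hle _ (by lia) _ hz'.1 ?_
      have cast : ∀ (q q' : ℤ) (hq : q + 0 = q') (hqq : q = q') (l : ((coprod U n).obj s).X q),
          IsBd (M.obj s) (hv hq F l) → IsBd (M.obj s) (hv (add_zero q) F l) := by
        rintro q _ hq rfl l hl
        exact hl
      exact cast _ (m + 1) _ (by lia) _ ((eq_neg_of_add_eq_zero_right hz'.2).symm ▸ (isBd_d _).neg)
    obtain ⟨y, hy, hyz⟩ := exists_sub_coneMk_zero hz hb
    refine ⟨y, hy, ?_⟩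
    rw [homOfCocycle_app, hv_coneInl]
    have := hyz.neg
    rwa [neg_sub] at this
  · intro Y a j hij hY φ hφ h hh
    rw [toHomComplex_homOfCocycle] at hh ⊢
    -- On the summand `x` the obstruction lives in degree `n x + (j - 1)`, and this is at least `j`
    -- because `n x ≥ 1`.
    refine cone_extend F hF hij hφ hh (hZero_hom_coprod U n fun x => hUY x Y _ (hY _ ?_))
    have := hn x
    lia
  · intro x
    rw [homOfCocycle_app, hv_coneInl]
    refine isBd_coneMk_zero (add_zero (n x)) (l := hv (zero_add (n x)) (cpInj U n x) (u x))
      (isCocycle_hv (isCocycle_cpInj U n x) _ (hu x)) ?_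
    have : hv (add_zero (n x)) F (hv (zero_add (n x)) (cpInj U n x) (u x)) =
        M.act (add_zero (n x)) (v x) (e x) := by
      rw [← hv_comp (add_comm 0 (n x)) F (cpInj U n x) (zero_add (n x)) (add_zero (n x)) (by lia),
        cpDesc_inj, hfx, hiu]
    rw [this, sub_self]
    exact isBd_zero

end DGModule

/-! ### Truncation models and their construction as colimits -/

namespace DGModule

open DGCategory

variable {k : Type v} [Field k]

section

variable {𝒜 : DGCategory.{v, o, h} k} {L M N : DGModule.{w} 𝒜}

theorem IsQI.of_comp {m n l : ℤ} (hl : m + n = l) {f : (homComplex M N).X m}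
    {g : (homComplex L M).X n} {e : (homComplex L N).X l} (hfc : IsCocycle (homComplex M N) f)
    (hgc : IsCocycle (homComplex L M) g) (hf : IsQI f) (he : IsQI e)
    (hb : IsBd (homComplex L N) (homComp hl f g - e)) : IsQI g := by
  intro a p q hpq
  have key : ∀ z : (L.obj a).X p, IsCocycle (L.obj a) z → IsBd (N.obj a)
      (hv (show q + m = p + l by lia) f (hv hpq g z) - hv rfl e z) := fun z hz => by
    have := isBd_hv_of_isBd hb (show p + l = p + l from rfl) hz
    rwa [map_sub, LinearMap.sub_apply, hv_comp _ _ _ hpq (show q + m = p + l by lia)] at this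
  refine ⟨fun z hz hbz => (he a p _ rfl).1 z hz ((isBd_iff_of_sub (key z hz)).1
    (isBd_hv hfc _ hbz)), fun y hy => ?_⟩
  obtain ⟨z, hz, hzy⟩ := (he a p _ rfl).2 _ (isCocycle_hv hfc (show q + m = p + l by lia) hy)
  refine ⟨z, hz, (hf a q (p + l) (by lia)).1 _ ((isCocycle_hv hgc hpq hz).sub hy) ?_⟩
  have := (key z hz).add hzy
  rwa [sub_add_sub_cancel, ← map_sub] at this

end

variable {𝒞 : DGCategory.{v, o, h} k} {s : 𝒞.Obj}

theorem IsWeightExtension.id (M : DGModule.{h} 𝒞) : IsWeightExtension s (𝟙 M) where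
  inj _ _ _ _ hb := hb
  surj n _ z hz := ⟨z, hz, by
    change IsBd _ (z - z)
    rw [sub_self]
    exact isBd_zero⟩
  extend {Y i j} _ _ φ _ h hh :=
    ⟨h, hh.trans (DGModule.comp_id φ), DGModule.comp_id h⟩

/-- A model of the weight truncation `σ_{≤0}` of the representable module at `s`. -/
structure IsTruncationModel (s : 𝒞.Obj) (P : DGModule.{h} 𝒞) (one : (P.obj s).X 0) : Prop where
  isHProjective : P.IsHProjective
  isCocycle : IsCocycle (P.obj s) one
  inj : ∀ n ≤ 0, ∀ c : ((representable 𝒞 s).obj s).X n, IsCocycle ((representable 𝒞 s).obj s) c →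
    IsBd (P.obj s) (hv (add_zero n) (ofElt one) c) → IsBd ((representable 𝒞 s).obj s) c
  surj : ∀ n ≤ 0, ∀ y : (P.obj s).X n, IsCocycle (P.obj s) y →
    ∃ c : ((representable 𝒞 s).obj s).X n, IsCocycle ((representable 𝒞 s).obj s) c ∧
      IsBd (P.obj s) (hv (add_zero n) (ofElt one) c - y)
  hZero : ∀ n > 0, HZero (P.obj s) n
  realize : ∀ (Y : DGModule.{h} 𝒞) (b : ℤ), (∀ l > b, HZero (Y.obj s) l) →
    ∀ y : (Y.obj s).X b, IsCocycle (Y.obj s) y → ∃ g : (homComplex P Y).X b,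
      IsCocycle (homComplex P Y) g ∧ IsBd (Y.obj s) (hv (zero_add b) g one - y)
  vanish : ∀ (Y : DGModule.{h} 𝒞) (j : ℤ), (∀ l ≥ j, HZero (Y.obj s) l) →
    HZero (homComplex P Y) j

/-- The property of being a truncation model is invariant under homotopy equivalence. -/
theorem IsTruncationModel.of_isQI {P Q : DGModule.{h} 𝒞} {one : (P.obj s).X 0}
    (hP : IsTruncationModel s P one) (hQ : Q.IsHProjective) {f : (homComplex P Q).X 0}
    (hf : IsCocycle (homComplex P Q) f) (hq : IsQI f) :
    IsTruncationModel s Q (hv (add_zero 0) f one) := by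
  obtain ⟨g, hg, hfg, hgf⟩ := hP.isHProjective.exists_homotopyInverse hQ hf hq
  have hact : ∀ (n : ℤ) (c : ((representable 𝒞 s).obj s).X n),
      hv (add_zero n) (ofElt (hv (add_zero 0) f one)) c =
        hv (add_zero n) f (hv (add_zero n) (ofElt one) c) := fun n c =>
    (hv_ofElt_hv f one _ _ _ c).symm
  refine ⟨hQ, isCocycle_hv hf _ hP.isCocycle, fun n hn c hc hb => ?_, fun n hn y hy => ?_,
    fun n hn y hy => ?_, fun Y b hY y hy => ?_, fun Y j hY φ hφ => ?_⟩
  · rw [hact] at hb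
    exact hP.inj n hn c hc ((hq s n n (add_zero n)).1 _
      (isCocycle_hv (isCocycle_ofElt hP.isCocycle) _ hc) hb)
  · obtain ⟨z, hz, hzy⟩ := (hq s n n (add_zero n)).2 y hy
    obtain ⟨c, hc, hcz⟩ := hP.surj n hn z hz
    refine ⟨c, hc, ?_⟩
    rw [hact]
    have := (isBd_hv hf (add_zero n) hcz).add hzy
    rwa [map_sub, sub_add_sub_cancel] at this
  · obtain ⟨z, hz, hzy⟩ := (hq s n n (add_zero n)).2 y hy
    exact (isBd_iff_of_sub hzy).1 (isBd_hv hf _ (hP.hZero n hn z hz))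
  · obtain ⟨e, he, hey⟩ := hP.realize Y b hY y hy
    refine ⟨homComp (add_zero b) e g, isCocycle_comp _ he hg, ?_⟩
    have h1 := isBd_hv_of_isBd (isBd_comp_right (add_zero b) he hgf) (zero_add b) hP.isCocycle
    rw [map_sub, comp_id, map_sub, LinearMap.sub_apply] at h1
    have := h1.add hey
    rw [sub_add_sub_cancel] at this
    rw [hv_comp _ _ _ (add_zero 0) (zero_add b)]
    rwa [hv_comp _ _ _ (add_zero 0) (zero_add b), hv_comp _ _ _ (add_zero 0) (add_zero 0)] at this
  · have h1 := isBd_comp_left (add_zero j)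
      (hP.vanish Y j hY _ (isCocycle_comp (add_zero j) hφ hf)) hg
    have h2 := isBd_comp_right (add_zero j) hφ hfg
    rw [map_sub, comp_id, ← comp_assoc (add_zero j) (add_zero 0) (add_zero j) (add_zero j)] at h2
    exact (isBd_iff_of_sub h2).1 h1

/-- The colimit of a sequence of weight extensions killing all cohomology in positive degrees is a
truncation model. -/
theorem isTruncationModel_seqColimit (F : ℕ ⥤ DGModule.{h} 𝒞) (e : F.obj 0 = representable 𝒞 s)
    (hF : ∀ l, IsWeightExtension s (F.map (homOfLE (Nat.le_succ l))))
    (hkill : ∀ l, ∀ n > 0, ∀ z : ((F.obj l).obj s).X n, IsCocycle ((F.obj l).obj s) z →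
      IsBd ((F.obj (l + 1)).obj s) ((((F.map (homOfLE (Nat.le_succ l))).app s).f n).hom z)) :
    ∃ f : representable 𝒞 s ⟶ seqColimit F,
      IsTruncationModel s (seqColimit F) (((f.app s).f 0).hom (repId 𝒞 s)) := by
  have hF0 : ∀ l, IsWeightExtension s (F.map (homOfLE (Nat.zero_le l))) := fun l => by
    induction l with
    | zero =>
      rw [show homOfLE (Nat.zero_le 0) = 𝟙 (0 : ℕ) from Subsingleton.elim _ _, F.map_id]
      exact IsWeightExtension.id _
    | succ l ih =>
      rw [show homOfLE (Nat.zero_le (l + 1)) = homOfLE (Nat.zero_le l) ≫ homOfLE (Nat.le_succ l)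
        from Subsingleton.elim _ _, F.map_comp]
      exact ih.comp (hF l)
  have hinj : ∀ n ≤ 0, ∀ c : ((F.obj 0).obj s).X n, IsCocycle ((F.obj 0).obj s) c →
      IsBd ((seqColimit F).obj s) ((((seqι F 0).app s).f n).hom c) → IsBd ((F.obj 0).obj s) c := by
    intro n hn c hc hb
    obtain ⟨m, hm, hb⟩ := exists_isBd_seqMap hb
    exact (hF0 m).inj n hn c hc hb
  have hsurj : ∀ n ≤ 0, ∀ y : ((seqColimit F).obj s).X n, IsCocycle ((seqColimit F).obj s) y →
      ∃ c : ((F.obj 0).obj s).X n, IsCocycle ((F.obj 0).obj s) c ∧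
        IsBd ((seqColimit F).obj s) ((((seqι F 0).app s).f n).hom c - y) := by
    intro n hn y hy
    obtain ⟨l, x, hx, rfl⟩ := exists_seqι_cocycle hy
    obtain ⟨c, hc, hb⟩ := (hF0 l).surj n hn x hx
    refine ⟨c, hc, ?_⟩
    have := hb.map ((seqι F l).app s)
    rw [map_sub] at this
    exact (congrArg (fun t => IsBd ((seqColimit F).obj s) (t - (((seqι F l).app s).f n).hom x))
      (seqι_seqMap (F := F) (Nat.zero_le l) c)).mp this
  have hzero : ∀ n > 0, HZero ((seqColimit F).obj s) n := by
    intro n hn y hy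
    obtain ⟨l, x, hx, rfl⟩ := exists_seqι_cocycle hy
    rw [← seqι_seqMap (Nat.le_succ l) x]
    exact (hkill l n hn x hx).map _
  have hext : ∀ {Y : DGModule.{h} 𝒞} {i j : ℤ} (_ : i + 1 = j), (∀ l ≥ j, HZero (Y.obj s) l) →
      ∀ {φ : (homComplex (seqColimit F) Y).X j}, IsCocycle (homComplex (seqColimit F) Y) φ →
      ∀ g₀ : (homComplex (F.obj 0) Y).X i, ((homComplex (F.obj 0) Y).d i j).hom g₀ =
        homComp (add_zero j) φ (Hom.toHomComplex (seqι F 0)) →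
      ∃ g : (homComplex (seqColimit F) Y).X i, ((homComplex (seqColimit F) Y).d i j).hom g = φ ∧
        homComp (add_zero i) g (Hom.toHomComplex (seqι F 0)) = g₀ :=
    fun hij hY φ hφ g₀ h₀ => seq_extend hij hφ g₀ h₀ fun l ψ g hψ hg => (hF l).extend hij hY hψ hg
  -- All that matters about the sequence is now contained in `hinj`, `hsurj`, `hzero` and `hext`, so
  -- its first term can be identified with the representable module.
  clear hF0 hF hkill
  generalize seqι F 0 = ι at *
  generalize F.obj 0 = M at *
  subst e
  have hac : ∀ {n : ℤ} (c : ((representable 𝒞 s).obj s).X n),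
      hv (add_zero n) (ofElt (((ι.app s).f 0).hom (repId 𝒞 s))) c = ((ι.app s).f n).hom c := by
    intro n c
    rw [← hv_toHomComplex, ← hv_toHomComplex, ← hv_ofElt_hv _ _ (add_zero n) (add_zero n) (add_zero 0)]
    congr 1
    exact repId_act c
  -- Morphisms out of the representable module are elements. Thus `hext` says that a closed `φ` has
  -- a primitive with any value `y` at the unit such that `dy = φ(1)`. H-projectivity is the case of
  -- acyclic `Y`, `realize` the case `φ = 0`, and `vanish` the case where `y` comes from the
  -- vanishing of the cohomology of `Y` in degree `j`.
  have star : ∀ {Y : DGModule.{h} 𝒞} {i j : ℤ} (_ : i + 1 = j), (∀ l ≥ j, HZero (Y.obj s) l) →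
      ∀ {φ : (homComplex (seqColimit F) Y).X j}, IsCocycle (homComplex (seqColimit F) Y) φ →
      ∀ y : (Y.obj s).X i, ((Y.obj s).d i j).hom y =
        hv (zero_add j) φ (((ι.app s).f 0).hom (repId 𝒞 s)) →
      ∃ g : (homComplex (seqColimit F) Y).X i, ((homComplex (seqColimit F) Y).d i j).hom g = φ ∧
        hv (zero_add i) g (((ι.app s).f 0).hom (repId 𝒞 s)) = y := by
    intro Y i j hij hY φ hφ y hy
    obtain ⟨g, hg, hg'⟩ := hext hij hY hφ (ofElt y) (by
      rw [ofElt_d, hy, ← ofElt_hv_id (homComp _ _ _), hv_comp _ _ _ (add_zero 0) (zero_add j),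
        hv_toHomComplex])
    refine ⟨g, hg, ?_⟩
    rw [← hv_ofElt_id y, ← hg', hv_comp _ _ _ (add_zero 0) (zero_add i), hv_toHomComplex]
  have hone : IsCocycle ((seqColimit F).obj s) (((ι.app s).f 0).hom (repId 𝒞 s)) :=
    isCocycle_repId.map (ι.app s)
  refine ⟨ι, ⟨fun Y hY => acyclic_iff_hZero.2 fun j φ hφ => ?_, hone, fun n hn c hc hb => ?_,
    fun n hn y hy => ?_, hzero, fun Y b hY y hy => ?_, fun Y j hY φ hφ => ?_⟩⟩
  · obtain ⟨y, hy⟩ := (isAcyclic_iff.1 hY s j _ (isCocycle_hv hφ (zero_add j) hone)).out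
      (sub_add_cancel j 1)
    obtain ⟨g, hg, -⟩ := star (sub_add_cancel j 1) (fun l _ => isAcyclic_iff.1 hY s l) hφ y hy
    exact ⟨_, g, hg⟩
  · rw [hac] at hb
    exact hinj n hn c hc hb
  · simp only [hac]
    exact hsurj n hn y hy
  · obtain ⟨g, hg, hgy⟩ := star (φ := 0) rfl (fun l hl => hY l (by lia)) isCocycle_zero y (by
      rw [hy, map_zero, LinearMap.zero_apply])
    refine ⟨g, isCocycle_of rfl hg, ?_⟩
    rw [hgy, sub_self]
    exact isBd_zero
  · obtain ⟨y, hy⟩ := (hY j le_rfl _ (isCocycle_hv hφ (zero_add j) hone)).out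
      (sub_add_cancel j 1)
    obtain ⟨g, hg, -⟩ := star (sub_add_cancel j 1) hY hφ y hy
    exact ⟨_, g, hg⟩

end DGModule

/-! ### Existence and uniqueness of the weight truncation -/

namespace DGAlgebra

open DGModule DGCategory

variable {k : Type u} [Field k] (A : DGAlgebra.{u} k)

variable {A}

/-- Semisimplicity enters here. `H¹(M)` is a direct sum of cyclic modules `e H⁰(A)`, and attaching
the corresponding summands of `A` gives an attaching map that is injective on `H¹`. Killing the
generators kills all of `H¹(M)`. -/
theorem exists_isWeightExtension_one [IsSemisimpleRing A.H0]
    (hneg : ∀ n < 0, HZero ((representable A.toDGCategory A.pt).obj A.pt) n) (M : A.RightModule) :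
    ∃ (N : A.RightModule) (g : M ⟶ N), IsWeightExtension A.pt g ∧
      ∀ z : (M.obj A.pt).X 1, IsCocycle (M.obj A.pt) z →
        IsBd (N.obj A.pt) (((g.app A.pt).f 1).hom z) := by
  obtain ⟨X, e, v, hee, hv, hev, hspan, hind⟩ := A.exists_cyclic_decomposition M 1
  have key : ∀ (q : ℤ) (hq : 1 + q = 1) (t : Finset X)
      (c : X → ((representable A.toDGCategory A.pt).obj A.pt).X q),
      (∀ x, IsCocycle ((representable A.toDGCategory A.pt).obj A.pt) (c x)) →
      (∀ x, IsBd ((representable A.toDGCategory A.pt).obj A.pt) (DGModule.hv (add_zero q)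
        (ofElt (Y := representable A.toDGCategory A.pt) (e x).1) (c x) - c x)) →
      IsBd (M.obj A.pt) (∑ x ∈ t, M.act (a := A.pt) (b := A.pt) hq (v x) (c x)) →
      ∀ x ∈ t, IsBd ((representable A.toDGCategory A.pt).obj A.pt) (c x) := by
    intro q hq t c hc hec hb x hx
    obtain rfl : q = 0 := by lia
    have h1 := hind t (fun x => ⟨c x, LinearMap.mem_ker.2 (hc x 1)⟩) hb x hx
    exact (isBd_iff_of_sub (hec x)).1 ((A.mem_B0_iff _).1 h1)
  obtain ⟨N, g, hg, hkill⟩ := exists_isWeightExtension_attach (s := A.pt) hneg M (fun _ : X => 1)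
    (fun _ => le_rfl) (fun x => (e x).1) (fun x => (e x).isCocycle)
    (fun x => (A.mem_B0_iff _).1 (hee x)) v hv (fun t c => key _ (by lia) t c)
  refine ⟨N, g, hg, fun z hz => ?_⟩
  obtain ⟨t, r, hb⟩ := hspan z hz
  have hgv : ∀ x, IsBd (N.obj A.pt) (((g.app A.pt).f 1).hom (v x)) := fun x => by
    have := IsBd.map (g.app A.pt) (hev x)
    rw [map_sub] at this
    exact (isBd_iff_of_sub this).1 (hkill x)
  have h2 := IsBd.map (g.app A.pt) hb
  rw [map_sub, map_sum] at h2
  refine (isBd_iff_of_sub h2).2 (IsBd.sum t fun x _ => ?_)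
  refine (congrArg (IsBd (N.obj A.pt)) (g.app_act (a := A.pt) (b := A.pt) (add_zero 1) (v x)
    (r x).1)).mpr ?_
  exact N.isBd_act_left (a := A.pt) (add_zero 1) (hgv x) (r x).isCocycle

/-- Free cells suffice. Independence is only demanded of combinations landing in degree `1`, whose
coefficients have degree `1 - n < 0` and are coboundaries since `A` is coconnective. -/
theorem exists_isWeightExtension_two
    (hneg : ∀ n < 0, HZero ((representable A.toDGCategory A.pt).obj A.pt) n) (M : A.RightModule) :
    ∃ (N : A.RightModule) (g : M ⟶ N), IsWeightExtension A.pt g ∧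
      ∀ n ≥ 2, ∀ z : (M.obj A.pt).X n, IsCocycle (M.obj A.pt) z →
        IsBd (N.obj A.pt) (((g.app A.pt).f n).hom z) := by
  let X := Σ n : {n : ℤ // 2 ≤ n}, {z : (M.obj A.pt).X n // IsCocycle (M.obj A.pt) z}
  obtain ⟨N, g, hg, hkill⟩ := exists_isWeightExtension_attach (s := A.pt) hneg M
    (fun x : X => x.1.1) (fun x => by have := x.1.2; lia) (fun x => repId _ _)
    (fun x => isCocycle_repId) (fun x => by
      rw [hv_ofElt_id, sub_self]
      exact isBd_zero) (fun x => x.2.1) (fun x => x.2.2) (fun t c hc _ _ x _ =>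
      hneg _ (by have := x.1.2; lia) _ (hc x))
  refine ⟨N, g, hg, fun n hn z hz => ?_⟩
  exact (congrArg (fun t => IsBd (N.obj A.pt) (((g.app A.pt).f n).hom t))
    (orbit_repId (s := A.pt) z)).mp (hkill ⟨⟨n, hn⟩, ⟨z, hz⟩⟩)

theorem exists_isWeightExtension [IsSemisimpleRing A.H0]
    (hneg : ∀ n < 0, HZero ((representable A.toDGCategory A.pt).obj A.pt) n) (M : A.RightModule) :
    ∃ (N : A.RightModule) (g : M ⟶ N), IsWeightExtension A.pt g ∧
      ∀ n > 0, ∀ z : (M.obj A.pt).X n, IsCocycle (M.obj A.pt) z →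
        IsBd (N.obj A.pt) (((g.app A.pt).f n).hom z) := by
  obtain ⟨N, g, hg, hgz⟩ := exists_isWeightExtension_one hneg M
  obtain ⟨N', g', hg', hgz'⟩ := exists_isWeightExtension_two hneg N
  refine ⟨N', g ≫ g', hg.comp hg', fun n hn z hz => ?_⟩
  rcases (show n = 1 ∨ 2 ≤ n by lia) with rfl | hn
  · exact IsBd.map (g'.app A.pt) (hgz z hz)
  · exact hgz' n hn _ (IsCocycle.map (g.app A.pt) hz)

/-- Attaching cells kills the classes that are present but may create new ones in positive degrees.
Countably many repetitions exhaust them, because every cocycle of the colimit already lives at some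
stage. -/
theorem exists_isTruncationModel [IsSemisimpleRing A.H0]
    (hneg : ∀ n < 0, HZero ((representable A.toDGCategory A.pt).obj A.pt) n) :
    ∃ (S : A.RightModule) (f : representable A.toDGCategory A.pt ⟶ S),
      IsTruncationModel A.pt S (((f.app A.pt).f 0).hom (repId _ _)) := by
  choose K κ hκ hκ0 using exists_isWeightExtension (A := A) hneg
  let X : ℕ → A.RightModule := fun l => Nat.rec (representable A.toDGCategory A.pt) (fun _ M => K M) l
  let F : ℕ ⥤ A.RightModule := Functor.ofSequence (X := X) fun l => κ (X l)
  have hF : ∀ l, F.map (homOfLE (Nat.le_succ l)) = κ (X l) := fun l =>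
    Functor.ofSequence_map_homOfLE_succ _ l
  obtain ⟨f, hf⟩ := isTruncationModel_seqColimit (s := A.pt) F rfl
    (fun l => by rw [hF]; exact hκ (X l)) (fun l => by rw [hF]; exact hκ0 (X l))
  exact ⟨_, f, hf⟩

/-- A morphism from a truncation model realizing a weight truncation is a quasi-isomorphism. -/
theorem _root_.DGModule.IsTruncationModel.isQI {P S : A.RightModule} {one : (P.obj A.pt).X 0}
    (hP : IsTruncationModel A.pt P one) (f : representable A.toDGCategory A.pt ⟶ S)
    (hf : ∀ n ≤ 0, InjH ((representable A.toDGCategory A.pt).obj A.pt) (S.obj A.pt) n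
      ((f.app A.pt).f n).hom ∧ SurjH ((representable A.toDGCategory A.pt).obj A.pt) (S.obj A.pt) n
      ((f.app A.pt).f n).hom) (hS : ∀ n > 0, HZero (S.obj A.pt) n)
    {g : (homComplex P S).X 0} (hg : IsCocycle (homComplex P S) g)
    (hb : IsBd (S.obj A.pt) (DGModule.hv (add_zero 0) g one - ((f.app A.pt).f 0).hom (repId _ _))) :
    IsQI g := by
  have key : ∀ {n : ℤ} (c : ((representable A.toDGCategory A.pt).obj A.pt).X n),
      IsCocycle ((representable A.toDGCategory A.pt).obj A.pt) c → IsBd (S.obj A.pt)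
        (DGModule.hv (add_zero n) g (DGModule.hv (add_zero n) (ofElt one) c) -
          ((f.app A.pt).f n).hom c) := by
    intro n c hc
    have h1 : ((f.app A.pt).f n).hom c =
        DGModule.hv (add_zero n) (ofElt (((f.app A.pt).f 0).hom (repId _ _))) c := by
      rw [← hv_toHomComplex, ← hv_toHomComplex, ← hv_ofElt_hv _ _ (add_zero n) (add_zero n)
        (add_zero 0)]
      congr 1
      exact (repId_act c).symm
    rw [h1, hv_ofElt_hv g one _ _ (add_zero 0), ← LinearMap.sub_apply, ← map_sub, ← map_sub]
    exact isBd_hv_of_isBd (isBd_ofElt hb) _ hc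
  have main : ∀ n : ℤ, InjH (P.obj A.pt) (S.obj A.pt) n (DGModule.hv (add_zero n) g) ∧
      SurjH (P.obj A.pt) (S.obj A.pt) n (DGModule.hv (add_zero n) g) := by
    intro n
    by_cases hn : n ≤ 0
    · constructor
      · intro y hy hby
        obtain ⟨c, hc, hcy⟩ := hP.surj n hn y hy
        have h1 := isBd_hv hg (add_zero n) hcy
        rw [map_sub] at h1
        have h2 := (isBd_iff_of_sub h1).2 hby
        have h3 := (isBd_iff_of_sub (key c hc)).1 h2
        exact (isBd_iff_of_sub hcy).1
          (isBd_hv (isCocycle_ofElt hP.isCocycle) (add_zero n) ((hf n hn).1 c hc h3))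
      · intro y hy
        obtain ⟨c, hc, hcy⟩ := (hf n hn).2 y hy
        refine ⟨_, isCocycle_hv (isCocycle_ofElt hP.isCocycle) (add_zero n) hc, ?_⟩
        have := (key c hc).add hcy
        rwa [sub_add_sub_cancel] at this
    · constructor
      · exact fun y hy _ => hP.hZero n (by lia) y hy
      · exact fun y hy => ⟨0, isCocycle_zero, by
          rw [map_zero, zero_sub]
          exact (hS n (by lia) y hy).neg⟩
  rintro ⟨⟩ p q hpq
  obtain rfl : p = q := by lia
  exact main p

/-- The truncation map is determined by the class of the image of `1` in `H⁰(S)`. A model built from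
`A` realises this class by a map to `S`, which is a quasi-isomorphism since both sides agree with
`A` in degrees `≤ 0` and vanish above. It lifts along the resolution, and the property of being a
model is transported. -/
theorem IsWeightTruncation.isTruncationModel [IsSemisimpleRing A.H0]
    (hneg : ∀ n < 0, HZero ((representable A.toDGCategory A.pt).obj A.pt) n) {S : A.RightModule}
    (hS : A.IsWeightTruncation S) {P : A.RightModule} {p : P ⟶ S} (hp : IsResolution p) :
    ∃ one, IsTruncationModel A.pt P one := by
  obtain ⟨S', f', hS'⟩ := exists_isTruncationModel (A := A) hneg
  obtain ⟨f, hf, hS0⟩ := hS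
  have hf' : ∀ n ≤ 0, InjH ((representable A.toDGCategory A.pt).obj A.pt) (S.obj A.pt) n
      ((f.app A.pt).f n).hom ∧ SurjH ((representable A.toDGCategory A.pt).obj A.pt) (S.obj A.pt) n
      ((f.app A.pt).f n).hom := fun n hn => (isIso_homologyMap_iff (f.app A.pt) n).1 (hf n hn)
  have hS0' : ∀ n > 0, HZero (S.obj A.pt) n := fun n hn => (isZero_homology_iff n).1 (hS0 n hn)
  obtain ⟨g, hg, hb⟩ := hS'.realize S 0 hS0' (((f.app A.pt).f 0).hom (repId _ _))
    (isCocycle_repId.map (f.app A.pt))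
  have hq := hS'.isQI f hf' hS0' hg hb
  obtain ⟨g', hg', hb'⟩ := hS'.isHProjective.exists_lift (isCocycle_toHomComplex p)
    (isQI_toHomComplex_iff.2 hp.2) hg
  have hq' : IsQI g' := IsQI.of_comp (zero_add 0) (isCocycle_toHomComplex p) hg'
    (isQI_toHomComplex_iff.2 hp.2) hq hb'
  exact ⟨_, hS'.of_isQI hp.1 hg' hq'⟩

theorem exists_isWeightTruncation [IsSemisimpleRing A.H0]
    (hneg : ∀ n < 0, HZero ((representable A.toDGCategory A.pt).obj A.pt) n) :
    ∃ S : A.RightModule, A.IsWeightTruncation S := by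
  obtain ⟨S, f, hS⟩ := exists_isTruncationModel (A := A) hneg
  have hac : ∀ {n : ℤ} (c : ((representable A.toDGCategory A.pt).obj A.pt).X n),
      DGModule.hv (add_zero n) (ofElt (((f.app A.pt).f 0).hom (repId _ _))) c =
        ((f.app A.pt).f n).hom c := by
    intro n c
    rw [← hv_toHomComplex, ← hv_toHomComplex, ← hv_ofElt_hv _ _ (add_zero n) (add_zero n)
      (add_zero 0)]
    congr 1
    exact repId_act c
  refine ⟨S, f, fun n hn => (isIso_homologyMap_iff (f.app A.pt) n).2 ⟨fun c hc hb => ?_,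
    fun y hy => ?_⟩, fun n hn => (isZero_homology_iff n).2 (hS.hZero n hn)⟩
  · refine hS.inj n hn c hc ?_
    rw [hac]
    exact hb
  · have := hS.surj n hn y hy
    simp only [hac] at this
    exact this

end DGAlgebra

/-! ### Maps between cohomology spaces -/

section

variable {k : Type v} [Field k] {K : CochainComplex (ModuleCat.{w} k) ℤ}
  {L : CochainComplex (ModuleCat.{w'} k) ℤ} {M : CochainComplex (ModuleCat.{x} k) ℤ} {p q r : ℤ}

/-- The map on cohomology given by a linear map which preserves cocycles and coboundaries. -/
def hnMap (φ : K.X p →ₗ[k] L.X q) (hc : ∀ x, IsCocycle K x → IsCocycle L (φ x))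
    (hb : ∀ x, IsBd K x → IsBd L (φ x)) : Hn K p →ₗ[k] Hn L q :=
  Submodule.mapQ _ _ (φ.restrict (p := cocycles K p) (q := cocycles L q)
    fun x hx => hc x (isCocycle_of rfl hx) _)
    fun x hx => (hb x.1 ⟨_, hx⟩).out (sub_add_cancel q 1)

theorem hnMap_cls (φ : K.X p →ₗ[k] L.X q) (hc : ∀ x, IsCocycle K x → IsCocycle L (φ x))
    (hb : ∀ x, IsBd K x → IsBd L (φ x)) {x : K.X p} (hx : IsCocycle K x) :
    hnMap φ hc hb (clsOf K x hx) = clsOf L (φ x) (hc x hx) := rfl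

/-- Exactness on cohomology, on elements. -/
theorem hnMap_range_eq_ker {φ : K.X p →ₗ[k] L.X q} {hc : ∀ x, IsCocycle K x → IsCocycle L (φ x)}
    {hb : ∀ x, IsBd K x → IsBd L (φ x)} {ψ : L.X q →ₗ[k] M.X r}
    {hc' : ∀ x, IsCocycle L x → IsCocycle M (ψ x)} {hb' : ∀ x, IsBd L x → IsBd M (ψ x)}
    (h0 : ∀ x, IsCocycle K x → IsBd M (ψ (φ x)))
    (hex : ∀ y, IsCocycle L y → IsBd M (ψ y) → ∃ x, IsCocycle K x ∧ IsBd L (φ x - y)) :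
    LinearMap.range (hnMap φ hc hb) = LinearMap.ker (hnMap ψ hc' hb') := by
  ext y
  obtain ⟨y, hy, rfl⟩ := exists_cls y
  rw [LinearMap.mem_ker, hnMap_cls, cls_eq_zero_iff]
  constructor
  · rintro ⟨x, hx⟩
    obtain ⟨x, hx', rfl⟩ := exists_cls x
    rw [hnMap_cls, cls_eq_iff] at hx
    have := hb' _ hx
    rw [map_sub] at this
    exact (isBd_iff_of_sub this).1 (h0 x hx')
  · intro h
    obtain ⟨x, hx, hxy⟩ := hex y hy h
    exact ⟨clsOf K x hx, (cls_eq_iff (hx := hc x hx) (hy := hy)).2 hxy⟩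

theorem finite_hn_of_exact (φ : K.X p →ₗ[k] L.X q) (hc : ∀ x, IsCocycle K x → IsCocycle L (φ x))
    (hb : ∀ x, IsBd K x → IsBd L (φ x)) (ψ : L.X q →ₗ[k] M.X r)
    (hc' : ∀ x, IsCocycle L x → IsCocycle M (ψ x)) (hb' : ∀ x, IsBd L x → IsBd M (ψ x))
    (h0 : ∀ x, IsCocycle K x → IsBd M (ψ (φ x)))
    (hex : ∀ y, IsCocycle L y → IsBd M (ψ y) → ∃ x, IsCocycle K x ∧ IsBd L (φ x - y))
    [Module.Finite k (Hn K p)] [Module.Finite k (Hn M r)] : Module.Finite k (Hn L q) := by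
  have e := hnMap_range_eq_ker (hc := hc) (hb := hb) (hc' := hc') (hb' := hb') h0 hex
  have : Module.Finite k (LinearMap.ker (hnMap ψ hc' hb')) := e ▸ inferInstance
  have : Module.Finite k (Hn L q ⧸ LinearMap.ker (hnMap ψ hc' hb')) :=
    Module.Finite.equiv (hnMap ψ hc' hb').quotKerEquivRange.symm
  exact Module.Finite.of_submodule_quotient (LinearMap.ker (hnMap ψ hc' hb'))

end

namespace DGModule

variable {k : Type v} [Field k] {𝒜 : DGCategory.{v, o, h} k}

theorem isPerfectlyValued_iff {M : DGModule.{w} 𝒜} : M.IsPerfectlyValued ↔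
    ∀ a, (∀ n, Module.Finite k (Hn (M.obj a) n)) ∧
      ∃ i j : ℤ, ∀ n, (n < i ∨ j < n) → HZero (M.obj a) n :=
  forall_congr' fun _ => hasFiniteTotalCohomology_iff

theorem IsPerfectlyValued.cone {L M : DGModule.{w} 𝒜} (hL : L.IsPerfectlyValued)
    (hM : M.IsPerfectlyValued) {n : ℤ} (f : (homComplex L M).X n)
    (hf : IsCocycle (homComplex L M) f) : (cone f hf).IsPerfectlyValued := by
  refine isPerfectlyValued_iff.2 fun a => ?_
  obtain ⟨hL, i, j, hij⟩ := isPerfectlyValued_iff.1 hL a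
  obtain ⟨hM, i', j', hij'⟩ := isPerfectlyValued_iff.1 hM a
  have hex : ∀ {p : ℤ} (z : ((DGModule.cone f hf).obj a).X p),
      IsCocycle ((DGModule.cone f hf).obj a) z → IsBd (L.obj a) (coneSnd f hf z) →
      ∃ y : (M.obj a).X p, IsCocycle (M.obj a) y ∧
        IsBd ((DGModule.cone f hf).obj a) (hv (add_zero p) (coneInl f hf) y - z) := by
    intro p z hz hb
    obtain ⟨y, hy, hyz⟩ := exists_sub_coneMk_zero hz hb
    refine ⟨y, hy, ?_⟩
    rw [hv_coneInl, ← neg_sub]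
    exact hyz.neg
  refine ⟨fun p => ?_, min i' (i + n - 1), max j' (j + n - 1), fun p hp z hz => ?_⟩
  · refine finite_hn_of_exact (hv (add_zero p) (coneInl f hf))
      (fun x hx => isCocycle_hv (isCocycle_coneInl f hf) _ hx)
      (fun x hx => isBd_hv (isCocycle_coneInl f hf) _ hx)
      (hv (show p + (1 - n) = p + 1 - n by lia) (coneBd f hf))
      (fun x hx => isCocycle_hv (isCocycle_coneBd f hf) _ hx)
      (fun x hx => isBd_hv (isCocycle_coneBd f hf) _ hx) (fun x hx => ?_) fun z hz hb => ?_
    · rw [hv_coneInl, hv_coneBd, coneSnd_mk]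
      exact isBd_zero
    · rw [hv_coneBd] at hb
      exact hex z hz hb
  · obtain ⟨y, hy, hyz⟩ := hex z hz (hij _ (by lia) _
      (isCocycle_coneMk_iff.1 ((coneMk_eta f hf z).symm ▸ hz)).1)
    exact (isBd_iff_of_sub hyz).1 (isBd_hv (isCocycle_coneInl f hf) _ (hij' p (by lia) y hy))

theorem isCocycle_cpSingle {X : Type w} (L : X → DGModule.{w} 𝒜) (n : X → ℤ) {a : 𝒜.Obj} {i : ℤ} (x : X)
    {c : ((L x).obj a).X (i - n x)} (hc : IsCocycle ((L x).obj a) c) :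
    IsCocycle ((coprod L n).obj a) (cpSingle L n x c) :=
  isCocycle_of rfl (by rw [cpSingle_d L n rfl, hc, smul_zero, map_zero])

theorem cp_sum_fintype {X : Type w} [Fintype X] (L : X → DGModule.{w} 𝒜) (n : X → ℤ) {a : 𝒜.Obj}
    {i : ℤ} (z : ((coprod L n).obj a).X i) : z = ∑ x, cpSingle L n x (cpFun L n z x) := by
  classical
  refine cp_ext L n fun y => ?_
  rw [map_sum]
  refine Eq.symm ((DFinsupp.finsetSum_apply _ _ _).trans ?_)
  rw [Finset.sum_eq_single y]
  · exact cpFun_cpSingle_same L n y _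
  · exact fun x _ hxy => cpFun_cpSingle_ne L n hxy.symm _
  · exact fun h => (h (Finset.mem_univ y)).elim

theorem IsPerfectlyValued.coprod {X : Type w} [Fintype X] (L : X → DGModule.{w} 𝒜) (n : X → ℤ)
    (hL : ∀ x, (L x).IsPerfectlyValued) : (coprod L n).IsPerfectlyValued := by
  refine isPerfectlyValued_iff.2 fun a => ?_
  choose hfin i j hij using fun x => isPerfectlyValued_iff.1 (hL x) a
  refine ⟨fun p => ?_, ?_⟩
  · let F : (∀ x, Hn ((L x).obj a) (p - n x)) →ₗ[k] Hn ((DGModule.coprod L n).obj a) p :=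
      ∑ x, (hnMap (cpSingle L n x) (fun _ hc => isCocycle_cpSingle L n x hc)
        (fun _ hb => isBd_cpSingle L n hb)) ∘ₗ LinearMap.proj x
    refine Module.Finite.of_surjective F fun y => ?_
    obtain ⟨z, hz, rfl⟩ := exists_cls y
    have hzx := (isCocycle_cp_iff L n).1 hz
    refine ⟨fun x => clsOf _ (cpFun L n z x) (hzx x), ?_⟩
    rw [LinearMap.sum_apply]
    refine Eq.trans (map_sum (coboundaries ((DGModule.coprod L n).obj a) p).mkQ
      (fun x => (⟨cpSingle L n x (cpFun L n z x), isCocycle_cpSingle L n x (hzx x) _⟩ :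
        cocycles ((DGModule.coprod L n).obj a) p)) Finset.univ).symm
      (congrArg _ (Subtype.ext ?_))
    exact (map_sum (cocycles _ p).subtype _ _).trans (cp_sum_fintype L n z).symm
  · obtain ⟨i', hi'⟩ := (Set.finite_range fun x => i x + n x).bddBelow
    obtain ⟨j', hj'⟩ := (Set.finite_range fun x => j x + n x).bddAbove
    refine ⟨i', j', fun p hp z hz => isBd_cp L n fun x => hij x _ ?_ _
      ((isCocycle_cp_iff L n).1 hz x)⟩
    have h1 : i' ≤ i x + n x := hi' ⟨x, rfl⟩
    have h2 : j x + n x ≤ j' := hj' ⟨x, rfl⟩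
    lia

end DGModule

namespace DGModule

open DGCategory

/-! ### Modules with cohomology in a single degree -/

section Cone

variable {k : Type v} [Field k] {𝒜 : DGCategory.{v, o, h} k} {L M Y : DGModule.{w} 𝒜} {n : ℤ}
  {f : (homComplex L M).X n} {hf : IsCocycle (homComplex L M) f} {a : 𝒜.Obj}

theorem conePr_coneLift {j j' : ℤ} (hj : j' = j + 1 - n) (g : (homComplex Y M).X j)
    (t : (homComplex Y L).X j') :
    homComp (zero_add j) (conePr f hf) (coneLift f hf hj g t) = g := by
  refine hom_ext' fun a p q hpq z => ?_
  rw [hv_comp _ _ _ hpq (add_zero q), hv_conePr, hv_coneLift, coneFst_mk]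

theorem coneBd_coneLift {j j' : ℤ} (hj : j' = j + 1 - n) (g : (homComplex Y M).X j)
    (t : (homComplex Y L).X j') :
    homComp (show 1 - n + j = j' by lia) (coneBd f hf) (coneLift f hf hj g t) = t := by
  refine hom_ext' fun a p q hpq z => ?_
  obtain rfl : q = p + j + 1 - n := by lia
  rw [hv_comp _ _ _ rfl (show p + j + (1 - n) = p + j + 1 - n by lia), hv_coneBd, hv_coneLift,
    coneSnd_mk]

theorem isBd_of_coneBd {p q : ℤ} (hpq : p + (1 - n) = q) {z : ((cone f hf).obj a).X p}
    (hz : IsCocycle ((cone f hf).obj a) z) (hb : IsBd (L.obj a) (hv hpq (coneBd f hf) z)) :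
    ∃ y : (M.obj a).X p, IsCocycle (M.obj a) y ∧
      IsBd ((cone f hf).obj a) (z - hv (add_zero p) (coneInl f hf) y) := by
  obtain rfl : q = p + 1 - n := by lia
  rw [hv_coneBd] at hb
  obtain ⟨y, hy, hyz⟩ := exists_sub_coneMk_zero hz hb
  refine ⟨y, hy, ?_⟩
  rwa [hv_coneInl]

theorem exists_hv_coneBd_eq {p q r : ℤ} (hpq : p + (1 - n) = q) (hqr : q + n = r)
    {l : (L.obj a).X q} (hl : IsCocycle (L.obj a) l) (hb : IsBd (M.obj a) (hv hqr f l)) :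
    ∃ z : ((cone f hf).obj a).X p, IsCocycle ((cone f hf).obj a) z ∧ hv hpq (coneBd f hf) z = l := by
  obtain rfl : q = p + 1 - n := by lia
  obtain rfl : r = p + 1 := by lia
  obtain ⟨y, hy⟩ := hb.out rfl
  refine ⟨coneMk f hf (-y) l, isCocycle_coneMk_iff.2 ⟨hl, ?_⟩, ?_⟩
  · rw [map_neg, hy, neg_add_cancel]
  · rw [hv_coneBd, coneSnd_mk]

theorem isBd_of_conePr_of_coneBd (hc : IsCocycle (homComplex (cone f hf) M) (conePr f hf)) {p q : ℤ}
    (hpq : p + (1 - n) = q) {z : ((cone f hf).obj a).X p} (hz : IsCocycle ((cone f hf).obj a) z)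
    (hb : IsBd (L.obj a) (hv hpq (coneBd f hf) z))
    (hb' : IsBd (M.obj a) (hv (add_zero p) (conePr f hf) z)) : IsBd ((cone f hf).obj a) z := by
  obtain ⟨y, hy, hyz⟩ := isBd_of_coneBd hpq hz hb
  refine (isBd_iff_of_sub hyz).2 (isBd_hv (isCocycle_coneInl f hf) _ ?_)
  have := isBd_hv hc (add_zero p) hyz
  rw [map_sub, ← hv_comp (add_zero 0) _ _ (add_zero p) (add_zero p) (add_zero p), conePr_coneInl,
    hv_id] at this
  exact (isBd_iff_of_sub this).1 hb'

/-- The cone of the zero morphism is the direct sum of `M` and a shift of `L`, and both projections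
become closed. Biproducts are obtained in this way below. -/
theorem isCocycle_conePr_of_eq_zero (h : f = 0) :
    IsCocycle (homComplex (cone f hf) M) (conePr f hf) := by
  subst h
  refine isCocycle_of (zero_add 1) ?_
  rw [conePr_d, map_zero, LinearMap.zero_apply, neg_zero]

theorem isCocycle_coneLift_of_eq_zero (h : f = 0) {j j' : ℤ} (hj : j' = j + 1 - n)
    {g : (homComplex Y M).X j} {t : (homComplex Y L).X j'} (hg : IsCocycle (homComplex Y M) g)
    (ht : IsCocycle (homComplex Y L) t) :
    IsCocycle (homComplex Y (cone f hf)) (coneLift f hf hj g t) := by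
  subst h
  refine isCocycle_of rfl ?_
  have e : homComp (show n + j' = j + 1 by lia) (0 : (homComplex L M).X n) t = 0 :=
    LinearMap.map_zero₂ _ _
  rw [coneLift_d 0 hf hj rfl rfl, hg, ht, e, smul_zero, add_zero]
  exact hom_ext' fun a p q hpq z => rfl

end Cone

variable {k : Type v} [Field k] {𝒞 : DGCategory.{v, o, h} k} {s : 𝒞.Obj} {P : DGModule.{h} 𝒞}
  {one : (P.obj s).X 0}

theorem IsTruncationModel.hZero_neg (hP : IsTruncationModel s P one)
    (hneg : ∀ n < 0, HZero (𝒞.Hom s s) n) {n : ℤ} (hn : n < 0) :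
    HZero (P.obj s) n := fun y hy => by
  obtain ⟨c, hc, hcy⟩ := hP.surj n hn.le y hy
  exact (isBd_iff_of_sub hcy).1 (isBd_hv (isCocycle_ofElt hP.isCocycle) _ (hneg n hn c hc))

section Free

variable (hP : IsTruncationModel s P one) (X : Type h) (b : ℤ)

variable (P) in
/-- A direct sum of copies of a module, in degree `b`. -/
abbrev copies : DGModule.{h} 𝒞 := coprod (fun _ : X => P) (fun _ => b)

variable {X} in
/-- The generator of a summand. -/
def copiesGen (one : (P.obj s).X 0) (x : X) : ((copies P X b).obj s).X b :=
  hv (zero_add b) (cpInj (fun _ : X => P) (fun _ => b) x) one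

variable {X b}

include hP in
theorem isCocycle_copiesGen (x : X) : IsCocycle ((copies P X b).obj s) (copiesGen b one x) :=
  isCocycle_hv (isCocycle_cpInj _ _ x) _ hP.isCocycle

include hP in
theorem hZero_copies (hneg : ∀ n < 0, HZero (𝒞.Hom s s) n) {n : ℤ} (hn : n ≠ b) :
    HZero ((copies P X b).obj s) n := fun z hz => by
  refine isBd_cp _ _ fun x => ?_
  have hzx := (isCocycle_cp_iff _ _).1 hz x
  rcases hn.lt_or_gt with hn | hn
  · exact hP.hZero_neg hneg (show n - b < 0 by lia) _ hzx
  · exact hP.hZero (n - b) (by lia) _ hzx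

include hP in
-- `one` generates `H⁰(P)` over `H⁰`, so in degree `b` a finite sum of copies of `P` behaves like a
-- module generated by the `copiesGen`.
theorem exists_copies_sum [Fintype X] (z : ((copies P X b).obj s).X b)
    (hz : IsCocycle ((copies P X b).obj s) z) :
    ∃ r : X → (𝒞.Hom s s).X 0,
      (∀ x, IsCocycle (𝒞.Hom s s) (r x)) ∧
      IsBd ((copies P X b).obj s)
        (z - ∑ x, (copies P X b).act (add_zero b) (copiesGen b one x) (r x)) := by
  have aux : ∀ (q : ℤ) (hq : 0 + 0 = q) (y : (P.obj s).X q), IsCocycle (P.obj s) y →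
      ∃ c : (𝒞.Hom s s).X 0, IsCocycle (𝒞.Hom s s) c ∧
        IsBd (P.obj s) (y - hv hq (idHom P) (P.act (add_zero 0) one c)) := by
    intro q hq y hy
    obtain rfl : q = 0 := by lia
    obtain ⟨c, hc, hcy⟩ := hP.surj 0 le_rfl y hy
    refine ⟨c, hc, ?_⟩
    rw [hv_id, ← neg_sub]
    exact hcy.neg
  choose r hr hrb using fun x => aux (b - b) (by lia) (cpFun (fun _ : X => P) (fun _ => b) z x)
    ((isCocycle_cp_iff _ _).1 hz x)
  refine ⟨r, hr, ?_⟩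
  rw [cp_sum_fintype _ _ z, ← Finset.sum_sub_distrib]
  refine IsBd.sum _ fun x _ => ?_
  have e : (copies P X b).act (add_zero b) (copiesGen b one x) (r x) =
      cpSingle (fun _ : X => P) (fun _ => b) x (hv (show 0 + 0 = b - b by lia) (idHom P)
        (P.act (add_zero 0) one (r x))) := by
    rw [← hv_cpInj (fun _ : X => P) (fun _ => b) x (zero_add b)]
    exact (hv_act _ _ _ _ _ _ _).symm
  rw [e, ← map_sub]
  exact isBd_cpSingle _ _ (hrb x)

include hP in
-- `realize` on each summand. Up to homotopy the sum of copies has the universal property of a free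
-- module, towards modules without cohomology above the degree of the chosen values.
theorem exists_copies_hom {Y : DGModule.{h} 𝒞} {j c : ℤ} (hj : b + j = c)
    (hY : ∀ n > c, HZero (Y.obj s) n) (m : X → (Y.obj s).X c)
    (hm : ∀ x, IsCocycle (Y.obj s) (m x)) :
    ∃ F : (homComplex (copies P X b) Y).X j, IsCocycle (homComplex (copies P X b) Y) F ∧
      ∀ x, IsBd (Y.obj s) (hv hj F (copiesGen b one x) - m x) := by
  subst hj
  choose g hg hgm using fun x => hP.realize Y _ hY (m x) (hm x)
  refine ⟨cpDesc _ _ g, isCocycle_cpDesc _ _ hg, fun x => ?_⟩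
  refine (congrArg (fun t => IsBd (Y.obj s) (t - m x)) ?_).mp (hgm x)
  exact (congrArg (fun t => hv (zero_add (b + j)) t one)
    (cpDesc_inj (fun _ : X => P) (fun _ => b) g x)).symm.trans
    (hv_comp (add_comm j b) (cpDesc _ _ g) (cpInj _ _ x) (zero_add b) rfl (zero_add _) one)

end Free

theorem isBd_sum_act {Y : DGModule.{h} 𝒞} {X : Type*} [Fintype X] {b : ℤ} {m m' : X → (Y.obj s).X b}
    (hb : ∀ x, IsBd (Y.obj s) (m x - m' x)) {r : X → (𝒞.Hom s s).X 0}
    (hr : ∀ x, IsCocycle (𝒞.Hom s s) (r x)) :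
    IsBd (Y.obj s) (∑ x, Y.act (add_zero b) (m x) (r x) - ∑ x, Y.act (add_zero b) (m' x) (r x)) := by
  rw [← Finset.sum_sub_distrib]
  refine IsBd.sum _ fun x _ => ?_
  rw [← LinearMap.sub_apply, ← map_sub]
  exact Y.isBd_act_left (add_zero b) (hb x) (hr x)

theorem isBd_sum_act_right {Y : DGModule.{h} 𝒞} {X : Type*} [Fintype X] {b : ℤ}
    {m : X → (Y.obj s).X b} (hm : ∀ x, IsCocycle (Y.obj s) (m x))
    {r r' : X → (𝒞.Hom s s).X 0}
    (hr : ∀ x, IsBd (𝒞.Hom s s) (r x - r' x)) :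
    IsBd (Y.obj s) (∑ x, Y.act (add_zero b) (m x) (r x) - ∑ x, Y.act (add_zero b) (m x) (r' x)) := by
  rw [← Finset.sum_sub_distrib]
  refine IsBd.sum _ fun x _ => ?_
  have : Y.act (add_zero b) (m x) (r x) - Y.act (add_zero b) (m x) (r' x) =
      Y.act (add_zero b) (m x) (r x - r' x) := (map_sub (Y.act (add_zero b) (m x)) _ _).symm
  rw [this]
  exact Y.isBd_act_right (add_zero b) (hm x) (hr x)

theorem hv_sum_act {Y Z : DGModule.{h} 𝒞} {X : Type*} [Fintype X] {b j c : ℤ} (hj : b + j = c)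
    (f : (homComplex Y Z).X j) (m : X → (Y.obj s).X b)
    (r : X → (𝒞.Hom s s).X 0) :
    hv hj f (∑ x, Y.act (add_zero b) (m x) (r x)) =
      ∑ x, Z.act (add_zero c) (hv hj f (m x)) (r x) := by
  rw [map_sum]
  exact Finset.sum_congr rfl fun x _ => hv_act f _ _ _ _ _ _

theorem sum_act_comm {Y : DGModule.{h} 𝒞} {X : Type*} [Fintype X] {b : ℤ} (m : X → (Y.obj s).X b)
    (κ : X → X → (𝒞.Hom s s).X 0) (r : X → (𝒞.Hom s s).X 0) :
    ∑ x, Y.act (add_zero b) (∑ y, Y.act (add_zero b) (m y) (κ x y)) (r x) =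
      ∑ y, Y.act (add_zero b) (m y)
        (∑ x, 𝒞.comp (add_zero 0) (κ x y) (r x)) := by
  have e : ∀ y, Y.act (add_zero b) (m y)
      (∑ x, 𝒞.comp (add_zero 0) (κ x y) (r x)) =
      ∑ x, Y.act (add_zero b) (Y.act (add_zero b) (m y) (κ x y)) (r x) := fun y =>
    (map_sum (Y.act (add_zero b) (m y)) _ _).trans
      (Finset.sum_congr rfl fun x _ => (Y.act_act _ _ _ _ (m y) (κ x y) (r x)).symm)
  rw [Finset.sum_congr rfl fun y _ => e y, Finset.sum_comm]
  exact Finset.sum_congr rfl fun x _ => LinearMap.map_sum₂ (Y.act (add_zero b)) _ _ _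

/-- The map `(F, Ψ) : G → M ⊕ C` to the sum with a shift of the cone `C` of `F` is a
quasi-isomorphism when `Ψ` splits the kernel of `F` off from the cohomology of `G`. -/
theorem isQI_of_splitting (hs : ∀ a : 𝒞.Obj, a = s) {G M : DGModule.{h} 𝒞} {b : ℤ}
    {F : (homComplex G M).X 0} (hF : IsCocycle (homComplex G M) F)
    {Ψ : (homComplex G (cone F hF)).X (-1)} (hΨ : IsCocycle (homComplex G (cone F hF)) Ψ)
    (hG : ∀ n ≠ b, HZero (G.obj s) n) (hM : ∀ n ≠ b, HZero (M.obj s) n)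
    (hC : ∀ n ≠ b - 1, HZero ((cone F hF).obj s) n)
    (hsurj : ∀ y : (M.obj s).X b, IsCocycle (M.obj s) y → ∃ g : (G.obj s).X b,
      IsCocycle (G.obj s) g ∧ IsBd (M.obj s) (hv (add_zero b) F g - y))
    (hFz : ∀ z : ((cone F hF).obj s).X (b - 1), IsCocycle ((cone F hF).obj s) z →
      IsBd (M.obj s) (hv (add_zero b) F
        (hv (show b - 1 + (1 - 0) = b by lia) (coneBd F hF) z)))
    (hkey : ∀ g : (G.obj s).X b, IsCocycle (G.obj s) g → IsBd (M.obj s) (hv (add_zero b) F g) →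
      IsBd (G.obj s) (hv (show b - 1 + (1 - 0) = b by lia) (coneBd F hF)
        (hv (show b + -1 = b - 1 by lia) Ψ g) - g))
    {z₀ : (homComplex (cone F hF) M).X 2} (hz₀ : IsCocycle (homComplex (cone F hF) M) z₀)
    (hpr : IsCocycle (homComplex (cone z₀ hz₀) M) (conePr z₀ hz₀))
    (hθ : IsCocycle (homComplex G (cone z₀ hz₀))
      (coneLift z₀ hz₀ (show (-1 : ℤ) = 0 + 1 - 2 by lia) F Ψ)) :
    IsQI (coneLift z₀ hz₀ (show (-1 : ℤ) = 0 + 1 - 2 by lia) F Ψ) := by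
  have hθF : ∀ {n : ℤ} (g : (G.obj s).X n),
      hv (add_zero n) (conePr z₀ hz₀) (hv (add_zero n)
        (coneLift z₀ hz₀ (show (-1 : ℤ) = 0 + 1 - 2 by lia) F Ψ) g) = hv (add_zero n) F g :=
    fun g => by
      rw [← hv_comp (zero_add 0) _ _ (add_zero _) (add_zero _) (add_zero _), conePr_coneLift]
  have hθΨ : ∀ (g : (G.obj s).X b),
      hv (show b + (1 - 2) = b - 1 by lia) (coneBd z₀ hz₀) (hv (add_zero b)
        (coneLift z₀ hz₀ (show (-1 : ℤ) = 0 + 1 - 2 by lia) F Ψ) g) =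
        hv (show b + -1 = b - 1 by lia) Ψ g := fun g => by
    rw [← hv_comp (show 1 - 2 + 0 = -1 by lia) _ _ (add_zero _)
      (show b + (1 - 2) = b - 1 by lia) (show b + -1 = b - 1 by lia), coneBd_coneLift]
  -- As `H^{b-1}(M) = 0`, the cohomology of the cone in degree `b - 1` embeds into `H^b(G)`.
  have hCinj : ∀ z : ((cone F hF).obj s).X (b - 1), IsCocycle ((cone F hF).obj s) z →
      IsBd (G.obj s) (hv (show b - 1 + (1 - 0) = b by lia) (coneBd F hF) z) →
      IsBd ((cone F hF).obj s) z := by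
    intro z hz hb
    obtain ⟨y, hy, hyz⟩ := isBd_of_coneBd _ hz hb
    exact (isBd_iff_of_sub hyz).2 (isBd_hv (isCocycle_coneInl F hF) _ (hM (b - 1) (by lia) y hy))
  generalize coneLift z₀ hz₀ (show (-1 : ℤ) = 0 + 1 - 2 by lia) F Ψ = θ at hθ hθF hθΨ
  intro a p q hpq
  obtain rfl := hs a
  obtain rfl : p = q := by lia
  by_cases hpb : p = b
  · subst hpb
    constructor
    · intro g hg hb
      have h1 := isBd_hv hpr (add_zero p) hb
      rw [hθF] at h1
      have h4 := isBd_hv (isCocycle_coneBd z₀ hz₀) (show p + (1 - 2) = p - 1 by lia) hb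
      rw [hθΨ] at h4
      have h6 := isBd_hv (isCocycle_coneBd F hF) (show p - 1 + (1 - 0) = p by lia) h4
      exact (isBd_iff_of_sub (hkey g hg h1)).1 h6
    · intro w hw
      obtain ⟨g, hg, hgF⟩ := hsurj _ (isCocycle_hv hpr (add_zero p) hw)
      have hc : IsCocycle ((cone F hF).obj a)
          (hv (show p + (1 - 2) = p - 1 by lia) (coneBd z₀ hz₀) w -
            hv (show p + -1 = p - 1 by lia) Ψ g) :=
        (isCocycle_hv (isCocycle_coneBd z₀ hz₀) _ hw).sub (isCocycle_hv hΨ _ hg)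
      generalize hce : hv (show p + (1 - 2) = p - 1 by lia) (coneBd z₀ hz₀) w -
        hv (show p + -1 = p - 1 by lia) Ψ g = c at hc
      have hl := isCocycle_hv (isCocycle_coneBd F hF) (show p - 1 + (1 - 0) = p by lia) hc
      have hlF := hFz c hc
      generalize hle : hv (show p - 1 + (1 - 0) = p by lia) (coneBd F hF) c = l at hl hlF
      -- `c` is the error made by `g` in the second component, and `l` is its image in `G`, which
      -- lies in the kernel of `F`. By `hkey` the elements `Ψ l` and `c` have the same image in
      -- `H^b(G)`, so they agree in the cohomology of the cone. Hence `g + l` is correct in both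
      -- components.
      have h6 := hCinj (hv (show p + -1 = p - 1 by lia) Ψ l - c) ((isCocycle_hv hΨ _ hl).sub hc) (by
        rw [map_sub, hle]
        exact hkey l hl hlF)
      refine ⟨g + l, hg.add hl, isBd_of_conePr_of_coneBd hpr (show p + (1 - 2) = p - 1 by lia)
        ((isCocycle_hv hθ _ (hg.add hl)).sub hw) ?_ ?_⟩
      · rw [map_sub, hθΨ, map_add]
        refine (congrArg (IsBd _) ?_).mp h6
        rw [← hce]
        abel
      · rw [map_sub, hθF, map_add, add_sub_right_comm]
        exact hgF.add hlF
  · constructor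
    · exact fun g hg _ => hG p hpb g hg
    · intro w hw
      refine ⟨0, isCocycle_zero, ?_⟩
      rw [map_zero, zero_sub]
      exact (isBd_of_conePr_of_coneBd hpr (show p + (1 - 2) = p - 1 by lia) hw
        (hC _ (by lia) _ (isCocycle_hv (isCocycle_coneBd z₀ hz₀) _ hw))
        (hM p hpb _ (isCocycle_hv hpr _ hw))).neg

/-- A module with cohomology in a single degree which is projective over `H⁰` is a retract up to
homotopy of a sum of copies of the truncation model. -/
theorem IsTruncationModel.exists_section (hP : IsTruncationModel s P one) (hs : ∀ a : 𝒞.Obj, a = s)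
    (hneg : ∀ n < 0, HZero (𝒞.Hom s s) n) {M : DGModule.{h} 𝒞}
    (hMproj : M.IsHProjective) {b : ℤ} (hM : ∀ n ≠ b, HZero (M.obj s) n) {X : Type h} [Fintype X]
    (m : X → (M.obj s).X b) (κ : X → X → (𝒞.Hom s s).X 0)
    (hm : ∀ x, IsCocycle (M.obj s) (m x))
    (hκ : ∀ x y, IsCocycle (𝒞.Hom s s) (κ x y))
    (hspan : ∀ y : (M.obj s).X b, IsCocycle (M.obj s) y →
      ∃ r : X → (𝒞.Hom s s).X 0,
        (∀ x, IsCocycle (𝒞.Hom s s) (r x)) ∧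
        IsBd (M.obj s) (y - ∑ x, M.act (add_zero b) (m x) (r x)))
    (hmκ : ∀ x, IsBd (M.obj s) (∑ y, M.act (add_zero b) (m y) (κ x y)))
    (hret : ∀ r : X → (𝒞.Hom s s).X 0,
      (∀ x, IsCocycle (𝒞.Hom s s) (r x)) →
      IsBd (M.obj s) (∑ x, M.act (add_zero b) (m x) (r x)) → ∀ y,
        IsBd (𝒞.Hom s s)
          (∑ x, 𝒞.comp (add_zero 0) (κ x y) (r x) - r y)) :
    ∃ (F : (homComplex (copies P X b) M).X 0) (α : (homComplex M (copies P X b)).X 0),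
      IsCocycle _ F ∧ IsCocycle _ α ∧
      IsBd (homComplex M M) (homComp (add_zero 0) F α - idHom M) := by
  have hG : ∀ n ≠ b, HZero ((copies P X b).obj s) n := fun n hn => hZero_copies hP hneg hn
  have hJ : ∀ x : X, IsCocycle ((copies P X b).obj s) (copiesGen b one x) := isCocycle_copiesGen hP
  obtain ⟨F, hF, hFm⟩ := exists_copies_hom hP (add_zero b) (fun n hn => hM n (by lia)) m hm
  have hFsum : ∀ r : X → (𝒞.Hom s s).X 0,
      (∀ x, IsCocycle (𝒞.Hom s s) (r x)) → IsBd (M.obj s)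
      (hv (add_zero b) F (∑ x, (copies P X b).act (add_zero b) (copiesGen b one x) (r x)) -
        ∑ x, M.act (add_zero b) (m x) (r x)) := fun r hr => by
    rw [hv_sum_act]
    exact isBd_sum_act hFm hr
  have hsumc : ∀ r : X → (𝒞.Hom s s).X 0, (∀ x, IsCocycle (𝒞.Hom s s) (r x)) →
      IsCocycle ((copies P X b).obj s)
        (∑ x, (copies P X b).act (add_zero b) (copiesGen b one x) (r x)) := fun r hr n => by
    rw [map_sum]
    exact Finset.sum_eq_zero fun y _ => DGModule.isCocycle_act _ _ (hJ y) (hr y) n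
  have hFz : ∀ z : ((cone F hF).obj s).X (b - 1), IsCocycle ((cone F hF).obj s) z →
      IsBd (M.obj s) (hv (add_zero b) F
        (hv (show b - 1 + (1 - 0) = b by lia) (coneBd F hF) z)) := by
    intro z hz
    have h1 := isBd_d (m := 0) (n := 1) (conePr F hF)
    rw [conePr_d] at h1
    have h2 := (isBd_hv_of_isBd h1 (sub_add_cancel b 1) hz).neg
    rwa [map_neg, LinearMap.neg_apply, neg_neg,
      hv_comp _ F (coneBd F hF) (show b - 1 + (1 - 0) = b by lia) (add_zero b)] at h2
  -- In degree `b - 1` the cone computes the kernel of `F` on `H^b`. The element `ζ x` corresponds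
  -- to the relation with coefficients `κ x`.
  choose ζ hζ hζl using fun x => exists_hv_coneBd_eq (hf := hF)
    (show b - 1 + (1 - 0) = b by lia) (add_zero b) (hsumc _ (hκ x))
    ((isBd_iff_of_sub (hFsum _ (hκ x))).2 (hmκ x))
  have hCzero : ∀ n ≠ b - 1, HZero ((cone F hF).obj s) n := by
    intro n hn
    refine hZero_cone (q := n) (r := n + 1) (add_zero n) rfl (by lia)
      (fun l hl _ => hG _ (by lia) l hl) fun y hy => ?_
    by_cases hnb : n = b
    · subst hnb
      obtain ⟨r, hr, hyr⟩ := hspan y hy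
      refine ⟨_, hsumc r hr, ?_⟩
      have := (hFsum r hr).sub hyr
      rwa [sub_sub_sub_cancel_right] at this
    · exact ⟨0, isCocycle_zero, by
        rw [map_zero, zero_sub]
        exact (hM n hnb y hy).neg⟩
  -- Morphisms out of `M` cannot be prescribed on cohomology, whereas morphisms out of copies of `P`
  -- can. So it is not the section `M → G` that is realised but the complementary projection of `G`
  -- onto the kernel of `F`, with the cone as target.
  obtain ⟨Ψ, hΨ, hΨζ⟩ := exists_copies_hom hP (show b + -1 = b - 1 by lia)
    (fun n hn => hCzero n (by lia)) ζ hζ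
  have key : ∀ r : X → (𝒞.Hom s s).X 0, (∀ x, IsCocycle (𝒞.Hom s s) (r x)) →
      IsBd (M.obj s) (∑ x, M.act (add_zero b) (m x) (r x)) → IsBd ((copies P X b).obj s)
        (hv (show b - 1 + (1 - 0) = b by lia) (coneBd F hF) (hv (show b + -1 = b - 1 by lia) Ψ
          (∑ x, (copies P X b).act (add_zero b) (copiesGen b one x) (r x))) -
          ∑ x, (copies P X b).act (add_zero b) (copiesGen b one x) (r x)) := by
    intro r hr hb
    have h1 := isBd_sum_act_right hJ (hret r hr hb)
    rw [← sum_act_comm] at h1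
    have h2 := isBd_hv (isCocycle_coneBd F hF) (show b - 1 + (1 - 0) = b by lia)
      (isBd_sum_act hΨζ hr)
    rw [map_sub, hv_sum_act _ (coneBd F hF) ζ] at h2
    rw [hv_sum_act (show b + -1 = b - 1 by lia) Ψ]
    simp only [hζl] at h2
    have := h2.add h1
    rwa [sub_add_sub_cancel] at this
  -- The cone of the zero morphism of degree `2` is the sum of `M` and the shift `C[-1]`, for which
  -- `(F, Ψ)` is a morphism of degree `0`.
  obtain ⟨z₀, hz⟩ : ∃ z : (homComplex (cone F hF) M).X 2, z = 0 := ⟨0, rfl⟩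
  have hz₀ : IsCocycle (homComplex (cone F hF) M) z₀ := hz ▸ isCocycle_zero
  have hpr := isCocycle_conePr_of_eq_zero (hf := hz₀) hz
  have hθ := isCocycle_coneLift_of_eq_zero (hf := hz₀) hz (show (-1 : ℤ) = 0 + 1 - 2 by lia) hF hΨ
  have hθq := isQI_of_splitting hs hF hΨ hG hM hCzero
    (fun y hy => by
      obtain ⟨r, hr, hyr⟩ := hspan y hy
      refine ⟨_, hsumc r hr, ?_⟩
      have := (hFsum r hr).sub hyr
      rwa [sub_sub_sub_cancel_right] at this) hFz
    (fun g hg hb => by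
      obtain ⟨r, hr, hgr⟩ := exists_copies_sum hP g hg
      have h2 := isBd_hv hF (add_zero b) hgr
      rw [map_sub] at h2
      have h3 := key r hr ((isBd_iff_of_sub (hFsum r hr)).1 ((isBd_iff_of_sub h2).1 hb))
      have h5 := isBd_hv (isCocycle_coneBd F hF) (show b - 1 + (1 - 0) = b by lia)
        (isBd_hv hΨ (show b + -1 = b - 1 by lia) hgr)
      rw [map_sub, map_sub] at h5
      have := (h5.add h3).sub hgr
      rwa [sub_add_sub_cancel, sub_sub_sub_cancel_right] at this) hz₀ hpr hθ
  -- Since `(F, Ψ)` is a quasi-isomorphism and `M` is h-projective, the inclusion of `M` into the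
  -- sum lifts to `G`. Projecting back to `M` gives `F α ∼ id`.
  obtain ⟨α, hα, hαθ⟩ := hMproj.exists_lift hθ hθq (isCocycle_coneInl z₀ hz₀)
  refine ⟨F, α, hF, hα, ?_⟩
  have := isBd_comp_right (zero_add 0) hpr hαθ
  rw [map_sub, conePr_coneInl, ← comp_assoc (zero_add 0) (zero_add 0) (zero_add 0) (zero_add 0),
    conePr_coneLift] at this
  exact this

end DGModule

namespace DGModule

/-! ### Modules over an opposite dg category -/

section Opposite

variable {k : Type v} [Field k] {𝒟 : DGCategory.{v, o, h} k} (N : DGModule.{w} 𝒟.op)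
  {a b c : 𝒟.Obj} {p q r s t n : ℤ}

/-- The action of morphisms of `𝒟` on a module over the opposite. -/
def opAct (hpq : p + q = n) : (N.obj a).X p →ₗ[k] (𝒟.Hom a b).X q →ₗ[k] (N.obj b).X n :=
  N.act (a := b) (b := a) hpq

theorem opAct_id (x : (N.obj a).X n) : N.opAct (add_zero n) x (𝒟.id a) = x := N.act_id x

theorem opAct_opAct (hpq : p + q = s) (hqr : r + q = t) (hsr : s + r = n) (hpt : p + t = n)
    (x : (N.obj a).X p) (φ : (𝒟.Hom a b).X q) (ψ : (𝒟.Hom b c).X r) :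
    N.opAct hsr (N.opAct hpq x φ) ψ = koszulSign k (q * r) • N.opAct hpt x (𝒟.comp hqr ψ φ) :=
  (N.act_act (a := c) (b := b) (c := a) hpq (show q + r = t by lia) hsr hpt x φ ψ).trans
    (map_smul (N.opAct hpt x) _ _)

theorem opAct_d {p' q' n' : ℤ} (hpq : p + q = n) (hp : p + 1 = p') (hq : q + 1 = q')
    (hn : n + 1 = n') (x : (N.obj a).X p) (φ : (𝒟.Hom a b).X q) :
    ((N.obj b).d n n').hom (N.opAct hpq x φ) =
      N.opAct (show p' + q = n' by lia) (((N.obj a).d p p').hom x) φ +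
        koszulSign k p • N.opAct (show p + q' = n' by lia) x (((𝒟.Hom a b).d q q').hom φ) :=
  N.act_d (a := b) (b := a) hpq hp hq hn x φ

theorem isCocycle_opAct (hpq : p + q = n) {x : (N.obj a).X p} {φ : (𝒟.Hom a b).X q}
    (hx : IsCocycle (N.obj a) x) (hφ : IsCocycle (𝒟.Hom a b) φ) :
    IsCocycle (N.obj b) (N.opAct hpq x φ) :=
  N.isCocycle_act (a := b) (b := a) hpq hx hφ

theorem isBd_opAct_left (hpq : p + q = n) {x : (N.obj a).X p} {φ : (𝒟.Hom a b).X q}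
    (hx : IsBd (N.obj a) x) (hφ : IsCocycle (𝒟.Hom a b) φ) :
    IsBd (N.obj b) (N.opAct hpq x φ) :=
  N.isBd_act_left (a := b) (b := a) hpq hx hφ

theorem isBd_opAct_right (hpq : p + q = n) {x : (N.obj a).X p} {φ : (𝒟.Hom a b).X q}
    (hx : IsCocycle (N.obj a) x) (hφ : IsBd (𝒟.Hom a b) φ) :
    IsBd (N.obj b) (N.opAct hpq x φ) :=
  N.isBd_act_right (a := b) (b := a) hpq hx hφ

/-- Acyclicity of a module at an object follows from acyclicity at the objects of which it is a
homotopy retract. -/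
theorem hZero_of_homotopyRetract {ι : Type*} [Fintype ι] {M : 𝒟.Obj} (G : ι → 𝒟.Obj) (d e : ι → ℤ)
    (hde : ∀ i, d i + e i = 0) (j : ∀ i, (𝒟.Hom (G i) M).X (d i))
    (ρ : ∀ i, (𝒟.Hom M (G i)).X (e i)) (hj : ∀ i, IsCocycle (𝒟.Hom (G i) M) (j i))
    (hρ : ∀ i, IsCocycle (𝒟.Hom M (G i)) (ρ i))
    (hid : IsBd (𝒟.Hom M M) (∑ i, 𝒟.comp (hde i) (j i) (ρ i) - 𝒟.id M))
    (hG : ∀ i n, HZero (N.obj (G i)) n) : HZero (N.obj M) n := by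
  intro x hx
  have h1 := N.isBd_opAct_right (add_zero n) hx hid
  rw [map_sub, opAct_id, map_sum] at h1
  refine (isBd_iff_of_sub h1).1 (IsBd.sum _ fun i _ => ?_)
  have h2 := N.opAct_opAct rfl (hde i) (show n + e i + d i = n by have := hde i; lia) (add_zero n) x
    (ρ i) (j i)
  rw [← isBd_smul_iff (koszulSign_ne_zero (e i * d i)), ← h2]
  exact N.isBd_opAct_left _ (hG i _ _ (N.isCocycle_opAct rfl hx (hρ i))) (hj i)

/-- Acyclicity of a module at `M` follows from acyclicity at the cone of a morphism to `M` and at its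
source. -/
theorem hZero_of_cone {M C L : 𝒟.Obj} {e e' : ℤ} (he : e' + e = 1) {i : (𝒟.Hom M C).X 0}
    {π : (𝒟.Hom C M).X 0} {δ : (𝒟.Hom C L).X e} {f : (𝒟.Hom L M).X e'}
    (hi : IsCocycle (𝒟.Hom M C) i) (hδ : IsCocycle (𝒟.Hom C L) δ) (hf : IsCocycle (𝒟.Hom L M) f)
    (hπ : ((𝒟.Hom C M).d 0 1).hom π = -𝒟.comp he f δ) (hπi : 𝒟.comp (add_zero 0) π i = 𝒟.id M)
    (hδi : 𝒟.comp (add_zero e) δ i = 0) (hC : ∀ n, HZero (N.obj C) n)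
    (hL : ∀ n, HZero (N.obj L) n) : HZero (N.obj M) n := by
  intro x hx
  -- `x · i = dw` at the cone. Then `d(w · π)` equals `x` up to the term `w · (f δ)`. As `δ i = 0`,
  -- the element `w · δ` is closed, hence a coboundary by acyclicity at `L`, and so is `w · (f δ)`.
  obtain ⟨w, hw⟩ := (hC n _ (N.isCocycle_opAct (add_zero n) hx hi)).out (sub_add_cancel n 1)
  have h1 := N.opAct_d (add_zero (n - 1)) (sub_add_cancel n 1) (zero_add 1) (sub_add_cancel n 1) w π
  rw [hw, hπ, N.opAct_opAct _ (add_zero 0) _ (add_zero n), hπi, opAct_id, zero_mul, koszulSign_zero,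
    one_smul, map_neg] at h1
  have hwδ : IsCocycle (N.obj L) (N.opAct (show n - 1 + e = n + e - 1 by lia) w δ) := by
    refine isCocycle_of (sub_add_cancel (n + e) 1) ?_
    rw [N.opAct_d _ (sub_add_cancel n 1) rfl (sub_add_cancel (n + e) 1), hw, hδ, map_zero, smul_zero,
      add_zero, N.opAct_opAct (add_zero n) (add_zero e) rfl rfl, hδi, map_zero, smul_zero]
  have h2 := N.isBd_opAct_left (show n + e - 1 + e' = n by lia) (hL _ _ hwδ) hf
  rw [N.opAct_opAct _ he _ (show n - 1 + 1 = n by lia),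
    isBd_smul_iff (koszulSign_ne_zero (e * e'))] at h2
  have h3 : x = ((N.obj M).d (n - 1) n).hom (N.opAct (add_zero (n - 1)) w π) +
      koszulSign k (n - 1) • N.opAct (show n - 1 + 1 = n by lia) w (𝒟.comp he f δ) := by
    rw [h1, smul_neg, neg_add_cancel_right]
  rw [h3]
  exact (isBd_d _).add (h2.smul _)

end Opposite

section Proj

variable {k : Type v} [Field k] {𝒜 : DGCategory.{v, o, h} k} {X : Type w} (L : X → DGModule.{w} 𝒜)
  (n : X → ℤ) {a : 𝒜.Obj}

/-- The projection to a summand. -/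
def cpProj (x : X) : (homComplex (coprod L n) (L x)).X (-n x) :=
  mkHom (fun a p q hpq => hv (show p - n x + 0 = q by lia) (idHom (L x)) ∘ₗ
      DFinsupp.lapply (M := fun x => ((L x).obj a).X (p - n x)) x ∘ₗ (cpFun L n).toLinearMap)
    (fun a b p r s p' s' hp hr hs hr' m c => by
      refine (congrArg (fun t => hv (show s - n x + 0 = s' by lia) (idHom (L x)) t)
        (cpFun_act L n hr m c x)).trans ?_
      exact hv_act (idHom (L x)) (show p - n x + 0 = p' by lia) (show p - n x + r = s - n x by lia)
        _ hr' _ _)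

theorem hv_cpProj (x : X) {p q : ℤ} (hpq : p + -n x = q) (z : ((coprod L n).obj a).X p) :
    hv hpq (cpProj L n x) z = hv (show p - n x + 0 = q by lia) (idHom (L x)) (cpFun L n z x) := rfl

theorem isCocycle_cpProj (x : X) : IsCocycle (homComplex (coprod L n) (L x)) (cpProj L n x) := by
  refine isCocycle_hom_iff.2 fun a p q p' q' hpq hp hq c => ?_
  rw [hv_cpProj, hv_cpProj, cpFun_d L n hp, map_smul, smul_smul, koszulSign_neg,
    koszulSign_mul_self, one_smul, d_hv_id _ (show p - n x + 1 = p' - n x by lia)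
    (show p' - n x + 0 = q' by lia)]

theorem sum_cpInj_cpProj [Fintype X] :
    ∑ x, homComp (add_neg_cancel (n x)) (cpInj L n x) (cpProj L n x) = idHom (coprod L n) := by
  refine hom_ext' fun a p q hpq z => ?_
  obtain rfl : p = q := by lia
  rw [map_sum, LinearMap.sum_apply, hv_id]
  refine Eq.trans (Finset.sum_congr rfl fun x _ => ?_) (cp_sum_fintype L n z).symm
  rw [hv_comp _ _ _ rfl (show p + -n x + n x = p by lia), hv_cpInj, hv_cpProj, hv_hv_id, hv_id]

end Proj

end DGModule

/-! ### The weight truncation generates `D_fd(A)` -/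

namespace DGAlgebra

open DGModule

variable {k : Type u} [Field k] {A : DGAlgebra.{u} k} {P : A.RightModule}
  {one : (P.obj A.pt).X 0}

theorem exists_presentation [IsSemisimpleRing A.H0] (M : A.RightModule) (n : ℤ)
    (hfin : Module.Finite k (Hn (M.obj A.pt) n)) :
    ∃ (X : Type u) (_ : Fintype X) (m : X → (M.obj A.pt).X n)
      (κ : X → X → (A.toDGCategory.Hom A.pt A.pt).X 0),
      (∀ x, IsCocycle (M.obj A.pt) (m x)) ∧
      (∀ x y, IsCocycle (A.toDGCategory.Hom A.pt A.pt) (κ x y)) ∧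
      (∀ y : (M.obj A.pt).X n, IsCocycle (M.obj A.pt) y →
        ∃ r : X → (A.toDGCategory.Hom A.pt A.pt).X 0,
          (∀ x, IsCocycle (A.toDGCategory.Hom A.pt A.pt) (r x)) ∧
          IsBd (M.obj A.pt) (y - ∑ x, M.act (add_zero n) (m x) (r x))) ∧
      (∀ x, IsBd (M.obj A.pt) (∑ y, M.act (add_zero n) (m y) (κ x y))) ∧
      ∀ r : X → (A.toDGCategory.Hom A.pt A.pt).X 0,
        (∀ x, IsCocycle (A.toDGCategory.Hom A.pt A.pt) (r x)) →
        IsBd (M.obj A.pt) (∑ x, M.act (add_zero n) (m x) (r x)) → ∀ y,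
          IsBd (A.toDGCategory.Hom A.pt A.pt)
            (∑ x, A.toDGCategory.comp (add_zero 0) (κ x y) (r x) - r y) := by
  obtain ⟨X, hX, m, c, hm, hspan, hc, hret⟩ := A.exists_syzygy_retraction M n hfin
  refine ⟨X, hX, m, fun x y => (c x y).1, hm, fun x y => (c x y).isCocycle, fun y hy => ?_, hc,
    fun r hr hb y => ?_⟩
  · obtain ⟨r, hr⟩ := hspan y hy
    exact ⟨fun x => (r x).1, fun x => (r x).isCocycle, hr⟩
  · let r' : X → A.Z0 := fun x => ⟨r x, hr x 1⟩
    have := (A.mem_B0_iff _).1 (hret r' hb y)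
    refine (congrArg (IsBd A.complex) ?_).mp this
    refine congrArg₂ (· - ·) ?_ rfl
    exact map_sum (LinearMap.ker (A.complex.d 0 1).hom).subtype
      (fun x => c x y * r' x) Finset.univ

/-- Induction on the amplitude of `M`. In amplitude zero `M` is a homotopy retract of a finite sum
of shifts of `P`. Otherwise map such a sum, placed in the top degree `b`, onto `H^b(M)`: the cone
has no cohomology in degree `b`, and the kernel reappears in degree `b - 1` only, so the amplitude
drops. The module `N` vanishes at the sum and at the cone, hence at `M`. -/
theorem hZero_of_hZero_truncationModel [IsSemisimpleRing A.H0]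
    (hP : IsTruncationModel A.pt P one) (hneg : ∀ n < 0, HZero A.complex n)
    (hPfd : P.IsHProjective ∧ P.IsPerfectlyValued)
    (N : DGModule.{w} (Dfd.{u} A.toDGCategory).op)
    (hN : ∀ n, HZero (N.obj ⟨P, hPfd⟩) n) (len : ℕ) :
    ∀ (b : ℤ) (M : (Dfd.{u} A.toDGCategory).Obj),
      (∀ n, (n < b - len ∨ b < n) → HZero (M.1.obj A.pt) n) → ∀ n, HZero (N.obj M) n := by
  have hG : ∀ (X : Type u) [Fintype X] (b : ℤ), (copies P X b).IsHProjective ∧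
      (copies P X b).IsPerfectlyValued := fun X _ b =>
    ⟨isHProjective_coprod _ _ fun _ => hPfd.1, IsPerfectlyValued.coprod _ _ fun _ => hPfd.2⟩
  have hNG : ∀ (X : Type u) [Fintype X] (b : ℤ) (n : ℤ), HZero (N.obj ⟨copies P X b, hG X b⟩) n :=
    fun X _ b n => N.hZero_of_homotopyRetract (𝒟 := Dfd.{u} A.toDGCategory)
      (M := ⟨copies P X b, hG X b⟩) (fun _ : X => ⟨P, hPfd⟩)
      (fun _ => b) (fun _ => -b) (fun _ => add_neg_cancel b)
      (fun x => cpInj (fun _ : X => P) (fun _ => b) x)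
      (fun x => cpProj (fun _ : X => P) (fun _ => b) x)
      (fun x => isCocycle_cpInj _ _ x) (fun x => isCocycle_cpProj _ _ x)
      (by
        have := sum_cpInj_cpProj (fun _ : X => P) (fun _ => b)
        have e := sub_eq_zero.2 this
        exact (congrArg (IsBd _) e).mpr isBd_zero) (fun _ => hN)
  have hs : ∀ a : A.toDGCategory.Obj, a = A.pt := fun _ => rfl
  induction len with
  | zero =>
    intro b M hM n
    obtain ⟨X, _, m, κ, hm, hκ, hspan, hmκ, hret⟩ := A.exists_presentation M.1 b
      ((isPerfectlyValued_iff.1 M.2.2 A.pt).1 b)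
    obtain ⟨F, α, hF, hα, hFα⟩ := hP.exists_section hs hneg M.2.1
      (fun n hn => hM n (by push_cast; lia)) m κ hm hκ hspan hmκ hret
    refine N.hZero_of_homotopyRetract (𝒟 := Dfd.{u} A.toDGCategory) (M := M)
      (fun _ : Unit => ⟨copies P X b, hG X b⟩)
      (fun _ => 0) (fun _ => 0) (fun _ => add_zero 0) (fun _ => F) (fun _ => α) (fun _ => hF)
      (fun _ => hα) ?_ (fun _ => hNG X b)
    rw [Fintype.sum_unique]
    exact hFα
  | succ len ih =>
    intro b M hM n
    obtain ⟨X, _, m, κ, hm, hκ, hspan, hmκ, hret⟩ := A.exists_presentation M.1 b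
      ((isPerfectlyValued_iff.1 M.2.2 A.pt).1 b)
    obtain ⟨F, hF, hFm⟩ := exists_copies_hom hP (add_zero b)
      (fun n hn => hM n (Or.inr hn)) m hm
    let C : (Dfd.{u} A.toDGCategory).Obj := ⟨cone F hF, isHProjective_cone F hF M.2.1 (hG X b).1,
      (hG X b).2.cone M.2.2 F hF⟩
    refine N.hZero_of_cone (𝒟 := Dfd.{u} A.toDGCategory) (M := M) (C := C)
      (L := ⟨copies P X b, hG X b⟩) (show 0 + (1 - 0) = 1 by lia) (isCocycle_coneInl F hF)
      (isCocycle_coneBd F hF) hF (conePr_d F hF) (conePr_coneInl F hF) (coneBd_coneInl F hF)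
      (ih (b - 1) C fun n hn => ?_) (hNG X b)
    refine hZero_cone (hf := hF) (q := n) (r := n + 1) (add_zero n) rfl (by lia)
      (fun l hl _ => hZero_copies hP hneg (by lia) l hl) fun y hy => ?_
    by_cases hnb : n = b
    · subst hnb
      obtain ⟨r, hr, hyr⟩ := hspan y hy
      refine ⟨∑ x, (copies P X n).act (add_zero n) (copiesGen n one x) (r x), fun m => ?_, ?_⟩
      · rw [map_sum]
        exact Finset.sum_eq_zero fun y _ =>
          DGModule.isCocycle_act _ _ (isCocycle_copiesGen hP y) (hr y) m
      · rw [hv_sum_act]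
        have := (isBd_sum_act hFm hr).sub hyr
        rwa [sub_sub_sub_cancel_right] at this
    · refine ⟨0, isCocycle_zero, ?_⟩
      rw [map_zero, zero_sub]
      exact (hM n (by push_cast at hn ⊢; lia) y hy).neg

/-- A module over `D_fd(A)ᵒᵖ` which is acyclic at the weight truncation of `A` is acyclic. -/
theorem isAcyclic_of_hZero_truncationModel [IsSemisimpleRing A.H0]
    (hP : IsTruncationModel A.pt P one) (hneg : ∀ n < 0, HZero A.complex n)
    (hPfd : P.IsHProjective ∧ P.IsPerfectlyValued)
    (N : DGModule.{w} (Dfd.{u} A.toDGCategory).op)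
    (hN : ∀ n, HZero (N.obj ⟨P, hPfd⟩) n) : N.IsAcyclic := by
  refine isAcyclic_iff.2 fun M n => ?_
  obtain ⟨-, i, j, hij⟩ := isPerfectlyValued_iff.1 M.2.2 A.pt
  -- If `j < i`, the truncated difference is `0`; the bounds remain valid because `M` then has no
  -- cohomology at all.
  exact hZero_of_hZero_truncationModel hP hneg hPfd N hN (j - i).toNat j M
    (fun n hn => hij n (by lia)) n

end DGAlgebra

namespace DGModule

/-! ### Thick subcategories -/

variable {k : Type v} [Field k] {𝒜 : DGCategory.{v, o, h} k} {L M : DGModule.{w} 𝒜}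

section Cone

variable {n : ℤ} (f : (homComplex L M).X n) (hf : IsCocycle (homComplex L M) f) {a : 𝒜.Obj} {p q : ℤ}

theorem hv_coneInl_injective :
    Function.Injective (hv (a := a) (add_zero p) (coneInl f hf)) := fun y y' hyy => by
  rw [hv_coneInl, hv_coneInl] at hyy
  have := congrArg (coneFst f hf) hyy
  rwa [coneFst_mk, coneFst_mk] at this

theorem hv_coneBd_surjective (hpq : p + (1 - n) = q) :
    Function.Surjective (hv (a := a) hpq (coneBd f hf)) := fun l => by
  obtain rfl : q = p + 1 - n := by lia
  exact ⟨coneMk f hf 0 l, by rw [hv_coneBd, coneSnd_mk]⟩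

theorem exact_coneInl_coneBd (hpq : p + (1 - n) = q) : Function.Exact
    (hv (a := a) (add_zero p) (coneInl f hf)) (hv (a := a) hpq (coneBd f hf)) := fun z => by
  obtain rfl : q = p + 1 - n := by lia
  rw [hv_coneBd]
  constructor
  · intro h
    refine ⟨coneFst f hf z, ?_⟩
    rw [hv_coneInl, ← h, coneMk_eta]
  · rintro ⟨y, rfl⟩
    rw [hv_coneInl, coneSnd_mk]

end Cone

/-- In degree `1` the second summand of the cone is `L` without a shift, so the triangle of `f` is a
short exact sequence. Other degrees are reduced to this one by composing with shifts. -/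
theorem isShortExact_cone (f : (homComplex L M).X 1) (hf : IsCocycle (homComplex L M) f) :
    IsShortExact (homOfCocycle (coneInl f hf) (isCocycle_coneInl f hf))
      (homOfCocycle (M := cone f hf) (N := L) (coneBd f hf) (isCocycle_coneBd f hf)) :=
  fun _ p => ⟨hv_coneInl_injective f hf, exact_coneInl_coneBd f hf (add_zero p),
    hv_coneBd_surjective f hf (add_zero p)⟩

variable (M) in
/-- The identity, as a morphism of degree `m` from the shift of a module. -/
def shiftDown (m : ℤ) : (homComplex (M.shift m) M).X m :=
  mkHom (fun a p q hpq => hv (show p + m + 0 = q by lia) (idHom M))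
    fun a b p r s p' s' hp hr hs hr' y c => hv_act (idHom M) (show p + m + 0 = p' by lia)
      (show p + m + r = s + m by lia) (show s + m + 0 = s' by lia) hr' y c

variable (M) in
/-- The identity, as a morphism of degree `-m` to the shift of a module. -/
def shiftUp (m : ℤ) : (homComplex M (M.shift m)).X (-m) :=
  mkHom (fun a p q hpq => hv (show p + 0 = q + m by lia) (idHom M))
    fun a b p r s p' s' hp hr hs hr' y c => hv_act (idHom M) (show p + 0 = p' + m by lia)
      hr (show s + 0 = s' + m by lia) (show p' + m + r = s' + m by lia) y c

theorem hv_shiftUp {m : ℤ} {a : 𝒜.Obj} {p q : ℤ} (hpq : p + -m = q) (y : (M.obj a).X p) :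
    hv hpq (shiftUp M m) y = hv (show p + 0 = q + m by lia) (idHom M) y := rfl

theorem isCocycle_shiftDown (m : ℤ) : IsCocycle (homComplex (M.shift m) M) (shiftDown M m) := by
  refine isCocycle_hom_iff.2 fun a p q p' q' hpq hp hq y => ?_
  have e := shift_d M m hp y
  refine Eq.trans ?_ (congrArg (fun t => koszulSign k m • hv hq (shiftDown M m) t) e.symm)
  refine Eq.trans ?_ (congrArg (fun t => koszulSign k m • t)
    (map_smul (hv (show p' + m + 0 = q' by lia) (idHom M)) _ _).symm)
  rw [smul_smul, koszulSign_mul_self, one_smul]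
  exact d_hv_id (show p + m + 0 = q by lia) (show p + m + 1 = p' + m by lia)
    (show p' + m + 0 = q' by lia) y

theorem isCocycle_shiftUp (m : ℤ) : IsCocycle (homComplex M (M.shift m)) (shiftUp M m) := by
  refine isCocycle_hom_iff.2 fun a p q p' q' hpq hp hq y => ?_
  refine (shift_d M m (show q + 1 = q' by lia) (hv (show p + 0 = q + m by lia) (idHom M) y)).trans ?_
  rw [koszulSign_neg, d_hv_id _ hp (show p' + 0 = q' + m by lia)]
  rfl

theorem shiftUp_shiftDown (m : ℤ) :
    homComp (neg_add_cancel m) (shiftUp M m) (shiftDown M m) = idHom (M.shift m) := by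
  refine hom_ext' fun a p q hpq y => ?_
  obtain rfl : p = q := by lia
  rw [hv_comp _ _ _ rfl (show p + m + -m = p by lia), hv_id, hv_shiftUp]
  exact (hv_hv_id (idHom M) (show p + m + 0 = p + m by lia) (show p + m + 0 = p + m by lia) y).trans
    (hv_id y)

theorem shiftDown_shiftUp (m : ℤ) :
    homComp (add_neg_cancel m) (shiftDown M m) (shiftUp M m) = idHom M := by
  refine hom_ext' fun a p q hpq y => ?_
  obtain rfl : p = q := by lia
  rw [hv_comp _ _ _ rfl (show p + -m + m = p by lia), hv_id]
  exact (hv_hv_id (idHom M) (show p + 0 = p + -m + m by lia) (show p + -m + m + 0 = p by lia) y).trans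
    (hv_id y)

/-- A closed morphism with a closed inverse is a quasi-isomorphism. -/
theorem isQI_of_inverse {n n' : ℤ} {f : (homComplex L M).X n} {g : (homComplex M L).X n'}
    (hg : IsCocycle (homComplex M L) g) (h : n' + n = 0)
    (hgf : homComp h g f = idHom L) (hfg : homComp (show n + n' = 0 by lia) f g = idHom M) :
    IsQI f := by
  have hgf' : ∀ {a : 𝒜.Obj} {p q : ℤ} (h1 : p + n = q) (h2 : q + n' = p) (z : (L.obj a).X p),
      hv h2 g (hv h1 f z) = z := fun h1 h2 z => by
    rw [← hv_comp h g f h1 h2 (add_zero _), hgf, hv_id]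
  have hfg' : ∀ {a : 𝒜.Obj} {p q : ℤ} (h1 : p + n = q) (h2 : q + n' = p) (z : (M.obj a).X q),
      hv h1 f (hv h2 g z) = z := fun h1 h2 z => by
    rw [← hv_comp (show n + n' = 0 by lia) f g h2 h1 (add_zero _), hfg, hv_id]
  intro a p q hpq
  refine ⟨fun z _ hb => ?_, fun w hw => ⟨hv (show q + n' = p by lia) g w, isCocycle_hv hg _ hw, ?_⟩⟩
  · rw [← hgf' hpq (show q + n' = p by lia) z]
    exact isBd_hv hg _ hb
  · rw [hfg', sub_self]
    exact isBd_zero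

theorem isQI_shiftDown (m : ℤ) : IsQI (shiftDown M m) :=
  isQI_of_inverse (isCocycle_shiftUp m) _ (shiftUp_shiftDown m)
    (shiftDown_shiftUp m)

theorem isQI_shiftUp (m : ℤ) : IsQI (shiftUp M m) :=
  isQI_of_inverse (isCocycle_shiftDown m) (add_neg_cancel m)
    (shiftDown_shiftUp m) (shiftUp_shiftDown m)

namespace IsThick

variable {T : DGModule.{w} 𝒜 → Prop} (hT : IsThick T)

include hT

/-- The cone is acyclic, and the two outer closure properties of short exact sequences compare `L`
with `M`. As `f` has degree `1`, closure under shifts is included. -/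
theorem iff_of_isQI_one {f : (homComplex L M).X 1} (hf : IsCocycle (homComplex L M) f) (hq : IsQI f) :
    T L ↔ T M := by
  have hC := hT.of_isAcyclic _ (isAcyclic_cone_iff (hf := hf).2 hq)
  exact ⟨fun h => hT.left _ _ (isShortExact_cone f hf) hC h,
    fun h => hT.right _ _ (isShortExact_cone f hf) h hC⟩

/-- A thick subcategory is closed under shifts and quasi-isomorphisms. -/
theorem iff_of_isQI {n : ℤ} : ∀ {L M : DGModule.{w} 𝒜} {f : (homComplex L M).X n},
    IsCocycle (homComplex L M) f → IsQI f → (T L ↔ T M) := by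
  induction n using Int.induction_on with
  | zero =>
    intro L M f hf hq
    refine hT.iff_of_isQuasiIso (homOfCocycle f hf) (isQI_toHomComplex_iff.1 ?_)
    rwa [toHomComplex_homOfCocycle]
  | succ n ih =>
    intro L M f hf hq
    exact (ih (isCocycle_comp (show -1 + ((n : ℤ) + 1) = n by lia) (isCocycle_shiftUp 1) hf)
      ((isQI_shiftUp 1).comp hq (isCocycle_shiftUp 1) hf _)).trans
      (hT.iff_of_isQI_one (isCocycle_shiftDown 1) (isQI_shiftDown 1))
  | pred n ih =>
    intro L M f hf hq
    exact (hT.iff_of_isQI_one (isCocycle_shiftDown 1) (isQI_shiftDown 1)).symm.trans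
      (ih (isCocycle_comp (show -(n : ℤ) - 1 + 1 = -n by lia) hf (isCocycle_shiftDown 1))
      (hq.comp (isQI_shiftDown 1) hf (isCocycle_shiftDown 1) _))

theorem of_cone_source {f : (homComplex L M).X 1} (hf : IsCocycle (homComplex L M) f)
    (hC : T (cone f hf)) (hL : T L) : T M := hT.left _ _ (isShortExact_cone f hf) hC hL

theorem of_hv_retract {i : (homComplex L M).X 0} {p : (homComplex M L).X 0}
    (hi : IsCocycle (homComplex L M) i) (hp : IsCocycle (homComplex M L) p)
    (hpi : ∀ (a : 𝒜.Obj) (n : ℤ) (y : (L.obj a).X n), hv (add_zero n) p (hv (add_zero n) i y) = y)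
    (hM : T M) : T L :=
  hT.of_retract ⟨homOfCocycle i hi, homOfCocycle p hp, Hom.ext (funext fun a =>
    HomologicalComplex.hom_ext _ _ fun n => ModuleCat.hom_ext (LinearMap.ext fun y => hpi a n y))⟩ hM

end IsThick

end DGModule

/-! ### Cocycles of semifree modules -/

namespace SemifreeDatum

open DGModule DGCategory

open scoped Classical

variable {k : Type v} [Field k] {𝒞 : DGCategory.{v, o, h} k} {s : 𝒞.Obj}
  (D : SemifreeDatum.{v, o, h, x} 𝒞 s)

theorem frAct_bd_apply_of_le {n m : ℤ} (y : D.X) (hnm : D.deg y + 1 + n = m)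
    (c : (𝒞.Hom s s).X n) {x : D.X} (hx : D.rank y ≤ D.rank x) :
    frAct D.deg hnm (D.bd y) c x = 0 := by
  rw [frAct_apply]
  have : D.bd y x = 0 := by
    by_contra h
    exact (D.rank_lt y x h).not_ge hx
  rw [this]
  exact LinearMap.map_zero₂ _ _

/-- Boundaries only involve cells of smaller rank, so at a cell of maximal rank the coefficient is
differentiated on its own. -/
theorem frD_apply_of_le {n m : ℤ} (hnm : n + 1 = m) (z : Fr s D.deg s n) (x : D.X)
    (hz : ∀ y, z y ≠ 0 → D.rank y ≤ D.rank x) :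
    frD D.bd s hnm z x =
      koszulSign k (D.deg x) • ((𝒞.Hom s s).d (n - D.deg x) (m - D.deg x)).hom (z x) := by
  have e : frD D.bd s hnm z = ∑ y ∈ z.support, frD D.bd s hnm (DFinsupp.single y (z y)) := by
    rw [← map_sum]
    exact congrArg _ (DFinsupp.sum_single (f := z)).symm
  rw [e, DFinsupp.finsetSum_apply]
  have e2 : ∀ y ∈ z.support, frD D.bd s hnm (DFinsupp.single y (z y)) x =
      (DFinsupp.single y (koszulSign k (D.deg y) •
        ((𝒞.Hom s s).d (n - D.deg y) (m - D.deg y)).hom (z y)) : Fr s D.deg s m) x := by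
    intro y hy
    rw [frD_single, DFinsupp.add_apply, frAct_bd_apply_of_le D y _ _ (hz y (by simpa using hy)),
      zero_add, DFinsupp.single_smul]
  rw [Finset.sum_congr rfl e2, Finset.sum_eq_single x]
  · exact DFinsupp.single_eq_same
  · exact fun y _ hyx => DFinsupp.single_eq_of_ne hyx.symm
  · intro hx
    have : z x = 0 := by simpa using hx
    rw [this, map_zero, smul_zero, DFinsupp.single_zero]
    rfl

/-- Induction on cocycles of a semifree module: only the cells whose endomorphisms have
cohomology in the relevant degree matter, provided that they have no boundary. -/
theorem cocycle_induction {n : ℤ} {p : ((module.{w} D).obj s).X n → Prop}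
    (hbd : ∀ z, IsBd ((module.{w} D).obj s) z → p z) (hadd : ∀ z z', p z → p z' → p (z + z'))
    (hcell : ∀ x, HZero (𝒞.Hom s s) (n - D.deg x) ∨ D.bd x = 0 ∧
      ∀ c : (𝒞.Hom s s).X (n - D.deg x), IsCocycle (𝒞.Hom s s) c →
        p (el.{w} D (DFinsupp.single x c)))
    (z : ((module.{w} D).obj s).X n) (hz : IsCocycle ((module.{w} D).obj s) z) : p z := by
  obtain ⟨z, rfl⟩ := (el.{w} D).surjective z
  obtain ⟨r, hr⟩ : ∃ r, ∀ x, z x ≠ 0 → D.rank x < r :=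
    ⟨z.support.sup D.rank + 1, fun x hx => Nat.lt_succ_of_le
      (Finset.le_sup (f := D.rank) (by simpa using hx))⟩
  have hp0 : p 0 := hbd _ isBd_zero
  induction r generalizing z with
  | zero =>
    obtain rfl : z = 0 := DFinsupp.ext fun x => by
      by_contra h
      exact absurd (hr x h) (Nat.not_lt_zero _)
    rwa [map_zero]
  | succ r ih =>
    have hzd : frD D.bd s rfl z = 0 := by
      have := hz (n + 1)
      rwa [el_d D rfl, LinearEquiv.map_eq_zero_iff] at this
    have key : ∀ x, ∃ u : Fr s D.deg s n, D.rank x = r →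
        p (el.{w} D u) ∧ IsCocycle ((module.{w} D).obj s) (el.{w} D u) ∧
        ∀ y, r ≤ D.rank y → u y = (DFinsupp.single x (z x) : Fr s D.deg s n) y := by
      intro x
      by_cases hx : D.rank x = r
      swap
      · exact ⟨0, fun h => (hx h).elim⟩
      have hc : IsCocycle (𝒞.Hom s s) (z x) := by
        refine isCocycle_of (show n - D.deg x + 1 = n + 1 - D.deg x by lia) ?_
        have := D.frD_apply_of_le rfl z x fun y hy => hx ▸ Nat.le_of_lt_succ (hr y hy)
        rw [hzd] at this
        exact (smul_eq_zero.1 this.symm).resolve_left (koszulSign_ne_zero _)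
      -- The coefficient at a cell of top rank is a cocycle, and the aim is an element satisfying
      -- `p` with the same top coefficient. Either this coefficient is some `de`, and the boundary
      -- of `x · e` serves, its other terms having smaller rank; or `x` has no boundary and `x · z
      -- x` is itself closed.
      rcases hcell x with h | ⟨hb, hpx⟩
      · obtain ⟨e, he⟩ := (h _ hc).out (show n - 1 - D.deg x + 1 = n - D.deg x by lia)
        have hu : IsBd ((module.{w} D).obj s) (el.{w} D (koszulSign k (D.deg x) •
            frD D.bd s (sub_add_cancel n 1) (DFinsupp.single x e))) := by
          rw [map_smul, ← el_d]
          exact (isBd_d _).smul _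
        refine ⟨_, fun _ => ⟨hbd _ hu, hu.isCocycle, fun y hy => ?_⟩⟩
        rw [frD_single, he, smul_add, smul_smul, koszulSign_mul_self, one_smul, DFinsupp.add_apply,
          DFinsupp.smul_apply, D.frAct_bd_apply_of_le x _ _ (hx ▸ hy), smul_zero, zero_add]
      · refine ⟨DFinsupp.single x (z x), fun _ => ⟨hpx _ hc, isCocycle_of rfl ?_, fun y _ => rfl⟩⟩
        rw [el_d D rfl, frD_single, hb, map_zero, LinearMap.zero_apply, zero_add, hc,
          DFinsupp.single_zero, smul_zero, map_zero]
    choose u hu using key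
    let S := z.support.filter fun x => D.rank x = r
    have hS : ∀ x ∈ S, D.rank x = r := fun x hx => (Finset.mem_filter.1 hx).2
    have hsum : p (el.{w} D (∑ x ∈ S, u x)) := by
      rw [map_sum]
      exact Finset.sum_induction _ p hadd hp0 fun x hx => (hu x (hS x hx)).1
    have hsumc : IsCocycle ((module.{w} D).obj s) (el.{w} D (∑ x ∈ S, u x)) := fun m => by
      rw [map_sum, map_sum]
      exact Finset.sum_eq_zero fun x hx => (hu x (hS x hx)).2.1 m
    have := ih (z - ∑ x ∈ S, u x) (by rw [map_sub]; exact hz.sub hsumc) fun y hy => ?_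
    · have := hadd _ _ this hsum
      rwa [← map_add, sub_add_cancel] at this
    · by_contra hyr
      refine hy ?_
      rw [DFinsupp.sub_apply, DFinsupp.finsetSum_apply,
        Finset.sum_congr rfl fun x hx => (hu x (hS x hx)).2.2 y (not_lt.1 hyr), sub_eq_zero]
      by_cases hyS : y ∈ S
      · rw [Finset.sum_eq_single y (fun x _ hxy => DFinsupp.single_eq_of_ne hxy.symm)
          fun h => (h hyS).elim]
        exact (show (DFinsupp.single y (z y) : Fr s D.deg s n) y = z y from
          DFinsupp.single_eq_same).symm
      · rw [Finset.sum_eq_zero fun x hx => show (DFinsupp.single x (z x) : Fr s D.deg s n) y = 0 from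
          DFinsupp.single_eq_of_ne (by rintro rfl; exact hyS hx)]
        by_contra h0
        exact hyS (Finset.mem_filter.2 ⟨by simpa using h0,
          le_antisymm (Nat.le_of_lt_succ (hr y h0)) (not_lt.1 hyr)⟩)

end SemifreeDatum

namespace DGModule

open DGCategory SemifreeDatum

/-! ### Modules with cohomology in a single degree over a dg category with an object whose
endomorphisms have no cohomology in positive degrees -/

variable {k : Type v} [Field k] {𝒞 : DGCategory.{v, o, h} k} {s : 𝒞.Obj}

/-- Endomorphisms of `s` have no positive cohomology, so cells of degree `≤ b` create none above
`b`. In degree `b` only cells with values in the orbit of `y` are attached, and below all cells that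
make `p` injective on cohomology. What remains is the submodule of `H^b(N)` generated by `y`: a
truncation for the natural t-structure. -/
theorem exists_cyclic_truncation (N : DGModule.{max h w} 𝒞)
    (hpos : ∀ n > 0, HZero (𝒞.Hom s s) n) {b : ℤ} (hN : ∀ n < b, HZero (N.obj s) n)
    {y : (N.obj s).X b} (hy : IsCocycle (N.obj s) y) :
    ∃ (Q : DGModule.{max h w} 𝒞) (p : (homComplex Q N).X 0), IsCocycle (homComplex Q N) p ∧
      (∀ n ≠ b, HZero (Q.obj s) n) ∧
      (∀ z : (Q.obj s).X b, IsCocycle (Q.obj s) z → IsBd (N.obj s) (hv (add_zero b) p z) →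
        IsBd (Q.obj s) z) ∧
      (∀ z : (Q.obj s).X b, IsCocycle (Q.obj s) z → ∃ c : (𝒞.Hom s s).X 0,
        IsCocycle (𝒞.Hom s s) c ∧
        IsBd (N.obj s) (hv (add_zero b) p z - N.act (add_zero b) y c)) ∧
      ∃ z : (Q.obj s).X b, IsCocycle (Q.obj s) z ∧ hv (add_zero b) p z = y := by
  let Gen : ∀ n, Set ((N.obj s).X n) := fun n => {m | ∃ c : (𝒞.Hom s s).X (n - b),
    IsCocycle (𝒞.Hom s s) c ∧ m = N.act (show b + (n - b) = n by lia) y c}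
  obtain ⟨D, p, hp, hI, hD, hinj, hsurj⟩ := exists_semifree.{w} s (Set.Iic b) (Set.Iio b) N Gen
    fun n => ⟨0, isCocycle_zero, (map_zero (N.act (show b + (n - b) = n by lia) y)).symm⟩
  have hinj' : ∀ {i n : ℤ}, i + 1 = n → n ≤ b → ∀ z : ((module.{w} D).obj s).X n,
      IsCocycle ((module.{w} D).obj s) z → IsBd (N.obj s) (hv (add_zero n) p z) →
      IsBd ((module.{w} D).obj s) z := by
    rintro i n rfl hn z hz hb
    obtain ⟨m, hm⟩ := hb.out rfl
    obtain ⟨e, he⟩ := hinj i (show i ≤ b by lia) (show i < b by lia) z m hz hm.symm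
    exact ⟨i, e, he⟩
  refine ⟨module.{w} D, p, hp, fun n hn => ?_, hinj' (sub_add_cancel b 1) le_rfl, ?_, ?_⟩
  · rcases hn.lt_or_gt with hn | hn
    · exact fun z hz => hinj' (sub_add_cancel n 1) hn.le z hz (hN n hn _ (isCocycle_hv hp _ hz))
    · refine D.cocycle_induction (fun _ => id) (fun _ _ => IsBd.add) fun x => .inl (hpos _ ?_)
      have := Set.mem_Iic.1 (hI x)
      lia
  · refine D.cocycle_induction (fun z hz => ⟨0, isCocycle_zero, ?_⟩) ?_ fun x => ?_
    · rw [map_zero, sub_zero]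
      exact isBd_hv hp _ hz
    · rintro z z' ⟨c, hc, hb⟩ ⟨c', hc', hb'⟩
      refine ⟨c + c', hc.add hc', ?_⟩
      have := hb.add hb'
      rwa [← add_sub_add_comm, ← map_add, ← map_add] at this
    · rcases hD x with hx | ⟨hx, c, hc, hxc⟩
      · have := Set.mem_Iio.1 hx
        exact .inl (hpos _ (by lia))
      · refine .inr ⟨hx, fun c' hc' => ⟨𝒞.comp (show D.deg x - b + (b - D.deg x) = 0 by lia) c c',
          (representable 𝒞 s).isCocycle_act (a := s) (b := s) _ hc hc', ?_⟩⟩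
        rw [← gen_act, hv_act p (add_zero _) _ _ (show D.deg x + (b - D.deg x) = b by lia), hxc,
          N.act_act _ (show D.deg x - b + (b - D.deg x) = 0 by lia) _ (add_zero b), sub_self]
        exact isBd_zero
  · obtain ⟨x, hx, hb, hxy⟩ := hsurj b (Set.mem_Iic.2 le_rfl) y hy
      (.inr ⟨𝒞.idAt s (sub_self b), isCocycle_idAt 𝒞 s _, (act_idAt 𝒞 N (sub_self b) _ y).symm⟩)
    have hgen : IsCocycle ((module.{w} D).obj s) (gen.{w} D x) := isCocycle_of rfl (by
      rw [gen_d, hb, map_zero])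
    have aux : ∀ {c : ℤ} (hc : b = c) (g : ((module.{w} D).obj s).X c),
        IsCocycle ((module.{w} D).obj s) g → hv (add_zero c) p g = hc ▸ y →
        ∃ z : ((module.{w} D).obj s).X b, IsCocycle ((module.{w} D).obj s) z ∧
          hv (add_zero b) p z = y := by
      rintro _ rfl g hg hgy
      exact ⟨g, hg, hgy⟩
    exact aux hx _ hgen hxy

end DGModule

/-! ### Biproducts, and pieces of the lowest cohomology -/

namespace DGModule

section Biproduct

variable {k : Type v} [Field k] {𝒜 : DGCategory.{v, o, h} k}

/-- The cone of the zero morphism of degree `1`, for which no shift of `L` occurs. -/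
theorem exists_biproduct (M L : DGModule.{w} 𝒜) :
    ∃ (Y : DGModule.{w} 𝒜) (i₁ : (homComplex M Y).X 0) (i₂ : (homComplex L Y).X 0)
      (p₁ : (homComplex Y M).X 0) (p₂ : (homComplex Y L).X 0),
      IsCocycle _ i₁ ∧ IsCocycle _ i₂ ∧ IsCocycle _ p₁ ∧ IsCocycle _ p₂ ∧
      ∀ (a : 𝒜.Obj) (n : ℤ),
        (∀ y : (M.obj a).X n, hv (add_zero n) p₁ (hv (add_zero n) i₁ y) = y ∧
          hv (add_zero n) p₂ (hv (add_zero n) i₁ y) = 0) ∧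
        (∀ x : (L.obj a).X n, hv (add_zero n) p₁ (hv (add_zero n) i₂ x) = 0 ∧
          hv (add_zero n) p₂ (hv (add_zero n) i₂ x) = x) ∧
        ∀ z : (Y.obj a).X n, hv (add_zero n) i₁ (hv (add_zero n) p₁ z) +
          hv (add_zero n) i₂ (hv (add_zero n) p₂ z) = z := by
  obtain ⟨f, h0⟩ : ∃ f : (homComplex L M).X 1, f = 0 := ⟨0, rfl⟩
  have hf : IsCocycle (homComplex L M) f := h0 ▸ isCocycle_zero
  have aux : ∀ {j : ℤ} (hj : 1 - 1 = j), ∃ (i₂ : (homComplex L (cone f hf)).X j)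
      (p₂ : (homComplex (cone f hf) L).X j), IsCocycle _ i₂ ∧ IsCocycle _ p₂ ∧
      ∀ (a : 𝒜.Obj) (n : ℤ) (hn : n + j = n),
        (∀ y : (M.obj a).X n, hv hn p₂ (hv (add_zero n) (coneInl f hf) y) = 0) ∧
        (∀ x : (L.obj a).X n, hv (add_zero n) (conePr f hf) (hv hn i₂ x) = 0 ∧ hv hn p₂ (hv hn i₂ x) = x) ∧
        ∀ z : ((cone f hf).obj a).X n, hv (add_zero n) (coneInl f hf) (hv (add_zero n)
          (conePr f hf) z) + hv hn i₂ (hv hn p₂ z) = z := by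
    rintro _ rfl
    refine ⟨coneLift f hf (show (0 : ℤ) = 1 - 1 + 1 - 1 by lia) 0 (idHom L), coneBd f hf,
      isCocycle_coneLift_of_eq_zero h0 _ isCocycle_zero isCocycle_id, isCocycle_coneBd f hf,
      fun a n hn => ?_⟩
    have hBd : ∀ z : ((cone f hf).obj a).X n, hv hn (coneBd f hf) z =
        hv (show n + 1 - 1 + 0 = n by lia) (idHom L) (coneSnd f hf z) := fun z => by
      rw [coneBd, hv_coneDesc, map_zero, LinearMap.zero_apply, zero_add]
    refine ⟨fun y => ?_, fun x => ⟨?_, ?_⟩, fun z => cone_ext f hf ?_ ?_⟩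
    · rw [hBd, hv_coneInl, coneSnd_mk, map_zero]
    · rw [hv_coneLift, hv_conePr, coneFst_mk, map_zero, LinearMap.zero_apply]
    · rw [hBd, hv_coneLift, coneSnd_mk, hv_hv_id, hv_id]
    · rw [map_add, hv_coneInl, hv_coneLift, hv_conePr, coneFst_mk, coneFst_mk, map_zero,
        LinearMap.zero_apply, add_zero]
    · rw [map_add, hv_coneInl, hv_coneLift, coneSnd_mk, coneSnd_mk, hBd, hv_hv_id, hv_id, zero_add]
  obtain ⟨i₂, p₂, hi₂, hp₂, H⟩ := aux (sub_self 1)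
  refine ⟨cone f hf, coneInl f hf, i₂, conePr f hf, p₂, isCocycle_coneInl f hf, hi₂,
    isCocycle_conePr_of_eq_zero h0, hp₂, fun a n => ⟨fun y => ⟨?_, (H a n _).1 y⟩, (H a n _).2.1,
    (H a n _).2.2⟩⟩
  rw [hv_coneInl, hv_conePr, coneFst_mk]

end Biproduct

variable {k : Type v} [Field k] {𝒞 : DGCategory.{v, o, h} k} {s : 𝒞.Obj}

/-- The cone of `f` has no cohomology at `s`, hence is acyclic. -/
theorem isQI_of_detect (hdet : ∀ M : DGModule.{w} 𝒞, (∀ n, HZero (M.obj s) n) → M.IsAcyclic)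
    {M N : DGModule.{w} 𝒞} {f : (homComplex M N).X 0} (hf : IsCocycle (homComplex M N) f)
    (H : ∀ n, (∀ z : (M.obj s).X n, IsCocycle (M.obj s) z → IsBd (N.obj s) (hv (add_zero n) f z) →
        IsBd (M.obj s) z) ∧
      ∀ y : (N.obj s).X n, IsCocycle (N.obj s) y → ∃ z : (M.obj s).X n, IsCocycle (M.obj s) z ∧
        IsBd (N.obj s) (hv (add_zero n) f z - y)) : IsQI f :=
  (isAcyclic_cone_iff (hf := hf)).1 (hdet _ fun n => hZero_cone (hf := hf) (q := n) (r := n + 1)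
    (add_zero n) rfl (add_zero (n + 1)) (H (n + 1)).1 (H n).2)

/-- A part of the lowest cohomology of `N`, generated by one element, which is a direct summand of
the cohomology of `E` can be realized in the thick subcategory generated by `E`. -/
theorem IsThick.exists_piece {T : DGModule.{max h w} 𝒞 → Prop} (hT : IsThick T)
    (hdet : ∀ M : DGModule.{max h w} 𝒞, (∀ n, HZero (M.obj s) n) → M.IsAcyclic)
    (hpos : ∀ n > 0, HZero (𝒞.Hom s s) n) {N E : DGModule.{max h w} 𝒞} {b : ℤ} (hE : T E)
    (hE0 : ∀ n ≠ b, HZero (E.obj s) n) (hN : ∀ n < b, HZero (N.obj s) n) {y : (N.obj s).X b}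
    (hy : IsCocycle (N.obj s) y) {x x' : (E.obj s).X b} (hx : IsCocycle (E.obj s) x)
    (hx' : IsCocycle (E.obj s) x')
    (hgen : ∀ e : (E.obj s).X b, IsCocycle (E.obj s) e → ∃ c c' : (𝒞.Hom s s).X 0,
      IsCocycle (𝒞.Hom s s) c ∧ IsCocycle (𝒞.Hom s s) c' ∧
      IsBd (E.obj s) (E.act (add_zero b) x c + E.act (add_zero b) x' c' - e))
    (hdir : ∀ c c' : (𝒞.Hom s s).X 0, IsCocycle (𝒞.Hom s s) c → IsCocycle (𝒞.Hom s s) c' →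
      IsBd (E.obj s) (E.act (add_zero b) x c + E.act (add_zero b) x' c') →
      IsBd (E.obj s) (E.act (add_zero b) x c))
    (hxy : ∀ c : (𝒞.Hom s s).X 0, IsCocycle (𝒞.Hom s s) c →
      (IsBd (E.obj s) (E.act (add_zero b) x c) ↔ IsBd (N.obj s) (N.act (add_zero b) y c))) :
    ∃ (K : DGModule.{max h w} 𝒞) (f : (homComplex K N).X 0), IsCocycle (homComplex K N) f ∧ T K ∧
      (∀ n ≠ b, HZero (K.obj s) n) ∧
      (∀ z : (K.obj s).X b, IsCocycle (K.obj s) z → IsBd (N.obj s) (hv (add_zero b) f z) →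
        IsBd (K.obj s) z) ∧
      ∃ z : (K.obj s).X b, IsCocycle (K.obj s) z ∧ hv (add_zero b) f z = y := by
  obtain ⟨Y, i₁, i₂, p₁, p₂, hi₁, hi₂, hp₁, hp₂, H⟩ := exists_biproduct N E
  have hw : IsCocycle (Y.obj s) (hv (add_zero b) i₁ y + hv (add_zero b) i₂ x) :=
    (isCocycle_hv hi₁ _ hy).add (isCocycle_hv hi₂ _ hx)
  have hw₁ : hv (add_zero b) p₁ (hv (add_zero b) i₁ y + hv (add_zero b) i₂ x) = y := by
    rw [map_add, ((H s b).1 y).1, ((H s b).2.1 x).1, add_zero]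
  have hw₂ : hv (add_zero b) p₂ (hv (add_zero b) i₁ y + hv (add_zero b) i₂ x) = x := by
    rw [map_add, ((H s b).1 y).2, ((H s b).2.1 x).2, zero_add]
  generalize hv (add_zero b) i₁ y + hv (add_zero b) i₂ x = u at hw hw₁ hw₂
  have hYbd : ∀ {n : ℤ} (z : (Y.obj s).X n), IsBd (N.obj s) (hv (add_zero n) p₁ z) →
      IsBd (E.obj s) (hv (add_zero n) p₂ z) → IsBd (Y.obj s) z := fun z h₁ h₂ => by
    rw [← (H s _).2.2 z]
    exact (isBd_hv hi₁ _ h₁).add (isBd_hv hi₂ _ h₂)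
  -- `K` realises the submodule generated by `(y, x)` in the lowest cohomology of `N ⊕ E`. As `x`
  -- and `y` have the same annihilator, both projections are injective on it.
  obtain ⟨K, p, hp, hK0, hKinj, hKact, u', hu', hpu⟩ := exists_cyclic_truncation.{w} Y hpos
    (fun n hn z hz => hYbd z (hN n hn _ (isCocycle_hv hp₁ _ hz))
      (hE0 n hn.ne _ (isCocycle_hv hp₂ _ hz))) hw
  obtain ⟨L, q, hq, hL0, hLinj, hLact, t', ht', hqt⟩ := exists_cyclic_truncation.{w} E hpos
    (fun n hn => hE0 n hn.ne) hx'
  have hf := isCocycle_comp (add_zero 0) hp₁ hp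
  have hfp : ∀ {n : ℤ} (z : (K.obj s).X n), hv (add_zero n) (homComp (add_zero 0) p₁ p) z =
      hv (add_zero n) p₁ (hv (add_zero n) p z) := fun z => hv_comp _ _ _ _ _ _ z
  have hpz : ∀ z : (K.obj s).X b, IsCocycle (K.obj s) z → ∃ c : (𝒞.Hom s s).X 0,
      IsCocycle (𝒞.Hom s s) c ∧
      IsBd (N.obj s) (hv (add_zero b) p₁ (hv (add_zero b) p z) - N.act (add_zero b) y c) ∧
      IsBd (E.obj s) (hv (add_zero b) p₂ (hv (add_zero b) p z) - E.act (add_zero b) x c) := by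
    intro z hz
    obtain ⟨c, hc, hb⟩ := hKact z hz
    have h₁ := isBd_hv hp₁ (add_zero b) hb
    have h₂ := isBd_hv hp₂ (add_zero b) hb
    rw [map_sub, hv_act p₁ (add_zero b) _ _ (add_zero b), hw₁] at h₁
    rw [map_sub, hv_act p₂ (add_zero b) _ _ (add_zero b), hw₂] at h₂
    exact ⟨c, hc, h₁, h₂⟩
  refine ⟨K, homComp (add_zero 0) p₁ p, hf, ?_, hK0, fun z hz hb => ?_, u', hu', by
    rw [hfp, hpu, hw₁]⟩
  -- With `L` realising the submodule generated by `x'`, the map `K ⊕ L → E` is a quasi-isomorphism: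
  -- onto by `hgen`, injective by `hdir` and `hxy`. So `K ⊕ L` lies in `T`, and with it the retract
  -- `K`.
  · obtain ⟨S, j₁, j₂, r₁, r₂, hj₁, hj₂, hr₁, hr₂, HS⟩ := exists_biproduct K L
    refine hT.of_hv_retract hj₁ hr₁ (fun a n y => ((HS a n).1 y).1) ?_
    have hθ : IsCocycle (homComplex S E) (homComp (add_zero 0) (homComp (add_zero 0) p₂ p) r₁ +
        homComp (add_zero 0) q r₂) :=
      (isCocycle_comp _ (isCocycle_comp _ hp₂ hp) hr₁).add (isCocycle_comp _ hq hr₂)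
    have hθz : ∀ {n : ℤ} (z : (S.obj s).X n), hv (add_zero n)
        (homComp (add_zero 0) (homComp (add_zero 0) p₂ p) r₁ + homComp (add_zero 0) q r₂) z =
        hv (add_zero n) p₂ (hv (add_zero n) p (hv (add_zero n) r₁ z)) +
          hv (add_zero n) q (hv (add_zero n) r₂ z) := fun z => by
      rw [map_add, LinearMap.add_apply, hv_comp _ _ _ (add_zero _) (add_zero _),
        hv_comp _ _ _ (add_zero _) (add_zero _), hv_comp _ _ _ (add_zero _) (add_zero _)]
    have hSbd : ∀ {n : ℤ} (z : (S.obj s).X n), IsBd (K.obj s) (hv (add_zero n) r₁ z) →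
        IsBd (L.obj s) (hv (add_zero n) r₂ z) → IsBd (S.obj s) z := fun z h₁ h₂ => by
      rw [← (HS s _).2.2 z]
      exact (isBd_hv hj₁ _ h₁).add (isBd_hv hj₂ _ h₂)
    refine (hT.iff_of_isQI hθ (isQI_of_detect hdet hθ fun n => ?_)).2 hE
    by_cases hn : n = b
    · subst hn
      refine ⟨fun z hz hb => ?_, fun e he => ?_⟩
      · rw [hθz] at hb
        obtain ⟨c, hc, h₁, h₂⟩ := hpz _ (isCocycle_hv hr₁ _ hz)
        obtain ⟨c', hc', h₃⟩ := hLact _ (isCocycle_hv hr₂ _ hz)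
        have h₄ := h₂.add h₃
        rw [← add_sub_add_comm] at h₄
        have h₅ := hdir c c' hc hc' ((isBd_iff_of_sub h₄).1 hb)
        have h₆ := (isBd_iff_of_sub h₁).2 ((hxy c hc).1 h₅)
        have h₇ := (isBd_iff_of_sub h₂).2 h₅
        refine hSbd z (hKinj _ (isCocycle_hv hr₁ _ hz) (hYbd _ h₆ h₇))
          (hLinj _ (isCocycle_hv hr₂ _ hz) ?_)
        have := hb.sub h₇
        rwa [add_sub_cancel_left] at this
      · obtain ⟨c, c', hc, hc', hb⟩ := hgen e he
        refine ⟨hv (add_zero n) j₁ (K.act (add_zero n) u' c) +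
          hv (add_zero n) j₂ (L.act (add_zero n) t' c'),
          (isCocycle_hv hj₁ _ (K.isCocycle_act _ hu' hc)).add
            (isCocycle_hv hj₂ _ (L.isCocycle_act _ ht' hc')), ?_⟩
        rw [hθz, map_add (hv (add_zero n) r₁), ((HS s n).1 _).1, ((HS s n).2.1 _).1, add_zero,
          map_add (hv (add_zero n) r₂), ((HS s n).1 _).2, ((HS s n).2.1 _).2, zero_add,
          hv_act p (add_zero n) _ _ (add_zero n), hpu, hv_act p₂ (add_zero n) _ _ (add_zero n), hw₂, hv_act q (add_zero n) _ _ (add_zero n), hqt]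
        exact hb
    · exact ⟨fun z hz _ => hSbd z (hK0 n hn _ (isCocycle_hv hr₁ _ hz))
        (hL0 n hn _ (isCocycle_hv hr₂ _ hz)), fun e he => ⟨0, isCocycle_zero, by
          rw [map_zero, zero_sub]
          exact (hE0 n hn e he).neg⟩⟩
  · rw [hfp] at hb
    obtain ⟨c, hc, h₁, h₂⟩ := hpz z hz
    exact hKinj z hz (hYbd _ hb ((isBd_iff_of_sub h₂).2 ((hxy c hc).2 ((isBd_iff_of_sub h₁).1 hb))))

end DGModule

/-! ### Dévissage along the lowest cohomology -/

namespace DGModule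

variable {k : Type v} [Field k]

section Cone

variable {𝒜 : DGCategory.{v, o, h} k} {L M : DGModule.{w} 𝒜} {n : ℤ} {a : 𝒜.Obj}

/-- The map from the cohomology of `M` to that of the cone of a morphism to `M`. -/
def hnConeInl (f : (homComplex L M).X n) (hf : IsCocycle (homComplex L M) f) (a : 𝒜.Obj) (p : ℤ) :
    Hn (M.obj a) p →ₗ[k] Hn ((cone f hf).obj a) p :=
  hnMap (hv (add_zero p) (coneInl f hf)) (fun _ hx => isCocycle_hv (isCocycle_coneInl f hf) _ hx)
    fun _ hx => isBd_hv (isCocycle_coneInl f hf) _ hx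

variable {f : (homComplex L M).X n} {hf : IsCocycle (homComplex L M) f}

theorem isBd_hv_hv_coneBd {p q r : ℤ} (hpq : p + (1 - n) = q) (hqr : q + n = r)
    {z : ((cone f hf).obj a).X p} (hz : IsCocycle ((cone f hf).obj a) z) :
    IsBd (M.obj a) (hv hqr f (hv hpq (coneBd f hf) z)) := by
  have h1 := isBd_d (m := 0) (n := 1) (conePr f hf)
  rw [conePr_d] at h1
  have h2 := (isBd_hv_of_isBd h1 (show p + 1 = r by lia) hz).neg
  rwa [map_neg, LinearMap.neg_apply, neg_neg, hv_comp _ f (coneBd f hf) hpq hqr] at h2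

/-- If `f` is injective on cohomology, then the cohomology of `M` surjects onto that of the cone. -/
theorem hnConeInl_surjective (hinj : ∀ (q r : ℤ) (hqr : q + n = r) (l : (L.obj a).X q),
    IsCocycle (L.obj a) l → IsBd (M.obj a) (hv hqr f l) → IsBd (L.obj a) l) (p : ℤ) :
    Function.Surjective (hnConeInl f hf a p) := fun z => by
  obtain ⟨z, hz, rfl⟩ := exists_cls z
  have hpq : p + (1 - n) = p + (1 - n) := rfl
  obtain ⟨y, hy, hyz⟩ := isBd_of_coneBd hpq hz (hinj _ _ rfl _
    (isCocycle_hv (isCocycle_coneBd f hf) hpq hz) (isBd_hv_hv_coneBd hpq rfl hz))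
  refine ⟨clsOf _ y hy, (cls_eq_iff (hx := isCocycle_hv (isCocycle_coneInl f hf) _ hy)
    (hy := hz)).2 ?_⟩
  rw [← neg_sub]
  exact hyz.neg

theorem hnConeInl_hv {p q : ℤ} (hpq : q + n = p) {l : (L.obj a).X q} (hl : IsCocycle (L.obj a) l) :
    hnConeInl f hf a p (clsOf _ (hv hpq f l) (isCocycle_hv hf hpq hl)) = 0 := by
  refine (cls_eq_zero_iff (hx := isCocycle_hv (isCocycle_coneInl f hf) _
    (isCocycle_hv hf hpq hl))).2 ?_
  change IsBd _ (hv (add_zero p) (coneInl f hf) (hv hpq f l))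
  rw [hv_coneInl]
  exact isBd_coneMk_zero hpq hl (by rw [sub_self]; exact isBd_zero)

end Cone

variable {𝒞 : DGCategory.{v, o, h} k} {s : 𝒞.Obj}

/-- A thick subcategory which contains enough pieces of the lowest cohomology of modules contains all
modules with finite dimensional cohomology. -/
theorem IsThick.of_finite {T : DGModule.{w} 𝒞 → Prop} (hT : IsThick T)
    (hdet : ∀ M : DGModule.{w} 𝒞, (∀ n, HZero (M.obj s) n) → M.IsAcyclic)
    (hpiece : ∀ (N : DGModule.{w} 𝒞) (b : ℤ), (∀ n < b, HZero (N.obj s) n) →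
      Module.Finite k (Hn (N.obj s) b) → ¬ HZero (N.obj s) b →
      ∃ (K : DGModule.{w} 𝒞) (f : (homComplex K N).X 0), IsCocycle (homComplex K N) f ∧ T K ∧
        (∀ n ≠ b, HZero (K.obj s) n) ∧
        (∀ z : (K.obj s).X b, IsCocycle (K.obj s) z → IsBd (N.obj s) (hv (add_zero b) f z) →
          IsBd (K.obj s) z) ∧
        ∃ z : (K.obj s).X b, IsCocycle (K.obj s) z ∧ ¬ IsBd (N.obj s) (hv (add_zero b) f z))
    (i j : ℤ) (d : ℕ) : ∀ N : DGModule.{w} 𝒞, (∀ n, Module.Finite k (Hn (N.obj s) n)) →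
      (∀ n, (n < i ∨ j < n) → HZero (N.obj s) n) →
      ∑ n ∈ Finset.Icc i j, Module.finrank k (Hn (N.obj s) n) = d → T N := by
  induction d using Nat.strong_induction_on with
  | _ d ih =>
    intro N hfin hN hd
    by_cases h0 : ∀ n, HZero (N.obj s) n
    · exact hT.of_isAcyclic _ (hdet _ h0)
    push Not at h0
    obtain ⟨b, hb, hmin⟩ := Int.exists_least_of_bdd (P := fun n => ¬ HZero (N.obj s) n)
      ⟨i, fun z hz => not_lt.1 fun h => hz (hN z (.inl h))⟩ h0
    obtain ⟨K, f, hf, hK, hK0, hinj, z, hz, hzb⟩ := hpiece N b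
      (fun n hn => by by_contra h; exact absurd (hmin n h) (not_le.2 hn)) (hfin b) hb
    -- The morphism `f`, regarded as one of degree `1` from the shift of `K`, for which the cone
    -- fits into a short exact sequence of modules.
    have hg := isCocycle_comp (zero_add 1) hf (isCocycle_shiftDown (M := K) 1)
    have hgv : ∀ {q r : ℤ} (hqr : q + 1 = r) (l : ((K.shift 1).obj s).X q),
        hv hqr (homComp (zero_add 1) f (shiftDown K 1)) l =
          hv (add_zero r) f (hv hqr (shiftDown K 1) l) := fun _ _ => hv_comp _ _ _ _ _ _ _
    generalize hge : homComp (zero_add 1) f (shiftDown K 1) = g at hg hgv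
    have hginj : ∀ (q r : ℤ) (hqr : q + 1 = r) (l : ((K.shift 1).obj s).X q),
        IsCocycle ((K.shift 1).obj s) l → IsBd (N.obj s) (hv hqr g l) →
        IsBd ((K.shift 1).obj s) l := by
      intro q r hqr l hl hlb
      refine (isQI_shiftDown 1 s q r hqr).1 l hl ?_
      have hl' := isCocycle_hv (isCocycle_shiftDown 1) hqr hl
      by_cases hr : r = b
      · subst hr
        rw [hgv] at hlb
        exact hinj _ hl' hlb
      · exact hK0 r hr _ hl'
    obtain ⟨l, hl, hlz⟩ := (isQI_shiftDown (M := K) 1 s (b - 1) b (sub_add_cancel b 1)).2 z hz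
    have hlb : ¬ IsBd (N.obj s) (hv (sub_add_cancel b 1) g l) := by
      rw [hgv]
      have := isBd_hv hf (add_zero b) hlz
      rw [map_sub] at this
      exact fun h => hzb ((isBd_iff_of_sub this).1 h)
    -- Since `g` is injective on cohomology, the cohomology of the cone is a quotient of that of
    -- `N`. In degree `b` it is a proper quotient, the class coming from `K` being killed, so the
    -- total dimension drops.
    have hsurj := hnConeInl_surjective (hf := hg) hginj
    refine hT.of_cone_source hg ?_ ((hT.iff_of_isQI (isCocycle_shiftDown 1) (isQI_shiftDown 1)).2 hK)
    refine ih _ ?_ (cone g hg) (fun n => Module.Finite.of_surjective _ (hsurj n))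
      (fun n hn => hZero_iff_subsingleton.2 ?_) rfl
    · rw [← hd]
      refine Finset.sum_lt_sum
        (fun n _ => LinearMap.finrank_le_finrank_of_surjective (hsurj n)) ⟨b, ?_, ?_⟩
      · rw [Finset.mem_Icc]
        exact ⟨not_lt.1 fun h => hb (hN b (.inl h)), not_lt.1 fun h => hb (hN b (.inr h))⟩
      · rw [← LinearMap.finrank_range_add_finrank_ker (hnConeInl g hg s b),
          LinearMap.range_eq_top.2 (hsurj b), finrank_top]
        refine Nat.lt_add_of_pos_right (Module.finrank_pos_iff_exists_ne_zero.2
          ⟨⟨_, LinearMap.mem_ker.2 (hnConeInl_hv (sub_add_cancel b 1) hl)⟩, fun h => ?_⟩)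
        exact hlb ((cls_eq_zero_iff (hx := isCocycle_hv hg (sub_add_cancel b 1) hl)).1
          (congrArg Subtype.val h))
    · have := hZero_iff_subsingleton.1 (hN n hn)
      exact (hsurj n).subsingleton

/-- The map `c ↦ [y · c]` on endomorphisms of degree `0`. -/
def actHn (N : DGModule.{w} 𝒞) {b : ℤ} (y : (N.obj s).X b) (hy : IsCocycle (N.obj s) y) :
    cocycles (𝒞.Hom s s) 0 →ₗ[k] Hn (N.obj s) b :=
  (coboundaries (N.obj s) b).mkQ ∘ₗ
    (N.act (add_zero b) y).restrict (p := cocycles (𝒞.Hom s s) 0) (q := cocycles (N.obj s) b)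
      fun _ hc => N.isCocycle_act (add_zero b) hy (isCocycle_of rfl hc) _

theorem actHn_apply (N : DGModule.{w} 𝒞) {b : ℤ} {y : (N.obj s).X b} (hy : IsCocycle (N.obj s) y)
    {c : (𝒞.Hom s s).X 0} (hc : IsCocycle (𝒞.Hom s s) c) :
    actHn N y hy ⟨c, hc _⟩ =
      clsOf _ (N.act (add_zero b) y c) (N.isCocycle_act (add_zero b) hy hc) := rfl

/-- An element whose multiples by endomorphisms of degree `0` are as few as possible. -/
theorem exists_minimal_generator (N : DGModule.{w} 𝒞) {b : ℤ} (hfin : Module.Finite k (Hn (N.obj s) b))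
    (hb : ¬ HZero (N.obj s) b) :
    ∃ y : (N.obj s).X b, IsCocycle (N.obj s) y ∧ ¬ IsBd (N.obj s) y ∧
      ∀ c : (𝒞.Hom s s).X 0, IsCocycle (𝒞.Hom s s) c →
        ¬ IsBd (N.obj s) (N.act (add_zero b) y c) → ∃ c' : (𝒞.Hom s s).X 0,
          IsCocycle (𝒞.Hom s s) c' ∧
          IsBd (N.obj s) (N.act (add_zero b) y (𝒞.comp (add_zero 0) c c') - y) := by
  simp only [HZero, not_forall] at hb
  obtain ⟨y₀, hy₀, hyb₀⟩ := hb
  let Y := {y : (N.obj s).X b // IsCocycle (N.obj s) y ∧ ¬ IsBd (N.obj s) y}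
  have : Nonempty Y := ⟨⟨y₀, hy₀, hyb₀⟩⟩
  let φ : Y → ℕ := fun y => Module.finrank k (LinearMap.range (actHn N y.1 y.2.1))
  obtain ⟨y, hmin⟩ : ∃ y : Y, ∀ z, φ y ≤ φ z := ⟨Function.argmin φ, fun z => Function.argmin_le φ z⟩
  refine ⟨y.1, y.2.1, y.2.2, fun c hc hyc => ?_⟩
  have hc' := N.isCocycle_act (add_zero b) y.2.1 hc
  have hle : LinearMap.range (actHn N _ hc') ≤ LinearMap.range (actHn N y.1 y.2.1) := by
    rintro _ ⟨⟨c', hcc'⟩, rfl⟩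
    have hcc : IsCocycle (𝒞.Hom s s) (𝒞.comp (add_zero 0) c c') := (representable 𝒞 s).isCocycle_act (a := s) (b := s) (add_zero 0) hc
      (isCocycle_of rfl hcc')
    refine ⟨⟨𝒞.comp (add_zero 0) c c', hcc _⟩, ?_⟩
    rw [actHn_apply N y.2.1 hcc, actHn_apply N hc' (isCocycle_of rfl hcc')]
    refine cls_eq_iff.2 ?_
    rw [N.act_act (add_zero b) (add_zero 0) (add_zero b) (add_zero b)]
    exact (congrArg (IsBd _) (sub_self _)).mpr isBd_zero
  -- The multiples of `y · c` are multiples of `y`, and minimality of the dimension makes the two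
  -- spaces equal. Hence `y` itself is a multiple of `y · c`.
  have heq := Submodule.eq_of_le_of_finrank_le hle (hmin ⟨_, hc', hyc⟩)
  have hmem : clsOf _ y.1 y.2.1 ∈ LinearMap.range (actHn N y.1 y.2.1) := by
    refine ⟨⟨𝒞.id s, 𝒞.isCocycle_id s _⟩, ?_⟩
    rw [actHn_apply N y.2.1 (𝒞.isCocycle_id s)]
    refine cls_eq_iff.2 ?_
    rw [N.act_id, sub_self]
    exact isBd_zero
  rw [← heq] at hmem
  obtain ⟨⟨c', hcc'⟩, h⟩ := hmem
  refine ⟨c', isCocycle_of rfl hcc', ?_⟩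
  rw [actHn_apply N hc' (isCocycle_of rfl hcc'), cls_eq_iff,
    N.act_act (add_zero b) (add_zero 0) (add_zero b) (add_zero b)] at h
  exact h

end DGModule

namespace DGModule

/-! ### Evaluation modules -/

section Evaluation

variable {k : Type v} [Field k] {𝒜 : DGCategory.{v, o, h} k} {ι : Type o₁} (Q : ι → DGModule.{w} 𝒜)
  (a : 𝒜.Obj) {i j : ι} {n : ℤ}

/-- The elements of an evaluation module. -/
def evUp : ((Q i).obj a).X n ≃ₗ[k] ((evaluationModule.{w, u} Q a).obj i).X n :=
  ULift.moduleEquiv.symm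

theorem evUp_d {m : ℤ} (x : ((Q i).obj a).X n) :
    (((evaluationModule.{w, u} Q a).obj i).d n m).hom (evUp.{w, u} Q a x) =
      evUp.{w, u} Q a ((((Q i).obj a).d n m).hom x) := rfl

theorem isCocycle_evUp_iff {x : ((Q i).obj a).X n} :
    IsCocycle ((evaluationModule.{w, u} Q a).obj i) (evUp.{w, u} Q a x) ↔
      IsCocycle ((Q i).obj a) x :=
  forall_congr' fun m => by rw [evUp_d, LinearEquiv.map_eq_zero_iff]

theorem isBd_evUp_iff {x : ((Q i).obj a).X n} :
    IsBd ((evaluationModule.{w, u} Q a).obj i) (evUp.{w, u} Q a x) ↔ IsBd ((Q i).obj a) x := by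
  constructor
  · rintro ⟨m, y, hy⟩
    obtain ⟨y, rfl⟩ := (evUp.{w, u} Q a).surjective y
    exact ⟨m, y, (evUp.{w, u} Q a).injective hy⟩
  · rintro ⟨m, y, rfl⟩
    exact ⟨m, evUp.{w, u} Q a y, rfl⟩

theorem hZero_evaluationModule_iff :
    HZero ((evaluationModule.{w, u} Q a).obj i) n ↔ HZero ((Q i).obj a) n := by
  constructor
  · exact fun H x hx => (isBd_evUp_iff.{w, u} Q a).1 (H _ ((isCocycle_evUp_iff.{w, u} Q a).2 hx))
  · intro H x hx
    obtain ⟨x, rfl⟩ := (evUp.{w, u} Q a).surjective x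
    exact (isBd_evUp_iff.{w, u} Q a).2 (H _ ((isCocycle_evUp_iff.{w, u} Q a).1 hx))

theorem evUp_act {p q : ℤ} (hpq : p + q = n) (x : ((Q i).obj a).X p)
    (φ : (homComplex (Q i) (Q j)).X q) :
    (evaluationModule.{w, u} Q a).opAct (𝒟 := (dgCat.{w} 𝒜).full Q) hpq (evUp.{w, u} Q a x) φ =
      evUp.{w, u} Q a (koszulSign k (p * q) • hv hpq φ x) := rfl

end Evaluation

section Shift

variable {k : Type v} [Field k] {𝒞 : DGCategory.{v, o, h} k} {s : 𝒞.Obj}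

/-- Version of `IsThick.exists_piece` for pieces of a module in degree `0`. -/
theorem IsThick.exists_piece_shift {T : DGModule.{max h w} 𝒞 → Prop} (hT : IsThick T)
    (hdet : ∀ M : DGModule.{max h w} 𝒞, (∀ n, HZero (M.obj s) n) → M.IsAcyclic)
    (hpos : ∀ n > 0, HZero (𝒞.Hom s s) n) {N E : DGModule.{max h w} 𝒞} {b : ℤ} (hE : T E)
    (hE0 : ∀ n ≠ 0, HZero (E.obj s) n) (hN : ∀ n < b, HZero (N.obj s) n) {y : (N.obj s).X b}
    (hy : IsCocycle (N.obj s) y) {x x' : (E.obj s).X 0} (hx : IsCocycle (E.obj s) x)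
    (hx' : IsCocycle (E.obj s) x')
    (hgen : ∀ e : (E.obj s).X 0, IsCocycle (E.obj s) e → ∃ c c' : (𝒞.Hom s s).X 0,
      IsCocycle (𝒞.Hom s s) c ∧ IsCocycle (𝒞.Hom s s) c' ∧
      IsBd (E.obj s) (E.act (add_zero 0) x c + E.act (add_zero 0) x' c' - e))
    (hdir : ∀ c c' : (𝒞.Hom s s).X 0, IsCocycle (𝒞.Hom s s) c → IsCocycle (𝒞.Hom s s) c' →
      IsBd (E.obj s) (E.act (add_zero 0) x c + E.act (add_zero 0) x' c') →
      IsBd (E.obj s) (E.act (add_zero 0) x c))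
    (hxy : ∀ c : (𝒞.Hom s s).X 0, IsCocycle (𝒞.Hom s s) c →
      (IsBd (E.obj s) (E.act (add_zero 0) x c) ↔ IsBd (N.obj s) (N.act (add_zero b) y c))) :
    ∃ (K : DGModule.{max h w} 𝒞) (f : (homComplex K N).X 0), IsCocycle (homComplex K N) f ∧ T K ∧
      (∀ n ≠ b, HZero (K.obj s) n) ∧
      (∀ z : (K.obj s).X b, IsCocycle (K.obj s) z → IsBd (N.obj s) (hv (add_zero b) f z) →
        IsBd (K.obj s) z) ∧
      ∃ z : (K.obj s).X b, IsCocycle (K.obj s) z ∧ hv (add_zero b) f z = y := by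
  obtain ⟨m, rfl⟩ : ∃ m, b = -m := ⟨-b, (neg_neg b).symm⟩
  have hu := isCocycle_shiftUp (M := E) m
  have hq := isQI_shiftUp (M := E) m
  have hact : ∀ (x : (E.obj s).X 0) (c : (𝒞.Hom s s).X 0),
      (E.shift m).act (add_zero (-m)) (hv (zero_add (-m)) (shiftUp E m) x) c =
        hv (zero_add (-m)) (shiftUp E m) (E.act (add_zero 0) x c) := fun x c =>
    (hv_act _ _ _ _ _ _ _).symm
  have hbd : ∀ {x : (E.obj s).X 0}, IsCocycle (E.obj s) x →
      (IsBd ((E.shift m).obj s) (hv (zero_add (-m)) (shiftUp E m) x) ↔ IsBd (E.obj s) x) :=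
    fun hx => ⟨(hq s _ _ _).1 _ hx, isBd_hv hu _⟩
  refine hT.exists_piece.{w} hdet hpos (E := E.shift m)
    ((hT.iff_of_isQI hu hq).1 hE) (fun n hn e he => ?_) hN hy
    (isCocycle_hv hu (zero_add (-m)) hx) (isCocycle_hv hu (zero_add (-m)) hx') (fun e he => ?_)
    (fun c c' hc hc' hb => ?_) fun c hc => ?_
  · obtain ⟨z, hz, hze⟩ := (hq s (n + m) n (by lia)).2 e he
    exact (isBd_iff_of_sub hze).1 (isBd_hv hu _ (hE0 (n + m) (by lia) z hz))
  · obtain ⟨z, hz, hze⟩ := (hq s 0 (-m) (zero_add (-m))).2 e he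
    obtain ⟨c, c', hc, hc', hb⟩ := hgen z hz
    refine ⟨c, c', hc, hc', ?_⟩
    have := (isBd_hv hu (zero_add (-m)) hb).add hze
    rwa [map_sub, sub_add_sub_cancel, map_add, ← hact, ← hact] at this
  · rw [hact, hact, ← map_add] at hb
    rw [hact]
    have h₁ := E.isCocycle_act (add_zero 0) hx hc
    have h₂ := E.isCocycle_act (add_zero 0) hx' hc'
    exact (hbd h₁).2 (hdir c c' hc hc' ((hbd (h₁.add h₂)).1 hb))
  · rw [hact, hbd (E.isCocycle_act (add_zero 0) hx hc)]
    exact hxy c hc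

end Shift

end DGModule

namespace DGAlgebra

open DGModule

/-! ### Modules over the endomorphisms of a truncation model -/

variable {k : Type u} [Field k] {A : DGAlgebra.{u} k}

section Endomorphisms

variable {P : A.RightModule} {one : (P.obj A.pt).X 0}

theorem actZ0_sub {M : A.RightModule} {n : ℤ} (z w : A.Z0) (m : (M.obj A.pt).X n) :
    A.actZ0 M n (z - w) m = A.actZ0 M n z m - A.actZ0 M n w m :=
  map_sub (M.act (a := A.pt) (b := A.pt) (add_zero n) m) z.1 w.1

theorem exists_isBd_sub_actZ0 (hP : IsTruncationModel A.pt P one) {y : (P.obj A.pt).X 0}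
    (hy : IsCocycle (P.obj A.pt) y) :
    ∃ r : A.Z0, IsBd (P.obj A.pt) (y - A.actZ0 P 0 r one) := by
  obtain ⟨c, hc, hcy⟩ := hP.surj 0 le_rfl y hy
  refine ⟨⟨c, hc 1⟩, ?_⟩
  rw [← neg_sub]
  exact hcy.neg

theorem isBd_actZ0_one_iff (hP : IsTruncationModel A.pt P one) {r : A.Z0} :
    IsBd (P.obj A.pt) (A.actZ0 P 0 r one) ↔ r ∈ A.B0 := by
  rw [mem_B0_iff]
  exact ⟨hP.inj 0 le_rfl r.1 r.isCocycle, fun h =>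
    P.isBd_act_right (a := A.pt) (b := A.pt) (add_zero 0) hP.isCocycle h⟩

/-- `P` has no cohomology in positive degrees, so `realize` applies with target `P`. Together with
`exists_isBd_sub_actZ0` this attaches to each closed endomorphism `φ` of degree `0` a class `t` of
`H⁰(A)`, by `φ(one) ∼ one · t`, and every class occurs. -/
theorem exists_hom_actZ0 (hP : IsTruncationModel A.pt P one) (r : A.Z0) :
    ∃ φ : (homComplex P P).X 0, IsCocycle (homComplex P P) φ ∧
      IsBd (P.obj A.pt) (hv (add_zero 0) φ one - A.actZ0 P 0 r one) :=
  hP.realize P 0 hP.hZero _ (isCocycle_actZ0 r hP.isCocycle)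

theorem hv_actZ0 {M N : A.RightModule} {n : ℤ} (φ : (homComplex M N).X 0) (r : A.Z0)
    (y : (M.obj A.pt).X n) :
    hv (add_zero n) φ (A.actZ0 M n r y) = A.actZ0 N n r (hv (add_zero n) φ y) :=
  hv_act (a := A.pt) (b := A.pt) φ (add_zero n) (add_zero n) (add_zero n) (add_zero n) y r.1

/-- `φ` commutes with the right action, so `φ(one · r) = φ(one) · r ∼ one · t r`: in terms of
classes, `φ` is left multiplication by `t`. -/
theorem isBd_hv_actZ0_sub {φ : (homComplex P P).X 0} {t : A.Z0}
    (hφt : IsBd (P.obj A.pt) (hv (add_zero 0) φ one - A.actZ0 P 0 t one)) (r : A.Z0) :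
    IsBd (P.obj A.pt) (hv (add_zero 0) φ (A.actZ0 P 0 r one) - A.actZ0 P 0 (t * r) one) := by
  rw [hv_actZ0, actZ0_mul, ← map_sub]
  exact isBd_actZ0 r hφt

/-- Endomorphisms which kill the generator are quasi-nilpotent. -/
theorem exists_homotopyInverse_id_sub (hP : IsTruncationModel A.pt P one)
    (hneg : ∀ n < 0, HZero A.complex n) {φ : (homComplex P P).X 0}
    (hφ : IsCocycle (homComplex P P) φ) (hφb : IsBd (P.obj A.pt) (hv (add_zero 0) φ one)) :
    ∃ χ : (homComplex P P).X 0, IsCocycle (homComplex P P) χ ∧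
      IsBd (homComplex P P) (homComp (add_zero 0) χ (idHom P - φ) - idHom P) := by
  have hψ : IsCocycle (homComplex P P) (idHom P - φ) := isCocycle_id.sub hφ
  -- The cohomology of `P` is concentrated in degree `0` and generated there by `one`. Hence `φ` is
  -- zero on cohomology and `id - φ` is the identity on it.
  have key : ∀ n (z : (P.obj A.pt).X n), IsCocycle (P.obj A.pt) z →
      IsBd (P.obj A.pt) (hv (add_zero n) (idHom P - φ) z - z) := by
    intro n z hz
    rw [map_sub, LinearMap.sub_apply, hv_id, sub_sub_cancel_left]
    refine IsBd.neg ?_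
    rcases lt_trichotomy n 0 with hn | rfl | hn
    · exact hP.hZero_neg hneg hn _ (isCocycle_hv hφ _ hz)
    · obtain ⟨r, hr⟩ := exists_isBd_sub_actZ0 hP hz
      have := isBd_hv hφ (add_zero 0) hr
      rw [map_sub, hv_actZ0] at this
      exact (isBd_iff_of_sub this).2 (isBd_actZ0 r hφb)
    · exact hP.hZero n hn _ (isCocycle_hv hφ _ hz)
  obtain ⟨χ, hχ, -, hχψ⟩ := hP.isHProjective.exists_homotopyInverse hP.isHProjective hψ
    fun a p q hpq => by
      obtain rfl : p = q := by lia
      exact ⟨fun z hz hb => (isBd_iff_of_sub (key p z hz)).1 hb, fun z hz => ⟨z, hz, key p z hz⟩⟩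
  exact ⟨χ, hχ, hχψ⟩

end Endomorphisms

section Piece

variable {ι : Type o₁} {Q : ι → A.RightModule} {i : ι} {one : ((Q i).obj A.pt).X 0}
  {N : DGModule.{w} ((dgCat.{u} A.toDGCategory).full Q).op} {b : ℤ}

/-- Elements with few multiples are killed by all endomorphisms which kill the generator. -/
theorem isBd_opAct_of_minimal (hP : IsTruncationModel A.pt (Q i) one)
    (hneg : ∀ n < 0, HZero A.complex n) {y : (N.obj i).X b} (hy : IsCocycle (N.obj i) y)
    (hyb : ¬ IsBd (N.obj i) y)
    (hmin : ∀ c : (((dgCat.{u} A.toDGCategory).full Q).op.Hom i i).X 0,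
      IsCocycle (((dgCat.{u} A.toDGCategory).full Q).op.Hom i i) c →
        ¬ IsBd (N.obj i) (N.act (add_zero b) y c) →
        ∃ c' : (((dgCat.{u} A.toDGCategory).full Q).op.Hom i i).X 0,
          IsCocycle (((dgCat.{u} A.toDGCategory).full Q).op.Hom i i) c' ∧
          IsBd (N.obj i) (N.act (add_zero b) y
            (((dgCat.{u} A.toDGCategory).full Q).op.comp (add_zero 0) c c') - y))
    {φ : (homComplex (Q i) (Q i)).X 0} (hφ : IsCocycle (homComplex (Q i) (Q i)) φ)
    (hφb : IsBd ((Q i).obj A.pt) (hv (add_zero 0) φ one)) :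
    IsBd (N.obj i) (N.opAct (𝒟 := (dgCat.{u} A.toDGCategory).full Q) (add_zero b) y φ) := by
  by_contra hyφ
  obtain ⟨φ', hφ', hb⟩ := hmin φ hφ hyφ
  have hψ : IsCocycle (homComplex (Q i) (Q i)) (homComp (add_zero 0) φ' φ) :=
    isCocycle_comp _ hφ' hφ
  have hb' : IsBd (N.obj i) (N.opAct (𝒟 := (dgCat.{u} A.toDGCategory).full Q) (add_zero b) y
      (homComp (add_zero 0) φ' φ) - y) := by
    refine (congrArg (fun t => IsBd (N.obj i) (t - y)) ?_).mp hb
    refine (map_smul (N.opAct (𝒟 := (dgCat.{u} A.toDGCategory).full Q) (add_zero b) y) _ _).trans ?_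
    rw [zero_mul, koszulSign_zero, one_smul]
    rfl
  -- Nakayama: `ψ = φ' φ` kills the generator, so `id - ψ` has an inverse up to homotopy. But `y ·
  -- (id - ψ) ∼ 0`, which forces `y ∼ 0`.
  obtain ⟨χ, hχ, hχψ⟩ := exists_homotopyInverse_id_sub hP hneg hψ (by
    rw [hv_comp _ _ _ (add_zero 0) (add_zero 0)]
    exact isBd_hv hφ' _ hφb)
  have h₁ : IsBd (N.obj i) (N.opAct (𝒟 := (dgCat.{u} A.toDGCategory).full Q) (add_zero b) y
      (idHom (Q i) - homComp (add_zero 0) φ' φ)) := by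
    have e := map_sub (N.opAct (𝒟 := (dgCat.{u} A.toDGCategory).full Q) (add_zero b) y)
      (idHom (Q i)) (homComp (add_zero 0) φ' φ)
    rw [e, N.opAct_id (𝒟 := (dgCat.{u} A.toDGCategory).full Q) y, ← neg_sub]
    exact hb'.neg
  have h₂ := N.isBd_opAct_left (𝒟 := (dgCat.{u} A.toDGCategory).full Q) (add_zero b) h₁ hχ
  have e₂ := N.opAct_opAct (𝒟 := (dgCat.{u} A.toDGCategory).full Q) (add_zero b) (add_zero 0)
    (add_zero b) (add_zero b) y (idHom (Q i) - homComp (add_zero 0) φ' φ) χ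
  rw [e₂, zero_mul, koszulSign_zero, one_smul] at h₂
  have h₃ := N.isBd_opAct_right (𝒟 := (dgCat.{u} A.toDGCategory).full Q) (add_zero b) hy hχψ
  have e₃ := map_sub (N.opAct (𝒟 := (dgCat.{u} A.toDGCategory).full Q) (add_zero b) y)
    (homComp (add_zero 0) χ (idHom (Q i) - homComp (add_zero 0) φ' φ)) (idHom (Q i))
  rw [e₃, N.opAct_id (𝒟 := (dgCat.{u} A.toDGCategory).full Q) y] at h₃
  exact hyb ((isBd_iff_of_sub h₃).1 h₂)

/-- The annihilator of an element killed by all endomorphisms which kill the generator is generated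
by an idempotent. -/
theorem exists_annihilator_idempotent [IsSemisimpleRing A.H0] (hP : IsTruncationModel A.pt (Q i) one)
    {y : (N.obj i).X b}
    (hJ : ∀ φ : (homComplex (Q i) (Q i)).X 0, IsCocycle (homComplex (Q i) (Q i)) φ →
      IsBd ((Q i).obj A.pt) (hv (add_zero 0) φ one) →
      IsBd (N.obj i) (N.opAct (𝒟 := (dgCat.{u} A.toDGCategory).full Q) (add_zero b) y φ)) :
    ∃ e : A.Z0, (Ideal.Quotient.mk A.B0 e) * Ideal.Quotient.mk A.B0 e = Ideal.Quotient.mk A.B0 e ∧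
      ∀ (φ : (homComplex (Q i) (Q i)).X 0) (t : A.Z0), IsCocycle (homComplex (Q i) (Q i)) φ →
        IsBd ((Q i).obj A.pt) (hv (add_zero 0) φ one - A.actZ0 (Q i) 0 t one) →
        (t * e ∈ A.B0 ↔
          IsBd (N.obj i) (N.opAct (𝒟 := (dgCat.{u} A.toDGCategory).full Q) (add_zero b) y φ)) := by
  -- The classes of the endomorphisms that annihilate `y`. This is a left ideal, composition with an
  -- endomorphism of class `r` multiplying the class by `r`. By `hJ`, whether `φ` annihilates `y`
  -- depends on its class only.
  let I : Ideal A.H0 :=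
    { carrier := {ρ | ∃ (t : A.Z0) (φ : (homComplex (Q i) (Q i)).X 0),
        Ideal.Quotient.mk A.B0 t = ρ ∧ IsCocycle (homComplex (Q i) (Q i)) φ ∧
        IsBd ((Q i).obj A.pt) (hv (add_zero 0) φ one - A.actZ0 (Q i) 0 t one) ∧
        IsBd (N.obj i) (N.opAct (𝒟 := (dgCat.{u} A.toDGCategory).full Q) (add_zero b) y φ)}
      add_mem' := by
        rintro _ _ ⟨t, φ, rfl, hφ, h₁, h₂⟩ ⟨t', φ', rfl, hφ', h₁', h₂'⟩
        refine ⟨t + t', φ + φ', map_add _ _ _, hφ.add hφ', ?_, ?_⟩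
        · rw [map_add, LinearMap.add_apply, actZ0_add, add_sub_add_comm]
          exact h₁.add h₁'
        · exact (congrArg (IsBd (N.obj i)) (map_add (N.opAct
            (𝒟 := (dgCat.{u} A.toDGCategory).full Q) (add_zero b) y) φ φ')).mpr (h₂.add h₂')
      zero_mem' := ⟨0, 0, map_zero _, isCocycle_zero, by
        rw [map_zero, LinearMap.zero_apply, actZ0_zero, sub_self]
        exact isBd_zero, (congrArg (IsBd (N.obj i)) (map_zero (N.opAct
            (𝒟 := (dgCat.{u} A.toDGCategory).full Q) (add_zero b) y))).mpr isBd_zero⟩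
      smul_mem' := by
        rintro ρ _ ⟨t, φ, rfl, hφ, h₁, h₂⟩
        obtain ⟨r, rfl⟩ := Ideal.Quotient.mk_surjective ρ
        obtain ⟨φ', hφ', hb⟩ := exists_hom_actZ0 hP r
        refine ⟨r * t, homComp (add_zero 0) φ' φ, map_mul _ _ _, isCocycle_comp _ hφ' hφ, ?_, ?_⟩
        · have h₃ := (isBd_hv hφ' (add_zero 0) h₁).add (isBd_hv_actZ0_sub hb t)
          rwa [map_sub, sub_add_sub_cancel, ← hv_comp (add_zero 0) _ _ (add_zero 0) (add_zero 0)
            (add_zero 0)] at h₃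
        · have h₃ := N.isBd_opAct_left (𝒟 := (dgCat.{u} A.toDGCategory).full Q) (add_zero b) h₂ hφ'
          have e₃ := N.opAct_opAct (𝒟 := (dgCat.{u} A.toDGCategory).full Q) (add_zero b)
            (add_zero 0) (add_zero b) (add_zero b) y φ φ'
          rwa [e₃, zero_mul, koszulSign_zero, one_smul] at h₃ }
  obtain ⟨e, he, hI⟩ := IsSemisimpleRing.exists_idempotent_ideal I
  obtain ⟨e, rfl⟩ := Ideal.Quotient.mk_surjective e
  refine ⟨e, he, fun φ t hφ hφt => ?_⟩
  rw [← Ideal.Quotient.eq_zero_iff_mem, map_mul, ← hI]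
  constructor
  · rintro ⟨t', φ', htt, hφ', h₁, h₂⟩
    have h₃ : t - t' ∈ A.B0 := (Ideal.Quotient.eq.1 htt.symm)
    have h₄ := (isBd_actZ0_one_iff hP).2 h₃
    have h₅ := hJ (φ - φ') (hφ.sub hφ') (by
      rw [map_sub, LinearMap.sub_apply]
      have h₆ := hφt.sub h₁
      rw [sub_sub_sub_comm, ← actZ0_sub] at h₆
      exact (isBd_iff_of_sub h₆).2 h₄)
    have e₅ := map_sub (N.opAct (𝒟 := (dgCat.{u} A.toDGCategory).full Q) (add_zero b) y) φ φ'
    rw [e₅] at h₅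
    exact (isBd_iff_of_sub h₅).2 h₂
  · exact fun h => ⟨t, φ, rfl, hφ, hφt, h⟩

end Piece

end DGAlgebra

namespace DGAlgebra

open DGModule

/-! ### Modules generated by an evaluation module -/

section Generation

variable {k : Type u} [Field k] {A : DGAlgebra.{u} k} {ι : Type o₁} {Q : ι → A.RightModule} {i : ι}
  {one : ((Q i).obj A.pt).X 0}

theorem isBd_evaluationModule_act_sub {φ : (homComplex (Q i) (Q i)).X 0} {t : A.Z0}
    (hφt : IsBd ((Q i).obj A.pt) (hv (add_zero 0) φ one - A.actZ0 (Q i) 0 t one)) (r : A.Z0) :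
    IsBd ((evaluationModule.{u, w} Q A.pt).obj i)
      ((evaluationModule.{u, w} Q A.pt).opAct (𝒟 := (dgCat.{u} A.toDGCategory).full Q) (add_zero 0)
        (evUp.{u, w} Q A.pt (A.actZ0 (Q i) 0 r one)) φ -
          evUp.{u, w} Q A.pt (A.actZ0 (Q i) 0 (t * r) one)) := by
  rw [evUp_act, zero_mul, koszulSign_zero, one_smul, ← map_sub, isBd_evUp_iff]
  exact isBd_hv_actZ0_sub hφt r

theorem isBd_evaluationModule_act_add_sub {φ φ' : (homComplex (Q i) (Q i)).X 0} {t t' : A.Z0}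
    (ht : IsBd ((Q i).obj A.pt) (hv (add_zero 0) φ one - A.actZ0 (Q i) 0 t one))
    (ht' : IsBd ((Q i).obj A.pt) (hv (add_zero 0) φ' one - A.actZ0 (Q i) 0 t' one)) {r r' : A.Z0}
    {y : ((Q i).obj A.pt).X 0}
    (hy : IsBd ((Q i).obj A.pt) (A.actZ0 (Q i) 0 (t * r + t' * r') one - y)) :
    IsBd ((evaluationModule.{u, w} Q A.pt).obj i)
      ((evaluationModule.{u, w} Q A.pt).opAct (𝒟 := (dgCat.{u} A.toDGCategory).full Q) (add_zero 0)
        (evUp.{u, w} Q A.pt (A.actZ0 (Q i) 0 r one)) φ +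
          (evaluationModule.{u, w} Q A.pt).opAct (𝒟 := (dgCat.{u} A.toDGCategory).full Q)
            (add_zero 0) (evUp.{u, w} Q A.pt (A.actZ0 (Q i) 0 r' one)) φ' -
          evUp.{u, w} Q A.pt y) := by
  have h := ((isBd_hv_actZ0_sub ht r).add (isBd_hv_actZ0_sub ht' r'))
  rw [← add_sub_add_comm, ← actZ0_add] at h
  have h' := h.add hy
  rw [sub_add_sub_cancel] at h'
  rw [evUp_act, evUp_act, zero_mul, koszulSign_zero, one_smul, one_smul, ← map_add, ← map_sub,
    isBd_evUp_iff]
  exact h'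

theorem isBd_evUp_actZ0_one_iff (hP : IsTruncationModel A.pt (Q i) one) {r : A.Z0} :
    IsBd ((evaluationModule.{u, w} Q A.pt).obj i) (evUp.{u, w} Q A.pt (A.actZ0 (Q i) 0 r one)) ↔
      r ∈ A.B0 := by
  rw [isBd_evUp_iff, isBd_actZ0_one_iff hP]

/-- The lowest cohomology of a module contains pieces which are generated by the evaluation module. -/
theorem exists_piece_of_evaluationModule [IsSemisimpleRing A.H0]
    (hP : IsTruncationModel A.pt (Q i) one) (hneg : ∀ n < 0, HZero A.complex n)
    {T : DGModule.{max u w} ((dgCat.{u} A.toDGCategory).full Q).op → Prop} (hT : IsThick T)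
    (hdet : ∀ M : DGModule.{max u w} ((dgCat.{u} A.toDGCategory).full Q).op,
      (∀ n, HZero (M.obj i) n) → M.IsAcyclic)
    (hE : T (evaluationModule.{u, w} Q A.pt))
    (N : DGModule.{max u w} ((dgCat.{u} A.toDGCategory).full Q).op) (b : ℤ)
    (hN : ∀ n < b, HZero (N.obj i) n) (hfin : Module.Finite k (Hn (N.obj i) b))
    (hb : ¬ HZero (N.obj i) b) :
    ∃ (K : DGModule.{max u w} ((dgCat.{u} A.toDGCategory).full Q).op)
      (f : (homComplex K N).X 0), IsCocycle (homComplex K N) f ∧ T K ∧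
      (∀ n ≠ b, HZero (K.obj i) n) ∧
      (∀ z : (K.obj i).X b, IsCocycle (K.obj i) z → IsBd (N.obj i) (hv (add_zero b) f z) →
        IsBd (K.obj i) z) ∧
      ∃ z : (K.obj i).X b, IsCocycle (K.obj i) z ∧ ¬ IsBd (N.obj i) (hv (add_zero b) f z) := by
  obtain ⟨y, hy, hyb, hmin⟩ := exists_minimal_generator N hfin hb
  obtain ⟨e, he, hann⟩ := exists_annihilator_idempotent (N := N) (y := y) hP fun φ hφ hφb =>
    isBd_opAct_of_minimal hP hneg hy hyb hmin hφ hφb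
  have hcoc : ∀ r : A.Z0, IsCocycle ((evaluationModule.{u, w} Q A.pt).obj i)
      (evUp.{u, w} Q A.pt (A.actZ0 (Q i) 0 r one)) := fun r =>
    (isCocycle_evUp_iff.{u, w} Q A.pt).2 (isCocycle_actZ0 r hP.isCocycle)
  have hexp : ∀ φ : (homComplex (Q i) (Q i)).X 0, IsCocycle (homComplex (Q i) (Q i)) φ →
      ∃ t : A.Z0, IsBd ((Q i).obj A.pt) (hv (add_zero 0) φ one - A.actZ0 (Q i) 0 t one) :=
    fun φ hφ => exists_isBd_sub_actZ0 hP (isCocycle_hv hφ _ hP.isCocycle)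
  have hpos : ∀ n > 0, HZero (homComplex (Q i) (Q i)) n := fun n hn =>
    hP.vanish (Q i) n fun m hm => hP.hZero m (lt_of_lt_of_le hn hm)
  -- `one · e` and `one · (1 - e)` split the cohomology of the evaluation module in two. An
  -- endomorphism of class `t` sends the first to `one · t e`, so it annihilates it exactly when `t
  -- e = 0`, which by the choice of `e` is the condition for annihilating `y`.
  have key := hT.exists_piece_shift.{w} (s := i) hdet hpos (b := b) (y := y)
    (x := evUp.{u, w} Q A.pt (A.actZ0 (Q i) 0 e one))
    (x' := evUp.{u, w} Q A.pt (A.actZ0 (Q i) 0 (1 - e) one)) hE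
    (fun n hn => (hZero_evaluationModule_iff.{u, w} Q A.pt).2 ?_) hN hy (hcoc e) (hcoc (1 - e))
    (fun e₀ he₀ => ?_) (fun φ φ' hφ hφ' hb => ?_) fun φ hφ => ?_
  · obtain ⟨K, f, hf, hK, hK0, hinj, z, hz, hzy⟩ := key
    exact ⟨K, f, hf, hK, hK0, hinj, z, hz, hzy ▸ hyb⟩
  · rcases lt_or_gt_of_ne hn with hn | hn
    · exact hP.hZero_neg hneg hn
    · exact hP.hZero n hn
  · obtain ⟨y₀, rfl⟩ := (evUp.{u, w} Q A.pt).surjective e₀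
    obtain ⟨r, hr⟩ := exists_isBd_sub_actZ0 hP ((isCocycle_evUp_iff.{u, w} Q A.pt).1 he₀)
    obtain ⟨φ, hφ, hφr⟩ := exists_hom_actZ0 hP r
    -- The same endomorphism serves twice, since `r e + r (1 - e) = r`.
    refine ⟨φ, φ, hφ, hφ, ?_⟩
    refine isBd_evaluationModule_act_add_sub.{w, u} hφr hφr ?_
    rw [← mul_add, add_sub_cancel, _root_.mul_one, ← neg_sub]
    exact hr.neg
  · obtain ⟨t, ht⟩ := hexp φ hφ
    obtain ⟨t', ht'⟩ := hexp φ' hφ'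
    have h₁ := isBd_evaluationModule_act_add_sub.{w, u} ht ht' (r := e) (r' := 1 - e)
      ((congrArg (IsBd _) (sub_self _)).mpr isBd_zero)
    have h₂ := (isBd_evUp_actZ0_one_iff.{w, u} hP).1 ((isBd_iff_of_sub h₁).1 hb)
    refine (isBd_iff_of_sub (isBd_evaluationModule_act_sub.{w, u} ht e)).2
      ((isBd_evUp_actZ0_one_iff.{w, u} hP).2 ?_)
    rw [← Ideal.Quotient.eq_zero_iff_mem] at h₂ ⊢
    -- Multiplying `t e + t' (1 - e) = 0` by `e` on the right leaves `t e = 0`.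
    have h₃ := congrArg (· * Ideal.Quotient.mk A.B0 e) h₂
    simpa [mul_sub, sub_mul, add_mul, _root_.mul_assoc, he] using h₃
  · obtain ⟨t, ht⟩ := hexp φ hφ
    refine Iff.trans ?_ (hann φ t hφ ht)
    exact (isBd_iff_of_sub (isBd_evaluationModule_act_sub.{w, u} ht e)).trans
      (isBd_evUp_actZ0_one_iff.{w, u} hP)

/-- Modules with finite dimensional cohomology are generated by the evaluation module. -/
theorem thick_evaluationModule [IsSemisimpleRing A.H0]
    (hP : IsTruncationModel A.pt (Q i) one) (hneg : ∀ n < 0, HZero A.complex n)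
    (hdet : ∀ M : DGModule.{max u w} ((dgCat.{u} A.toDGCategory).full Q).op,
      (∀ n, HZero (M.obj i) n) → M.IsAcyclic)
    {T : DGModule.{max u w} ((dgCat.{u} A.toDGCategory).full Q).op → Prop} (hT : IsThick T)
    (hE : T (evaluationModule.{u, w} Q A.pt))
    (N : DGModule.{max u w} ((dgCat.{u} A.toDGCategory).full Q).op) (hN : N.IsPerfectlyValued) :
    T N := by
  obtain ⟨hfin, a, b, hab⟩ := isPerfectlyValued_iff.1 hN i
  exact hT.of_finite hdet (exists_piece_of_evaluationModule.{w, u} hP hneg hT hdet hE) a b _ N hfin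
    hab rfl

end Generation

end DGAlgebra

/-! ### Perfectly valued modules form a thick subcategory -/

section Complexes

variable {k : Type v} [Field k]

theorem ModuleCat.finite_of_exact {S : ShortComplex (ModuleCat.{w} k)} (hS : S.Exact)
    (h₁ : Module.Finite k S.X₁) (h₃ : Module.Finite k S.X₃) : Module.Finite k S.X₂ := by
  have e := hS.moduleCat_range_eq_ker
  have : Module.Finite k (LinearMap.ker S.g.hom) := e ▸ inferInstance
  have : Module.Finite k (S.X₂ ⧸ LinearMap.ker S.g.hom) :=
    Module.Finite.equiv S.g.hom.quotKerEquivRange.symm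
  exact Module.Finite.of_submodule_quotient (LinearMap.ker S.g.hom)

/-- The offsets `i` and `j` let one statement serve all three positions of the long exact sequence.
-/
theorem HasFiniteTotalCohomology.of_exact {K L M : CochainComplex (ModuleCat.{w} k) ℤ} {i j : ℤ}
    (hK : HasFiniteTotalCohomology K) (hM : HasFiniteTotalCohomology M)
    (H : ∀ n : ℤ, ∃ S : ShortComplex (ModuleCat.{w} k), S.Exact ∧ S.X₁ = K.homology (n + i) ∧
      S.X₂ = L.homology n ∧ S.X₃ = M.homology (n + j)) : HasFiniteTotalCohomology L := by
  refine ⟨fun n => ?_, ((hK.2.preimage (f := (· + i)) (add_left_injective i).injOn).union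
    (hM.2.preimage (f := (· + j)) (add_left_injective j).injOn)).subset fun n hn => ?_⟩
  · obtain ⟨S, hS, e₁, e₂, e₃⟩ := H n
    rw [← e₂]
    exact ModuleCat.finite_of_exact hS (e₁ ▸ hK.1 _) (e₃ ▸ hM.1 _)
  · obtain ⟨S, hS, e₁, e₂, e₃⟩ := H n
    by_contra h
    rw [Set.mem_union, not_or] at h
    simp only [Set.mem_preimage, Set.mem_ofPred_eq, not_not] at h
    rw [Set.mem_ofPred_eq, ← e₂] at hn
    rw [← e₁, ← e₃] at h
    exact hn (hS.isZero_of_both_zeros (h.1.eq_of_src _ _) (h.2.eq_of_tgt _ _))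

theorem HasFiniteTotalCohomology.of_retract {K L : CochainComplex (ModuleCat.{w} k) ℤ}
    (r : ∀ n, Retract (K.homology n) (L.homology n)) (hL : HasFiniteTotalCohomology L) :
    HasFiniteTotalCohomology K := by
  refine ⟨fun n => ?_, hL.2.subset fun n hn h => hn ?_⟩
  · have := hL.1 n
    exact Module.Finite.of_surjective (r n).r.hom ((ModuleCat.epi_iff_surjective _).1 inferInstance)
  · exact h.of_mono (r n).i

end Complexes

namespace DGModule

variable {k : Type v} [Field k] {𝒜 : DGCategory.{v, o, h} k}

theorem IsShortExact.shortExact {L M N : DGModule.{w} 𝒜} {f : L ⟶ M} {g : M ⟶ N}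
    (hfg : IsShortExact f g) (a : 𝒜.Obj) :
    ∃ w : f.app a ≫ g.app a = 0, (ShortComplex.mk (f.app a) (g.app a) w).ShortExact := by
  have w : f.app a ≫ g.app a = 0 := by
    ext n x
    exact (hfg a n).2.1.apply_apply_eq_zero x
  refine ⟨w, HomologicalComplex.shortExact_of_degreewise_shortExact _ fun n => ?_⟩
  exact
    { exact := (ShortComplex.ShortExact.moduleCat_exact_iff_function_exact _).2 (hfg a n).2.1
      mono_f := (ModuleCat.mono_iff_injective _).2 (hfg a n).1
      epi_g := (ModuleCat.epi_iff_surjective _).2 (hfg a n).2.2 }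

theorem isThick_isPerfectlyValued : IsThick (IsPerfectlyValued (𝒜 := 𝒜)) where
  of_isAcyclic M hM a := by
    have h : ∀ n, Limits.IsZero ((M.obj a).homology n) := fun n => (hM a n).isZero_homology
    refine ⟨fun n => ?_, Set.finite_empty.subset fun n hn => absurd (h n) hn⟩
    have := ModuleCat.subsingleton_of_isZero (h n)
    infer_instance
  iff_of_isQuasiIso {M N} f hf := by
    have e : ∀ a n, (M.obj a).homology n ≅ (N.obj a).homology n := fun a n => by
      have := hf a
      exact asIso (HomologicalComplex.homologyMap (f.app a) n)
    exact ⟨fun h a => (h a).of_retract fun n => (e a n).symm.retract,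
      fun h a => (h a).of_retract fun n => (e a n).retract⟩
  left f g hfg hM hN a := by
    obtain ⟨w, hS⟩ := hfg.shortExact a
    refine (hN a).of_exact (i := -1) (j := 0) (hM a) fun n =>
      ⟨_, hS.homology_exact₁ (n - 1) n (by simp), ?_, ?_, ?_⟩
    all_goals simp [sub_eq_add_neg]
  middle f g hfg hL hN a := by
    obtain ⟨w, hS⟩ := hfg.shortExact a
    refine (hL a).of_exact (i := 0) (j := 0) (hN a) fun n => ⟨_, hS.homology_exact₂ n, ?_, ?_, ?_⟩
    all_goals simp
  right f g hfg hL hM a := by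
    obtain ⟨w, hS⟩ := hfg.shortExact a
    refine (hM a).of_exact (i := 0) (j := 1) (hL a) fun n =>
      ⟨_, hS.homology_exact₃ n (n + 1) (by simp), ?_, ?_, ?_⟩
    all_goals simp
  of_retract {M N} r hN a := (hN a).of_retract fun n =>
    { i := HomologicalComplex.homologyMap (r.i.app a) n
      r := HomologicalComplex.homologyMap (r.r.app a) n
      retract := by
        rw [← HomologicalComplex.homologyMap_comp]
        have e : r.i.app a ≫ r.r.app a = 𝟙 _ := congrArg (fun f => Hom.app f a) r.retract
        rw [e, HomologicalComplex.homologyMap_id] }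

end DGModule

/-! ### Independence of the choice of resolutions -/

namespace DGModule

variable {k : Type v} [Field k]

section Independence

variable {ℬ : DGCategory.{v, o, h} k} {Q Q' M N : DGModule.{w} ℬ}

/-- Resolutions of the same module are homotopy equivalent over the module. -/
theorem exists_homotopyEquiv_of_isQI {p : (homComplex Q M).X 0} {p' : (homComplex Q' M).X 0}
    (hQ : Q.IsHProjective) (hQ' : Q'.IsHProjective) (hp : IsCocycle (homComplex Q M) p)
    (hp' : IsCocycle (homComplex Q' M) p') (hqi : IsQI p) (hqi' : IsQI p') :
    ∃ (α : (homComplex Q' Q).X 0) (β : (homComplex Q Q').X 0), IsCocycle (homComplex Q' Q) α ∧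
      IsCocycle (homComplex Q Q') β ∧ IsBd (homComplex Q' M) (homComp (add_zero 0) p α - p') ∧
      IsBd (homComplex Q M) (homComp (add_zero 0) p' β - p) ∧
      IsBd (homComplex Q' Q') (homComp (add_zero 0) β α - idHom Q') := by
  obtain ⟨α, hα, hpα⟩ := hQ'.exists_lift hp hqi hp'
  obtain ⟨β, hβ, hpβ⟩ := hQ.exists_lift hp' hqi' hp
  refine ⟨α, β, hα, hβ, hpα, hpβ, hQ'.isBd_of_comp hp' hqi'
    ((isCocycle_comp _ hβ hα).sub isCocycle_id) ?_⟩
  have h := (isBd_comp_left (add_zero 0) hpβ hα).add hpα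
  rw [map_sub, LinearMap.sub_apply, comp_assoc (add_zero 0) (add_zero 0) (add_zero 0) (add_zero 0),
    sub_add_sub_cancel] at h
  rwa [map_sub, comp_id]

/-- The map `f ↦ f ∘ p` to the derived morphisms from `M`, computed by a resolution `p`, is bijective
on cohomology independently of the choice of `p`. -/
theorem bijective_comp_of_isQI {K : CochainComplex (ModuleCat.{w'} k) ℤ} {n : ℤ}
    {F : K.X n →ₗ[k] (homComplex M N).X n}
    (hF : ∀ x, IsCocycle K x → IsCocycle (homComplex M N) (F x))
    {p : (homComplex Q M).X 0} {p' : (homComplex Q' M).X 0}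
    (hQ : Q.IsHProjective) (hQ' : Q'.IsHProjective) (hp : IsCocycle (homComplex Q M) p)
    (hp' : IsCocycle (homComplex Q' M) p') (hqi : IsQI p) (hqi' : IsQI p')
    (H : InjH K (homComplex Q N) n ((homComp (add_zero n)).flip p ∘ₗ F) ∧
      SurjH K (homComplex Q N) n ((homComp (add_zero n)).flip p ∘ₗ F)) :
    InjH K (homComplex Q' N) n ((homComp (add_zero n)).flip p' ∘ₗ F) ∧
      SurjH K (homComplex Q' N) n ((homComp (add_zero n)).flip p' ∘ₗ F) := by
  -- Up to homotopy, composition with `β` turns `p'` into `p` and composition with `α` turns `p`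
  -- back into `p'`. This carries both properties from `Q` to `Q'`.
  obtain ⟨α, β, hα, hβ, hpα, hpβ, hβα⟩ := exists_homotopyEquiv_of_isQI hQ hQ' hp hp' hqi hqi'
  constructor
  · intro x hx hb
    refine H.1 x hx ?_
    change IsBd _ (homComp (add_zero n) (F x) p')  at hb
    change IsBd _ (homComp (add_zero n) (F x) p)
    have h₁ := isBd_comp_left (add_zero n) hb hβ
    have h₂ := isBd_comp_right (add_zero n) (hF x hx) hpβ
    rw [map_sub, ← comp_assoc (add_zero n) (add_zero 0) (add_zero n) (add_zero n)] at h₂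
    exact (isBd_iff_of_sub h₂).1 h₁
  · intro y hy
    obtain ⟨x, hx, hxy⟩ := H.2 (homComp (add_zero n) y β) (isCocycle_comp _ hy hβ)
    refine ⟨x, hx, ?_⟩
    change IsBd _ (homComp (add_zero n) (F x) p - _) at hxy
    change IsBd _ (homComp (add_zero n) (F x) p' - _)
    have h₁ := isBd_comp_left (add_zero n) hxy hα
    rw [map_sub, LinearMap.sub_apply, comp_assoc (add_zero n) (add_zero 0) (add_zero n) (add_zero n),
      comp_assoc (add_zero n) (add_zero 0) (add_zero n) (add_zero n)] at h₁
    have h₂ := isBd_comp_right (add_zero n) (hF x hx) hpα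
    rw [map_sub] at h₂
    have h₃ := isBd_comp_right (add_zero n) hy hβα
    rw [map_sub, comp_id] at h₃
    have h₄ := (h₁.add h₃).sub h₂
    rwa [sub_add_sub_cancel, sub_sub_sub_cancel_left] at h₄

theorem _root_.DGFunctor.isCocycle_map {𝒞 : DGCategory.{v, o₁, h₁} k} {ℬ : DGCategory.{v, o₂, h₂} k}
    (F : DGFunctor 𝒞 ℬ) {a b : 𝒞.Obj} {n : ℤ} {x : (𝒞.Hom a b).X n} (hx : IsCocycle (𝒞.Hom a b) x) :
    IsCocycle (ℬ.Hom (F.obj a) (F.obj b)) (F.map n x) :=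
  isCocycle_of rfl (by rw [← F.map_d, hx, map_zero])

/-- Quasi-full faithfulness can be checked with given resolutions. -/
theorem _root_.DGFunctor.isQuasiFullyFaithful_iff {𝒞 : DGCategory.{v, o₁, h₁} k}
    (F : DGFunctor 𝒞 (dgCat.{w} ℬ)) (Q : 𝒞.Obj → DGModule.{w} ℬ)
    (p : ∀ a, (homComplex (Q a) (F.obj a)).X 0) (hQ : ∀ a, (Q a).IsHProjective)
    (hp : ∀ a, IsCocycle (homComplex (Q a) (F.obj a)) (p a)) (hqi : ∀ a, IsQI (p a)) :
    F.IsQuasiFullyFaithful ↔ ∀ (a b : 𝒞.Obj) (n : ℤ),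
      InjH (𝒞.Hom a b) (homComplex (Q a) (F.obj b)) n
        ((homComp (add_zero n)).flip (p a) ∘ₗ F.map n) ∧
      SurjH (𝒞.Hom a b) (homComplex (Q a) (F.obj b)) n
        ((homComp (add_zero n)).flip (p a) ∘ₗ F.map n) := by
  constructor
  · intro H a b n
    obtain ⟨Q', p', ⟨hQ', hqi'⟩, H⟩ := H a b
    exact bijective_comp_of_isQI (fun x hx => F.isCocycle_map hx) hQ' (hQ a)
      (isCocycle_toHomComplex p') (hp a) (isQI_toHomComplex_iff.2 hqi') (hqi a)
      (inducesCohomologyIso_iff.1 H n)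
  · intro H a b
    refine ⟨Q a, homOfCocycle (p a) (hp a), ⟨hQ a, ?_⟩, inducesCohomologyIso_iff.2 fun n => ?_⟩
    · rw [← isQI_toHomComplex_iff, toHomComplex_homOfCocycle]
      exact hqi a
    · rw [toHomComplex_homOfCocycle]
      exact H a b n

end Independence

section OneObject

open SemifreeDatum

variable {𝒞 : DGCategory.{v, o, h} k} (s : 𝒞.Obj)

/-- Modules are resolved by semifree modules, at one object. -/
theorem exists_semifree_resolution (N : DGModule.{max h w} 𝒞) :
    ∃ (D : SemifreeDatum.{v, o, h, max h w} 𝒞 s) (p : (homComplex (module.{w} D) N).X 0),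
      IsCocycle (homComplex (module.{w} D) N) p ∧ ∀ n,
        InjH ((module.{w} D).obj s) (N.obj s) n (hv (add_zero n) p) ∧
        SurjH ((module.{w} D).obj s) (N.obj s) n (hv (add_zero n) p) := by
  obtain ⟨D, p, hp, -, -, hinj, hsurj⟩ := exists_semifree.{w} s Set.univ Set.univ N
    (fun _ => Set.univ) fun _ => trivial
  refine ⟨D, p, hp, fun n => ⟨fun z hz hb => ?_, fun m hm => ?_⟩⟩
  · obtain ⟨n, rfl⟩ : ∃ i, n = i + 1 := ⟨n - 1, by lia⟩
    obtain ⟨m, hm⟩ := hb.out rfl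
    obtain ⟨y, hy⟩ := hinj n trivial trivial z m hz hm.symm
    exact ⟨n, y, hy⟩
  · obtain ⟨x, rfl, hx, hxm⟩ := hsurj n trivial m hm (.inl trivial)
    refine ⟨gen.{w} D x, isCocycle_of rfl (by rw [gen_d, hx, map_zero]), ?_⟩
    rw [hxm, sub_self]
    exact isBd_zero

end OneObject

end DGModule

/-! ### Comparison of modules at one object -/

section

variable {k : Type v} [Field k] {K : CochainComplex (ModuleCat.{w} k) ℤ}
  {L : CochainComplex (ModuleCat.{w'} k) ℤ} (c : ∀ n, K.X n ≃ₗ[k] L.X n)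
  (hc : ∀ n m x, (L.d n m).hom (c n x) = c m ((K.d n m).hom x))
include hc

theorem isCocycle_equiv_iff {n : ℤ} {x : K.X n} : IsCocycle L (c n x) ↔ IsCocycle K x :=
  forall_congr' fun m => by rw [hc, LinearEquiv.map_eq_zero_iff]

theorem isBd_equiv_iff {n : ℤ} {x : K.X n} : IsBd L (c n x) ↔ IsBd K x := by
  constructor
  · rintro ⟨m, y, hy⟩
    obtain ⟨y, rfl⟩ := (c m).surjective y
    exact ⟨m, y, (c n).injective ((hc _ _ _).symm.trans hy)⟩
  · rintro ⟨m, y, rfl⟩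
    exact ⟨m, c m y, hc _ _ _⟩

theorem injH_equiv_iff {J : CochainComplex (ModuleCat.{x} k) ℤ} {n : ℤ} {F : J.X n → K.X n}
    {F' : J.X n → L.X n} (hF : ∀ x, F' x = c n (F x)) : InjH J L n F' ↔ InjH J K n F :=
  forall_congr' fun x => by rw [hF, isBd_equiv_iff c hc]

theorem surjH_equiv_iff {J : CochainComplex (ModuleCat.{x} k) ℤ} {n : ℤ} {F : J.X n → K.X n}
    {F' : J.X n → L.X n} (hF : ∀ x, F' x = c n (F x)) : SurjH J L n F' ↔ SurjH J K n F := by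
  refine ((c n).toEquiv.forall_congr fun y =>
    imp_congr (isCocycle_equiv_iff c hc).symm (exists_congr fun x => and_congr Iff.rfl ?_)).symm
  rw [hF, LinearEquiv.coe_toEquiv, ← map_sub, isBd_equiv_iff c hc]

end

namespace SemifreeDatum

open DGCategory DGModule

variable {k : Type v} [Field k] {𝒟 : DGCategory.{v, o, h} k} {ι : Type o₁} {Q : ι → 𝒟.Obj} {i : ι}
  (D : SemifreeDatum.{v, o₂, h, x} (𝒟.full fun _ : PUnit.{o₂ + 1} => Q i).op PUnit.unit)

/-- A datum over the endomorphisms of an object, as a datum over a bigger dg category. -/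
def extend : SemifreeDatum.{v, o₁, h, x} (𝒟.full Q).op i where
  X := D.X
  deg := D.deg
  bd := D.bd
  rank := D.rank
  rank_lt := D.rank_lt
  frD_bd := D.frD_bd

variable (Q i) in
/-- A module over a dg category and one over the endomorphisms of an object agree at the object. -/
structure Comparison (N' : DGModule.{w'} (𝒟.full fun _ : PUnit.{o₂ + 1} => Q i).op)
    (N : DGModule.{w} (𝒟.full Q).op) where
  equiv : ∀ n, (N'.obj PUnit.unit).X n ≃ₗ[k] (N.obj i).X n
  d : ∀ n m x, ((N.obj i).d n m).hom (equiv n x) = equiv m (((N'.obj PUnit.unit).d n m).hom x)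
  act : ∀ {p q n : ℤ} (hpq : p + q = n) (x : (N'.obj PUnit.unit).X p) (φ : (𝒟.Hom (Q i) (Q i)).X q),
    equiv n (N'.opAct (𝒟 := 𝒟.full fun _ : PUnit.{o₂ + 1} => Q i) (a := PUnit.unit)
      (b := PUnit.unit) hpq x φ) =
      N.opAct (𝒟 := 𝒟.full Q) (a := i) (b := i) hpq (equiv p x) φ

section Transfer

variable {N' : DGModule.{max x h w'} (𝒟.full fun _ : PUnit.{o₂ + 1} => Q i).op}
  {N : DGModule.{max x h w} (𝒟.full Q).op} (c : Comparison Q i N' N) {n : ℤ}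

/-- The elements at the object of the semifree modules on a datum and on its extension agree. -/
def elEquiv (n : ℤ) : ((module.{w'} D).obj PUnit.unit).X n ≃ₗ[k] ((module.{w} D.extend).obj i).X n :=
  (el.{w'} D (a := PUnit.unit)).symm ≪≫ₗ (el.{w} D.extend (a := i))

theorem elEquiv_d (n m : ℤ) (z : ((module.{w'} D).obj PUnit.unit).X n) :
    (((module.{w} D.extend).obj i).d n m).hom (elEquiv.{w} D n z) =
      elEquiv.{w} D m ((((module.{w'} D).obj PUnit.unit).d n m).hom z) := by
  obtain ⟨z, rfl⟩ := (el.{w'} D (a := PUnit.unit)).surjective z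
  by_cases hnm : n + 1 = m
  · rw [el_d D hnm]
    exact el_d D.extend hnm z
  · rw [((module.{w'} D).obj PUnit.unit).shape _ _ hnm, ((module.{w} D.extend).obj i).shape _ _ hnm]
    exact (map_zero _).symm

/-- Transfer of morphisms from a semifree module to the extended one. -/
def transfer (f : (homComplex (module.{w'} D) N').X n) :
    (homComplex (module.{w} D.extend) N).X n :=
  lift D.extend fun x => c.equiv _ (hv rfl f (gen.{w'} D x))

theorem hv_transfer (f : (homComplex (module.{w'} D) N').X n) {p q : ℤ} (hpq : p + n = q)
    (z : ((module.{w'} D).obj PUnit.unit).X p) :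
    hv hpq (transfer.{w} D c f) (elEquiv.{w} D p z) = c.equiv q (hv hpq f z) := by
  obtain ⟨z, rfl⟩ := (el.{w'} D (a := PUnit.unit)).surjective z
  induction z using fr_induction with
  | zero => simp only [map_zero]
  | add z z' h h' => simp only [map_add, h, h']
  | single x φ =>
    refine (hv_lift_single.{w} D.extend _ hpq x φ).trans ?_
    rw [← gen_act.{w'} D x φ, hv_act f rfl _ hpq (by lia)]
    exact (c.act _ _ _).symm

/-- The generators of the extended semifree module. -/
def extGen (x : D.X) : ((module.{w} D.extend).obj i).X (D.deg x) := gen.{w} D.extend x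

theorem hom_ext_extend {f g : (homComplex (module.{w} D.extend) N).X n}
    (H : ∀ x : D.X, hv rfl f (extGen.{w} D x) = hv rfl g (extGen.{w} D x)) : f = g :=
  hom_ext.{w} D.extend H

theorem hv_transfer_gen (f : (homComplex (module.{w'} D) N').X n) (x : D.X) :
    hv rfl (transfer.{w} D c f) (extGen.{w} D x) = c.equiv _ (hv rfl f (gen.{w'} D x)) :=
  hv_lift_gen.{w} D.extend _ x

/-- Transfer of morphisms is bijective. -/
def transferEquiv (n : ℤ) :
    (homComplex (module.{w'} D) N').X n ≃ₗ[k] (homComplex (module.{w} D.extend) N).X n where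
  toFun := transfer.{w} D c
  invFun g := lift D fun x => (c.equiv _).symm (hv rfl g (extGen.{w} D x))
  map_add' f g := hom_ext_extend D fun x => by
    rw [map_add, LinearMap.add_apply, hv_transfer_gen, hv_transfer_gen, hv_transfer_gen,
      map_add, LinearMap.add_apply, map_add]
  map_smul' r f := hom_ext_extend D fun x => by
    rw [map_smul, LinearMap.smul_apply, hv_transfer_gen, hv_transfer_gen,
      map_smul, LinearMap.smul_apply, map_smul, RingHom.id_apply]
  left_inv f := hom_ext D fun x => by
    rw [hv_lift_gen, hv_transfer_gen, LinearEquiv.symm_apply_apply]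
  right_inv g := hom_ext_extend D fun x => by
    rw [hv_transfer_gen, hv_lift_gen, LinearEquiv.apply_symm_apply]

theorem hv_transferEquiv_gen (f : (homComplex (module.{w'} D) N').X n) (x : D.X) :
    hv rfl (transferEquiv.{w} D c n f) (extGen.{w} D x) = c.equiv _ (hv rfl f (gen.{w'} D x)) :=
  hv_transfer_gen.{w} D c f x

theorem hv_transferEquiv (f : (homComplex (module.{w'} D) N').X n) {p q : ℤ} (hpq : p + n = q)
    (z : ((module.{w'} D).obj PUnit.unit).X p) :
    hv hpq (transferEquiv.{w} D c n f) (elEquiv.{w} D p z) = c.equiv q (hv hpq f z) :=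
  hv_transfer.{w} D c f hpq z

theorem extGen_d (x : D.X) : (((module.{w} D.extend).obj i).d (D.deg x) (D.deg x + 1)).hom
    (extGen.{w} D x) = elEquiv.{w} D (D.deg x + 1) (el.{w'} D (D.bd x)) :=
  gen_d.{w} D.extend x

/-- A morphism out of a semifree module is a free choice of values on the generators, and these
values lie in the target at `i`, where the two targets agree. The boundaries of the generators
correspond as well, so the two complexes of morphisms are isomorphic. -/
theorem transferEquiv_d (n m : ℤ) (f : (homComplex (module.{w'} D) N').X n) :
    ((homComplex (module.{w} D.extend) N).d n m).hom (transferEquiv.{w} D c n f) =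
      transferEquiv.{w} D c m (((homComplex (module.{w'} D) N').d n m).hom f) := by
  by_cases hnm : n + 1 = m
  · refine hom_ext_extend D fun x => ?_
    rw [hv_transferEquiv_gen, hv_d_gen D hnm, hv_d hnm _ rfl rfl rfl, extGen_d, hv_transferEquiv_gen,
      hv_transferEquiv D c f (show D.deg x + 1 + n = D.deg x + m by lia), map_sub, map_smul, c.d]
  · rw [(homComplex (module.{w'} D) N').shape _ _ hnm,
      (homComplex (module.{w} D.extend) N).shape _ _ hnm]
    exact (map_zero (transferEquiv.{w} D c m)).symm

theorem isCocycle_transferEquiv {f : (homComplex (module.{w'} D) N').X n}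
    (hf : IsCocycle (homComplex (module.{w'} D) N') f) :
    IsCocycle (homComplex (module.{w} D.extend) N) (transferEquiv.{w} D c n f) :=
  (isCocycle_equiv_iff _ (transferEquiv_d.{w} D c)).2 hf

/-- Transfer preserves quasi-isomorphisms at the object. -/
theorem injH_surjH_transferEquiv {p' : (homComplex (module.{w'} D) N').X 0}
    (hq' : ∀ n, InjH ((module.{w'} D).obj PUnit.unit) (N'.obj PUnit.unit) n (hv (add_zero n) p') ∧
      SurjH ((module.{w'} D).obj PUnit.unit) (N'.obj PUnit.unit) n (hv (add_zero n) p')) (n : ℤ) :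
    InjH ((module.{w} D.extend).obj i) (N.obj i) n (hv (add_zero n) (transferEquiv.{w} D c 0 p')) ∧
      SurjH ((module.{w} D.extend).obj i) (N.obj i) n
        (hv (add_zero n) (transferEquiv.{w} D c 0 p')) := by
  constructor
  · intro z hz hb
    obtain ⟨z, rfl⟩ := (elEquiv.{w} D n).surjective z
    rw [hv_transferEquiv, isBd_equiv_iff _ c.d] at hb
    exact (isBd_equiv_iff _ (elEquiv_d.{w} D)).2
      ((hq' n).1 z ((isCocycle_equiv_iff _ (elEquiv_d.{w} D)).1 hz) hb)
  · intro y hy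
    obtain ⟨y, rfl⟩ := (c.equiv n).surjective y
    obtain ⟨z, hz, hzy⟩ := (hq' n).2 y ((isCocycle_equiv_iff _ c.d).1 hy)
    refine ⟨elEquiv.{w} D n z, (isCocycle_equiv_iff _ (elEquiv_d.{w} D)).2 hz, ?_⟩
    rw [hv_transferEquiv, ← map_sub]
    exact (isBd_equiv_iff _ c.d).2 hzy

theorem homComp_transferEquiv {M' : DGModule.{max x h w'} (𝒟.full fun _ : PUnit.{o₂ + 1} => Q i).op}
    {M : DGModule.{max x h w} (𝒟.full Q).op} (e : Comparison Q i M' M) {p q : ℤ} (hpq : p + q = n)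
    {g' : (homComplex N' M').X p} {g : (homComplex N M).X p}
    (hg : ∀ (r t : ℤ) (hrt : r + p = t) (y : (N'.obj PUnit.unit).X r),
      hv hrt g (c.equiv r y) = e.equiv t (hv hrt g' y)) (f : (homComplex (module.{w'} D) N').X q) :
    homComp hpq g (transferEquiv.{w} D c q f) = transferEquiv.{w} D e n (homComp hpq g' f) := by
  refine hom_ext_extend D fun x => ?_
  rw [hv_transferEquiv_gen, hv_comp hpq g _ rfl (show D.deg x + q + p = D.deg x + n by lia) rfl,
    hv_comp hpq g' _ rfl (show D.deg x + q + p = D.deg x + n by lia) rfl, hv_transferEquiv_gen, hg]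

end Transfer

end SemifreeDatum

namespace DGFunctor

open DGModule SemifreeDatum

variable {k : Type v} [Field k] {𝒟 : DGCategory.{v, o, h} k} {ι : Type o₁} {Q : ι → 𝒟.Obj} {i : ι}
  {𝒞 : DGCategory.{v, o₂, h₂} k}

/-- Whether a functor is quasi-fully faithful can be decided at an object which detects acyclicity. -/
theorem isQuasiFullyFaithful_iff_of_comparison
    (hdet : ∀ M : DGModule.{max h w w'} (𝒟.full Q).op, (∀ n, HZero (M.obj i) n) → M.IsAcyclic)
    (F' : DGFunctor 𝒞 (dgCat.{max h w'} (𝒟.full fun _ : PUnit.{x + 1} => Q i).op))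
    (F : DGFunctor 𝒞 (dgCat.{max h w w'} (𝒟.full Q).op))
    (c : ∀ a, Comparison Q i (F'.obj a) (F.obj a))
    (hF : ∀ (a b : 𝒞.Obj) (n : ℤ) (x : (𝒞.Hom a b).X n) (r t : ℤ) (hrt : r + n = t)
      (y : ((F'.obj a).obj PUnit.unit).X r),
      hv (a := i) hrt (F.map n x) ((c a).equiv r y) =
        (c b).equiv t (hv (a := PUnit.unit) hrt (F'.map n x) y)) :
    F.IsQuasiFullyFaithful ↔ F'.IsQuasiFullyFaithful := by
  -- `F' a` is resolved by a semifree module over the one-object category. On the extended datum the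
  -- transferred morphism to `F a` is an isomorphism on cohomology at `i`, hence a quasi-isomorphism
  -- by `hdet`. Both conditions of full faithfulness are then about isomorphic complexes.
  choose D p' hp' hq' using fun a => exists_semifree_resolution.{w', v, x, h} (PUnit.unit) (F'.obj a)
  have hT := fun a b => transferEquiv_d.{max w w', v, o, o₁, x, h, w', max h w'} (D a) (c b)
  have hp := fun a => isCocycle_transferEquiv.{max w w', v, o, o₁, x, h, w', max h w'} (D a) (c a) (hp' a)
  have hqi' : ∀ a, IsQI (p' a) := fun a _ p q hpq => by
    obtain rfl : p = q := (add_zero p).symm.trans hpq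
    exact hq' a p
  have hqi : ∀ a, IsQI (transferEquiv.{max w w', v, o, o₁, x, h, w', max h w'} (D a) (c a) 0 (p' a)) := fun a =>
    isQI_of_detect hdet (hp a) (injH_surjH_transferEquiv.{max w w', v, o, o₁, x, h, w', max h w'} (D a) (c a) (hq' a))
  have key := fun (a b : 𝒞.Obj) (n : ℤ) (x : (𝒞.Hom a b).X n) =>
    homComp_transferEquiv.{max w w', v, o, o₁, x, h, w', max h w'} (D a) (c a) (c b) (add_zero n) (hF a b n x) (p' a)
  have h₁ := F.isQuasiFullyFaithful_iff (fun a => module.{max w w', v, o₁, h, max h w'} (D a).extend)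
    (fun a => transferEquiv.{max w w', v, o, o₁, x, h, w', max h w'} (D a) (c a) 0 (p' a))
    (fun a => isHProjective.{max w w', v, o₁, h, max h w'} (D a).extend) hp hqi
  have h₂ := F'.isQuasiFullyFaithful_iff (fun a => module.{w', v, x, h, max h w'} (D a)) p'
    (fun a => isHProjective.{w', v, x, h, max h w'} (D a)) hp' hqi'
  refine h₁.trans (Iff.trans ?_ h₂.symm)
  exact forall_congr' fun a => forall_congr' fun b => forall_congr' fun n =>
    and_congr (injH_equiv_iff _ (hT a b) (key a b n)) (surjH_equiv_iff _ (hT a b) (key a b n))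

end DGFunctor

/-! ### Evaluation functors on several modules and on a single one -/

namespace DGAlgebra

open DGModule SemifreeDatum

variable {k : Type u} [Field k] {A : DGAlgebra.{u} k} {ι : Type o₁} (Q : ι → A.RightModule) (i : ι)

/-- The values of the evaluation modules at an object do not depend on the other objects. -/
def evComparison : Comparison (𝒟 := dgCat.{u} A.toDGCategory) Q i
    (evaluationModule.{u, u} (fun _ : PUnit.{u + 1} => Q i) A.pt)
    (evaluationModule.{u, w} Q A.pt) where
  equiv n := (evUp.{u, u} (fun _ : PUnit.{u + 1} => Q i) (i := PUnit.unit) A.pt (n := n)).symm ≪≫ₗ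
    evUp.{u, w} Q A.pt
  d _ _ _ := rfl
  act _ _ _ := rfl

theorem hv_evaluationMap_evComparison {n : ℤ} (x : A.complex.X n) (r t : ℤ) (hrt : r + n = t)
    (y : ((evaluationModule.{u, u} (fun _ : PUnit.{u + 1} => Q i) A.pt).obj PUnit.unit).X r) :
    hv (a := i) hrt ((evaluation.{u, w} Q).map (a := A.pt) (b := A.pt) n x)
        ((evComparison.{w} Q i).equiv r y) =
      (evComparison.{w} Q i).equiv t (hv (a := PUnit.unit) hrt ((doubleCentraliserFunctor (Q i)).map
        (a := A.pt) (b := A.pt) n x) y) := rfl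

/-- Whether the evaluation functor is quasi-fully faithful can be decided at an object which detects
acyclicity. -/
theorem isQuasiFullyFaithful_evaluation_iff
    (hdet : ∀ M : DGModule.{max u w} ((dgCat.{u} A.toDGCategory).full Q).op,
      (∀ n, HZero (M.obj i) n) → M.IsAcyclic) :
    (evaluation.{u, w} Q).IsQuasiFullyFaithful ↔
      (doubleCentraliserFunctor (Q i)).IsQuasiFullyFaithful :=
  DGFunctor.isQuasiFullyFaithful_iff_of_comparison.{w, u, u + 1, o₁, u, u, u, u, u} hdet (doubleCentraliserFunctor (Q i))
    (evaluation.{u, w} Q) (fun _ => evComparison.{w} Q i)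
    fun _ _ _ x => hv_evaluationMap_evComparison.{w} Q i x

end DGAlgebra

/-! ### Free modules of rank one -/

namespace SemifreeDatum

open DGCategory DGModule

variable {k : Type v} [Field k] {𝒞 : DGCategory.{v, o, h} k} (s : 𝒞.Obj)

/-- The datum of a free module of rank one. -/
def point : SemifreeDatum.{v, o, h, x} 𝒞 s where
  X := PUnit
  deg _ := 0
  bd _ := 0
  rank _ := 0
  rank_lt _ _ hz := (hz rfl).elim
  frD_bd _ := map_zero _

/-- The generator of the free module of rank one. -/
def pointGen : ((module.{w} (point.{v, o, h, x} s)).obj s).X 0 :=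
  gen.{w} (point.{v, o, h, x} s) PUnit.unit

theorem isCocycle_pointGen :
    IsCocycle ((module.{w} (point.{v, o, h, x} s)).obj s) (pointGen.{w} s) :=
  isCocycle_of (n := 0) (m := 0 + 1) rfl
    ((gen_d.{w} (point.{v, o, h, x} s) PUnit.unit).trans (map_zero _))

variable {s}

theorem exists_pointGen_act {a : 𝒞.Obj} {n : ℤ} (z : ((module.{w} (point.{v, o, h, x} s)).obj a).X n) :
    ∃ c : (𝒞.Hom a s).X n,
      (module.{w} (point.{v, o, h, x} s)).act (zero_add n) (pointGen.{w} s) c = z := by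
  suffices H : ∃ (q : ℤ) (hq : 0 + q = n) (c : (𝒞.Hom a s).X q),
      (module.{w} (point.{v, o, h, x} s)).act hq (pointGen.{w} s) c = z by
    obtain ⟨q, hq, c, hc⟩ := H
    obtain rfl : q = n := (zero_add q).symm.trans hq
    exact ⟨c, hc⟩
  obtain ⟨z, rfl⟩ := (el.{w} (point.{v, o, h, x} s)).surjective z
  refine ⟨n - 0, by lia, z PUnit.unit, (gen_act.{w} (point.{v, o, h, x} s) PUnit.unit _).trans
    (congrArg _ (DFinsupp.ext fun y => ?_))⟩
  classical
  cases y
  exact DFinsupp.single_eq_same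

variable {N : DGModule.{max x h w} 𝒞} {n q : ℤ}

theorem isBd_of_pointGen (hq : 0 + n = q)
    {f : (homComplex (module.{w} (point.{v, o, h, x} s)) N).X n}
    (hf : IsCocycle (homComplex (module.{w} (point.{v, o, h, x} s)) N) f)
    (hb : IsBd (N.obj s) (hv hq f (pointGen.{w} s))) :
    IsBd (homComplex (module.{w} (point.{v, o, h, x} s)) N) f := by
  subst hq
  exact isBd_of_cells _ hf fun _ => .inr ⟨rfl, hb⟩

theorem exists_hom_pointGen (hq : 0 + n = q) {y : (N.obj s).X q} (hy : IsCocycle (N.obj s) y) :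
    ∃ f : (homComplex (module.{w} (point.{v, o, h, x} s)) N).X n,
      IsCocycle (homComplex (module.{w} (point.{v, o, h, x} s)) N) f ∧
      hv hq f (pointGen.{w} s) = y := by
  subst hq
  refine ⟨lift (point s) fun _ => y, isCocycle_of rfl ((d_lift (point s) rfl _).trans
    (hom_ext (point s) fun x => ?_)), hv_lift_gen.{w} (point s) _ PUnit.unit⟩
  rw [hv_lift_gen, map_zero, LinearMap.zero_apply]
  refine (congrArg₂ (· - ·) (hy _) (congrArg _ (map_zero _))).trans ?_
  rw [smul_zero, sub_zero]

end SemifreeDatum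

namespace DGModule

variable {k : Type v} [Field k] {𝒜 : DGCategory.{v, o, h} k} {M N : DGModule.{w} 𝒜} {a : 𝒜.Obj}

theorem hv_isCocycle_d {p n m q q' : ℤ} {y : (M.obj a).X p} (hy : IsCocycle (M.obj a) y)
    (hq : p + n = q) (hq' : p + m = q') (f : (homComplex M N).X n) :
    ((N.obj a).d q q').hom (hv hq f y) = hv hq' (((homComplex M N).d n m).hom f) y := by
  by_cases hnm : n + 1 = m
  · rw [hv_d hnm f hq' hq rfl, hy, map_zero, smul_zero, sub_zero]
  · rw [d_eq_zero _ hnm, d_eq_zero _ (by lia), map_zero, LinearMap.zero_apply]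

theorem act_isCocycle_d {b : 𝒜.Obj} {n m : ℤ} {y : (M.obj b).X 0} (hy : IsCocycle (M.obj b) y)
    (c : (𝒜.Hom a b).X n) :
    ((M.obj a).d n m).hom (M.act (zero_add n) y c) =
      M.act (zero_add m) y (((𝒜.Hom a b).d n m).hom c) := by
  by_cases hnm : n + 1 = m
  · rw [M.act_d (zero_add n) rfl hnm hnm, hy, map_zero, LinearMap.zero_apply, zero_add,
      koszulSign_zero, one_smul]
  · rw [d_eq_zero _ hnm, d_eq_zero _ hnm, map_zero]

end DGModule

/-! ### Functors with free values -/

namespace DGFunctor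

open DGModule SemifreeDatum

variable {k : Type v} [Field k] {ℬ : DGCategory.{v, o, h} k} {𝒞 : DGCategory.{v, o₁, h₁} k}

/-- A functor is quasi-fully faithful if its values are freely generated by elements and morphisms
correspond to the images of these elements. -/
theorem isQuasiFullyFaithful_of_bijective (F : DGFunctor 𝒞 (dgCat.{max h w} ℬ)) (s : 𝒞.Obj → ℬ.Obj)
    (y : ∀ a, ((F.obj a).obj (s a)).X 0) (hy : ∀ a, IsCocycle ((F.obj a).obj (s a)) (y a))
    (hact : ∀ a (i : ℬ.Obj) (n : ℤ), Function.Bijective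
      fun φ : (ℬ.Hom i (s a)).X n => (F.obj a).act (zero_add n) (y a) φ)
    (hmap : ∀ (a b : 𝒞.Obj) (n : ℤ), Function.Bijective
      fun x : (𝒞.Hom a b).X n => hv (zero_add n) (F.map n x) (y a)) :
    F.IsQuasiFullyFaithful := by
  let c (a : 𝒞.Obj) (i : ℬ.Obj) (n : ℤ) : (ℬ.Hom i (s a)).X n ≃ₗ[k] ((F.obj a).obj i).X n :=
    LinearEquiv.ofBijective ((F.obj a).act (zero_add n) (y a)) (hact a i n)
  have hc : ∀ a i n m x, (((F.obj a).obj i).d n m).hom (c a i n x) =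
      c a i m (((ℬ.Hom i (s a)).d n m).hom x) := fun a i n m x => act_isCocycle_d (hy a) x
  let e (a b : 𝒞.Obj) (n : ℤ) : (𝒞.Hom a b).X n ≃ₗ[k] ((F.obj b).obj (s a)).X n :=
    LinearEquiv.ofBijective ((hv (zero_add n)).flip (y a) ∘ₗ F.map n) (hmap a b n)
  have he : ∀ a b n m x, (((F.obj b).obj (s a)).d n m).hom (e a b n x) =
      e a b m (((𝒞.Hom a b).d n m).hom x) := fun a b n m x => by
    refine (hv_isCocycle_d (N := F.obj b) (hy a) (zero_add n) (zero_add m) (F.map n x)).trans ?_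
    refine congrArg (fun f => hv (zero_add m) f (y a)) ?_
    by_cases hnm : n + 1 = m
    · subst hnm
      exact (F.map_d n x).symm
    · rw [d_eq_zero _ hnm, d_eq_zero _ hnm, map_zero]
  -- The semifree module with one cell of degree `0` resolves `F a`, its generator being sent to `y
  -- a`.
  choose p hp hpe using fun a => exists_hom_pointGen.{w, v, o, h, h} (N := F.obj a) (zero_add 0) (hy a)
  have hpz : ∀ a i n (φ : (ℬ.Hom i (s a)).X n), hv (add_zero n) (p a)
      ((module.{w, v, o, h, h} (point.{v, o, h, h} (s a))).act (zero_add n)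
        (pointGen.{w, v, o, h, h} (s a)) φ) = c a i n φ := fun a i n φ => by
    rw [hv_act (p a) (zero_add 0) (zero_add n) (add_zero n) (zero_add n), hpe]
    rfl
  have hqi : ∀ a, IsQI (p a) := fun a i n q hq => by
    obtain rfl : n = q := (add_zero n).symm.trans hq
    refine ⟨fun z hz hb => ?_, fun y hy => ?_⟩
    · obtain ⟨φ, rfl⟩ := exists_pointGen_act z
      rw [hpz, isBd_equiv_iff (c a i) (hc a i)] at hb
      exact DGModule.isBd_act_right _ (zero_add n) (isCocycle_pointGen.{w, v, o, h, h} (s a)) hb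
    · obtain ⟨φ, rfl⟩ := (c a i n).surjective y
      refine ⟨_, DGModule.isCocycle_act _ (zero_add n) (isCocycle_pointGen.{w, v, o, h, h} (s a))
        ((isCocycle_equiv_iff (c a i) (hc a i)).1 hy), ?_⟩
      rw [hpz, sub_self]
      exact isBd_zero
  have hev : ∀ (a b : 𝒞.Obj) (n : ℤ) (x : (𝒞.Hom a b).X n), hv (zero_add n)
      (homComp (add_zero n) (F.map n x) (p a)) (pointGen.{w, v, o, h, h} (s a)) = e a b n x :=
    fun a b n x => by
      rw [hv_comp _ _ _ (zero_add 0) (zero_add n), hpe]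
      rfl
  refine (F.isQuasiFullyFaithful_iff (fun a => module.{w, v, o, h, h} (point.{v, o, h, h} (s a)))
    p (fun a => isHProjective.{w, v, o, h, h} _) hp hqi).2
    fun a b n => ⟨fun x hx hb => ?_, fun z hz => ?_⟩
  · have h := isBd_hv_of_isBd hb (zero_add n) (isCocycle_pointGen.{w, v, o, h, h} (s a))
    exact (isBd_equiv_iff (e a b) (he a b)).1 ((congrArg (IsBd _) (hev a b n x)).mp h)
  · obtain ⟨x, hx⟩ := (e a b n).surjective
      (hv (zero_add n) z (pointGen.{w, v, o, h, h} (s a)))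
    have hxc : IsCocycle (𝒞.Hom a b) x := (isCocycle_equiv_iff (e a b) (he a b)).1
      (hx ▸ isCocycle_hv hz (zero_add n) (isCocycle_pointGen.{w, v, o, h, h} (s a)))
    refine ⟨x, hxc, isBd_of_pointGen.{w, v, o, h, h} (zero_add n) ((isCocycle_comp (add_zero n)
      (F.isCocycle_map hxc) (hp a)).sub hz) ?_⟩
    refine (congrArg (IsBd _) ?_).mpr isBd_zero
    exact (LinearMap.congr_fun (map_sub (hv (zero_add n)) _ z) _).trans
      (sub_eq_zero.2 ((hev a b n x).trans hx))

end DGFunctor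

namespace DGAlgebra

open DGModule SemifreeDatum

variable {k : Type u} [Field k] {A : DGAlgebra.{u} k} {ι : Type o₁} (Q : ι → A.RightModule) (j : ι)

/-- The evaluation functor is quasi-fully faithful if one of the modules is free of rank one. -/
theorem isQuasiFullyFaithful_evaluation_of_free {one : ((Q j).obj A.pt).X 0}
    (hone : IsCocycle ((Q j).obj A.pt) one)
    (hM : ∀ (M : A.RightModule) (n : ℤ), Function.Bijective
      fun f : (homComplex (Q j) M).X n => hv (zero_add n) f one)
    (hA : ∀ n : ℤ, Function.Bijective fun x : A.complex.X n =>
      (Q j).act (a := A.pt) (b := A.pt) (zero_add n) one x) :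
    (evaluation.{u, w} Q).IsQuasiFullyFaithful := by
  -- By `hM` the evaluation module is represented by `Q j`, with universal element `one`. By `hA`
  -- its endomorphisms are then given by the elements of `A`.
  refine DGFunctor.isQuasiFullyFaithful_of_bijective.{w} (evaluation.{u, w} Q) (fun _ => j)
    (fun _ => evUp.{u, w} Q A.pt one) (fun _ => (isCocycle_evUp_iff.{u, w} Q A.pt).2 hone)
    (fun _ i n => ?_) fun _ _ n => ?_
  · have h := (evUp.{u, w} Q A.pt).bijective.comp (hM (Q i) n)
    refine (congrArg Function.Bijective (funext fun φ => ?_)).mp h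
    refine Eq.symm ((evUp_act.{u, w} Q A.pt (zero_add n) one φ).trans ?_)
    rw [zero_mul, koszulSign_zero, one_smul]
    rfl
  · have h := (evUp.{u, w} Q A.pt).bijective.comp (hA n)
    refine (congrArg Function.Bijective (funext fun x => ?_)).mp h
    have e : koszulSign k (n * 0) = 1 := by rw [mul_zero, koszulSign_zero]
    exact Eq.symm ((congrArg (fun r : k => evUp.{u, w} Q A.pt (r • (Q j).act (a := A.pt)
      (b := A.pt) (zero_add n) one x)) e).trans (congrArg (evUp.{u, w} Q A.pt) (one_smul k _)))

end DGAlgebra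

namespace DGAlgebra

open DGModule SemifreeDatum

variable {k : Type u} [Field k] {A : DGAlgebra.{u} k}

/-! ### Reflexivity -/

theorem exists_resolution (M : A.RightModule) : ∃ (P : A.RightModule) (p : P ⟶ M), IsResolution p := by
  obtain ⟨D, p, hp, hq⟩ := exists_semifree_resolution.{u} A.pt M
  refine ⟨_, homOfCocycle p hp, isHProjective.{u} D, ?_⟩
  rw [← isQI_toHomComplex_iff, toHomComplex_homOfCocycle]
  intro a n q hnq
  obtain rfl : n = q := (add_zero n).symm.trans hnq
  exact hq n

/-- A truncation model is perfectly valued if `H⁰(A)` is finite dimensional. -/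
theorem _root_.DGModule.IsTruncationModel.isPerfectlyValued {P : A.RightModule}
    {one : (P.obj A.pt).X 0} (hP : IsTruncationModel A.pt P one)
    (hneg : ∀ n < 0, HZero A.complex n) (hfin : Module.Finite k (Hn A.complex 0)) :
    P.IsPerfectlyValued := by
  have h0 : ∀ n ≠ 0, HZero (P.obj A.pt) n := fun n hn => by
    rcases lt_or_gt_of_ne hn with hn | hn
    · exact hP.hZero_neg hneg hn
    · exact hP.hZero n hn
  refine isPerfectlyValued_iff.2 fun _ => ⟨fun n => ?_, 0, 0, fun n hn => h0 n (by lia)⟩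
  by_cases hn : n = 0
  · subst hn
    have hone := isCocycle_ofElt hP.isCocycle
    have : Module.Finite k (Hn ((representable A.toDGCategory A.pt).obj A.pt) 0) := hfin
    refine Module.Finite.of_surjective (hnMap (K := (representable A.toDGCategory A.pt).obj A.pt)
      (hv (add_zero 0) (ofElt one)) (fun _ hx => isCocycle_hv hone _ hx)
      fun _ hx => isBd_hv hone _ hx) fun y => ?_
    obtain ⟨y, hy, rfl⟩ := exists_cls y
    obtain ⟨c, hc, hcy⟩ := hP.surj 0 le_rfl y hy
    exact ⟨clsOf _ c hc, (cls_eq_iff (hx := isCocycle_hv hone _ hc) (hy := hy)).2 hcy⟩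
  · have := hZero_iff_subsingleton.1 (h0 n hn)
    exact (inferInstance : Module.Finite k (Hn (P.obj A.pt) n))

theorem isPerfectlyValued_evaluationModule {ι : Type o₁} {Q : ι → A.RightModule}
    (hQ : ∀ i, (Q i).IsPerfectlyValued) : (evaluationModule.{u, w} Q A.pt).IsPerfectlyValued := by
  refine isPerfectlyValued_iff.2 fun i => ?_
  obtain ⟨hfin, a, b, hab⟩ := isPerfectlyValued_iff.1 (hQ i) A.pt
  refine ⟨fun n => ?_, a, b, fun n hn => (hZero_evaluationModule_iff.{u, w} Q A.pt).2 (hab n hn)⟩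
  have := hfin n
  refine Module.Finite.of_surjective (hnMap (evUp.{u, w} Q A.pt (i := i) (n := n)).toLinearMap
    (fun _ hx => (isCocycle_evUp_iff.{u, w} Q A.pt).2 hx)
    fun _ hx => (isBd_evUp_iff.{u, w} Q A.pt).2 hx) fun y => ?_
  obtain ⟨y, hy, rfl⟩ := exists_cls y
  obtain ⟨y, rfl⟩ := (evUp.{u, w} Q A.pt).surjective y
  exact ⟨clsOf _ y ((isCocycle_evUp_iff.{u, w} Q A.pt).1 hy), rfl⟩

/-- If there is a perfectly valued truncation model, then reflexivity means that the evaluation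
functor is quasi-fully faithful. -/
theorem isReflexive_iff [IsSemisimpleRing A.H0] {P : A.RightModule} {one : (P.obj A.pt).X 0}
    (hP : IsTruncationModel A.pt P one) (hneg : ∀ n < 0, HZero A.complex n)
    (hPfd : P.IsPerfectlyValued) : A.IsReflexive ↔ A.toDGCategory.ev.IsQuasiFullyFaithful := by
  -- The generation half of the Morita condition holds in any case. One inclusion is formal,
  -- perfectly valued modules being a thick class containing the image; the other is
  -- `thick_evaluationModule`.
  refine and_iff_left fun N => ⟨fun h => ?_, fun hN T hT hS => ?_⟩
  · refine h IsPerfectlyValued isThick_isPerfectlyValued ?_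
    rintro _ ⟨a, rfl⟩
    exact isPerfectlyValued_evaluationModule.{u + 1} fun M => M.2.2
  · exact thick_evaluationModule.{u + 1}
      (Q := fun M : {M : A.RightModule // M.IsHProjective ∧ M.IsPerfectlyValued} => M.1)
      (i := ⟨P, hP.isHProjective, hPfd⟩) hP hneg
      (isAcyclic_of_hZero_truncationModel hP hneg ⟨hP.isHProjective, hPfd⟩) hT (hS _ ⟨A.pt, rfl⟩)
      N hN

/-- `P` is an object of `D_fd(A)` that detects acyclicity, so derived morphisms between evaluation
modules may be computed over its endomorphisms alone. -/
theorem isQuasiFullyFaithful_ev_iff [IsSemisimpleRing A.H0] {P : A.RightModule}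
    {one : (P.obj A.pt).X 0} (hP : IsTruncationModel A.pt P one)
    (hneg : ∀ n < 0, HZero A.complex n) (hPfd : P.IsPerfectlyValued) :
    A.toDGCategory.ev.IsQuasiFullyFaithful ↔ (doubleCentraliserFunctor P).IsQuasiFullyFaithful :=
  isQuasiFullyFaithful_evaluation_iff.{u + 1}
    (fun M : {M : A.RightModule // M.IsHProjective ∧ M.IsPerfectlyValued} => M.1)
    ⟨P, hP.isHProjective, hPfd⟩
    (isAcyclic_of_hZero_truncationModel hP hneg ⟨hP.isHProjective, hPfd⟩)

/-- Properness puts `A` itself into `D_fd(A)`, where it represents the evaluation module because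
`Hom(A, M) = M`. Yoneda then identifies the derived endomorphisms of that module with `A`. -/
theorem IsProper.isQuasiFullyFaithful_ev (hA : A.IsProper) :
    A.toDGCategory.ev.IsQuasiFullyFaithful :=
  isQuasiFullyFaithful_evaluation_of_free.{u + 1}
    (fun M : {M : A.RightModule // M.IsHProjective ∧ M.IsPerfectlyValued} => M.1)
    ⟨representable A.toDGCategory A.pt, isHProjective_representable, fun _ => hA⟩
    (one := repId A.toDGCategory A.pt) isCocycle_repId
    (fun _ _ => ⟨fun f g hfg => by rw [← ofElt_hv_id f, ← ofElt_hv_id g]; exact congrArg _ hfg,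
      fun y => ⟨ofElt y, hv_ofElt_id y⟩⟩)
    fun _ => ⟨fun x y hxy => (repId_act (s := A.pt) (a := A.pt) x).symm.trans
      (Eq.trans hxy (repId_act (s := A.pt) (a := A.pt) y)),
      fun x => ⟨x, repId_act (s := A.pt) (a := A.pt) x⟩⟩

end DGAlgebra

end

/-- Let `A` be a coconnective dg algebra over a field `k` such that `H⁰(A)` is a finite dimensional
semisimple algebra.  Then `A` has a weight truncation `σ_{≤0} A`; for every choice `S` of it, `A` is
reflexive if and only if `A` is derived complete at `S`; and if `A` is proper, then `A` is reflexive.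
-/
theorem mainTheorem3 {k : Type u} [Field k] (A : DGAlgebra.{u} k) (hA : A.IsCoconnective)
    (hfin : Module.Finite k (A.complex.homology 0)) (hss : IsSemisimpleRing A.H0) :
    (∃ S : A.RightModule, A.IsWeightTruncation S) ∧
      (∀ S : A.RightModule, A.IsWeightTruncation S →
        (A.IsReflexive ↔ A.IsDerivedCompleteAt S)) ∧
      (A.IsProper → A.IsReflexive) := by
  have hneg : ∀ n < 0, HZero A.complex n := fun n hn => (isZero_homology_iff n).1 (hA n hn)
  -- Valid for every truncation and every resolution of it. Hence the resolution supplied by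
  -- `IsDerivedCompleteAt` can be used as it stands.
  have hmodel : ∀ {S : A.RightModule}, A.IsWeightTruncation S → ∀ {P : A.RightModule} (p : P ⟶ S),
      DGModule.IsResolution p → ∃ one, DGModule.IsTruncationModel A.pt P one ∧
        P.IsPerfectlyValued := fun hS P p hp => by
    obtain ⟨one, hP⟩ := hS.isTruncationModel hneg hp
    exact ⟨one, hP, hP.isPerfectlyValued hneg ((finite_homology_iff 0).1 hfin)⟩
  have hex : ∃ S : A.RightModule, A.IsWeightTruncation S := DGAlgebra.exists_isWeightTruncation hneg
  refine ⟨hex, fun S hS => ⟨fun h => ?_, ?_⟩, fun h => ?_⟩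
  · obtain ⟨P, p, hp⟩ := DGAlgebra.exists_resolution S
    obtain ⟨one, hP, hPfd⟩ := hmodel hS p hp
    exact ⟨P, p, hp, (DGAlgebra.isQuasiFullyFaithful_ev_iff hP hneg hPfd).1 h.1⟩
  · rintro ⟨P, p, hp, h⟩
    obtain ⟨one, hP, hPfd⟩ := hmodel hS p hp
    exact (DGAlgebra.isReflexive_iff hP hneg hPfd).2
      ((DGAlgebra.isQuasiFullyFaithful_ev_iff hP hneg hPfd).2 h)
  · obtain ⟨S, hS⟩ := hex
    obtain ⟨P, p, hp⟩ := DGAlgebra.exists_resolution S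
    obtain ⟨one, hP, hPfd⟩ := hmodel hS p hp
    exact (DGAlgebra.isReflexive_iff hP hneg hPfd).2 h.isQuasiFullyFaithful_ev
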